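/- **Tours, swaps.** A tour of a graph is a Hamiltonian cycle, identified with its edge set. In a complete graph with weights $c$ in $\mathbb Z_{\ge 0}$, a $K$-swap is a pair $(E_1,E_2)$ of edge sets with $|E_1|=|E_2|\le K$. It is improving for a tour $\tau\supseteq E_1$ if $(\tau\setminus E_1)\cup E_2$ is a tour of smaller total weight. A tour is $K$-Opt locally optimal if no $K$-swap is improving for it. **Data.** Let $k\ge 15$, let $H$ be a finite simple graph of maximum degree at most $5$ with $n$ vertices and $m$ edges, and let $w:E(H)\to\mathbb Z$ be not identically zero. Choose a partition of $E(H)$ into undirected and directed edges and an orientation of the directed edges such that the undirected edges form a disjoint union of stars and every vertex $x$ has out-degree $d^+(x)\le 2$. Write each edge as an ordered pair $(x,y)$, where directed edges go from $x$ to $y$ and the order is arbitrary for undirected edges. Let $\psi$ be a linear order on $E(H)$ in which the directed edges precede the undirected ones. Let $d(x)$ be the degree of $x$ in $H$. **Gadgets.** The strict gadget has the vertices $X,X',Y,Y',Z,Z',a,a',b,b'$, the edges $Xb, ab, X'b', a'b', a'Z, YZ', ZZ', Y'a, Z'a, Y'Z$, and four paths of length two, with new inner vertices, joining $a'$ and $X$,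 $a$ and $X'$, $b$ and $b'$, $Y$ and $Y'$. Its same-set edges are $ZZ', Y'a$, and its different-set edges are $Z'a, Y'Z$. The flexible gadget has the vertices $X,X',Y,Y',Z,Z'$, the edges $XZ, YZ', ZZ', X'Y', Y'Z, X'Z'$, and two paths of length two, with new inner vertices, joining $X$ and $X'$, $Y$ and $Y'$. Its same-set edges are $ZZ', X'Y'$, and its different-set edges are $Y'Z, X'Z'$. **The graph $G$ and the weights $c$.** Start with a cycle of $3(n+m)$ edges, and assign every third edge to one of the $n+m$ vertices and edges of $H$ (bijectively, in any order). Call the endpoints of the edge assigned to $x\in V(H)$ $x_\ell$ and $x_r$, and those of the edge assigned to $e\in E(H)$ $\bar Z_e$ and $\bar Z_e'$. For each $x\in V(H)$, with $d=d(x)$, add a path $(x_\ell,x_1,x_1',\dots,x_d,x_d',x_r)$. For each $e=(x,y)\in E(H)$, which is the $i$-th edge at $x$ and the $j$-th edge at $y$ in the order $\psi$, delete the edges $x_ix_i'$, $y_jy_j'$, $\bar Z_e\bar Z_e'$, and add a copy of the strict gadget (if $e$ is directed) or of the flexible gadget (if not), whose vertices $X,X',Y,Y',Z,Z'$ are identified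 with $x_i,x_i',y_j,y_j',\bar Z_e,\bar Z_e'$. Its same-set edges get weight $\max(w(e),0)$ and its different-set edges weight $\max(-w(e),0)$. Finally, for each $x\in V(H)$, let $p=k-2d(x)-2d^+(x)-1\ge 0$, subdivide the edge $x_\ell x_r$ of the cycle into $(x_\ell,a_1,\dots,a_p,x_r)$ and the last edge $vx_r$ of the added path of $x$ (where $v=x_d'$, or $v=x_\ell$ if $d=0$) into $(v,b_1,\dots,b_p,x_r)$, and join $a_i$ and $b_i$ by a path of length two with a new inner vertex, for $1\le i\le p$. All edges without a specified weight have weight $0$. **Priorities and $(G_\infty,c_\infty)$.** Let $N=|V(G)|$. Give the priorities $\lambda(v)=N,N-1,\dots,1$ to the vertices of $G$ in the following order: first all vertices of degree two in $G$, in any order; then all $x_\ell$, in any order; then, for each $x\in V(H)$ in any order, $a_1,\dots,a_p,x_r,b_p,\dots,b_1$; then, for each parity gadget in the order $\psi$, its vertices in the order $Y,X,b,X',b',a',Z,Z',a,Y'$ (strict gadget) or $Y,X,Z,Z',X',Y'$ (flexible gadget). Let $M$ be the sum of the weights of all edges of $G$. $G_\infty$ is the complete graph on $V(G)$. Its edges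 that are not in $G$ are called non-edges. Put $c_\infty(e)=c(e)$ for $e\in E(G)$ and $c_\infty(vv')=M\cdot 4^{\max\{\lambda(v),\lambda(v')\}}$ for every non-edge $vv'$. **Lemma.** For all choices above, every tour of $(G_\infty,c_\infty)$ that contains a non-edge has an improving $3$-swap. Consequently, for every $K\ge 3$, no $K$-Opt locally optimal tour of $(G_\infty,c_\infty)$ contains a non-edge. -/

import Mathlib

/-! ## Tours, swaps and local optima of the travelling salesman problem -/

namespace TSP

variable {U : Type*} [DecidableEq U]

/-- A set `τ` of edges is (the edge set of) a tour of the graph `G`, i.e. of a Hamiltonian cycle. -/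
def IsTour (G : SimpleGraph U) (τ : Finset (Sym2 U)) : Prop :=
  ∃ (v : U) (p : G.Walk v v), p.IsHamiltonianCycle ∧ p.edges.toFinset = τ

/-- `(E₁, E₂)` is a `k`-swap of the complete graph on `U`: two sets of edges of the same
cardinality, which is at most `k`. -/
def IsSwap (k : ℕ) (E₁ E₂ : Finset (Sym2 U)) : Prop :=
  (∀ z ∈ E₁, z ∈ (⊤ : SimpleGraph U).edgeSet) ∧ (∀ z ∈ E₂, z ∈ (⊤ : SimpleGraph U).edgeSet) ∧
    E₁.card = E₂.card ∧ E₁.card ≤ k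

/-- The edge set that results from removing `E₁` from `τ` and then adding `E₂`. -/
def perform (τ E₁ E₂ : Finset (Sym2 U)) : Finset (Sym2 U) := (τ \ E₁) ∪ E₂

/-- The total weight of a set of edges. -/
def weight (c : Sym2 U → ℕ) (τ : Finset (Sym2 U)) : ℕ := ∑ z ∈ τ, c z

/-- The swap `(E₁, E₂)` of edges of the complete graph is improving for `τ`: the edges of `E₁`
can be removed from `τ`, and the swap leads to a tour of lower weight. -/
def IsImproving (c : Sym2 U → ℕ) (τ E₁ E₂ : Finset (Sym2 U)) : Prop :=
  E₁ ⊆ τ ∧ IsTour (⊤ : SimpleGraph U) (perform τ E₁ E₂) ∧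
    weight c (perform τ E₁ E₂) < weight c τ

/-- `τ` is a local optimum of the complete instance with weights `c` for the `k`-Opt
neighborhood. -/
def IsLocalOptimum (k : ℕ) (c : Sym2 U → ℕ) (τ : Finset (Sym2 U)) : Prop :=
  IsTour (⊤ : SimpleGraph U) τ ∧
    ∀ E₁ E₂ : Finset (Sym2 U), IsSwap k E₁ E₂ → E₁ ⊆ τ →
      IsTour (⊤ : SimpleGraph U) (perform τ E₁ E₂) →
        weight c τ ≤ weight c (perform τ E₁ E₂)

end TSP

/-! ## The reduction from Max-Cut -/

namespace MaxCutReduction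

/-- A graph is a disjoint union of stars (isolated vertices and single edges count as stars). -/
def IsDisjointUnionOfStars {V : Type*} (F : SimpleGraph V) : Prop :=
  ∀ K : F.ConnectedComponent, ∃ r : K.supp, F.induce K.supp = SimpleGraph.starGraph r

/-- The vertices of the strict gadget: `X, X', Y, Y', Z, Z', a, a', b, b'` (a prime is written
`p`) and the four inner vertices of the paths of length two between `a'` and `X`, `a` and `X'`,
`b` and `b'`, and `Y` and `Y'`. -/
inductive StrictVertex
  | X | Xp | Y | Yp | Z | Zp | a | ap | b | bp | midApX | midAXp | midBBp | midYYp
  deriving DecidableEq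

instance : Fintype StrictVertex where
  elems := {.X, .Xp, .Y, .Yp, .Z, .Zp, .a, .ap, .b, .bp, .midApX, .midAXp, .midBBp, .midYYp}
  complete q := by cases q <;> decide

/-- The vertices of the flexible gadget: `X, X', Y, Y', Z, Z'` and the inner vertices `R` and `S`
of the paths of length two between `X` and `X'` and between `Y` and `Y'`. -/
inductive FlexVertex
  | X | Xp | Y | Yp | Z | Zp | R | S
  deriving DecidableEq

instance : Fintype FlexVertex where
  elems := {.X, .Xp, .Y, .Yp, .Z, .Zp, .R, .S}
  complete q := by cases q <;> decide

/-- The edges of the strict gadget. -/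
def strictEdges : List (StrictVertex × StrictVertex) :=
  [(.ap, .midApX), (.midApX, .X), (.a, .midAXp), (.midAXp, .Xp),
   (.b, .midBBp), (.midBBp, .bp), (.Y, .midYYp), (.midYYp, .Yp),
   (.X, .b), (.b, .a), (.Xp, .bp), (.bp, .ap), (.ap, .Z), (.Y, .Zp),
   (.Z, .Zp), (.Yp, .a), (.Zp, .a), (.Yp, .Z)]

/-- The edges of the flexible gadget. -/
def flexEdges : List (FlexVertex × FlexVertex) :=
  [(.X, .R), (.R, .Xp), (.Y, .S), (.S, .Yp), (.X, .Z), (.Y, .Zp),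
   (.Z, .Zp), (.Xp, .Yp), (.Yp, .Z), (.Xp, .Zp)]

/-- The position of a vertex of the strict gadget in the priority order
`(Y, X, b, X', b', a', Z, Z', a, Y')`. The degree-two vertices do not take part in it. -/
def strictPos : StrictVertex → ℕ
  | .Y => 0 | .X => 1 | .b => 2 | .Xp => 3 | .bp => 4 | .ap => 5 | .Z => 6 | .Zp => 7
  | .a => 8 | .Yp => 9 | _ => 0

/-- The position of a vertex of the flexible gadget in the priority order
`(Y, X, Z, Z', X', Y')`. The degree-two vertices do not take part in it. -/
def flexPos : FlexVertex → ℕ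
  | .Y => 0 | .X => 1 | .Z => 2 | .Zp => 3 | .Xp => 4 | .Yp => 5 | _ => 0

variable {V : Type*} [Fintype V] [DecidableEq V]

/-- The choices that the construction leaves open, for the Max-Cut graph `H`. -/
structure Choices (H : SimpleGraph V) [DecidableRel H.Adj] where
  /-- Whether an `H`-edge is directed, i.e. gets the strict gadget. -/
  directed : H.edgeSet → Bool
  /-- The `H`-edge `e` gets its gadget assigned to the pair `(src e, tgt e)`. A directed `H`-edge
  is directed from `src e` to `tgt e`; for an undirected one the order is arbitrary. -/
  src : H.edgeSet → V
  /-- The second component of that pair. -/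
  tgt : H.edgeSet → V
  endpoints : ∀ e : H.edgeSet, s(src e, tgt e) = (e : Sym2 V)
  /-- The undirected edges form a disjoint union of stars. -/
  stars : IsDisjointUnionOfStars
    (SimpleGraph.fromEdgeSet {z : Sym2 V | ∃ h : z ∈ H.edgeSet, directed ⟨z, h⟩ = false})
  /-- Every out-degree with respect to the directed edges is at most two. -/
  outDegree_le : ∀ x : V,
    (Finset.univ.filter fun e : H.edgeSet => directed e = true ∧ src e = x).card ≤ 2
  /-- The order `ψ` of the `H`-edges. -/
  psi : H.edgeSet ≃ Fin (Fintype.card H.edgeSet)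
  /-- The directed edges precede the undirected edges in `ψ`. -/
  psi_directed : ∀ e f : H.edgeSet, directed e = true → directed f = false → psi e < psi f
  /-- The cyclic arrangement of the assigned edges on the initial cycle with `3 (n + m)` edges:
  `next s` is the owner of the first assigned edge behind the assigned edge of `s`. As `n + m` of
  the `3 (n + m)` edges are assigned, at pairwise distance at least two, exactly two edges, which
  share a vertex, lie between consecutive assigned edges. -/
  next : Equiv.Perm (V ⊕ H.edgeSet)
  next_cycle : next.IsCycleOn Set.univ
  /-- Which endpoint of an assigned edge is `x_ℓ` (resp. `Z`): if `false`, the one that is met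
  first when the cycle is traversed along `next`, otherwise the other one. -/
  flip : V ⊕ H.edgeSet → Bool
  /-- The order in which the `H`-vertices are treated when the vertices of the XOR gadgets get
  their priorities. -/
  ord : V ≃ Fin (Fintype.card V)

section Construction

variable {H : SimpleGraph V} [DecidableRel H.Adj] (C : Choices H) (k : ℕ)

/-- The out-degree `d⁺(x)` with respect to the directed edges. -/
def outDegree (x : V) : ℕ :=
  (Finset.univ.filter fun e : H.edgeSet => C.directed e = true ∧ C.src e = x).card

/-- The order `k - 2 d(x) - 2 d⁺(x) - 1` of the XOR gadget of `x`. (The subtraction is exact for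
`k ≥ 15` and `d(x) ≤ 5`.) -/
def xorOrder (x : V) : ℕ := k - 2 * H.degree x - 2 * outDegree C x - 1

/-- The vertices of the graph `G`. The vertices `x_i, x'_i` of the second-set paths and the
endpoints of the `xy`-edges are the vertices `X, X', Y, Y', Z, Z'` of the parity gadgets with which
they are identified. -/
inductive Vertex
  /-- The vertex of the initial cycle between the two unassigned edges behind the assigned edge
  of `s`. -/
  | gap (s : V ⊕ H.edgeSet)
  /-- The vertex `x_ℓ`. -/
  | left (x : V)
  /-- The vertex `x_r`. -/
  | right (x : V)
  /-- The vertex `a_{i+1}` of the first rail of the XOR gadget of `x`. -/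
  | railA (x : V) (i : Fin (xorOrder C k x))
  /-- The vertex `b_{i+1}` of the second rail of the XOR gadget of `x`. -/
  | railB (x : V) (i : Fin (xorOrder C k x))
  /-- The inner vertex of the path of length two between `a_{i+1}` and `b_{i+1}`. -/
  | rung (x : V) (i : Fin (xorOrder C k x))
  /-- The vertices of the strict gadgets. -/
  | strict (e : {e : H.edgeSet // C.directed e = true}) (q : StrictVertex)
  /-- The vertices of the flexible gadgets. -/
  | flex (e : {e : H.edgeSet // ¬ C.directed e = true}) (q : FlexVertex)

noncomputable instance : DecidableEq (Vertex C k) := Classical.decEq _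

/-- The vertices as elements of a sum of finite types. -/
def Vertex.code : Vertex C k →
    (V ⊕ H.edgeSet) ⊕ V ⊕ V ⊕ (Σ x : V, Fin (xorOrder C k x)) ⊕
      (Σ x : V, Fin (xorOrder C k x)) ⊕ (Σ x : V, Fin (xorOrder C k x)) ⊕
      ({e : H.edgeSet // C.directed e = true} × StrictVertex) ⊕
      ({e : H.edgeSet // ¬ C.directed e = true} × FlexVertex)
  | .gap s => .inl s
  | .left x => .inr (.inl x)
  | .right x => .inr (.inr (.inl x))
  | .railA x i => .inr (.inr (.inr (.inl ⟨x, i⟩)))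
  | .railB x i => .inr (.inr (.inr (.inr (.inl ⟨x, i⟩))))
  | .rung x i => .inr (.inr (.inr (.inr (.inr (.inl ⟨x, i⟩)))))
  | .strict e q => .inr (.inr (.inr (.inr (.inr (.inr (.inl (e, q)))))))
  | .flex e q => .inr (.inr (.inr (.inr (.inr (.inr (.inr (e, q)))))))

theorem Vertex.code_injective : Function.Injective (Vertex.code C k) := by
  intro u v h
  cases u <;> cases v <;> simp_all [Vertex.code]

noncomputable instance : Fintype (Vertex C k) := Fintype.ofInjective _ (Vertex.code_injective C k)

/-- The vertex of the parity gadget of `e` that is called `q₁` if the gadget is strict and `q₂`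
if it is flexible. -/
def port (q₁ : StrictVertex) (q₂ : FlexVertex) (e : H.edgeSet) : Vertex C k :=
  if h : C.directed e = true then .strict ⟨e, h⟩ q₁ else .flex ⟨e, h⟩ q₂

/-- The vertex of the gadget of `e` at which the second-set path of `x`, traversed from `x_ℓ`,
enters the gadget: `X` or `Y`. -/
def enter (x : V) (e : H.edgeSet) : Vertex C k :=
  if x = C.src e then port C k .X .X e else port C k .Y .Y e

/-- The vertex of the gadget of `e` at which the second-set path of `x`, traversed from `x_ℓ`,
leaves the gadget: `X'` or `Y'`. -/
def leave (x : V) (e : H.edgeSet) : Vertex C k :=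
  if x = C.src e then port C k .Xp .Xp e else port C k .Yp .Yp e

/-- The vertex `x_ℓ` or `Z` of an assigned edge of the initial cycle. -/
def slotLeft : V ⊕ H.edgeSet → Vertex C k
  | .inl x => .left x
  | .inr e => port C k .Z .Z e

/-- The vertex `x_r` or `Z'` of an assigned edge of the initial cycle. -/
def slotRight : V ⊕ H.edgeSet → Vertex C k
  | .inl x => .right x
  | .inr e => port C k .Zp .Zp e

/-- The endpoint of the assigned edge of `s` that is met first along the initial cycle. -/
def slotFirst (s : V ⊕ H.edgeSet) : Vertex C k :=
  if C.flip s then slotRight C k s else slotLeft C k s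

/-- The endpoint of the assigned edge of `s` that is met last along the initial cycle. -/
def slotLast (s : V ⊕ H.edgeSet) : Vertex C k :=
  if C.flip s then slotLeft C k s else slotRight C k s

/-- Among the `H`-edges at `x`, the edge `f` is the immediate `ψ`-successor of `e`. -/
def Follows (x : V) (e f : H.edgeSet) : Prop :=
  x ∈ (e : Sym2 V) ∧ x ∈ (f : Sym2 V) ∧ C.psi e < C.psi f ∧
    ∀ g : H.edgeSet, x ∈ (g : Sym2 V) → ¬ (C.psi e < C.psi g ∧ C.psi g < C.psi f)

/-- `e` is the `ψ`-first among the `H`-edges at `x`. -/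
def IsFirst (x : V) (e : H.edgeSet) : Prop :=
  x ∈ (e : Sym2 V) ∧ ∀ g : H.edgeSet, x ∈ (g : Sym2 V) → C.psi e ≤ C.psi g

/-- `e` is the `ψ`-last among the `H`-edges at `x`. -/
def IsLast (x : V) (e : H.edgeSet) : Prop :=
  x ∈ (e : Sym2 V) ∧ ∀ g : H.edgeSet, x ∈ (g : Sym2 V) → C.psi g ≤ C.psi e

/-- The path `(x_ℓ, a_1, …, a_p, x_r)`, as a sequence indexed by `0, …, p + 1`. -/
def pathA (x : V) (i : ℕ) : Vertex C k :=
  if i = 0 then .left x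
  else if h : i - 1 < xorOrder C k x then .railA x ⟨i - 1, h⟩ else .right x

/-- The path `(b_1, …, b_p, x_r)`, as a sequence indexed by `1, …, p + 1`. -/
def pathB (x : V) (i : ℕ) : Vertex C k :=
  if h : i - 1 < xorOrder C k x then .railB x ⟨i - 1, h⟩ else .right x

/-- The edges of the graph `G`, each in one direction. -/
inductive Link : Vertex C k → Vertex C k → Prop
  /-- The unassigned edges of the initial cycle. -/
  | gapBefore (s : V ⊕ H.edgeSet) : Link (slotLast C k s) (.gap s)
  | gapAfter (s : V ⊕ H.edgeSet) : Link (.gap s) (slotFirst C k (C.next s))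
  /-- The subdivided first-set edge of `x`. -/
  | firstSet (x : V) (i : ℕ) (hi : i ≤ xorOrder C k x) :
      Link (pathA C k x i) (pathA C k x (i + 1))
  /-- The door at `x_ℓ`, if `x` has positive degree. -/
  | doorFirst (x : V) (e : H.edgeSet) (h : IsFirst C x e) : Link (.left x) (enter C k x e)
  /-- The doors between two gadgets. -/
  | door (x : V) (e f : H.edgeSet) (h : Follows C x e f) : Link (leave C k x e) (enter C k x f)
  /-- The closest door to `x_r`, if `x` has positive degree. -/
  | doorLast (x : V) (e : H.edgeSet) (h : IsLast C x e) : Link (leave C k x e) (pathB C k x 1)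
  /-- If `x` has degree zero, its only door joins `x_ℓ` and the XOR gadget of `x`. -/
  | doorOnly (x : V) (h : ∀ e : H.edgeSet, x ∉ (e : Sym2 V)) : Link (.left x) (pathB C k x 1)
  /-- The other edges of the subdivided door. -/
  | secondSet (x : V) (i : ℕ) (h₁ : 1 ≤ i) (h₂ : i ≤ xorOrder C k x) :
      Link (pathB C k x i) (pathB C k x (i + 1))
  /-- The paths of length two between the rails of the XOR gadgets. -/
  | rungA (x : V) (i : Fin (xorOrder C k x)) : Link (.railA x i) (.rung x i)
  | rungB (x : V) (i : Fin (xorOrder C k x)) : Link (.rung x i) (.railB x i)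
  /-- The internal edges of the parity gadgets. -/
  | strict (e : {e : H.edgeSet // C.directed e = true}) (q r : StrictVertex)
      (h : (q, r) ∈ strictEdges) : Link (.strict e q) (.strict e r)
  | flex (e : {e : H.edgeSet // ¬ C.directed e = true}) (q r : FlexVertex)
      (h : (q, r) ∈ flexEdges) : Link (.flex e q) (.flex e r)

/-- The graph `G`. -/
def graph : SimpleGraph (Vertex C k) := SimpleGraph.fromRel (Link C k)

/-- The same-set edges of the parity gadget of `e`: `ZZ'` and `Y'a` in the strict gadget, `ZZ'`
and `X'Y'` in the flexible gadget. -/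
noncomputable def sameSetEdges (e : H.edgeSet) : Finset (Sym2 (Vertex C k)) :=
  {s(port C k .Z .Z e, port C k .Zp .Zp e), s(port C k .Yp .Yp e, port C k .a .Xp e)}

/-- The different-set edges of the parity gadget of `e`: `Y'Z` and `Z'a` in the strict gadget,
`Y'Z` and `Z'X'` in the flexible gadget. -/
noncomputable def differentSetEdges (e : H.edgeSet) : Finset (Sym2 (Vertex C k)) :=
  {s(port C k .Yp .Yp e, port C k .Z .Z e), s(port C k .Zp .Zp e, port C k .a .Xp e)}

/-- The weights `c` of the edges of `G`: the same-set weight of the gadget of `e` is `w e` if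
`w e ≥ 0` and zero otherwise, its different-set weight is `-w e` if `w e < 0` and zero otherwise,
and all other edges have weight zero. -/
noncomputable def edgeWeight (w : H.edgeSet → ℤ) (z : Sym2 (Vertex C k)) : ℕ :=
  ∑ e : H.edgeSet, ((if z ∈ sameSetEdges C k e then (w e).toNat else 0) +
    (if z ∈ differentSetEdges C k e then (-w e).toNat else 0))

open Classical in
/-- The sum `M` of all edge weights of `G`. -/
noncomputable def totalWeight (w : H.edgeSet → ℤ) : ℕ :=
  ∑ z ∈ (graph C k).edgeFinset, edgeWeight C k w z

open Classical in
/-- The weights `c_∞` of the complete graph `G_∞`: a non-edge `vv'` has weight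
`M * 4 ^ max (prio v) (prio v')`. -/
noncomputable def completedWeight (w : H.edgeSet → ℤ) (prio : Vertex C k → ℕ)
    (z : Sym2 (Vertex C k)) : ℕ :=
  if z ∈ (graph C k).edgeSet then edgeWeight C k w z
  else totalWeight C k w * 4 ^ (z.map prio).sup

/-- The place (phase, block, position in the block) of a vertex of degree at least three in the
order in which the priorities are given out. The phases are: `1` for the vertices `x_ℓ`, `2` for
the vertices `(a_1, …, a_p, x_r, b_p, …, b_1)` of each `H`-vertex, `3` for the gadgets in the
order `ψ`. -/
def rawPlace : Vertex C k → ℕ ×ₗ ℕ ×ₗ ℕ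
  | .left _ => toLex (1, toLex (0, 0))
  | .railA x i => toLex (2, toLex ((C.ord x : ℕ), (i : ℕ)))
  | .right x => toLex (2, toLex ((C.ord x : ℕ), xorOrder C k x))
  | .railB x i => toLex (2, toLex ((C.ord x : ℕ), 2 * xorOrder C k x - (i : ℕ)))
  | .strict e q => toLex (3, toLex ((C.psi e.1 : ℕ), strictPos q))
  | .flex e q => toLex (3, toLex ((C.psi e.1 : ℕ), flexPos q))
  | _ => toLex (0, toLex (0, 0))

open Classical in
/-- The place of a vertex in the order in which the priorities are given out. The vertices of
degree two come first. Ties are broken arbitrarily. -/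
noncomputable def place (v : Vertex C k) : ℕ ×ₗ ℕ ×ₗ ℕ :=
  if (graph C k).degree v = 2 then toLex (0, toLex (0, 0)) else rawPlace C k v

/-- `prio` is a priority assignment: the values `N, …, 1`, where `N` is the number of vertices of
`G`, are given out in decreasing order along `place`. -/
def IsPriority (prio : Vertex C k → ℕ) : Prop :=
  Set.BijOn prio Set.univ (Set.Icc 1 (Fintype.card (Vertex C k))) ∧
    ∀ u v : Vertex C k, place C k u < place C k v → prio v < prio u

end Construction

end MaxCutReduction

/-! Suppose that a tour T contains a non-edge and has no improving 3-swap. Let v be the vertex of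
highest priority on a non-edge of T, let vv' be such a non-edge, and call the vertices of higher
priority than v high. All tour edges at high vertices then belong to G. Costs of non-edges grow by a
factor of 4 with the priority, so the removal of vv' pays for one edge of G and two more edges, each
of which lies in G or has both ends below v.

Let u be a neighbor of v in G with vu not in T, and traverse T as v', ..., p, u, s, ..., v. The
2-exchange of vv', us for vu, v's shows that s is high. If p is not high, the 3-exchange of vv', pu,
ab for vu, av', pb shows that every edge ab of the part from u to v contains v or a high vertex
(`exists_stuck`). This part and the edge vu form a cycle K, the trap.

The order of the priorities leaves no room for a trap. Vertices of degree two come first; it follows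
that v has degree at least three and that all edges at vertices of degree two belong to T. Every
vertex of degree at least three has exactly one neighbor of degree two. Hence vv' and the edge to
this neighbor are the tour edges at v, and K is contained in G. For most vertices v a neighbor u is
found directly whose only high tour neighbor has degree two; then p is not high and the trap exists.
In the remaining cases the position of T in the gadget is used to find u.

Two kinds of contradiction occur. Locally, K is followed along the paths of length two until it
reaches a low vertex with only low vertices left to go to, or would need a third edge somewhere.
Globally, K contains a gap, i.e. a vertex of degree two on the initial cycle. If at every parity
gadget K uses both or none of the two doors of either second-set path, then handshakes in the parity
gadgets and cuts through the XOR gadgets carry the use of gaps from slot to slot, so K contains all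
gaps (`all_gaps`). But some Z, and with it the gap next to it, is missing from K.

The condition on the doors depends on the position of a gadget in ψ. Later gadgets are low apart
from their vertices of degree two (`Ctx.doors_of_low`). In earlier gadgets K follows T, and T has
equal doors there (`GadgetCtx.doors_of_early`). At the source of a strict gadget, unequal doors
would close a subtour with six vertices, and the handshake settles the target. A flexible gadget is
the last one at a leaf of its star, behind strict gadgets only; there the XOR gadget forces equal
doors, and the handshake settles the other end. A missing Z is usually found in a later gadget: the
vertex v' is not high, so outside of the gadget of v it can only lie in a later one, and unequal
doors of T at the gadget of v also imply that a later one follows. -/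

namespace TSP

/-! ### Paths and cycles as lists of vertices. -/

variable {U : Type*}

/-- The edges between consecutive entries of a list. -/
def pathEdges : List U → List (Sym2 U)
  | x :: y :: l => s(x, y) :: pathEdges (y :: l)
  | _ => []

/-- The edges of the closed walk through the entries of a list. -/
def cycEdges : List U → List (Sym2 U)
  | [] => []
  | x :: l => s((x :: l).getLast (by simp), x) :: pathEdges (x :: l)

theorem cycEdges_eq {l : List U} (h : l ≠ []) :
    cycEdges l = s(l.getLast h, l.head h) :: pathEdges l := by
  cases l with
  | nil => exact absurd rfl h
  | cons x l => rfl

theorem pathEdges_append {A B : List U} (hA : A ≠ []) (hB : B ≠ []) :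
    pathEdges (A ++ B) = pathEdges A ++ s(A.getLast hA, B.head hB) :: pathEdges B := by
  induction A with
  | nil => exact absurd rfl hA
  | cons x A ih =>
    cases A with
    | nil =>
      cases B with
      | nil => exact absurd rfl hB
      | cons y B => simp [pathEdges]
    | cons z A =>
      have := ih (by simp)
      simp only [List.cons_append, pathEdges] at this ⊢
      rw [this]
      simp

theorem pathEdges_reverse_perm (l : List U) : (pathEdges l.reverse).Perm (pathEdges l) := by
  induction l with
  | nil => simp
  | cons x l ih =>
    cases l with
    | nil => simp
    | cons y l =>
      rw [List.reverse_cons, pathEdges_append (by simp) (by simp)]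
      simp only [List.getLast_reverse, List.head_cons, pathEdges]
      rw [Sym2.eq_swap]
      exact (List.perm_append_singleton _ _).trans (List.Perm.cons _ ih)

theorem mem_of_mem_pathEdges {l : List U} {x y : U} (h : s(x, y) ∈ pathEdges l) :
    x ∈ l ∧ y ∈ l := by
  induction l with
  | nil => simp [pathEdges] at h
  | cons a l ih =>
    cases l with
    | nil => simp [pathEdges] at h
    | cons b l =>
      simp only [pathEdges, List.mem_cons] at h
      rcases h with h | h
      · rcases Sym2.eq_iff.1 h with ⟨rfl, rfl⟩ | ⟨rfl, rfl⟩ <;> simp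
      · exact ⟨List.mem_cons_of_mem _ (ih h).1, List.mem_cons_of_mem _ (ih h).2⟩

theorem exists_split_of_mem_pathEdges {l : List U} {z : Sym2 U} (h : z ∈ pathEdges l) :
    ∃ (A B : List U) (hA : A ≠ []) (hB : B ≠ []),
      l = A ++ B ∧ z = s(A.getLast hA, B.head hB) := by
  induction l with
  | nil => simp [pathEdges] at h
  | cons a l ih =>
    cases l with
    | nil => simp [pathEdges] at h
    | cons b l =>
      simp only [pathEdges, List.mem_cons] at h
      rcases h with h | h
      · exact ⟨[a], b :: l, by simp, by simp, rfl, by simpa using h⟩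
      · obtain ⟨A, B, hA, hB, h₁, h₂⟩ := ih h
        exact ⟨a :: A, B, by simp, hB, by simp [h₁], by rw [h₂, List.getLast_cons hA]⟩

theorem nodup_pathEdges {l : List U} (hl : l.Nodup) : (pathEdges l).Nodup := by
  induction l with
  | nil => simp [pathEdges]
  | cons a l ih =>
    cases l with
    | nil => simp [pathEdges]
    | cons b l =>
      rw [List.nodup_cons] at hl
      simp only [pathEdges, List.nodup_cons]
      exact ⟨fun h => hl.1 (mem_of_mem_pathEdges h).1, ih hl.2⟩

theorem not_isDiag_of_mem_pathEdges {l : List U} (hl : l.Nodup) {z : Sym2 U}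
    (h : z ∈ pathEdges l) : ¬ z.IsDiag := by
  obtain ⟨A, B, hA, hB, rfl, rfl⟩ := exists_split_of_mem_pathEdges h
  intro hd
  rw [List.nodup_append] at hl
  exact hl.2.2 _ (List.getLast_mem hA) _ (List.head_mem hB) (by simpa using hd)

/-- The two edges between the arcs are listed apart from the edges inside. A 2-exchange reverses one
arc and, by `pathEdges_reverse_perm`, changes only these two. -/
theorem cycEdges_append_perm {A B : List U} (hA : A ≠ []) (hB : B ≠ []) :
    (cycEdges (A ++ B)).Perm ([s(B.getLast hB, A.head hA), s(A.getLast hA, B.head hB)] ++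
      (pathEdges A ++ pathEdges B)) := by
  rw [cycEdges_eq (by simp [hA]), pathEdges_append hA hB, List.getLast_append_of_ne_nil _ hB,
    List.head_append_of_ne_nil hA]
  refine List.Perm.cons _ ?_
  exact List.perm_middle

theorem cycEdges_rotate_perm (A B : List U) : (cycEdges (A ++ B)).Perm (cycEdges (B ++ A)) := by
  by_cases hA : A = []
  · simp [hA]
  by_cases hB : B = []
  · simp [hB]
  refine (cycEdges_append_perm hA hB).trans (List.Perm.trans ?_ (cycEdges_append_perm hB hA).symm)
  exact (List.Perm.swap _ _ _).append List.perm_append_comm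

/-- The same decomposition for three arcs. Interchanging the last two arcs, without reversal,
changes only the three connecting edges. -/
theorem cycEdges_append₃_perm {A B D : List U} (hA : A ≠ []) (hB : B ≠ []) (hD : D ≠ []) :
    (cycEdges (A ++ (B ++ D))).Perm
      ([s(D.getLast hD, A.head hA), s(A.getLast hA, B.head hB), s(B.getLast hB, D.head hD)] ++
      (pathEdges A ++ (pathEdges B ++ pathEdges D))) := by
  have hBD : B ++ D ≠ [] := by simp [hB]
  refine (cycEdges_append_perm hA hBD).trans ?_
  rw [List.getLast_append_of_ne_nil _ hD, List.head_append_of_ne_nil hB, pathEdges_append hB hD]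
  simp only [List.cons_append, List.nil_append]
  refine List.Perm.cons _ (List.Perm.cons _ ?_)
  rw [← List.append_assoc, ← List.append_assoc]
  exact List.perm_middle

theorem cycEdges_reverse_perm (l : List U) : (cycEdges l.reverse).Perm (cycEdges l) := by
  by_cases h : l = []
  · simp [h]
  rw [cycEdges_eq h, cycEdges_eq (by simpa using h)]
  simp only [List.getLast_reverse, List.head_reverse]
  rw [Sym2.eq_swap]
  exact List.Perm.cons _ (pathEdges_reverse_perm l)

theorem cycEdges_cons_cons {x c : U} {D : List U} :
    cycEdges (x :: c :: D) =
      s((c :: D).getLast (by simp), x) :: s(x, c) :: pathEdges (c :: D) := by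
  rw [cycEdges_eq (by simp)]
  simp [pathEdges, List.getLast_cons]

theorem nodup_cycEdges {l : List U} (hl : l.Nodup) (h3 : 3 ≤ l.length) : (cycEdges l).Nodup := by
  match l, hl, h3 with
  | x :: c :: d :: D, hl, _ =>
    rw [cycEdges_eq (by simp), List.nodup_cons]
    refine ⟨fun h => ?_, nodup_pathEdges hl⟩
    rw [List.nodup_cons, List.nodup_cons] at hl
    have hlast : (x :: c :: d :: D).getLast (by simp) ∈ d :: D := by simp [List.getLast_cons]
    rw [List.head_cons] at h
    rw [show pathEdges (x :: c :: d :: D) = s(x, c) :: pathEdges (c :: d :: D) from rfl,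
      List.mem_cons] at h
    rcases h with h | h
    · rcases Sym2.eq_iff.1 h with ⟨h₁, h₂⟩ | ⟨h₁, h₂⟩
      · exact hl.1 (h₁ ▸ List.mem_cons_of_mem _ hlast)
      · exact hl.2.1 (h₁ ▸ hlast)
    · exact hl.1 (mem_of_mem_pathEdges h).2

theorem not_isDiag_of_mem_cycEdges {l : List U} (hl : l.Nodup) (h3 : 3 ≤ l.length) {z : Sym2 U}
    (h : z ∈ cycEdges l) : ¬ z.IsDiag := by
  match l, hl, h3 with
  | x :: c :: D, hl, _ =>
    rw [cycEdges_eq (by simp), List.mem_cons] at h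
    rcases h with rfl | h
    · rw [List.nodup_cons] at hl
      intro hd
      apply hl.1
      have : (x :: c :: D).getLast (by simp) = x := by simpa using hd
      rw [List.getLast_cons (by simp)] at this
      exact this ▸ List.getLast_mem _
    · exact not_isDiag_of_mem_pathEdges hl h

theorem mem_of_mem_cycEdges {l : List U} {x y : U} (h : s(x, y) ∈ cycEdges l) :
    x ∈ l ∧ y ∈ l := by
  by_cases hl : l = []
  · simp [hl, cycEdges] at h
  rw [cycEdges_eq hl, List.mem_cons] at h
  rcases h with h | h
  · rcases Sym2.eq_iff.1 h with ⟨rfl, rfl⟩ | ⟨rfl, rfl⟩ <;> simp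
  · exact mem_of_mem_pathEdges h

/-! ### Cycles as relations: degrees, parity of cuts, connectedness. -/

/-- `K` is the adjacency relation of a cycle of length at least three through some vertices. -/
def IsCyc (K : U → U → Prop) : Prop :=
  ∃ B : List U, B.Nodup ∧ 3 ≤ B.length ∧ ∀ x y, K x y ↔ s(x, y) ∈ cycEdges B

theorem isCyc_symm {K : U → U → Prop} (hK : IsCyc K) {x y : U} (h : K x y) : K y x := by
  obtain ⟨B, -, -, h'⟩ := hK
  rw [h'] at h ⊢
  rwa [Sym2.eq_swap]

/-- Rotating the list so that it starts at `x` makes the second and the last entry the two neighbors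
of `x` on the cycle, which `cycEdges_cons_cons` then displays. -/
theorem exists_nbrs_of_mem {l : List U} (hl : l.Nodup) (h3 : 3 ≤ l.length) {x : U} (hx : x ∈ l) :
    ∃ c D, (x :: c :: D).Nodup ∧ (x :: c :: D).Perm l ∧ D ≠ [] ∧
      (cycEdges (x :: c :: D)).Perm (cycEdges l) := by
  obtain ⟨A, B, rfl⟩ := List.append_of_mem hx
  have hp : (x :: (B ++ A)).Perm (A ++ x :: B) := by
    rw [← List.cons_append]; exact List.perm_append_comm
  have h3' : 3 ≤ (x :: (B ++ A)).length := by rw [hp.length_eq]; exact h3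
  have hc := cycEdges_rotate_perm (x :: B) A
  rw [List.cons_append] at hc
  revert hp h3' hc
  cases B ++ A with
  | nil => intro _ h; simp at h
  | cons c D =>
    intro hp h3' hc
    refine ⟨c, D, hp.nodup_iff.2 hl, hp, ?_, hc⟩
    rintro rfl
    simp at h3'

theorem isCyc_two {K : U → U → Prop} (hK : IsCyc K) {x z : U} (h : K x z) :
    ∃ a b, a ≠ b ∧ ∀ y, K x y ↔ y = a ∨ y = b := by
  obtain ⟨B, hB, h3, h'⟩ := hK
  obtain ⟨c, D, hn, hp, hD, hc⟩ :=
    exists_nbrs_of_mem hB h3 (mem_of_mem_cycEdges ((h' _ _).1 h)).1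
  rw [List.nodup_cons, List.nodup_cons] at hn
  refine ⟨(c :: D).getLast (by simp), c, ?_, fun y => ?_⟩
  · rw [List.getLast_cons hD]
    exact fun h => hn.2.1 (h ▸ List.getLast_mem hD)
  · rw [h', ← hc.mem_iff, cycEdges_cons_cons, List.mem_cons, List.mem_cons]
    constructor
    · rintro (h | h | h)
      · rcases Sym2.eq_iff.1 h with ⟨h₁, h₂⟩ | ⟨h₁, h₂⟩
        · exact absurd (h₁ ▸ List.getLast_mem _) hn.1
        · exact .inl h₂
      · rcases Sym2.eq_iff.1 h with ⟨h₁, h₂⟩ | ⟨h₁, h₂⟩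
        · exact .inr h₂
        · exact absurd (h₁ ▸ List.mem_cons_self) hn.1
      · exact absurd (mem_of_mem_pathEdges h).1 hn.1
    · rintro (rfl | rfl)
      · exact .inl Sym2.eq_swap
      · exact .inr (.inl rfl)

/-- The edge `z` joins a vertex satisfying `P` to one that does not. -/
def Crosses (P : U → Prop) (z : Sym2 U) : Prop := ∃ x y, z = s(x, y) ∧ P x ∧ ¬ P y

theorem crosses_mk {P : U → Prop} {x y : U} : Crosses P s(x, y) ↔ ¬ (P x ↔ P y) := by
  constructor
  · rintro ⟨a, b, h, ha, hb⟩
    rcases Sym2.eq_iff.1 h with ⟨rfl, rfl⟩ | ⟨rfl, rfl⟩ <;> tauto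
  · intro h
    by_cases hx : P x
    · exact ⟨x, y, rfl, hx, by tauto⟩
    · exact ⟨y, x, Sym2.eq_swap, by tauto, hx⟩

open Classical in
-- Each crossing edge switches between inside and outside, so the ends of the path decide the
-- parity.
theorem even_countP_pathEdges (P : U → Prop) {l : List U} (hl : l ≠ []) :
    Even ((pathEdges l).countP (fun z => decide (Crosses P z))) ↔
      (P (l.getLast hl) ↔ P (l.head hl)) := by
  induction l with
  | nil => exact absurd rfl hl
  | cons a l ih =>
    cases l with
    | nil => simp [pathEdges]
    | cons b l =>
      have ih := ih (by simp)
      simp only [pathEdges, List.countP_cons, List.getLast_cons (List.cons_ne_nil b l),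
        List.head_cons, decide_eq_true_eq, crosses_mk] at ih ⊢
      split_ifs with h
      · rw [add_zero, ih]; tauto
      · rw [Nat.even_add_one, ih]; tauto

open Classical in
theorem even_countP_cycEdges (P : U → Prop) (l : List U) :
    Even ((cycEdges l).countP (fun z => decide (Crosses P z))) := by
  by_cases hl : l = []
  · simp [hl, cycEdges]
  have h := even_countP_pathEdges P hl
  rw [cycEdges_eq hl, List.countP_cons]
  simp only [decide_eq_true_eq, crosses_mk]
  split_ifs with h'
  · rw [add_zero, h]; tauto
  · rw [Nat.even_add_one, h]; tauto

/-- A cycle crosses a cut of three edges an even number of times. -/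
theorem isCyc_parity {K : U → U → Prop} (hK : IsCyc K) (P : U → Prop) {a₁ b₁ a₂ b₂ a₃ b₃ : U}
    (ha₁ : P a₁) (ha₂ : P a₂) (ha₃ : P a₃) (hb₁ : ¬ P b₁) (hb₂ : ¬ P b₂) (hb₃ : ¬ P b₃)
    (h₁₂ : ¬ (a₁ = a₂ ∧ b₁ = b₂)) (h₁₃ : ¬ (a₁ = a₃ ∧ b₁ = b₃)) (h₂₃ : ¬ (a₂ = a₃ ∧ b₂ = b₃))
    (h : ∀ x y, P x → ¬ P y → K x y →
      (x = a₁ ∧ y = b₁) ∨ (x = a₂ ∧ y = b₂) ∨ (x = a₃ ∧ y = b₃)) :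
    (K a₁ b₁ ↔ K a₂ b₂) ↔ ¬ K a₃ b₃ := by
  classical
  obtain ⟨B, hB, h3, h'⟩ := hK
  have hev := even_countP_cycEdges P B
  rw [List.countP_eq_length_filter, ← List.toFinset_card_of_nodup
    ((nodup_cycEdges hB h3).filter _)] at hev
  have key : ∀ {a b c d : U}, P a → ¬ P b → P c → ¬ P d → s(a, b) = s(c, d) → a = c ∧ b = d := by
    intro a b c d ha hb hc hd h
    rcases Sym2.eq_iff.1 h with h | ⟨rfl, rfl⟩
    · exact h
    · exact absurd ha hd
  -- The crossing edges of the cycle are exactly those of the three candidates that it contains, so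
  -- the even count runs over at most three edges.
  have hset : ((cycEdges B).filter (fun z => decide (Crosses P z))).toFinset =
      ({s(a₁, b₁), s(a₂, b₂), s(a₃, b₃)} : Finset (Sym2 U)).filter (· ∈ cycEdges B) := by
    ext z
    simp only [List.toFinset_filter, Finset.mem_filter, List.mem_toFinset, decide_eq_true_eq,
      Finset.mem_insert, Finset.mem_singleton]
    constructor
    · rintro ⟨hz, x, y, rfl, hx, hy⟩
      rcases h x y hx hy ((h' _ _).2 hz) with ⟨rfl, rfl⟩ | ⟨rfl, rfl⟩ | ⟨rfl, rfl⟩ <;> simp [hz]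
    · rintro ⟨rfl | rfl | rfl, hz⟩
      · exact ⟨hz, _, _, rfl, ha₁, hb₁⟩
      · exact ⟨hz, _, _, rfl, ha₂, hb₂⟩
      · exact ⟨hz, _, _, rfl, ha₃, hb₃⟩
  rw [hset] at hev
  have n₁₂ : s(a₁, b₁) ≠ s(a₂, b₂) := fun h => h₁₂ (key ha₁ hb₁ ha₂ hb₂ h)
  have n₁₃ : s(a₁, b₁) ≠ s(a₃, b₃) := fun h => h₁₃ (key ha₁ hb₁ ha₃ hb₃ h)
  have n₂₃ : s(a₂, b₂) ≠ s(a₃, b₃) := fun h => h₂₃ (key ha₂ hb₂ ha₃ hb₃ h)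
  rw [h', h', h']
  -- Only the cases with an odd number of edges survive the simplification, and they contradict the
  -- parity.
  by_cases k₁ : s(a₁, b₁) ∈ cycEdges B <;> by_cases k₂ : s(a₂, b₂) ∈ cycEdges B <;>
    by_cases k₃ : s(a₃, b₃) ∈ cycEdges B <;>
    simp [Finset.filter_insert, Finset.filter_singleton, k₁, k₂, k₃, n₁₂, n₁₃, n₂₃] at hev ⊢
  all_goals exact absurd hev (by decide)

/-- A cycle with a vertex inside and a vertex outside of `P` has an edge that crosses `P`. -/
theorem isCyc_cut {K : U → U → Prop} (hK : IsCyc K) (P : U → Prop) {a a' b b' : U}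
    (ha : K a a') (hb : K b b') (hPa : P a) (hPb : ¬ P b) : ∃ x y, K x y ∧ P x ∧ ¬ P y := by
  by_contra hcon
  push Not at hcon
  have hsym : ∀ x y, K x y → (P x ↔ P y) :=
    fun x y h => ⟨hcon x y h, hcon y x (isCyc_symm hK h)⟩
  obtain ⟨B, hB, h3, h'⟩ := hK
  -- If no edge crosses, membership in `P` is constant along the list of the cycle.
  have hpath : ∀ l : List U, (∀ x y, s(x, y) ∈ pathEdges l → (P x ↔ P y)) →
      ∀ x ∈ l, ∀ y ∈ l, (P x ↔ P y) := by
    intro l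
    induction l with
    | nil => simp
    | cons c l ih =>
      intro hl
      cases l with
      | nil => simp
      | cons d l =>
        have h1 := hl c d (by simp [pathEdges])
        have ih' := ih (fun x y h => hl x y (by simp [pathEdges, h]))
        have h2 : ∀ x ∈ c :: d :: l, (P x ↔ P d) := by
          intro x hx
          rcases List.mem_cons.1 hx with rfl | hx
          · exact h1
          · exact ih' x hx d (by simp)
        exact fun x hx y hy => (h2 x hx).trans (h2 y hy).symm
  have hne : B ≠ [] := by rintro rfl; simp at h3
  have := hpath B (fun x y h => hsym x y ((h' x y).2 (by
    rw [cycEdges_eq hne]; exact List.mem_cons_of_mem _ h))) a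
    (mem_of_mem_cycEdges ((h' _ _).1 ha)).1 b (mem_of_mem_cycEdges ((h' _ _).1 hb)).1
  tauto

/-! ### Tours as lists, and swaps as rearrangements of lists. -/

/-- A list that runs through a tour with the edge set `τ`. -/
structure IsTourList (τ : Finset (Sym2 U)) (l : List U) : Prop where
  nodup : l.Nodup
  complete : ∀ x, x ∈ l
  length : 3 ≤ l.length
  mem_iff : ∀ z, z ∈ τ ↔ z ∈ cycEdges l

theorem edges_eq_pathEdges {G : SimpleGraph U} {a b : U} (p : G.Walk a b) :
    p.edges = pathEdges p.support := by
  induction p with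
  | nil => simp [pathEdges]
  | cons h q ih =>
    cases q with
    | nil => simp [pathEdges]
    | cons h' q =>
      rw [SimpleGraph.Walk.edges_cons, ih]
      simp [pathEdges]

theorem IsTourList.of_perm {τ : Finset (Sym2 U)} {l l' : List U} (h : IsTourList τ l)
    (hp : l'.Perm l) (hc : (cycEdges l').Perm (cycEdges l)) : IsTourList τ l' where
  nodup := hp.nodup_iff.2 h.nodup
  complete x := hp.mem_iff.2 (h.complete x)
  length := by rw [hp.length_eq]; exact h.length
  mem_iff z := by rw [hc.mem_iff, h.mem_iff]

/-- The tour is cut open at the edge `vv'`. After a rotation to `v`, its neighbors are the second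
and the last entry; if `v'` is the last one, the list is reversed. -/
theorem IsTourList.exists_ends {τ : Finset (Sym2 U)} {l : List U} (h : IsTourList τ l) {v v' : U}
    (hv : s(v, v') ∈ τ) : ∃ R, IsTourList τ (v' :: (R ++ [v])) := by
  obtain ⟨c, D, hn, hp, hD, hc⟩ := exists_nbrs_of_mem h.nodup h.length (h.complete v)
  have h1 : IsTourList τ (v :: c :: D) := h.of_perm hp hc
  have h2 : IsTourList τ ((c :: D) ++ [v]) :=
    h1.of_perm (List.perm_append_singleton _ _) (cycEdges_rotate_perm (c :: D) [v])
  rw [h1.mem_iff, cycEdges_cons_cons, List.mem_cons, List.mem_cons] at hv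
  rw [List.nodup_cons] at hn
  have hrev : v' = (c :: D).getLast (by simp) → ∃ R, IsTourList τ (v' :: (R ++ [v])) := by
    rintro rfl
    have h3 : IsTourList τ ((c :: D).reverse ++ [v]) := by
      refine h1.of_perm ((List.perm_append_singleton _ _).trans
        ((List.reverse_perm _).cons _)) ?_
      have : (c :: D).reverse ++ [v] = (v :: c :: D).reverse := by simp
      rw [this]
      exact cycEdges_reverse_perm _
    refine ⟨(c :: D).reverse.tail, ?_⟩
    have hne : (c :: D).reverse ≠ [] := by simp
    have : (c :: D).getLast (by simp) :: ((c :: D).reverse.tail ++ [v]) =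
        (c :: D).reverse ++ [v] := by
      rw [← List.cons_append]
      congr 1
      conv_rhs => rw [← List.cons_head_tail hne]
      rw [List.head_reverse]
    rw [this]
    exact h3
  rcases hv with hv | hv | hv
  · rcases Sym2.eq_iff.1 hv with ⟨h₁, h₂⟩ | ⟨h₁, h₂⟩
    · exact absurd (h₁ ▸ List.getLast_mem _) hn.1
    · exact hrev h₂
  · rcases Sym2.eq_iff.1 hv with ⟨h₁, h₂⟩ | ⟨h₁, h₂⟩
    · exact ⟨D, h₂ ▸ h2⟩
    · exact absurd (h₁ ▸ List.mem_cons_self) hn.1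
  · exact absurd (mem_of_mem_pathEdges hv).1 hn.1

variable [DecidableEq U]

/-- Without its first step, the Hamiltonian cycle is a path whose support contains each vertex once;
the omitted edge closes the list. -/
theorem exists_isTourList {τ : Finset (Sym2 U)} (h : IsTour (⊤ : SimpleGraph U) τ) :
    ∃ l, IsTourList τ l := by
  obtain ⟨v, p, hp, rfl⟩ := h
  have hc := SimpleGraph.Walk.isHamiltonianCycle_iff_isCycle_and_support_count_tail_eq_one.1 hp
  cases p with
  | nil => exact absurd rfl hp.isCycle.ne_nil
  | @cons _ w _ hvw q =>
    simp only [SimpleGraph.Walk.support_cons, List.tail_cons] at hc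
    refine ⟨q.support, List.nodup_iff_count_le_one.2 fun a => (hc.2 a).le,
      fun x => List.count_pos_iff.1 (by rw [hc.2]; simp), ?_, fun z => ?_⟩
    · have := hc.1.three_le_length
      simpa using this
    · rw [List.mem_toFinset, SimpleGraph.Walk.edges_cons, cycEdges_eq q.support_ne_nil,
        edges_eq_pathEdges]
      simp

theorem IsTourList.isTour {τ : Finset (Sym2 U)} {l : List U} (h : IsTourList τ l) :
    IsTour (⊤ : SimpleGraph U) τ := by
  have hne : l ≠ [] := by rintro rfl; simpa using h.length
  have hchain : l.IsChain (⊤ : SimpleGraph U).Adj := by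
    have := h.nodup
    rw [List.Nodup] at this
    exact this.isChain.imp fun a b h => by simpa using h
  have hnd := nodup_cycEdges h.nodup h.length
  rw [cycEdges_eq hne, List.nodup_cons] at hnd
  have hadj : (⊤ : SimpleGraph U).Adj (l.getLast hne) (l.head hne) := by
    have := not_isDiag_of_mem_cycEdges (z := s(l.getLast hne, l.head hne)) h.nodup h.length
      (by rw [cycEdges_eq hne]; simp)
    simpa using this
  let q := SimpleGraph.Walk.ofSupport l hne hchain
  have hq : q.support = l := SimpleGraph.Walk.support_ofSupport hne hchain
  have hqe : q.edges = pathEdges l := by rw [edges_eq_pathEdges, hq]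
  refine ⟨_, SimpleGraph.Walk.cons hadj q, ?_, ?_⟩
  · rw [SimpleGraph.Walk.isHamiltonianCycle_iff_isCycle_and_support_count_tail_eq_one]
    refine ⟨?_, fun a => ?_⟩
    · rw [SimpleGraph.Walk.cons_isCycle_iff, hqe, SimpleGraph.Walk.isPath_def, hq]
      exact ⟨h.nodup, hnd.1⟩
    · rw [SimpleGraph.Walk.support_cons, List.tail_cons, hq]
      exact List.count_eq_one_of_mem h.nodup (h.complete a)
  · ext z
    rw [List.mem_toFinset, SimpleGraph.Walk.edges_cons, hqe, h.mem_iff, cycEdges_eq hne]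

/-- Exchanging the edges `E₁` of a tour list for `E₂` is an improving swap. -/
theorem exists_improving_of_lists {c : Sym2 U → ℕ} {τ : Finset (Sym2 U)} {l l' : List U}
    (h : IsTourList τ l) (hp : l'.Perm l) {E₁ E₂ I : List (Sym2 U)}
    (h₁ : (cycEdges l).Perm (E₁ ++ I)) (h₂ : (cycEdges l').Perm (E₂ ++ I))
    (hlen : E₁.length = E₂.length) (h3 : E₁.length ≤ 3)
    (hc : (E₂.map c).sum < (E₁.map c).sum) :
    ∃ F₁ F₂ : Finset (Sym2 U), IsSwap 3 F₁ F₂ ∧ IsImproving c τ F₁ F₂ := by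
  have hnd' : l'.Nodup := hp.nodup_iff.2 h.nodup
  have hl3' : 3 ≤ l'.length := by rw [hp.length_eq]; exact h.length
  have hn₁ := h₁.nodup_iff.1 (nodup_cycEdges h.nodup h.length)
  have hn₂ := h₂.nodup_iff.1 (nodup_cycEdges hnd' hl3')
  have hτ : τ = (E₁ ++ I).toFinset := by
    ext z; rw [h.mem_iff, h₁.mem_iff, List.mem_toFinset]
  -- The common edges `I` are disjoint from `E₁` and survive the removal. An edge of `E₁` that
  -- reappears in `E₂` does no harm.
  have hperf : perform τ E₁.toFinset E₂.toFinset = (E₂ ++ I).toFinset := by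
    rw [List.nodup_append] at hn₁
    ext z
    simp only [perform, hτ, Finset.mem_union, Finset.mem_sdiff, List.mem_toFinset,
      List.mem_append]
    constructor
    · tauto
    · rintro (hz | hz)
      · exact .inr hz
      · exact .inl ⟨.inr hz, fun hz' => hn₁.2.2 z hz' z hz rfl⟩
  have hsum : ∀ E : List (Sym2 U), (E ++ I).Nodup →
      weight c (E ++ I).toFinset = (E.map c).sum + (I.map c).sum := by
    intro E hE
    rw [weight, List.sum_toFinset _ hE, List.map_append, List.sum_append]
  refine ⟨E₁.toFinset, E₂.toFinset, ⟨?_, ?_, ?_, ?_⟩, ?_, ?_, ?_⟩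
  · intro z hz
    have := not_isDiag_of_mem_cycEdges (z := z) h.nodup h.length
      (h₁.mem_iff.2 (List.mem_append_left _ (List.mem_toFinset.1 hz)))
    simpa using this
  · intro z hz
    have := not_isDiag_of_mem_cycEdges (z := z) hnd' hl3'
      (h₂.mem_iff.2 (List.mem_append_left _ (List.mem_toFinset.1 hz)))
    simpa using this
  · rw [List.toFinset_card_of_nodup (List.nodup_append.1 hn₁).1,
      List.toFinset_card_of_nodup (List.nodup_append.1 hn₂).1, hlen]
  · rw [List.toFinset_card_of_nodup (List.nodup_append.1 hn₁).1]; exact h3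
  · rw [hτ]; intro z; simp +contextual
  · refine IsTourList.isTour (l := l') ⟨hnd', fun x => hp.mem_iff.2 (h.complete x), hl3', ?_⟩
    intro z; rw [hperf, List.mem_toFinset, h₂.mem_iff]
  · rw [hperf, hτ, hsum _ hn₁, hsum _ hn₂]; omega

end TSP

/-! ### What the absence of improving 3-swaps implies. -/

namespace TSP

variable {U : Type*}

/-- A cycle `K` that consists of the edge `uv` and a part of the tour `T` between `u` and `v`, such
that no edge of that part joins two vertices that are neither high nor equal to `v`. The tour
edges `vv'` and `up` do not belong to `K`. -/
structure BadCycle (T : U → U → Prop) (high : U → Prop) (v v' u p : U) (K : U → U → Prop) :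
    Prop where
  cyc : IsCyc K
  adj : K v u
  tour : ∀ {x y}, K x y → T x y ∨ (x = u ∧ y = v) ∨ (x = v ∧ y = u)
  mem_tour : ∀ {x y z}, K x z → T x y → K x y ∨ (x = u ∧ y = p) ∨ (x = v ∧ y = v')
  not_mem : ∀ z, ¬ K p z
  not_low : ∀ {x y}, K x y → high x ∨ high y ∨ x = v ∨ y = v

/-- The situation at a vertex `v` with a tour edge `vv'` outside of `G`, if all tour edges at high
vertices belong to `G` and no improving swap with three edges adds an edge of `G` at `v`. -/
structure Stuck (G : SimpleGraph U) (T : U → U → Prop) (high : U → Prop) (v v' : U) : Prop where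
  cyc : IsCyc T
  total : ∀ x, ∃ y, T x y
  adj : T v v'
  not_adj : ¬ G.Adj v v'
  sat : ∀ {x y}, high x → T x y → G.Adj x y
  not_high : ¬ high v
  move : ∀ {u}, G.Adj v u → ¬ T v u → ∃ s p, s ≠ p ∧ T u s ∧ T u p ∧ high s ∧
    (¬ high p → ∃ K, BadCycle T high v v' u p K)

/-- Non-edges of `G` are expensive, according to the priorities of their endpoints, and all edges
of `G` together are cheap. -/
structure IsPenalty (G : SimpleGraph U) (prio : U → ℕ) (c : Sym2 U → ℕ) (M : ℕ) : Prop where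
  pos : 0 < M
  prio_pos : ∀ x, 1 ≤ prio x
  prio_inj : Function.Injective prio
  sum_le : ∀ F : Finset (Sym2 U), (∀ z ∈ F, z ∈ G.edgeSet) → ∑ z ∈ F, c z ≤ M
  eq : ∀ x y, ¬ G.Adj x y → c s(x, y) = M * 4 ^ max (prio x) (prio y)

section Penalty

variable {G : SimpleGraph U} {prio : U → ℕ} {c : Sym2 U → ℕ} {M : ℕ}

theorem IsPenalty.le_of_low (hW : IsPenalty G prio c M) {v x y : U} (hx : prio x < prio v)
    (hy : prio y < prio v) :
    s(x, y) ∈ G.edgeSet ∨ c s(x, y) ≤ M * 4 ^ (prio v - 1) := by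
  by_cases h : G.Adj x y
  · exact .inl h
  · right
    rw [hW.eq x y h]
    exact Nat.mul_le_mul_left _ (Nat.pow_le_pow_right (by norm_num) (by omega))

theorem IsPenalty.sum_lt (hW : IsPenalty G prio c M) (v : U) {g : Sym2 U} {L : List (Sym2 U)}
    (hn : (g :: L).Nodup) (hg : g ∈ G.edgeSet) (hlen : L.length ≤ 2)
    (h : ∀ z ∈ L, z ∈ G.edgeSet ∨ c z ≤ M * 4 ^ (prio v - 1)) :
    ((g :: L).map c).sum < M * 4 ^ prio v := by
  classical
  -- The edges of `G` in the list are collected in a set `F`. As the list has no duplicates, all of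
  -- them together cost at most `M`; every edge outside of `F` costs at most `M * 4 ^ (prio v - 1)`.
  have key : ∀ L : List (Sym2 U), (g :: L).Nodup →
      (∀ z ∈ L, z ∈ G.edgeSet ∨ c z ≤ M * 4 ^ (prio v - 1)) →
      ∃ F : Finset (Sym2 U), (∀ z ∈ F, z ∈ G.edgeSet) ∧ (∀ z ∈ F, z ∈ g :: L) ∧
        ((g :: L).map c).sum ≤ ∑ z ∈ F, c z + L.length * (M * 4 ^ (prio v - 1)) := by
    intro L
    induction L with
    | nil => exact fun _ _ => ⟨{g}, by simpa using hg, by simp, by simp⟩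
    | cons z L ih =>
      intro hn h
      simp only [List.nodup_cons, List.mem_cons, not_or] at hn
      obtain ⟨F, hF, hF', hs⟩ := ih (by simp [hn.1.2, hn.2.2])
        (fun z hz => h z (List.mem_cons_of_mem _ hz))
      simp only [List.map_cons, List.sum_cons, List.length_cons, add_mul, one_mul] at hs ⊢
      rcases h z (by simp) with hz | hz
      · refine ⟨insert z F, ?_, ?_, ?_⟩
        · simpa [hz] using hF
        · intro y hy
          rcases Finset.mem_insert.1 hy with rfl | hy
          · simp
          · rcases List.mem_cons.1 (hF' y hy) with h | h <;> simp [h]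
        · rw [Finset.sum_insert]
          · omega
          · intro hzF
            rcases List.mem_cons.1 (hF' z hzF) with h | h
            · exact hn.1.1 h.symm
            · exact hn.2.1 h
      · refine ⟨F, hF, fun y hy => ?_, by omega⟩
        rcases List.mem_cons.1 (hF' y hy) with h | h <;> simp [h]
  obtain ⟨F, hF, -, hs⟩ := key L hn h
  have h1 := hW.sum_le F hF
  -- The total is at most `M + 2 * (M * 4 ^ (prio v - 1))`, hence at most three quarters of `M * 4 ^
  -- prio v`. This is where the base 4 comes from.
  have h2 : M * 4 ^ prio v = 4 * (M * 4 ^ (prio v - 1)) := by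
    conv_lhs => rw [← Nat.sub_add_cancel (hW.prio_pos v), pow_succ]
    ring
  have h3 : M ≤ M * 4 ^ (prio v - 1) := Nat.le_mul_of_pos_right _ (by positivity)
  have h4 : L.length * (M * 4 ^ (prio v - 1)) ≤ 2 * (M * 4 ^ (prio v - 1)) :=
    Nat.mul_le_mul_right _ hlen
  have := hW.pos
  omega

variable [DecidableEq U]

/-- The exchange of two edges that reverses a part of the tour. -/
theorem exists_improving_two {τ : Finset (Sym2 U)} (hW : IsPenalty G prio c M) {v v' u s : U}
    {A B : List U} (hA : A ≠ []) (hB : B ≠ []) (h : IsTourList τ (A ++ B))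
    (hv' : A.head hA = v') (hu : A.getLast hA = u) (hs : B.head hB = s) (hv : B.getLast hB = v)
    (hvv' : ¬ G.Adj v v') (hvu : G.Adj v u) (hlow' : prio v' < prio v) (hlow : prio s < prio v) :
    ∃ F₁ F₂ : Finset (Sym2 U), IsSwap 3 F₁ F₂ ∧ IsImproving c τ F₁ F₂ := by
  subst hv' hu hs hv
  have hA' : A.reverse ≠ [] := by simpa using hA
  have h₁ := cycEdges_append_perm hA hB
  have h₂ := cycEdges_append_perm hA' hB
  have h₂' := h₂.trans (List.Perm.append_left _
    ((pathEdges_reverse_perm A).append_right (pathEdges B)))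
  simp only [List.head_reverse, List.getLast_reverse] at h₂'
  have hp : (A.reverse ++ B).Perm (A ++ B) := (List.reverse_perm A).append_right B
  refine exists_improving_of_lists h hp h₁ h₂' rfl (by simp) ?_
  have hn := h₂'.nodup_iff.1 (nodup_cycEdges (hp.nodup_iff.2 h.nodup)
    (by rw [hp.length_eq]; exact h.length))
  refine lt_of_lt_of_le (hW.sum_lt (B.getLast hB) (List.nodup_append.1 hn).1 hvu (by simp) ?_) ?_
  · intro z hz
    rw [List.mem_singleton] at hz
    subst hz
    exact hW.le_of_low hlow' hlow
  · rw [List.map_cons, List.sum_cons, hW.eq _ _ hvv', max_eq_left hlow'.le]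
    exact Nat.le_add_right _ _

/-- The exchange of three edges that swaps two consecutive parts of the tour. -/
theorem exists_improving_three {τ : Finset (Sym2 U)} (hW : IsPenalty G prio c M)
    {v v' u p a b : U}
    {A B D : List U} (hA : A ≠ []) (hB : B ≠ []) (hD : D ≠ []) (h : IsTourList τ (A ++ (B ++ D)))
    (hv' : A.head hA = v') (hp : A.getLast hA = p) (hu : B.head hB = u) (ha : B.getLast hB = a)
    (hb : D.head hD = b) (hv : D.getLast hD = v)
    (hvv' : ¬ G.Adj v v') (hvu : G.Adj v u) (hlow' : prio v' < prio v) (hlowp : prio p < prio v)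
    (hlowa : prio a < prio v) (hlowb : prio b < prio v) :
    ∃ F₁ F₂ : Finset (Sym2 U), IsSwap 3 F₁ F₂ ∧ IsImproving c τ F₁ F₂ := by
  subst hv' hp hu ha hb hv
  have h₁ := cycEdges_append₃_perm hA hB hD
  have h₂ := cycEdges_append₃_perm hA hD hB
  have h₂' : (cycEdges (A ++ (D ++ B))).Perm
      ([s(D.getLast hD, B.head hB), s(B.getLast hB, A.head hA), s(A.getLast hA, D.head hD)] ++
      (pathEdges A ++ (pathEdges B ++ pathEdges D))) := by
    refine h₂.trans (List.Perm.append ?_ (List.Perm.append_left _ List.perm_append_comm))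
    exact (List.perm_append_comm (l₁ := [s(B.getLast hB, A.head hA), s(A.getLast hA, D.head hD)])
      (l₂ := [s(D.getLast hD, B.head hB)]))
  have hperm : (A ++ (D ++ B)).Perm (A ++ (B ++ D)) :=
    List.Perm.append_left _ List.perm_append_comm
  refine exists_improving_of_lists h hperm h₁ h₂' rfl (by simp) ?_
  have hn := h₂'.nodup_iff.1 (nodup_cycEdges (hperm.nodup_iff.2 h.nodup)
    (by rw [hperm.length_eq]; exact h.length))
  refine lt_of_lt_of_le (hW.sum_lt (D.getLast hD) (List.nodup_append.1 hn).1 hvu (by simp) ?_) ?_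
  · intro z hz
    simp only [List.mem_cons, List.not_mem_nil, or_false] at hz
    rcases hz with rfl | rfl
    · exact hW.le_of_low hlowa hlow'
    · exact hW.le_of_low hlowp hlowb
  · rw [List.map_cons, List.sum_cons, hW.eq _ _ hvv', max_eq_left hlow'.le]
    exact Nat.le_add_right _ _

/-- A tour with a non-edge and without improving exchanges of three edges is stuck at the vertex of
highest priority that lies on a non-edge of the tour. -/
theorem exists_stuck [Finite U] (hW : IsPenalty G prio c M) {τ : Finset (Sym2 U)}
    (hτ : IsTour (⊤ : SimpleGraph U) τ) (hne : ∃ z ∈ τ, z ∉ G.edgeSet)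
    (hno : ¬ ∃ F₁ F₂ : Finset (Sym2 U), IsSwap 3 F₁ F₂ ∧ IsImproving c τ F₁ F₂) :
    ∃ v v', Stuck G (fun x y => s(x, y) ∈ τ) (fun x => prio v < prio x) v v' := by
  obtain ⟨l₀, hl₀⟩ := exists_isTourList hτ
  have hfin : {x : U | ∃ y, s(x, y) ∈ τ ∧ ¬ G.Adj x y}.Finite := Set.toFinite _
  have hnonempty : {x : U | ∃ y, s(x, y) ∈ τ ∧ ¬ G.Adj x y}.Nonempty := by
    obtain ⟨z, hz, hz'⟩ := hne
    induction z with
    | _ x y => exact ⟨x, y, hz, hz'⟩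
  -- By the maximality of `v`, all tour edges at vertices of higher priority belong to `G`.
  obtain ⟨v, ⟨v', hvτ, hvG⟩, hmax⟩ := Set.exists_max_image _ prio hfin hnonempty
  have hsat : ∀ {x y}, prio v < prio x → s(x, y) ∈ τ → G.Adj x y := by
    intro x y hx hxy
    by_contra hG
    exact absurd (hmax x ⟨y, hxy, hG⟩) (by omega)
  obtain ⟨R, hR⟩ := hl₀.exists_ends hvτ
  have hvv' : v ≠ v' := by
    have := not_isDiag_of_mem_cycEdges hR.nodup hR.length ((hR.mem_iff _).1 hvτ)
    simpa using this
  have hlow : ∀ {x}, x ≠ v → ¬ prio v < prio x → prio x < prio v := by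
    intro x hx h
    have : prio x ≠ prio v := fun h => hx (hW.prio_inj h)
    omega
  have hlow' : prio v' < prio v := hlow hvv'.symm fun h => hvG
    (hsat h (by rwa [Sym2.eq_swap])).symm
  refine ⟨v, v', ⟨_, hR.nodup, hR.length, fun x y => hR.mem_iff _⟩, fun x => ?_, hvτ, hvG, hsat,
    lt_irrefl _, ?_⟩
  · obtain ⟨c, D, -, -, -, hc⟩ := exists_nbrs_of_mem hR.nodup hR.length (hR.complete x)
    exact ⟨c, (hR.mem_iff _).2 (hc.mem_iff.1 (by rw [cycEdges_cons_cons]; simp))⟩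
  intro u hvu huT
  have huv : u ≠ v := hvu.ne'
  have huv' : u ≠ v' := fun h => hvG (h ▸ hvu)
  have huR : u ∈ R := by
    have := hR.complete u
    simpa [huv, huv'] using this
  obtain ⟨R₁, R₂, rfl⟩ := List.append_of_mem huR
  have hA : v' :: R₁ ≠ [] := by simp
  have hB : R₂ ++ [v] ≠ [] := by simp
  have huB : u :: (R₂ ++ [v]) ≠ [] := by simp
  have hl : v' :: (R₁ ++ u :: R₂ ++ [v]) = (v' :: R₁) ++ u :: (R₂ ++ [v]) := by simp
  rw [hl] at hR
  set A := v' :: R₁ with hAdef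
  set B := u :: (R₂ ++ [v]) with hBdef
  have hBlast : B.getLast huB = v := by
    simp [hBdef, List.getLast_cons hB]
  have hdisj := (List.nodup_append.1 hR.nodup).2.2
  have hBnd := (List.nodup_append.1 hR.nodup).2.1
  have hcyc := cycEdges_append_perm hA huB
  have hT : ∀ x y, s(x, y) ∈ τ ↔ s(x, y) = s(v, v') ∨ s(x, y) = s(A.getLast hA, u) ∨
      s(x, y) ∈ pathEdges A ∨ s(x, y) ∈ pathEdges B := by
    intro x y
    rw [hR.mem_iff, hcyc.mem_iff, hBlast]
    simp [hAdef, hBdef]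
  have hpathB : pathEdges B = s(u, (R₂ ++ [v]).head hB) :: pathEdges (R₂ ++ [v]) := by
    have := pathEdges_append (A := [u]) (B := R₂ ++ [v]) (by simp) hB
    simpa [pathEdges] using this
  have hpA : A.getLast hA ∈ A := List.getLast_mem hA
  have hsB : (R₂ ++ [v]).head hB ∈ B := List.mem_cons_of_mem _ (List.head_mem hB)
  -- If nothing lay between `u` and `v`, then `uv` would be a tour edge. Hence the successor of `u`
  -- is not `v`.
  have hR₂ : R₂ ≠ [] := by
    rintro rfl
    apply huT
    rw [hT, hpathB]
    simp
  refine ⟨(R₂ ++ [v]).head hB, A.getLast hA, ?_, ?_, ?_, ?_, ?_⟩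
  · exact fun h => hdisj _ hpA _ hsB h.symm
  · rw [hT, hpathB]; simp
  · rw [hT, Sym2.eq_swap]; simp
  -- If the successor `s` of `u` is not high, reversing the arc from `v'` to `u` trades `vv'` and
  -- `us` for `vu` and `v's`, and both ends of `v's` lie below `v`.
  · by_contra hs
    apply hno
    have hsv : (R₂ ++ [v]).head hB ≠ v := by
      rw [List.head_append_of_ne_nil hR₂]
      intro h
      have : v ∈ R₂ := h ▸ List.head_mem hR₂
      rw [hBdef, List.nodup_cons, List.nodup_append] at hBnd
      exact hBnd.2.2.2 v this v (by simp) rfl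
    refine exists_improving_two hW (A := A ++ [u]) (B := R₂ ++ [v]) (by simp) hB
      (by simpa [hBdef] using hR) ?_ (u := u) (by simp) rfl (v := v) (by simp) hvG hvu hlow'
      (hlow hsv hs)
    rw [List.head_append_of_ne_nil hA]; simp [hAdef]
  · intro hp
    have hpv : A.getLast hA ≠ v := fun h =>
      hdisj _ hpA _ (List.mem_cons_of_mem u (by simp : v ∈ R₂ ++ [v])) h
    have hB3 : 3 ≤ B.length := by
      have := List.length_pos_iff.2 hR₂
      simp [hBdef]; omega
    have hK : ∀ x y, s(x, y) ∈ cycEdges B ↔ s(x, y) = s(v, u) ∨ s(x, y) ∈ pathEdges B := by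
      intro x y
      rw [cycEdges_eq huB, hBlast, List.mem_cons]
      simp [hBdef]
    -- The bad cycle is the arc from `u` to `v`, closed by the edge `vu`.
    refine ⟨fun x y => s(x, y) ∈ cycEdges B, ⟨B, hBnd, hB3, fun _ _ => Iff.rfl⟩, ?_, ?_, ?_, ?_, ?_⟩
    · rw [hK]; exact .inl rfl
    · intro x y h
      rw [hK] at h
      rcases h with h | h
      · rcases Sym2.eq_iff.1 h with ⟨rfl, rfl⟩ | ⟨rfl, rfl⟩ <;> simp
      · exact .inl ((hT x y).2 (by simp [h]))
    · intro x y z hxz hxy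
      have hxB := (mem_of_mem_cycEdges hxz).1
      rw [hT] at hxy
      rcases hxy with h | h | h | h
      · rcases Sym2.eq_iff.1 h with ⟨rfl, rfl⟩ | ⟨rfl, rfl⟩
        · simp
        · exact absurd rfl (hdisj x (by simp [hAdef]) x hxB)
      · rcases Sym2.eq_iff.1 h with ⟨rfl, rfl⟩ | ⟨rfl, rfl⟩
        · exact absurd rfl (hdisj _ hpA _ hxB)
        · simp
      · exact absurd rfl (hdisj x (mem_of_mem_pathEdges h).1 x hxB)
      · exact .inl ((hK x y).2 (.inr h))
    · intro z hz
      exact hdisj _ hpA _ (mem_of_mem_cycEdges hz).1 rfl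
    · intro x y hxy
      by_contra! hcon
      obtain ⟨h₁, h₂, h₃, h₄⟩ := hcon
      rw [hK] at hxy
      rcases hxy with h | h
      · rcases Sym2.eq_iff.1 h with ⟨rfl, rfl⟩ | ⟨rfl, rfl⟩
        · exact h₃ rfl
        · exact h₄ rfl
      -- Let `ab` be an edge of the arc whose ends are neither high nor `v`. Cutting the arc there
      -- and interchanging its two parts trades `vv'`, `pu`, `ab` for `vu`, `av'`, `pb`; the last
      -- two have both ends below `v`.
      obtain ⟨B₁, B₂, hB₁, hB₂, hBB, hxy⟩ := exists_split_of_mem_pathEdges h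
      have hab : prio (B₁.getLast hB₁) < prio v ∧ prio (B₂.head hB₂) < prio v := by
        have hx := hlow h₃ (by omega)
        have hy := hlow h₄ (by omega)
        rcases Sym2.eq_iff.1 hxy with ⟨rfl, rfl⟩ | ⟨rfl, rfl⟩
        · exact ⟨hx, hy⟩
        · exact ⟨hy, hx⟩
      apply hno
      refine exists_improving_three hW (A := A) (B := B₁) (D := B₂) (u := u) (v := v) hA hB₁ hB₂
        (hBB ▸ hR) (by simp [hAdef]) rfl ?_ rfl rfl ?_ hvG hvu hlow' (hlow hpv hp) hab.1 hab.2
      · have : B.head huB = B₁.head hB₁ := by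
          simp only [hBB]; rw [List.head_append_of_ne_nil hB₁]
        rw [← this]; simp [hBdef]
      · have : B.getLast huB = B₂.getLast hB₂ := by
          simp only [hBB]; rw [List.getLast_append_of_ne_nil _ hB₂]
        rw [← this, hBlast]

end Penalty

end TSP

/-! ### The neighborhoods in G. -/

namespace MaxCutReduction

section Neighbors

variable {V : Type*} [Fintype V] [DecidableEq V]
variable {H : SimpleGraph V} [DecidableRel H.Adj] (C : Choices H) (k : ℕ)

/-! ### The two ends of an edge of `H` -/

theorem mem_iff_src_or_tgt {x : V} {e : H.edgeSet} :
    x ∈ (e : Sym2 V) ↔ x = C.src e ∨ x = C.tgt e := by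
  rw [← C.endpoints e, Sym2.mem_iff]

theorem src_ne_tgt (e : H.edgeSet) : C.src e ≠ C.tgt e := by
  have h := e.2
  rw [← C.endpoints e, SimpleGraph.mem_edgeSet] at h
  exact h.ne

theorem src_mem (e : H.edgeSet) : C.src e ∈ (e : Sym2 V) := (mem_iff_src_or_tgt C).2 (.inl rfl)

theorem tgt_mem (e : H.edgeSet) : C.tgt e ∈ (e : Sym2 V) := (mem_iff_src_or_tgt C).2 (.inr rfl)

/-! ### The order of the edges at a vertex -/

variable {C} in
theorem Follows.left_unique {x : V} {e e' f : H.edgeSet} (h : Follows C x e f)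
    (h' : Follows C x e' f) : e = e' := by
  apply C.psi.injective
  have h1 := h.2.2.2 e' h'.1
  have h2 := h'.2.2.2 e h.1
  have h3 := h.2.2.1
  have h4 := h'.2.2.1
  rcases lt_trichotomy (C.psi e) (C.psi e') with h | h | h
  · exact absurd ⟨h, h4⟩ h1
  · exact h
  · exact absurd ⟨h, h3⟩ h2

variable {C} in
theorem Follows.right_unique {x : V} {e f f' : H.edgeSet} (h : Follows C x e f)
    (h' : Follows C x e f') : f = f' := by
  apply C.psi.injective
  have h1 := h.2.2.2 f' h'.2.1
  have h2 := h'.2.2.2 f h.2.1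
  have h3 := h.2.2.1
  have h4 := h'.2.2.1
  rcases lt_trichotomy (C.psi f) (C.psi f') with h | h | h
  · exact absurd ⟨h3, h⟩ h2
  · exact h
  · exact absurd ⟨h4, h⟩ h1

variable {C} in
theorem IsFirst.unique {x : V} {e f : H.edgeSet} (h : IsFirst C x e) (h' : IsFirst C x f) :
    e = f :=
  C.psi.injective (le_antisymm (h.2 f h'.1) (h'.2 e h.1))

variable {C} in
theorem IsLast.unique {x : V} {e f : H.edgeSet} (h : IsLast C x e) (h' : IsLast C x f) :
    e = f :=
  C.psi.injective (le_antisymm (h'.2 e h.1) (h.2 f h'.1))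

theorem isFirst_or_exists_follows {x : V} {e : H.edgeSet} (hx : x ∈ (e : Sym2 V)) :
    IsFirst C x e ∨ ∃ f, Follows C x f e := by
  by_cases h : ∃ f : H.edgeSet, x ∈ (f : Sym2 V) ∧ C.psi f < C.psi e
  · right
    obtain ⟨f, hf, hmax⟩ := Set.exists_max_image
      {f : H.edgeSet | x ∈ (f : Sym2 V) ∧ C.psi f < C.psi e} C.psi (Set.toFinite _) h
    exact ⟨f, hf.1, hx, hf.2, fun g hg hg' => absurd (hmax g ⟨hg, hg'.2⟩) (not_le.2 hg'.1)⟩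
  · left
    push Not at h
    exact ⟨hx, h⟩

theorem isLast_or_exists_follows {x : V} {e : H.edgeSet} (hx : x ∈ (e : Sym2 V)) :
    IsLast C x e ∨ ∃ f, Follows C x e f := by
  by_cases h : ∃ f : H.edgeSet, x ∈ (f : Sym2 V) ∧ C.psi e < C.psi f
  · right
    obtain ⟨f, hf, hmin⟩ := Set.exists_min_image
      {f : H.edgeSet | x ∈ (f : Sym2 V) ∧ C.psi e < C.psi f} C.psi (Set.toFinite _) h
    exact ⟨f, hx, hf.1, hf.2, fun g hg hg' => absurd (hmin g ⟨hg, hg'.1⟩) (not_le.2 hg'.2)⟩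
  · left
    push Not at h
    exact ⟨hx, h⟩

theorem exists_isFirst {x : V} {e : H.edgeSet} (hx : x ∈ (e : Sym2 V)) :
    ∃ f, IsFirst C x f := by
  obtain ⟨f, hf, hmin⟩ := Set.exists_min_image
    {f : H.edgeSet | x ∈ (f : Sym2 V)} C.psi (Set.toFinite _) ⟨e, hx⟩
  exact ⟨f, hf, hmin⟩

theorem exists_isLast {x : V} {e : H.edgeSet} (hx : x ∈ (e : Sym2 V)) :
    ∃ f, IsLast C x f := by
  obtain ⟨f, hf, hmax⟩ := Set.exists_max_image
    {f : H.edgeSet | x ∈ (f : Sym2 V)} C.psi (Set.toFinite _) ⟨e, hx⟩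
  exact ⟨f, hf, hmax⟩

variable {C} in
theorem IsFirst.not_follows {x : V} {e f : H.edgeSet} (h : IsFirst C x e) : ¬ Follows C x f e :=
  fun h' => absurd (h.2 f h'.1) (not_le.2 h'.2.2.1)

variable {C} in
theorem IsLast.not_follows {x : V} {e f : H.edgeSet} (h : IsLast C x e) : ¬ Follows C x e f :=
  fun h' => absurd (h.2 f h'.2.1) (not_le.2 h'.2.2.1)

/-! ### The doors -/

open Classical in
/-- The vertex before the gadget of `e` on the second-set path of `x`. -/
noncomputable def prevV (x : V) (e : H.edgeSet) : Vertex C k :=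
  if h : ∃ f, Follows C x f e then leave C k x h.choose else .left x

open Classical in
/-- The vertex behind the gadget of `e` on the second-set path of `x`. -/
noncomputable def nextV (x : V) (e : H.edgeSet) : Vertex C k :=
  if h : ∃ f, Follows C x e f then enter C k x h.choose else pathB C k x 1

open Classical in
/-- The vertex behind `x_ℓ` on the second-set path of `x`. -/
noncomputable def firstDoor (x : V) : Vertex C k :=
  if h : ∃ e, IsFirst C x e then enter C k x h.choose else pathB C k x 1

open Classical in
/-- The vertex before the XOR gadget of `x` on the second-set path of `x`. -/
noncomputable def lastDoor (x : V) : Vertex C k :=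
  if h : ∃ e, IsLast C x e then leave C k x h.choose else .left x

/-- The path `(v, b_1, …, b_p, x_r)`, where `v` is the vertex before the XOR gadget of `x`. -/
noncomputable def pathB₀ (x : V) (i : ℕ) : Vertex C k :=
  if i = 0 then lastDoor C k x else pathB C k x i

/-- The neighbor of `x_ℓ` or `Z` on the initial cycle that is not in the slot. -/
def gapLeft (s : V ⊕ H.edgeSet) : Vertex C k :=
  if C.flip s then .gap s else .gap (C.next.symm s)

/-- The neighbor of `x_r` or `Z'` on the initial cycle that is not in the slot. -/
def gapRight (s : V ⊕ H.edgeSet) : Vertex C k :=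
  if C.flip s then .gap (C.next.symm s) else .gap s

variable {C} in
theorem Follows.prevV_eq {x : V} {e f : H.edgeSet} (h : Follows C x f e) :
    prevV C k x e = leave C k x f := by
  have h' : ∃ f, Follows C x f e := ⟨f, h⟩
  rw [prevV, dif_pos h', h'.choose_spec.left_unique h]

variable {C} in
theorem IsFirst.prevV_eq {x : V} {e : H.edgeSet} (h : IsFirst C x e) :
    prevV C k x e = .left x := by
  rw [prevV, dif_neg]
  rintro ⟨f, hf⟩
  exact h.not_follows hf

variable {C} in
theorem Follows.nextV_eq {x : V} {e f : H.edgeSet} (h : Follows C x e f) :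
    nextV C k x e = enter C k x f := by
  have h' : ∃ f, Follows C x e f := ⟨f, h⟩
  rw [nextV, dif_pos h', h'.choose_spec.right_unique h]

variable {C} in
theorem IsLast.nextV_eq {x : V} {e : H.edgeSet} (h : IsLast C x e) :
    nextV C k x e = pathB C k x 1 := by
  rw [nextV, dif_neg]
  rintro ⟨f, hf⟩
  exact h.not_follows hf

variable {C} in
theorem IsFirst.firstDoor_eq {x : V} {e : H.edgeSet} (h : IsFirst C x e) :
    firstDoor C k x = enter C k x e := by
  have h' : ∃ e, IsFirst C x e := ⟨e, h⟩
  rw [firstDoor, dif_pos h', h'.choose_spec.unique h]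

variable {C} in
theorem IsLast.lastDoor_eq {x : V} {e : H.edgeSet} (h : IsLast C x e) :
    lastDoor C k x = leave C k x e := by
  have h' : ∃ e, IsLast C x e := ⟨e, h⟩
  rw [lastDoor, dif_pos h', h'.choose_spec.unique h]

theorem firstDoor_eq_of_isolated {x : V} (h : ∀ e : H.edgeSet, x ∉ (e : Sym2 V)) :
    firstDoor C k x = pathB C k x 1 := by
  rw [firstDoor, dif_neg]
  rintro ⟨f, hf⟩
  exact h f hf.1

theorem lastDoor_eq_of_isolated {x : V} (h : ∀ e : H.edgeSet, x ∉ (e : Sym2 V)) :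
    lastDoor C k x = .left x := by
  rw [lastDoor, dif_neg]
  rintro ⟨f, hf⟩
  exact h f hf.1

/-! ### Equations between vertices -/

section Equations

variable {C k}

theorem port_strict (e : {e : H.edgeSet // C.directed e = true}) (q₁ : StrictVertex)
    (q₂ : FlexVertex) : port C k q₁ q₂ e.1 = .strict e q₁ := by
  rw [port, dif_pos e.2]

theorem port_flex (e : {e : H.edgeSet // ¬ C.directed e = true}) (q₁ : StrictVertex)
    (q₂ : FlexVertex) : port C k q₁ q₂ e.1 = .flex e q₂ := by
  rw [port, dif_neg e.2]

theorem port_eq_strict {e : {e : H.edgeSet // C.directed e = true}} {f : H.edgeSet}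
    {q₁ q : StrictVertex} {q₂ : FlexVertex} :
    port C k q₁ q₂ f = .strict e q ↔ f = e.1 ∧ q₁ = q := by
  unfold port
  split_ifs with h
  · rw [Vertex.strict.injEq, Subtype.ext_iff]
  · simp only [false_iff, not_and]
    rintro rfl
    exact absurd e.2 h

theorem port_eq_flex {e : {e : H.edgeSet // ¬ C.directed e = true}} {f : H.edgeSet}
    {q₁ : StrictVertex} {q₂ q : FlexVertex} :
    port C k q₁ q₂ f = .flex e q ↔ f = e.1 ∧ q₂ = q := by
  unfold port
  split_ifs with h
  · simp only [false_iff, not_and]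
    rintro rfl
    exact absurd h e.2
  · rw [Vertex.flex.injEq, Subtype.ext_iff]

theorem port_cases (q₁ : StrictVertex) (q₂ : FlexVertex) (f : H.edgeSet) :
    (∃ e q, port C k q₁ q₂ f = .strict e q) ∨ ∃ e q, port C k q₁ q₂ f = .flex e q := by
  by_cases h : C.directed f = true
  · exact .inl ⟨⟨f, h⟩, q₁, port_strict ⟨f, h⟩ _ _⟩
  · exact .inr ⟨⟨f, h⟩, q₂, port_flex ⟨f, h⟩ _ _⟩

theorem enter_eq_strict {e : {e : H.edgeSet // C.directed e = true}} {f : H.edgeSet} {x : V}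
    {q : StrictVertex} : enter C k x f = .strict e q ↔
      f = e.1 ∧ ((x = C.src f ∧ q = .X) ∨ (x ≠ C.src f ∧ q = .Y)) := by
  unfold enter
  split_ifs with h <;> simp [port_eq_strict, h, eq_comm]

theorem leave_eq_strict {e : {e : H.edgeSet // C.directed e = true}} {f : H.edgeSet} {x : V}
    {q : StrictVertex} : leave C k x f = .strict e q ↔
      f = e.1 ∧ ((x = C.src f ∧ q = .Xp) ∨ (x ≠ C.src f ∧ q = .Yp)) := by
  unfold leave
  split_ifs with h <;> simp [port_eq_strict, h, eq_comm]

theorem enter_eq_flex {e : {e : H.edgeSet // ¬ C.directed e = true}} {f : H.edgeSet} {x : V}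
    {q : FlexVertex} : enter C k x f = .flex e q ↔
      f = e.1 ∧ ((x = C.src f ∧ q = .X) ∨ (x ≠ C.src f ∧ q = .Y)) := by
  unfold enter
  split_ifs with h <;> simp [port_eq_flex, h, eq_comm]

theorem leave_eq_flex {e : {e : H.edgeSet // ¬ C.directed e = true}} {f : H.edgeSet} {x : V}
    {q : FlexVertex} : leave C k x f = .flex e q ↔
      f = e.1 ∧ ((x = C.src f ∧ q = .Xp) ∨ (x ≠ C.src f ∧ q = .Yp)) := by
  unfold leave
  split_ifs with h <;> simp [port_eq_flex, h, eq_comm]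

theorem enter_cases (x : V) (f : H.edgeSet) :
    (∃ e q, enter C k x f = .strict e q) ∨ ∃ e q, enter C k x f = .flex e q := by
  unfold enter
  split_ifs <;> exact port_cases _ _ _

theorem leave_cases (x : V) (f : H.edgeSet) :
    (∃ e q, leave C k x f = .strict e q) ∨ ∃ e q, leave C k x f = .flex e q := by
  unfold leave
  split_ifs <;> exact port_cases _ _ _

theorem enter_ne_leave (x y : V) (e f : H.edgeSet) : enter C k x e ≠ leave C k y f := by
  intro h
  rcases leave_cases (C := C) (k := k) y f with ⟨g, q, hg⟩ | ⟨g, q, hg⟩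
  · rw [hg, enter_eq_strict] at h
    rw [leave_eq_strict] at hg
    grind
  · rw [hg, enter_eq_flex] at h
    rw [leave_eq_flex] at hg
    grind

theorem pathA_zero (x : V) : pathA C k x 0 = .left x := by simp [pathA]

theorem pathA_succ (x : V) (i : Fin (xorOrder C k x)) : pathA C k x (i + 1) = .railA x i := by
  simp [pathA]

theorem pathA_last (x : V) : pathA C k x (xorOrder C k x + 1) = .right x := by
  simp [pathA]

theorem pathB_succ (x : V) (i : Fin (xorOrder C k x)) : pathB C k x (i + 1) = .railB x i := by
  simp [pathB]

theorem pathB_last (x : V) : pathB C k x (xorOrder C k x + 1) = .right x := by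
  simp [pathB]

theorem pathB₀_zero (x : V) : pathB₀ C k x 0 = lastDoor C k x := by simp [pathB₀]

theorem pathB₀_succ (x : V) (i : ℕ) : pathB₀ C k x (i + 1) = pathB C k x (i + 1) := by
  simp [pathB₀]

theorem pathA_cases (x : V) {i : ℕ} (hi : i ≤ xorOrder C k x + 1) :
    (i = 0 ∧ pathA C k x i = .left x) ∨
    (∃ j : Fin (xorOrder C k x), i = j + 1 ∧ pathA C k x i = .railA x j) ∨
    (i = xorOrder C k x + 1 ∧ pathA C k x i = .right x) := by
  rcases Nat.eq_zero_or_pos i with rfl | h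
  · exact .inl ⟨rfl, pathA_zero x⟩
  · rcases hi.lt_or_eq with h' | rfl
    · refine .inr (.inl ⟨⟨i - 1, by omega⟩, by simp; omega, ?_⟩)
      rw [← pathA_succ]
      congr 1
      simp; omega
    · exact .inr (.inr ⟨rfl, pathA_last x⟩)

theorem pathB_cases (x : V) {i : ℕ} (h : 1 ≤ i) (hi : i ≤ xorOrder C k x + 1) :
    (∃ j : Fin (xorOrder C k x), i = j + 1 ∧ pathB C k x i = .railB x j) ∨
    (i = xorOrder C k x + 1 ∧ pathB C k x i = .right x) := by
  rcases hi.lt_or_eq with h' | rfl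
  · refine .inl ⟨⟨i - 1, by omega⟩, by simp; omega, ?_⟩
    rw [← pathB_succ]
    congr 1
    simp; omega
  · exact .inr ⟨rfl, pathB_last x⟩

theorem pathA_ne {x : V} {i : ℕ} {v : Vertex C k} (h₁ : ∀ y, v ≠ .left y)
    (h₂ : ∀ y, v ≠ .right y) (h₃ : ∀ y j, v ≠ .railA y j) : pathA C k x i ≠ v := by
  unfold pathA
  split_ifs
  · exact (h₁ x).symm
  · exact (h₃ _ _).symm
  · exact (h₂ x).symm

theorem pathB_ne {x : V} {i : ℕ} {v : Vertex C k} (h₂ : ∀ y, v ≠ .right y)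
    (h₃ : ∀ y j, v ≠ .railB y j) : pathB C k x i ≠ v := by
  unfold pathB
  split_ifs
  · exact (h₃ _ _).symm
  · exact (h₂ x).symm

theorem slotLast_eq_strict {e : {e : H.edgeSet // C.directed e = true}} {s : V ⊕ H.edgeSet}
    {q : StrictVertex} : slotLast C k s = .strict e q ↔
      s = .inr e.1 ∧ ((C.flip s = true ∧ q = .Z) ∨ (C.flip s = false ∧ q = .Zp)) := by
  unfold slotLast
  by_cases h : C.flip s = true <;> rcases s with x | f <;>
    simp [h, slotLeft, slotRight, port_eq_strict, eq_comm]

theorem slotFirst_eq_strict {e : {e : H.edgeSet // C.directed e = true}} {s : V ⊕ H.edgeSet}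
    {q : StrictVertex} : slotFirst C k s = .strict e q ↔
      s = .inr e.1 ∧ ((C.flip s = true ∧ q = .Zp) ∨ (C.flip s = false ∧ q = .Z)) := by
  unfold slotFirst
  by_cases h : C.flip s = true <;> rcases s with x | f <;>
    simp [h, slotLeft, slotRight, port_eq_strict, eq_comm]

theorem slotLast_eq_flex {e : {e : H.edgeSet // ¬ C.directed e = true}} {s : V ⊕ H.edgeSet}
    {q : FlexVertex} : slotLast C k s = .flex e q ↔
      s = .inr e.1 ∧ ((C.flip s = true ∧ q = .Z) ∨ (C.flip s = false ∧ q = .Zp)) := by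
  unfold slotLast
  by_cases h : C.flip s = true <;> rcases s with x | f <;>
    simp [h, slotLeft, slotRight, port_eq_flex, eq_comm]

theorem slotFirst_eq_flex {e : {e : H.edgeSet // ¬ C.directed e = true}} {s : V ⊕ H.edgeSet}
    {q : FlexVertex} : slotFirst C k s = .flex e q ↔
      s = .inr e.1 ∧ ((C.flip s = true ∧ q = .Zp) ∨ (C.flip s = false ∧ q = .Z)) := by
  unfold slotFirst
  by_cases h : C.flip s = true <;> rcases s with x | f <;>
    simp [h, slotLeft, slotRight, port_eq_flex, eq_comm]

theorem slotLast_cases (s : V ⊕ H.edgeSet) :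
    (∃ x, s = .inl x ∧ C.flip s = true ∧ slotLast C k s = .left x) ∨
    (∃ x, s = .inl x ∧ C.flip s = false ∧ slotLast C k s = .right x) ∨
    (∃ e q, slotLast C k s = .strict e q) ∨ ∃ e q, slotLast C k s = .flex e q := by
  unfold slotLast
  by_cases h : C.flip s = true <;> rcases s with x | f <;> simp only [h, slotLeft, slotRight]
  · exact .inl ⟨x, by simp⟩
  · exact .inr (.inr (port_cases _ _ f))
  · exact .inr (.inl ⟨x, by simp⟩)
  · exact .inr (.inr (port_cases _ _ f))

theorem slotFirst_cases (s : V ⊕ H.edgeSet) :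
    (∃ x, s = .inl x ∧ C.flip s = false ∧ slotFirst C k s = .left x) ∨
    (∃ x, s = .inl x ∧ C.flip s = true ∧ slotFirst C k s = .right x) ∨
    (∃ e q, slotFirst C k s = .strict e q) ∨ ∃ e q, slotFirst C k s = .flex e q := by
  unfold slotFirst
  by_cases h : C.flip s = true <;> rcases s with x | f <;> simp only [h, slotLeft, slotRight]
  · exact .inr (.inl ⟨x, by simp⟩)
  · exact .inr (.inr (port_cases _ _ f))
  · exact .inl ⟨x, by simp⟩
  · exact .inr (.inr (port_cases _ _ f))

theorem prevV_cases (x : V) (e : H.edgeSet) :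
    (∃ f, Follows C x f e ∧ prevV C k x e = leave C k x f) ∨ prevV C k x e = .left x := by
  by_cases h : ∃ f, Follows C x f e
  · obtain ⟨f, hf⟩ := h
    exact .inl ⟨f, hf, hf.prevV_eq k⟩
  · exact .inr (by rw [prevV, dif_neg h])

theorem nextV_cases (x : V) (e : H.edgeSet) :
    (∃ f, Follows C x e f ∧ nextV C k x e = enter C k x f) ∨
      nextV C k x e = pathB C k x 1 := by
  by_cases h : ∃ f, Follows C x e f
  · obtain ⟨f, hf⟩ := h
    exact .inl ⟨f, hf, hf.nextV_eq k⟩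
  · exact .inr (by rw [nextV, dif_neg h])

end Equations

/-! ### The neighbors of the vertices -/

variable {C k}

/-- `SimpleGraph.fromRel` discards loops, so adjacency amounts to a link in one of the directions
only because no link is a loop. -/
theorem Link.ne {a b : Vertex C k} (h : Link C k a b) : a ≠ b := by
  cases h with
  | gapBefore s =>
    rcases slotLast_cases (C := C) (k := k) s with ⟨x, -, -, h⟩ | ⟨x, -, -, h⟩ | ⟨e, q, h⟩ |
      ⟨e, q, h⟩ <;> simp [h]
  | gapAfter s =>
    rcases slotFirst_cases (C := C) (k := k) (C.next s) with ⟨x, -, -, h⟩ | ⟨x, -, -, h⟩ |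
      ⟨e, q, h⟩ | ⟨e, q, h⟩ <;> simp [h]
  | firstSet x i hi =>
    rcases pathA_cases (C := C) (k := k) x (i := i) (by omega) with
      ⟨h, h'⟩ | ⟨j, h, h'⟩ | ⟨h, h'⟩ <;>
    rcases pathA_cases (C := C) (k := k) x (i := i + 1) (by omega) with
      ⟨g, g'⟩ | ⟨j', g, g'⟩ | ⟨g, g'⟩ <;> rw [h', g'] <;> simp
    · omega
    · rintro rfl; omega
    · omega
  | doorFirst x e h =>
    rcases enter_cases (C := C) (k := k) x e with ⟨f, q, h⟩ | ⟨f, q, h⟩ <;> simp [h]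
  | door x e f h => exact (enter_ne_leave _ _ _ _).symm
  | doorLast x e h =>
    rcases leave_cases (C := C) (k := k) x e with ⟨f, q, h⟩ | ⟨f, q, h⟩ <;>
    rcases pathB_cases (C := C) (k := k) x (i := 1) (by omega) (by omega) with
      ⟨j, g, g'⟩ | ⟨g, g'⟩ <;> simp [h, g']
  | doorOnly x h =>
    rcases pathB_cases (C := C) (k := k) x (i := 1) (by omega) (by omega) with
      ⟨j, g, g'⟩ | ⟨g, g'⟩ <;> simp [g']
  | secondSet x i h₁ h₂ =>
    rcases pathB_cases (C := C) (k := k) x (i := i) (by omega) (by omega) with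
      ⟨j, h, h'⟩ | ⟨h, h'⟩ <;>
    rcases pathB_cases (C := C) (k := k) x (i := i + 1) (by omega) (by omega) with
      ⟨j', g, g'⟩ | ⟨g, g'⟩ <;> rw [h', g'] <;> simp
    · rintro rfl; omega
    · omega
  | rungA x i => simp
  | rungB x i => simp
  | strict e q r h => revert h; cases q <;> cases r <;> simp [strictEdges]
  | flex e q r h => revert h; cases q <;> cases r <;> simp [flexEdges]

theorem adj_iff_link {a b : Vertex C k} :
    (graph C k).Adj a b ↔ Link C k a b ∨ Link C k b a := by
  rw [graph, SimpleGraph.fromRel_adj]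
  constructor
  · exact fun h => h.2
  · rintro (h | h)
    · exact ⟨h.ne, .inl h⟩
    · exact ⟨h.ne.symm, .inr h⟩

theorem link_prevV {x : V} {e : H.edgeSet} (hx : x ∈ (e : Sym2 V)) :
    Link C k (prevV C k x e) (enter C k x e) := by
  rcases isFirst_or_exists_follows C hx with h | ⟨f, h⟩
  · rw [h.prevV_eq]; exact .doorFirst _ _ h
  · rw [h.prevV_eq]; exact .door _ _ _ h

theorem link_nextV {x : V} {e : H.edgeSet} (hx : x ∈ (e : Sym2 V)) :
    Link C k (leave C k x e) (nextV C k x e) := by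
  rcases isLast_or_exists_follows C hx with h | ⟨f, h⟩
  · rw [h.nextV_eq]; exact .doorLast _ _ h
  · rw [h.nextV_eq]; exact .door _ _ _ h

/-- Only the six ports have a neighbor outside of the gadget, and each of them has just one: a door
at `X`, `X'`, `Y`, `Y'` and a gap at `Z`, `Z'`. -/
theorem adj_strict {e : {e : H.edgeSet // C.directed e = true}} {q : StrictVertex}
    {y : Vertex C k} : (graph C k).Adj (.strict e q) y ↔
      (∃ r, y = .strict e r ∧ ((q, r) ∈ strictEdges ∨ (r, q) ∈ strictEdges)) ∨
      (q = .X ∧ y = prevV C k (C.src e) e) ∨ (q = .Xp ∧ y = nextV C k (C.src e) e) ∨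
      (q = .Y ∧ y = prevV C k (C.tgt e) e) ∨ (q = .Yp ∧ y = nextV C k (C.tgt e) e) ∨
      (q = .Z ∧ y = gapLeft C k (.inr e)) ∨ (q = .Zp ∧ y = gapRight C k (.inr e)) := by
  have hst := src_ne_tgt C e.1
  rw [adj_iff_link]
  constructor
  · generalize hv : Vertex.strict e q = a
    rintro (h | h)
    · cases h with
      | gapBefore s =>
        obtain ⟨rfl, h⟩ := slotLast_eq_strict.1 hv.symm
        rcases h with ⟨h, rfl⟩ | ⟨h, rfl⟩ <;> simp [gapLeft, gapRight, h]
      | gapAfter s => cases hv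
      | firstSet x i hi => exact absurd hv.symm (pathA_ne (by simp) (by simp) (by simp))
      | doorFirst x f h => cases hv
      | door x e' f h =>
        obtain ⟨rfl, h'⟩ := leave_eq_strict.1 hv.symm
        have := (mem_iff_src_or_tgt C).1 h.1
        rcases h' with ⟨rfl, rfl⟩ | ⟨hx, rfl⟩
        · simp [h.nextV_eq]
        · obtain rfl : x = C.tgt e.1 := by tauto
          simp [h.nextV_eq]
      | doorLast x e' h =>
        obtain ⟨rfl, h'⟩ := leave_eq_strict.1 hv.symm
        have := (mem_iff_src_or_tgt C).1 h.1
        rcases h' with ⟨rfl, rfl⟩ | ⟨hx, rfl⟩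
        · simp [h.nextV_eq]
        · obtain rfl : x = C.tgt e.1 := by tauto
          simp [h.nextV_eq]
      | doorOnly x h => cases hv
      | secondSet x i h₁ h₂ => exact absurd hv.symm (pathB_ne (by simp) (by simp))
      | rungA x i => cases hv
      | rungB x i => cases hv
      | strict e' q' r h =>
        cases hv
        exact .inl ⟨r, rfl, .inl h⟩
      | flex e' q' r h => cases hv
    · cases h with
      | gapBefore s => cases hv
      | gapAfter s =>
        obtain ⟨h', h⟩ := slotFirst_eq_strict.1 hv.symm
        have hs : s = C.next.symm (.inr e.1) := by rw [← h']; simp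
        rw [h'] at h
        rcases h with ⟨h, rfl⟩ | ⟨h, rfl⟩ <;> simp [gapLeft, gapRight, h, hs]
      | firstSet x i hi => exact absurd hv.symm (pathA_ne (by simp) (by simp) (by simp))
      | doorFirst x f h =>
        obtain ⟨rfl, h'⟩ := enter_eq_strict.1 hv.symm
        have := (mem_iff_src_or_tgt C).1 h.1
        rcases h' with ⟨rfl, rfl⟩ | ⟨hx, rfl⟩
        · simp [h.prevV_eq]
        · obtain rfl : x = C.tgt e.1 := by tauto
          simp [h.prevV_eq]
      | door x e' f h =>
        obtain ⟨rfl, h'⟩ := enter_eq_strict.1 hv.symm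
        have := (mem_iff_src_or_tgt C).1 h.2.1
        rcases h' with ⟨rfl, rfl⟩ | ⟨hx, rfl⟩
        · simp [h.prevV_eq]
        · obtain rfl : x = C.tgt e.1 := by tauto
          simp [h.prevV_eq]
      | doorLast x e' h => exact absurd hv.symm (pathB_ne (by simp) (by simp))
      | doorOnly x h => exact absurd hv.symm (pathB_ne (by simp) (by simp))
      | secondSet x i h₁ h₂ => exact absurd hv.symm (pathB_ne (by simp) (by simp))
      | rungA x i => cases hv
      | rungB x i => cases hv
      | strict e' q' r h =>
        cases hv
        exact .inl ⟨q', rfl, .inr h⟩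
      | flex e' q' r h => cases hv
  · have hE := fun x (hx : x ∈ (e.1 : Sym2 V)) => And.intro
      (link_prevV (C := C) (k := k) hx) (link_nextV (C := C) (k := k) hx)
    rintro (⟨r, rfl, h | h⟩ | ⟨rfl, rfl⟩ | ⟨rfl, rfl⟩ | ⟨rfl, rfl⟩ | ⟨rfl, rfl⟩ | ⟨rfl, rfl⟩ |
      ⟨rfl, rfl⟩)
    · exact .inl (.strict _ _ _ h)
    · exact .inr (.strict _ _ _ h)
    · have := (hE _ (src_mem C e.1)).1
      rw [enter_eq_strict (e := e) (q := .X) |>.2 (by simp)] at this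
      exact .inr this
    · have := (hE _ (src_mem C e.1)).2
      rw [leave_eq_strict (e := e) (q := .Xp) |>.2 (by simp)] at this
      exact .inl this
    · have := (hE _ (tgt_mem C e.1)).1
      rw [enter_eq_strict (e := e) (q := .Y) |>.2 (by simp [hst.symm])] at this
      exact .inr this
    · have := (hE _ (tgt_mem C e.1)).2
      rw [leave_eq_strict (e := e) (q := .Yp) |>.2 (by simp [hst.symm])] at this
      exact .inl this
    · by_cases h : C.flip (.inr e.1) = true
      · have := (Link.gapBefore (.inr e.1) : Link C k _ _)
        rw [slotLast_eq_strict (e := e) (q := .Z) |>.2 (by simp [h])] at this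
        simpa [gapLeft, h] using .inl this
      · have := (Link.gapAfter (C.next.symm (.inr e.1)) : Link C k _ _)
        rw [slotFirst_eq_strict (e := e) (q := .Z) |>.2 (by simp [h])] at this
        simpa [gapLeft, h] using .inr this
    · by_cases h : C.flip (.inr e.1) = true
      · have := (Link.gapAfter (C.next.symm (.inr e.1)) : Link C k _ _)
        rw [slotFirst_eq_strict (e := e) (q := .Zp) |>.2 (by simp [h])] at this
        simpa [gapRight, h] using .inr this
      · have := (Link.gapBefore (.inr e.1) : Link C k _ _)
        rw [slotLast_eq_strict (e := e) (q := .Zp) |>.2 (by simp [h])] at this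
        simpa [gapRight, h] using .inl this

theorem adj_flex {e : {e : H.edgeSet // ¬ C.directed e = true}} {q : FlexVertex}
    {y : Vertex C k} : (graph C k).Adj (.flex e q) y ↔
      (∃ r, y = .flex e r ∧ ((q, r) ∈ flexEdges ∨ (r, q) ∈ flexEdges)) ∨
      (q = .X ∧ y = prevV C k (C.src e) e) ∨ (q = .Xp ∧ y = nextV C k (C.src e) e) ∨
      (q = .Y ∧ y = prevV C k (C.tgt e) e) ∨ (q = .Yp ∧ y = nextV C k (C.tgt e) e) ∨
      (q = .Z ∧ y = gapLeft C k (.inr e)) ∨ (q = .Zp ∧ y = gapRight C k (.inr e)) := by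
  have hst := src_ne_tgt C e.1
  rw [adj_iff_link]
  constructor
  · generalize hv : Vertex.flex e q = a
    rintro (h | h)
    · cases h with
      | gapBefore s =>
        obtain ⟨rfl, h⟩ := slotLast_eq_flex.1 hv.symm
        rcases h with ⟨h, rfl⟩ | ⟨h, rfl⟩ <;> simp [gapLeft, gapRight, h]
      | gapAfter s => cases hv
      | firstSet x i hi => exact absurd hv.symm (pathA_ne (by simp) (by simp) (by simp))
      | doorFirst x f h => cases hv
      | door x e' f h =>
        obtain ⟨rfl, h'⟩ := leave_eq_flex.1 hv.symm
        have := (mem_iff_src_or_tgt C).1 h.1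
        rcases h' with ⟨rfl, rfl⟩ | ⟨hx, rfl⟩
        · simp [h.nextV_eq]
        · obtain rfl : x = C.tgt e.1 := by tauto
          simp [h.nextV_eq]
      | doorLast x e' h =>
        obtain ⟨rfl, h'⟩ := leave_eq_flex.1 hv.symm
        have := (mem_iff_src_or_tgt C).1 h.1
        rcases h' with ⟨rfl, rfl⟩ | ⟨hx, rfl⟩
        · simp [h.nextV_eq]
        · obtain rfl : x = C.tgt e.1 := by tauto
          simp [h.nextV_eq]
      | doorOnly x h => cases hv
      | secondSet x i h₁ h₂ => exact absurd hv.symm (pathB_ne (by simp) (by simp))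
      | rungA x i => cases hv
      | rungB x i => cases hv
      | strict e' q' r h => cases hv
      | flex e' q' r h =>
        cases hv
        exact .inl ⟨r, rfl, .inl h⟩
    · cases h with
      | gapBefore s => cases hv
      | gapAfter s =>
        obtain ⟨h', h⟩ := slotFirst_eq_flex.1 hv.symm
        have hs : s = C.next.symm (.inr e.1) := by rw [← h']; simp
        rw [h'] at h
        rcases h with ⟨h, rfl⟩ | ⟨h, rfl⟩ <;> simp [gapLeft, gapRight, h, hs]
      | firstSet x i hi => exact absurd hv.symm (pathA_ne (by simp) (by simp) (by simp))
      | doorFirst x f h =>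
        obtain ⟨rfl, h'⟩ := enter_eq_flex.1 hv.symm
        have := (mem_iff_src_or_tgt C).1 h.1
        rcases h' with ⟨rfl, rfl⟩ | ⟨hx, rfl⟩
        · simp [h.prevV_eq]
        · obtain rfl : x = C.tgt e.1 := by tauto
          simp [h.prevV_eq]
      | door x e' f h =>
        obtain ⟨rfl, h'⟩ := enter_eq_flex.1 hv.symm
        have := (mem_iff_src_or_tgt C).1 h.2.1
        rcases h' with ⟨rfl, rfl⟩ | ⟨hx, rfl⟩
        · simp [h.prevV_eq]
        · obtain rfl : x = C.tgt e.1 := by tauto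
          simp [h.prevV_eq]
      | doorLast x e' h => exact absurd hv.symm (pathB_ne (by simp) (by simp))
      | doorOnly x h => exact absurd hv.symm (pathB_ne (by simp) (by simp))
      | secondSet x i h₁ h₂ => exact absurd hv.symm (pathB_ne (by simp) (by simp))
      | rungA x i => cases hv
      | rungB x i => cases hv
      | strict e' q' r h => cases hv
      | flex e' q' r h =>
        cases hv
        exact .inl ⟨q', rfl, .inr h⟩
  · have hE := fun x (hx : x ∈ (e.1 : Sym2 V)) => And.intro
      (link_prevV (C := C) (k := k) hx) (link_nextV (C := C) (k := k) hx)
    rintro (⟨r, rfl, h | h⟩ | ⟨rfl, rfl⟩ | ⟨rfl, rfl⟩ | ⟨rfl, rfl⟩ | ⟨rfl, rfl⟩ | ⟨rfl, rfl⟩ |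
      ⟨rfl, rfl⟩)
    · exact .inl (.flex _ _ _ h)
    · exact .inr (.flex _ _ _ h)
    · have := (hE _ (src_mem C e.1)).1
      rw [enter_eq_flex (e := e) (q := .X) |>.2 (by simp)] at this
      exact .inr this
    · have := (hE _ (src_mem C e.1)).2
      rw [leave_eq_flex (e := e) (q := .Xp) |>.2 (by simp)] at this
      exact .inl this
    · have := (hE _ (tgt_mem C e.1)).1
      rw [enter_eq_flex (e := e) (q := .Y) |>.2 (by simp [hst.symm])] at this
      exact .inr this
    · have := (hE _ (tgt_mem C e.1)).2
      rw [leave_eq_flex (e := e) (q := .Yp) |>.2 (by simp [hst.symm])] at this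
      exact .inl this
    · by_cases h : C.flip (.inr e.1) = true
      · have := (Link.gapBefore (.inr e.1) : Link C k _ _)
        rw [slotLast_eq_flex (e := e) (q := .Z) |>.2 (by simp [h])] at this
        simpa [gapLeft, h] using .inl this
      · have := (Link.gapAfter (C.next.symm (.inr e.1)) : Link C k _ _)
        rw [slotFirst_eq_flex (e := e) (q := .Z) |>.2 (by simp [h])] at this
        simpa [gapLeft, h] using .inr this
    · by_cases h : C.flip (.inr e.1) = true
      · have := (Link.gapAfter (C.next.symm (.inr e.1)) : Link C k _ _)
        rw [slotFirst_eq_flex (e := e) (q := .Zp) |>.2 (by simp [h])] at this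
        simpa [gapRight, h] using .inr this
      · have := (Link.gapBefore (.inr e.1) : Link C k _ _)
        rw [slotLast_eq_flex (e := e) (q := .Zp) |>.2 (by simp [h])] at this
        simpa [gapRight, h] using .inl this

/-! #### Gaps and XOR gadgets -/

theorem enter_ne {x : V} {e : H.edgeSet} {v : Vertex C k} (h₁ : ∀ f q, v ≠ .strict f q)
    (h₂ : ∀ f q, v ≠ .flex f q) : enter C k x e ≠ v := by
  rintro rfl
  rcases enter_cases (C := C) (k := k) x e with ⟨f, q, h⟩ | ⟨f, q, h⟩
  · exact h₁ f q h
  · exact h₂ f q h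

theorem leave_ne {x : V} {e : H.edgeSet} {v : Vertex C k} (h₁ : ∀ f q, v ≠ .strict f q)
    (h₂ : ∀ f q, v ≠ .flex f q) : leave C k x e ≠ v := by
  rintro rfl
  rcases leave_cases (C := C) (k := k) x e with ⟨f, q, h⟩ | ⟨f, q, h⟩
  · exact h₁ f q h
  · exact h₂ f q h

theorem slotLast_ne {s : V ⊕ H.edgeSet} {v : Vertex C k} (h₁ : ∀ f q, v ≠ .strict f q)
    (h₂ : ∀ f q, v ≠ .flex f q) (h₃ : ∀ x, v ≠ .left x) (h₄ : ∀ x, v ≠ .right x) :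
    slotLast C k s ≠ v := by
  rintro rfl
  rcases slotLast_cases (C := C) (k := k) s with ⟨x, -, -, h⟩ | ⟨x, -, -, h⟩ | ⟨f, q, h⟩ |
    ⟨f, q, h⟩
  · exact h₃ x h
  · exact h₄ x h
  · exact h₁ f q h
  · exact h₂ f q h

theorem slotFirst_ne {s : V ⊕ H.edgeSet} {v : Vertex C k} (h₁ : ∀ f q, v ≠ .strict f q)
    (h₂ : ∀ f q, v ≠ .flex f q) (h₃ : ∀ x, v ≠ .left x) (h₄ : ∀ x, v ≠ .right x) :
    slotFirst C k s ≠ v := by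
  rintro rfl
  rcases slotFirst_cases (C := C) (k := k) s with ⟨x, -, -, h⟩ | ⟨x, -, -, h⟩ | ⟨f, q, h⟩ |
    ⟨f, q, h⟩
  · exact h₃ x h
  · exact h₄ x h
  · exact h₁ f q h
  · exact h₂ f q h

theorem adj_gap {s : V ⊕ H.edgeSet} {y : Vertex C k} : (graph C k).Adj (.gap s) y ↔
    y = slotLast C k s ∨ y = slotFirst C k (C.next s) := by
  rw [adj_iff_link]
  constructor
  · generalize hv : Vertex.gap s = a
    rintro (h | h)
    · cases h with
      | gapBefore s => exact absurd hv.symm (slotLast_ne (by simp) (by simp) (by simp) (by simp))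
      | gapAfter s => cases hv; exact .inr rfl
      | firstSet x i hi => exact absurd hv.symm (pathA_ne (by simp) (by simp) (by simp))
      | door x e f h => exact absurd hv.symm (leave_ne (by simp) (by simp))
      | doorLast x e h => exact absurd hv.symm (leave_ne (by simp) (by simp))
      | secondSet x i h₁ h₂ => exact absurd hv.symm (pathB_ne (by simp) (by simp))
      | _ => cases hv
    · cases h with
      | gapBefore s => cases hv; exact .inl rfl
      | gapAfter s => exact absurd hv.symm (slotFirst_ne (by simp) (by simp) (by simp) (by simp))
      | firstSet x i hi => exact absurd hv.symm (pathA_ne (by simp) (by simp) (by simp))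
      | doorFirst x e h => exact absurd hv.symm (enter_ne (by simp) (by simp))
      | door x e f h => exact absurd hv.symm (enter_ne (by simp) (by simp))
      | doorLast x e h => exact absurd hv.symm (pathB_ne (by simp) (by simp))
      | doorOnly x h => exact absurd hv.symm (pathB_ne (by simp) (by simp))
      | secondSet x i h₁ h₂ => exact absurd hv.symm (pathB_ne (by simp) (by simp))
      | _ => cases hv
  · rintro (rfl | rfl)
    · exact .inr (.gapBefore s)
    · exact .inl (.gapAfter s)

theorem link_gapLeft (x : V) : (graph C k).Adj (.left x) (gapLeft C k (.inl x)) := by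
  rw [adj_iff_link]
  by_cases h : C.flip (.inl x) = true
  · have := (Link.gapBefore (.inl x) : Link C k _ _)
    simp only [slotLast, h, slotLeft, if_true] at this
    simpa [gapLeft, h] using .inl this
  · have := (Link.gapAfter (C.next.symm (.inl x)) : Link C k _ _)
    simp only [slotFirst, h, slotLeft, Equiv.apply_symm_apply, if_false, Bool.false_eq_true] at this
    simpa [gapLeft, h] using .inr this

theorem link_gapRight (x : V) : (graph C k).Adj (.right x) (gapRight C k (.inl x)) := by
  rw [adj_iff_link]
  by_cases h : C.flip (.inl x) = true
  · have := (Link.gapAfter (C.next.symm (.inl x)) : Link C k _ _)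
    simp only [slotFirst, h, slotRight, Equiv.apply_symm_apply, if_true] at this
    simpa [gapRight, h] using .inr this
  · have := (Link.gapBefore (.inl x) : Link C k _ _)
    simp only [slotLast, h, slotRight, if_false, Bool.false_eq_true] at this
    simpa [gapRight, h] using .inl this

theorem link_pathB₀ {x : V} {i : ℕ} (hi : i ≤ xorOrder C k x) :
    Link C k (pathB₀ C k x i) (pathB₀ C k x (i + 1)) := by
  rw [pathB₀_succ]
  rcases Nat.eq_zero_or_pos i with rfl | h
  · rw [pathB₀_zero]
    by_cases h : ∃ e : H.edgeSet, x ∈ (e : Sym2 V)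
    · obtain ⟨e, he⟩ := h
      obtain ⟨f, hf⟩ := exists_isLast C he
      rw [hf.lastDoor_eq]
      exact .doorLast _ _ hf
    · push Not at h
      rw [lastDoor_eq_of_isolated C k h]
      exact .doorOnly _ h
  · rw [pathB₀, if_neg (by omega)]
    exact .secondSet _ _ h hi

theorem link_firstDoor (x : V) : Link C k (.left x) (firstDoor C k x) := by
  by_cases h : ∃ e : H.edgeSet, x ∈ (e : Sym2 V)
  · obtain ⟨e, he⟩ := h
    obtain ⟨f, hf⟩ := exists_isFirst C he
    rw [hf.firstDoor_eq]
    exact .doorFirst _ _ hf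
  · push Not at h
    rw [firstDoor_eq_of_isolated C k h]
    exact .doorOnly _ h

theorem adj_left {x : V} {y : Vertex C k} : (graph C k).Adj (.left x) y ↔
    y = gapLeft C k (.inl x) ∨ y = pathA C k x 1 ∨ y = firstDoor C k x := by
  constructor
  · rw [adj_iff_link]
    generalize hv : (Vertex.left x : Vertex C k) = a
    rintro (h | h)
    · cases h with
      | gapBefore s =>
        rcases slotLast_cases (C := C) (k := k) s with ⟨x', hx, hf, h⟩ | ⟨x', hx, hf, h⟩ |
          ⟨f, q, h⟩ | ⟨f, q, h⟩ <;> rw [h] at hv <;> cases hv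
        subst hx
        simp [gapLeft, hf]
      | firstSet x i hi =>
        rcases pathA_cases (C := C) (k := k) x (i := i) (by omega) with
          ⟨h, h'⟩ | ⟨j, h, h'⟩ | ⟨h, h'⟩ <;> rw [h'] at hv <;> cases hv
        simp [h]
      | doorFirst x e h => cases hv; simp [h.firstDoor_eq]
      | door x e f h => exact absurd hv.symm (leave_ne (by simp) (by simp))
      | doorLast x e h => exact absurd hv.symm (leave_ne (by simp) (by simp))
      | doorOnly x h => cases hv; simp [firstDoor_eq_of_isolated C k h]
      | secondSet x i h₁ h₂ => exact absurd hv.symm (pathB_ne (by simp) (by simp))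
      | _ => cases hv
    · cases h with
      | gapAfter s =>
        rcases slotFirst_cases (C := C) (k := k) (C.next s) with ⟨x', hx, hf, h⟩ |
          ⟨x', hx, hf, h⟩ | ⟨f, q, h⟩ | ⟨f, q, h⟩ <;> rw [h] at hv <;> cases hv
        have hs : s = C.next.symm (.inl x) := by rw [← hx]; simp
        rw [hx] at hf
        simp [gapLeft, hf, hs]
      | firstSet x i hi =>
        rcases pathA_cases (C := C) (k := k) x (i := i + 1) (by omega) with
          ⟨h, h'⟩ | ⟨j, h, h'⟩ | ⟨h, h'⟩ <;> rw [h'] at hv <;> cases hv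
        omega
      | doorFirst x e h => exact absurd hv.symm (enter_ne (by simp) (by simp))
      | door x e f h => exact absurd hv.symm (enter_ne (by simp) (by simp))
      | doorLast x e h => exact absurd hv.symm (pathB_ne (by simp) (by simp))
      | doorOnly x h => exact absurd hv.symm (pathB_ne (by simp) (by simp))
      | secondSet x i h₁ h₂ => exact absurd hv.symm (pathB_ne (by simp) (by simp))
      | _ => cases hv
  · rintro (rfl | rfl | rfl)
    · exact link_gapLeft x
    · have := (Link.firstSet x 0 (by omega) : Link C k _ _)
      rw [pathA_zero] at this
      exact adj_iff_link.2 (.inl this)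
    · exact adj_iff_link.2 (.inl (link_firstDoor x))

theorem adj_right {x : V} {y : Vertex C k} : (graph C k).Adj (.right x) y ↔
    y = gapRight C k (.inl x) ∨ y = pathA C k x (xorOrder C k x) ∨
      y = pathB₀ C k x (xorOrder C k x) := by
  constructor
  · rw [adj_iff_link]
    generalize hv : (Vertex.right x : Vertex C k) = a
    rintro (h | h)
    · cases h with
      | gapBefore s =>
        rcases slotLast_cases (C := C) (k := k) s with ⟨x', hx, hf, h⟩ | ⟨x', hx, hf, h⟩ |
          ⟨f, q, h⟩ | ⟨f, q, h⟩ <;> rw [h] at hv <;> cases hv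
        subst hx
        simp [gapRight, hf]
      | firstSet x i hi =>
        rcases pathA_cases (C := C) (k := k) x (i := i) (by omega) with
          ⟨h, h'⟩ | ⟨j, h, h'⟩ | ⟨h, h'⟩ <;> rw [h'] at hv <;> cases hv
        omega
      | door x e f h => exact absurd hv.symm (leave_ne (by simp) (by simp))
      | doorLast x e h => exact absurd hv.symm (leave_ne (by simp) (by simp))
      | secondSet x i h₁ h₂ =>
        rcases pathB_cases (C := C) (k := k) x (i := i) (by omega) (by omega) with
          ⟨j, h, h'⟩ | ⟨h, h'⟩ <;> rw [h'] at hv <;> cases hv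
        omega
      | _ => cases hv
    · cases h with
      | gapAfter s =>
        rcases slotFirst_cases (C := C) (k := k) (C.next s) with ⟨x', hx, hf, h⟩ |
          ⟨x', hx, hf, h⟩ | ⟨f, q, h⟩ | ⟨f, q, h⟩ <;> rw [h] at hv <;> cases hv
        have hs : s = C.next.symm (.inl x) := by rw [← hx]; simp
        rw [hx] at hf
        simp [gapRight, hf, hs]
      | firstSet x i hi =>
        rcases pathA_cases (C := C) (k := k) x (i := i + 1) (by omega) with
          ⟨h, h'⟩ | ⟨j, h, h'⟩ | ⟨h, h'⟩ <;> rw [h'] at hv <;> cases hv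
        obtain rfl : i = xorOrder C k x := by omega
        simp
      | doorFirst x e h => exact absurd hv.symm (enter_ne (by simp) (by simp))
      | door x e f h => exact absurd hv.symm (enter_ne (by simp) (by simp))
      | doorLast x e h =>
        rcases pathB_cases (C := C) (k := k) x (i := 1) (by omega) (by omega) with
          ⟨j, h, h'⟩ | ⟨h₁, h'⟩ <;> rw [h'] at hv <;> cases hv
        have h0 : xorOrder C k x = 0 := by omega
        simp [h0, pathB₀_zero, h.lastDoor_eq]
      | doorOnly x h =>
        rcases pathB_cases (C := C) (k := k) x (i := 1) (by omega) (by omega) with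
          ⟨j, h, h'⟩ | ⟨h₁, h'⟩ <;> rw [h'] at hv <;> cases hv
        have h0 : xorOrder C k x = 0 := by omega
        simp [h0, pathB₀_zero, lastDoor_eq_of_isolated C k h]
      | secondSet x i h₁ h₂ =>
        rcases pathB_cases (C := C) (k := k) x (i := i + 1) (by omega) (by omega) with
          ⟨j, h, h'⟩ | ⟨h, h'⟩ <;> rw [h'] at hv <;> cases hv
        obtain rfl : i = xorOrder C k x := by omega
        right; right
        rw [pathB₀, if_neg (by omega)]
      | _ => cases hv
  · rintro (rfl | rfl | rfl)
    · exact link_gapRight x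
    · have := (Link.firstSet x _ le_rfl : Link C k _ _)
      rw [pathA_last] at this
      exact adj_iff_link.2 (.inr this)
    · have := link_pathB₀ (C := C) (k := k) (x := x) le_rfl
      rw [pathB₀_succ, pathB_last] at this
      exact adj_iff_link.2 (.inr this)

theorem adj_railA {x : V} {i : Fin (xorOrder C k x)} {y : Vertex C k} :
    (graph C k).Adj (.railA x i) y ↔
      y = .rung x i ∨ y = pathA C k x i ∨ y = pathA C k x (i + 2) := by
  constructor
  · rw [adj_iff_link]
    generalize hv : Vertex.railA x i = a
    rintro (h | h)
    · cases h with
      | gapBefore s => exact absurd hv.symm (slotLast_ne (by simp) (by simp) (by simp) (by simp))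
      | firstSet x i hi =>
        rcases pathA_cases (C := C) (k := k) x (i := i) (by omega) with
          ⟨h, h'⟩ | ⟨j, h, h'⟩ | ⟨h, h'⟩ <;> rw [h'] at hv <;> cases hv
        simp [h]
      | door x e f h => exact absurd hv.symm (leave_ne (by simp) (by simp))
      | doorLast x e h => exact absurd hv.symm (leave_ne (by simp) (by simp))
      | secondSet x i h₁ h₂ => exact absurd hv.symm (pathB_ne (by simp) (by simp))
      | rungA x i => cases hv; simp
      | _ => cases hv
    · cases h with
      | gapAfter s => exact absurd hv.symm (slotFirst_ne (by simp) (by simp) (by simp) (by simp))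
      | firstSet x m hm =>
        rcases pathA_cases (C := C) (k := k) x (i := m + 1) (by omega) with
          ⟨h, h'⟩ | ⟨j, h, h'⟩ | ⟨h, h'⟩ <;> rw [h'] at hv <;> cases hv
        obtain rfl : m = i := by omega
        simp
      | doorFirst x e h => exact absurd hv.symm (enter_ne (by simp) (by simp))
      | door x e f h => exact absurd hv.symm (enter_ne (by simp) (by simp))
      | doorLast x e h => exact absurd hv.symm (pathB_ne (by simp) (by simp))
      | doorOnly x h => exact absurd hv.symm (pathB_ne (by simp) (by simp))
      | secondSet x i h₁ h₂ => exact absurd hv.symm (pathB_ne (by simp) (by simp))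
      | _ => cases hv
  · rintro (rfl | rfl | rfl)
    · exact adj_iff_link.2 (.inl (.rungA x i))
    · have := (Link.firstSet x i (by omega) : Link C k _ _)
      rw [pathA_succ] at this
      exact adj_iff_link.2 (.inr this)
    · have := (Link.firstSet x (i + 1) (by omega) : Link C k _ _)
      rw [pathA_succ] at this
      exact adj_iff_link.2 (.inl this)

theorem adj_railB {x : V} {i : Fin (xorOrder C k x)} {y : Vertex C k} :
    (graph C k).Adj (.railB x i) y ↔
      y = .rung x i ∨ y = pathB₀ C k x i ∨ y = pathB₀ C k x (i + 2) := by
  constructor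
  · rw [adj_iff_link]
    generalize hv : Vertex.railB x i = a
    rintro (h | h)
    · cases h with
      | gapBefore s => exact absurd hv.symm (slotLast_ne (by simp) (by simp) (by simp) (by simp))
      | firstSet x i hi => exact absurd hv.symm (pathA_ne (by simp) (by simp) (by simp))
      | door x e f h => exact absurd hv.symm (leave_ne (by simp) (by simp))
      | doorLast x e h => exact absurd hv.symm (leave_ne (by simp) (by simp))
      | secondSet x i h₁ h₂ =>
        rcases pathB_cases (C := C) (k := k) x (i := i) (by omega) (by omega) with
          ⟨j, h, h'⟩ | ⟨h, h'⟩ <;> rw [h'] at hv <;> cases hv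
        simp [h, pathB₀]
      | _ => cases hv
    · cases h with
      | gapAfter s => exact absurd hv.symm (slotFirst_ne (by simp) (by simp) (by simp) (by simp))
      | firstSet x i hi => exact absurd hv.symm (pathA_ne (by simp) (by simp) (by simp))
      | doorFirst x e h => exact absurd hv.symm (enter_ne (by simp) (by simp))
      | door x e f h => exact absurd hv.symm (enter_ne (by simp) (by simp))
      | doorLast x e h =>
        rcases pathB_cases (C := C) (k := k) x (i := 1) (by omega) (by omega) with
          ⟨j, h₁, h'⟩ | ⟨h₁, h'⟩ <;> rw [h'] at hv <;> cases hv
        have h0 : (i : ℕ) = 0 := by omega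
        simp [h0, pathB₀_zero, h.lastDoor_eq]
      | doorOnly x h =>
        rcases pathB_cases (C := C) (k := k) x (i := 1) (by omega) (by omega) with
          ⟨j, h₁, h'⟩ | ⟨h₁, h'⟩ <;> rw [h'] at hv <;> cases hv
        have h0 : (i : ℕ) = 0 := by omega
        simp [h0, pathB₀_zero, lastDoor_eq_of_isolated C k h]
      | secondSet x m h₁ h₂ =>
        rcases pathB_cases (C := C) (k := k) x (i := m + 1) (by omega) (by omega) with
          ⟨j, h, h'⟩ | ⟨h, h'⟩ <;> rw [h'] at hv <;> cases hv
        obtain rfl : m = i := by omega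
        right; left
        rw [pathB₀, if_neg (by omega)]
      | rungB x i => cases hv; simp
      | _ => cases hv
  · rintro (rfl | rfl | rfl)
    · exact adj_iff_link.2 (.inr (.rungB x i))
    · have := link_pathB₀ (C := C) (k := k) (x := x) (i := i) (by omega)
      rw [pathB₀_succ, pathB_succ] at this
      exact adj_iff_link.2 (.inr this)
    · have := link_pathB₀ (C := C) (k := k) (x := x) (i := i + 1) (by omega)
      rw [pathB₀_succ, pathB_succ] at this
      exact adj_iff_link.2 (.inl this)

theorem adj_rung {x : V} {i : Fin (xorOrder C k x)} {y : Vertex C k} :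
    (graph C k).Adj (.rung x i) y ↔ y = .railA x i ∨ y = .railB x i := by
  constructor
  · rw [adj_iff_link]
    generalize hv : Vertex.rung x i = a
    rintro (h | h)
    · cases h with
      | gapBefore s => exact absurd hv.symm (slotLast_ne (by simp) (by simp) (by simp) (by simp))
      | firstSet x i hi => exact absurd hv.symm (pathA_ne (by simp) (by simp) (by simp))
      | door x e f h => exact absurd hv.symm (leave_ne (by simp) (by simp))
      | doorLast x e h => exact absurd hv.symm (leave_ne (by simp) (by simp))
      | secondSet x i h₁ h₂ => exact absurd hv.symm (pathB_ne (by simp) (by simp))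
      | rungB x i => cases hv; simp
      | _ => cases hv
    · cases h with
      | gapAfter s => exact absurd hv.symm (slotFirst_ne (by simp) (by simp) (by simp) (by simp))
      | firstSet x i hi => exact absurd hv.symm (pathA_ne (by simp) (by simp) (by simp))
      | doorFirst x e h => exact absurd hv.symm (enter_ne (by simp) (by simp))
      | door x e f h => exact absurd hv.symm (enter_ne (by simp) (by simp))
      | doorLast x e h => exact absurd hv.symm (pathB_ne (by simp) (by simp))
      | doorOnly x h => exact absurd hv.symm (pathB_ne (by simp) (by simp))
      | secondSet x i h₁ h₂ => exact absurd hv.symm (pathB_ne (by simp) (by simp))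
      | rungA x i => cases hv; simp
      | _ => cases hv
  · rintro (rfl | rfl)
    · exact adj_iff_link.2 (.inr (.rungA x i))
    · exact adj_iff_link.2 (.inl (.rungB x i))

end Neighbors

end MaxCutReduction

namespace MaxCutReduction
section GadgetNeighbors

variable {V : Type*} [Fintype V] [DecidableEq V]
variable {H : SimpleGraph V} [DecidableRel H.Adj] {C : Choices H} {k : ℕ}

/-! ### The neighbors of the vertices of the parity gadgets -/

/-- The neighbors of a vertex of the strict gadget of `e`. -/
noncomputable def strictNbrs (C : Choices H) (k : ℕ) (e : {e : H.edgeSet // C.directed e = true}) :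
    StrictVertex → List (Vertex C k)
  | .X => [prevV C k (C.src e) e, .strict e .midApX, .strict e .b]
  | .Xp => [nextV C k (C.src e) e, .strict e .midAXp, .strict e .bp]
  | .Y => [prevV C k (C.tgt e) e, .strict e .midYYp, .strict e .Zp]
  | .Yp => [nextV C k (C.tgt e) e, .strict e .midYYp, .strict e .a, .strict e .Z]
  | .Z => [gapLeft C k (.inr e), .strict e .ap, .strict e .Zp, .strict e .Yp]
  | .Zp => [gapRight C k (.inr e), .strict e .Y, .strict e .Z, .strict e .a]
  | .a => [.strict e .midAXp, .strict e .b, .strict e .Yp, .strict e .Zp]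
  | .ap => [.strict e .midApX, .strict e .bp, .strict e .Z]
  | .b => [.strict e .midBBp, .strict e .X, .strict e .a]
  | .bp => [.strict e .midBBp, .strict e .Xp, .strict e .ap]
  | .midApX => [.strict e .ap, .strict e .X]
  | .midAXp => [.strict e .a, .strict e .Xp]
  | .midBBp => [.strict e .b, .strict e .bp]
  | .midYYp => [.strict e .Y, .strict e .Yp]

theorem adj_strict_iff_mem {e : {e : H.edgeSet // C.directed e = true}} {q : StrictVertex}
    {y : Vertex C k} : (graph C k).Adj (.strict e q) y ↔ y ∈ strictNbrs C k e q := by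
  rw [adj_strict]
  constructor
  · rintro (⟨r, rfl, h⟩ | h)
    · revert h; cases q <;> cases r <;> simp [strictEdges, strictNbrs]
    · revert h; cases q <;> simp +contextual [strictNbrs]
  · revert y
    cases q <;> simp [strictEdges, strictNbrs]

/-- The neighbors of a vertex of the flexible gadget of `e`. -/
noncomputable def flexNbrs (C : Choices H) (k : ℕ) (e : {e : H.edgeSet // ¬ C.directed e = true}) :
    FlexVertex → List (Vertex C k)
  | .X => [prevV C k (C.src e) e, .flex e .R, .flex e .Z]
  | .Xp => [nextV C k (C.src e) e, .flex e .R, .flex e .Yp, .flex e .Zp]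
  | .Y => [prevV C k (C.tgt e) e, .flex e .S, .flex e .Zp]
  | .Yp => [nextV C k (C.tgt e) e, .flex e .S, .flex e .Xp, .flex e .Z]
  | .Z => [gapLeft C k (.inr e), .flex e .X, .flex e .Zp, .flex e .Yp]
  | .Zp => [gapRight C k (.inr e), .flex e .Y, .flex e .Z, .flex e .Xp]
  | .R => [.flex e .X, .flex e .Xp]
  | .S => [.flex e .Y, .flex e .Yp]

theorem adj_flex_iff_mem {e : {e : H.edgeSet // ¬ C.directed e = true}} {q : FlexVertex}
    {y : Vertex C k} : (graph C k).Adj (.flex e q) y ↔ y ∈ flexNbrs C k e q := by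
  rw [adj_flex]
  constructor
  · rintro (⟨r, rfl, h⟩ | h)
    · revert h; cases q <;> cases r <;> simp [flexEdges, flexNbrs]
    · revert h; cases q <;> simp +contextual [flexNbrs]
  · revert y
    cases q <;> simp [flexEdges, flexNbrs]

theorem adj_strict_X {e : {e : H.edgeSet // C.directed e = true}} {y : Vertex C k} :
    (graph C k).Adj (.strict e .X) y ↔
      y = prevV C k (C.src e) e ∨ y = .strict e .midApX ∨ y = .strict e .b := by
  simp [adj_strict_iff_mem, strictNbrs]

theorem adj_strict_Xp {e : {e : H.edgeSet // C.directed e = true}} {y : Vertex C k} :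
    (graph C k).Adj (.strict e .Xp) y ↔
      y = nextV C k (C.src e) e ∨ y = .strict e .midAXp ∨ y = .strict e .bp := by
  simp [adj_strict_iff_mem, strictNbrs]

theorem adj_strict_Y {e : {e : H.edgeSet // C.directed e = true}} {y : Vertex C k} :
    (graph C k).Adj (.strict e .Y) y ↔
      y = prevV C k (C.tgt e) e ∨ y = .strict e .midYYp ∨ y = .strict e .Zp := by
  simp [adj_strict_iff_mem, strictNbrs]

theorem adj_strict_Yp {e : {e : H.edgeSet // C.directed e = true}} {y : Vertex C k} :
    (graph C k).Adj (.strict e .Yp) y ↔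
      y = nextV C k (C.tgt e) e ∨ y = .strict e .midYYp ∨ y = .strict e .a ∨ y = .strict e .Z := by
  simp [adj_strict_iff_mem, strictNbrs]

theorem adj_strict_Z {e : {e : H.edgeSet // C.directed e = true}} {y : Vertex C k} :
    (graph C k).Adj (.strict e .Z) y ↔
      y = gapLeft C k (.inr e) ∨ y = .strict e .ap ∨ y = .strict e .Zp ∨ y = .strict e .Yp := by
  simp [adj_strict_iff_mem, strictNbrs]

theorem adj_strict_Zp {e : {e : H.edgeSet // C.directed e = true}} {y : Vertex C k} :
    (graph C k).Adj (.strict e .Zp) y ↔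
      y = gapRight C k (.inr e) ∨ y = .strict e .Y ∨ y = .strict e .Z ∨ y = .strict e .a := by
  simp [adj_strict_iff_mem, strictNbrs]

theorem adj_strict_a {e : {e : H.edgeSet // C.directed e = true}} {y : Vertex C k} :
    (graph C k).Adj (.strict e .a) y ↔
      y = .strict e .midAXp ∨ y = .strict e .b ∨ y = .strict e .Yp ∨ y = .strict e .Zp := by
  simp [adj_strict_iff_mem, strictNbrs]

theorem adj_strict_ap {e : {e : H.edgeSet // C.directed e = true}} {y : Vertex C k} :
    (graph C k).Adj (.strict e .ap) y ↔
      y = .strict e .midApX ∨ y = .strict e .bp ∨ y = .strict e .Z := by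
  simp [adj_strict_iff_mem, strictNbrs]

theorem adj_strict_b {e : {e : H.edgeSet // C.directed e = true}} {y : Vertex C k} :
    (graph C k).Adj (.strict e .b) y ↔
      y = .strict e .midBBp ∨ y = .strict e .X ∨ y = .strict e .a := by
  simp [adj_strict_iff_mem, strictNbrs]

theorem adj_strict_bp {e : {e : H.edgeSet // C.directed e = true}} {y : Vertex C k} :
    (graph C k).Adj (.strict e .bp) y ↔
      y = .strict e .midBBp ∨ y = .strict e .Xp ∨ y = .strict e .ap := by
  simp [adj_strict_iff_mem, strictNbrs]

theorem adj_strict_midApX {e : {e : H.edgeSet // C.directed e = true}} {y : Vertex C k} :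
    (graph C k).Adj (.strict e .midApX) y ↔
      y = .strict e .ap ∨ y = .strict e .X := by
  simp [adj_strict_iff_mem, strictNbrs]

theorem adj_strict_midAXp {e : {e : H.edgeSet // C.directed e = true}} {y : Vertex C k} :
    (graph C k).Adj (.strict e .midAXp) y ↔
      y = .strict e .a ∨ y = .strict e .Xp := by
  simp [adj_strict_iff_mem, strictNbrs]

theorem adj_strict_midBBp {e : {e : H.edgeSet // C.directed e = true}} {y : Vertex C k} :
    (graph C k).Adj (.strict e .midBBp) y ↔
      y = .strict e .b ∨ y = .strict e .bp := by
  simp [adj_strict_iff_mem, strictNbrs]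

theorem adj_strict_midYYp {e : {e : H.edgeSet // C.directed e = true}} {y : Vertex C k} :
    (graph C k).Adj (.strict e .midYYp) y ↔
      y = .strict e .Y ∨ y = .strict e .Yp := by
  simp [adj_strict_iff_mem, strictNbrs]

theorem adj_flex_X {e : {e : H.edgeSet // ¬ C.directed e = true}} {y : Vertex C k} :
    (graph C k).Adj (.flex e .X) y ↔
      y = prevV C k (C.src e) e ∨ y = .flex e .R ∨ y = .flex e .Z := by
  simp [adj_flex_iff_mem, flexNbrs]

theorem adj_flex_Xp {e : {e : H.edgeSet // ¬ C.directed e = true}} {y : Vertex C k} :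
    (graph C k).Adj (.flex e .Xp) y ↔
      y = nextV C k (C.src e) e ∨ y = .flex e .R ∨ y = .flex e .Yp ∨ y = .flex e .Zp := by
  simp [adj_flex_iff_mem, flexNbrs]

theorem adj_flex_Y {e : {e : H.edgeSet // ¬ C.directed e = true}} {y : Vertex C k} :
    (graph C k).Adj (.flex e .Y) y ↔
      y = prevV C k (C.tgt e) e ∨ y = .flex e .S ∨ y = .flex e .Zp := by
  simp [adj_flex_iff_mem, flexNbrs]

theorem adj_flex_Yp {e : {e : H.edgeSet // ¬ C.directed e = true}} {y : Vertex C k} :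
    (graph C k).Adj (.flex e .Yp) y ↔
      y = nextV C k (C.tgt e) e ∨ y = .flex e .S ∨ y = .flex e .Xp ∨ y = .flex e .Z := by
  simp [adj_flex_iff_mem, flexNbrs]

theorem adj_flex_Z {e : {e : H.edgeSet // ¬ C.directed e = true}} {y : Vertex C k} :
    (graph C k).Adj (.flex e .Z) y ↔
      y = gapLeft C k (.inr e) ∨ y = .flex e .X ∨ y = .flex e .Zp ∨ y = .flex e .Yp := by
  simp [adj_flex_iff_mem, flexNbrs]

theorem adj_flex_Zp {e : {e : H.edgeSet // ¬ C.directed e = true}} {y : Vertex C k} :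
    (graph C k).Adj (.flex e .Zp) y ↔
      y = gapRight C k (.inr e) ∨ y = .flex e .Y ∨ y = .flex e .Z ∨ y = .flex e .Xp := by
  simp [adj_flex_iff_mem, flexNbrs]

theorem adj_flex_R {e : {e : H.edgeSet // ¬ C.directed e = true}} {y : Vertex C k} :
    (graph C k).Adj (.flex e .R) y ↔
      y = .flex e .X ∨ y = .flex e .Xp := by
  simp [adj_flex_iff_mem, flexNbrs]

theorem adj_flex_S {e : {e : H.edgeSet // ¬ C.directed e = true}} {y : Vertex C k} :
    (graph C k).Adj (.flex e .S) y ↔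
      y = .flex e .Y ∨ y = .flex e .Yp := by
  simp [adj_flex_iff_mem, flexNbrs]

end GadgetNeighbors
end MaxCutReduction

namespace MaxCutReduction

section Places

variable {V : Type*} [Fintype V] [DecidableEq V]
variable {H : SimpleGraph V} [DecidableRel H.Adj] {C : Choices H} {k : ℕ}

/-! ### The vertices of degree two -/

/-- The vertices of degree two of the strict gadget. -/
def StrictVertex.IsMid : StrictVertex → Prop
  | .midApX | .midAXp | .midBBp | .midYYp => True
  | _ => False

/-- The vertices of degree two of the flexible gadget. -/
def FlexVertex.IsMid : FlexVertex → Prop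
  | .R | .S => True
  | _ => False

/-- The vertices of degree two of `G`. -/
def IsMid : Vertex C k → Prop
  | .gap _ => True
  | .rung _ _ => True
  | .strict _ q => q.IsMid
  | .flex _ q => q.IsMid
  | _ => False

/-- For an isolated vertex both degrees vanish and the XOR gadget has order `k - 1`. This keeps the
two paths between `x_ℓ` and `x_r` apart. -/
theorem one_lt_xorOrder_of_isolated (hk : 15 ≤ k) {x : V}
    (h : ∀ e : H.edgeSet, x ∉ (e : Sym2 V)) : 1 < xorOrder C k x := by
  have h1 : H.degree x = 0 := by
    by_contra hd
    obtain ⟨y, hy⟩ := (H.degree_pos_iff_exists_adj x).1 (Nat.pos_of_ne_zero hd)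
    exact h ⟨s(x, y), hy⟩ (by simp)
  have h2 : outDegree C x = 0 := by
    rw [outDegree, Finset.card_eq_zero, Finset.filter_eq_empty_iff]
    rintro e - ⟨-, rfl⟩
    exact h e (src_mem C e)
  rw [xorOrder, h1, h2]
  omega

theorem xorOrder_pos_of_isolated (hk : 15 ≤ k) {x : V} (h : ∀ e : H.edgeSet, x ∉ (e : Sym2 V)) :
    0 < xorOrder C k x :=
  zero_lt_one.trans (one_lt_xorOrder_of_isolated hk h)

/-- Along a second-set path `ψ` strictly increases, so the door before the gadget of `f` comes from
a strictly earlier gadget or from `x_ℓ`. In particular, it is not an internal edge. -/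
theorem prevV_ne_strict {x : V} {f : H.edgeSet} {e : {e : H.edgeSet // C.directed e = true}}
    (h : C.psi f ≤ C.psi e) (q : StrictVertex) : prevV C k x f ≠ .strict e q := by
  intro h'
  rcases prevV_cases (C := C) (k := k) x f with ⟨g, hg, hg'⟩ | hg
  · rw [hg', leave_eq_strict] at h'
    obtain ⟨rfl, -⟩ := h'
    exact absurd hg.2.2.1 (not_lt.2 h)
  · rw [hg] at h'; cases h'

theorem prevV_ne_flex {x : V} {f : H.edgeSet} {e : {e : H.edgeSet // ¬ C.directed e = true}}
    (h : C.psi f ≤ C.psi e) (q : FlexVertex) : prevV C k x f ≠ .flex e q := by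
  intro h'
  rcases prevV_cases (C := C) (k := k) x f with ⟨g, hg, hg'⟩ | hg
  · rw [hg', leave_eq_flex] at h'
    obtain ⟨rfl, -⟩ := h'
    exact absurd hg.2.2.1 (not_lt.2 h)
  · rw [hg] at h'; cases h'

theorem nextV_ne_strict {x : V} {f : H.edgeSet} {e : {e : H.edgeSet // C.directed e = true}}
    (h : C.psi e ≤ C.psi f) (q : StrictVertex) : nextV C k x f ≠ .strict e q := by
  intro h'
  rcases nextV_cases (C := C) (k := k) x f with ⟨g, hg, hg'⟩ | hg
  · rw [hg', enter_eq_strict] at h'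
    obtain ⟨rfl, -⟩ := h'
    exact absurd hg.2.2.1 (not_lt.2 h)
  · rw [hg] at h'
    rcases pathB_cases (C := C) (k := k) x (i := 1) (by omega) (by omega) with
      ⟨j, g, g'⟩ | ⟨g, g'⟩ <;> rw [g'] at h' <;> cases h'

theorem nextV_ne_flex {x : V} {f : H.edgeSet} {e : {e : H.edgeSet // ¬ C.directed e = true}}
    (h : C.psi e ≤ C.psi f) (q : FlexVertex) : nextV C k x f ≠ .flex e q := by
  intro h'
  rcases nextV_cases (C := C) (k := k) x f with ⟨g, hg, hg'⟩ | hg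
  · rw [hg', enter_eq_flex] at h'
    obtain ⟨rfl, -⟩ := h'
    exact absurd hg.2.2.1 (not_lt.2 h)
  · rw [hg] at h'
    rcases pathB_cases (C := C) (k := k) x (i := 1) (by omega) (by omega) with
      ⟨j, g, g'⟩ | ⟨g, g'⟩ <;> rw [g'] at h' <;> cases h'

theorem gapLeft_cases (s : V ⊕ H.edgeSet) : ∃ t, gapLeft C k s = .gap t := by
  unfold gapLeft; split_ifs <;> exact ⟨_, rfl⟩

theorem gapRight_cases (s : V ⊕ H.edgeSet) : ∃ t, gapRight C k s = .gap t := by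
  unfold gapRight; split_ifs <;> exact ⟨_, rfl⟩

theorem isMid_gapLeft (s : V ⊕ H.edgeSet) : IsMid (gapLeft C k s) := by
  obtain ⟨t, h⟩ := gapLeft_cases (C := C) (k := k) s; rw [h]; trivial

theorem isMid_gapRight (s : V ⊕ H.edgeSet) : IsMid (gapRight C k s) := by
  obtain ⟨t, h⟩ := gapRight_cases (C := C) (k := k) s; rw [h]; trivial

theorem gapLeft_ne {s : V ⊕ H.edgeSet} {v : Vertex C k} (h : ∀ t, v ≠ .gap t) :
    gapLeft C k s ≠ v := by
  obtain ⟨t, h'⟩ := gapLeft_cases (C := C) (k := k) s; rw [h']; exact (h t).symm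

theorem gapRight_ne {s : V ⊕ H.edgeSet} {v : Vertex C k} (h : ∀ t, v ≠ .gap t) :
    gapRight C k s ≠ v := by
  obtain ⟨t, h'⟩ := gapRight_cases (C := C) (k := k) s; rw [h']; exact (h t).symm

theorem lastDoor_cases (x : V) :
    (∃ e, IsLast C x e ∧ lastDoor C k x = leave C k x e) ∨
      ((∀ e : H.edgeSet, x ∉ (e : Sym2 V)) ∧ lastDoor C k x = .left x) := by
  by_cases h : ∃ e : H.edgeSet, x ∈ (e : Sym2 V)
  · obtain ⟨e, he⟩ := h
    obtain ⟨f, hf⟩ := exists_isLast C he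
    exact .inl ⟨f, hf, hf.lastDoor_eq k⟩
  · push Not at h
    exact .inr ⟨h, lastDoor_eq_of_isolated C k h⟩

theorem firstDoor_cases (x : V) :
    (∃ e, IsFirst C x e ∧ firstDoor C k x = enter C k x e) ∨
      ((∀ e : H.edgeSet, x ∉ (e : Sym2 V)) ∧ firstDoor C k x = pathB C k x 1) := by
  by_cases h : ∃ e : H.edgeSet, x ∈ (e : Sym2 V)
  · obtain ⟨e, he⟩ := h
    obtain ⟨f, hf⟩ := exists_isFirst C he
    exact .inl ⟨f, hf, hf.firstDoor_eq k⟩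
  · push Not at h
    exact .inr ⟨h, firstDoor_eq_of_isolated C k h⟩

theorem lastDoor_ne {x : V} {v : Vertex C k} (h₁ : ∀ f q, v ≠ .strict f q)
    (h₂ : ∀ f q, v ≠ .flex f q) (h₃ : ∀ y, v ≠ .left y) : lastDoor C k x ≠ v := by
  rcases lastDoor_cases (C := C) (k := k) x with ⟨e, -, h⟩ | ⟨-, h⟩ <;> rw [h]
  · exact leave_ne h₁ h₂
  · exact (h₃ x).symm

/-- The second vertices of both paths from `x_ℓ` could coincide only for an isolated `x` with an XOR
gadget of order zero. -/
theorem pathA_one_ne_firstDoor (hk : 15 ≤ k) (x : V) : pathA C k x 1 ≠ firstDoor C k x := by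
  rcases firstDoor_cases (C := C) (k := k) x with ⟨e, -, h⟩ | ⟨h', h⟩ <;> rw [h]
  · exact (enter_ne (fun f q => (pathA_ne (by simp) (by simp) (by simp)))
      (fun f q => (pathA_ne (by simp) (by simp) (by simp)))).symm
  · have := xorOrder_pos_of_isolated (C := C) hk h'
    rw [show (1 : ℕ) = ((⟨0, this⟩ : Fin (xorOrder C k x)) : ℕ) + 1 from rfl, pathA_succ,
      pathB_succ]
    simp

/-- The predecessors of `x_r` on the two rails are distinct. -/
theorem pathA_ne_pathB₀ (hk : 15 ≤ k) (x : V) :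
    pathA C k x (xorOrder C k x) ≠ pathB₀ C k x (xorOrder C k x) := by
  rcases Nat.eq_zero_or_pos (xorOrder C k x) with h | h
  · rw [h, pathA_zero, pathB₀_zero]
    rcases lastDoor_cases (C := C) (k := k) x with ⟨e, -, h⟩ | ⟨h', -⟩
    · rw [h]; exact (leave_ne (by simp) (by simp)).symm
    · exact absurd (xorOrder_pos_of_isolated (C := C) hk h') (by omega)
  · obtain ⟨j, hj⟩ : ∃ j : Fin (xorOrder C k x), xorOrder C k x = j + 1 :=
      ⟨⟨xorOrder C k x - 1, by omega⟩, by simp; omega⟩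
    rw [hj, pathA_succ, pathB₀_succ, pathB_succ]
    simp

theorem pathA_ne_add_two (x : V) (i : Fin (xorOrder C k x)) :
    pathA C k x i ≠ pathA C k x (i + 2) := by
  rcases pathA_cases (C := C) (k := k) x (i := i) (by omega) with
    ⟨h, h'⟩ | ⟨j, h, h'⟩ | ⟨h, h'⟩ <;>
  rcases pathA_cases (C := C) (k := k) x (i := i + 2) (by omega) with
    ⟨g, g'⟩ | ⟨j', g, g'⟩ | ⟨g, g'⟩ <;> rw [h', g'] <;> simp
  · omega
  · rintro rfl; omega
  · omega

theorem pathB₀_ne_add_two (x : V) (i : Fin (xorOrder C k x)) :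
    pathB₀ C k x i ≠ pathB₀ C k x (i + 2) := by
  rw [pathB₀_succ]
  rcases pathB_cases (C := C) (k := k) x (i := i + 2) (by omega) (by omega) with
    ⟨j', g, g'⟩ | ⟨g, g'⟩ <;> rw [g']
  all_goals
    rcases Nat.eq_zero_or_pos (i : ℕ) with h | h
    · rw [h, pathB₀_zero]
      exact lastDoor_ne (by simp) (by simp) (by simp)
    · rw [pathB₀, if_neg (by omega)]
      rcases pathB_cases (C := C) (k := k) x (i := i) (by omega) (by omega) with
        ⟨j, h, h'⟩ | ⟨h, h'⟩ <;> rw [h'] <;> simp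
      omega

theorem degree_ne_two_of_three {a b c v : Vertex C k} [Fintype ((graph C k).neighborSet v)]
    (ha : (graph C k).Adj v a) (hb : (graph C k).Adj v b) (hc : (graph C k).Adj v c)
    (hab : a ≠ b) (hac : a ≠ c) (hbc : b ≠ c) : (graph C k).degree v ≠ 2 := by
  have : ({a, b, c} : Finset (Vertex C k)) ⊆ (graph C k).neighborFinset v := by
    intro z; simp only [Finset.mem_insert, Finset.mem_singleton, SimpleGraph.mem_neighborFinset]
    rintro (rfl | rfl | rfl) <;> assumption
  have := Finset.card_le_card this
  rw [SimpleGraph.card_neighborFinset_eq_degree, Finset.card_insert_of_notMem (by simp [hab, hac]),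
    Finset.card_insert_of_notMem (by simp [hbc]), Finset.card_singleton] at this
  omega

theorem degree_eq_two_of_iff {a b v : Vertex C k} [Fintype ((graph C k).neighborSet v)]
    (h : ∀ y, (graph C k).Adj v y ↔ y = a ∨ y = b)
    (hab : a ≠ b) : (graph C k).degree v = 2 := by
  rw [← SimpleGraph.card_neighborFinset_eq_degree, ← Finset.card_pair hab]
  congr 1
  ext z
  simp [h]

theorem place_of_isMid {v : Vertex C k} (hv : IsMid v) :
    place C k v = toLex (0, toLex (0, 0)) := by
  classical
  unfold place
  split_ifs with h
  · rfl
  · rcases v with s | x | x | ⟨x, i⟩ | ⟨x, i⟩ | ⟨x, i⟩ | ⟨e, q⟩ | ⟨e, q⟩ <;> try exact hv.elim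
    · rfl
    · rfl
    · cases q <;> try exact hv.elim
      · exact absurd (degree_eq_two_of_iff (fun y => adj_strict_midApX) (by simp)) h
      · exact absurd (degree_eq_two_of_iff (fun y => adj_strict_midAXp) (by simp)) h
      · exact absurd (degree_eq_two_of_iff (fun y => adj_strict_midBBp) (by simp)) h
      · exact absurd (degree_eq_two_of_iff (fun y => adj_strict_midYYp) (by simp)) h
    · cases q <;> try exact hv.elim
      · exact absurd (degree_eq_two_of_iff (fun y => adj_flex_R) (by simp)) h
      · exact absurd (degree_eq_two_of_iff (fun y => adj_flex_S) (by simp)) h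

/-- Three distinct neighbors decide the degree test in `place`. The bound on `k` matters at `x_ℓ`
and `x_r` of isolated vertices, where two neighbors might otherwise coincide. -/
theorem place_of_not_isMid (hk : 15 ≤ k) {v : Vertex C k} (hv : ¬ IsMid v) :
    place C k v = rawPlace C k v := by
  classical
  unfold place
  rw [if_neg]
  rcases v with s | x | x | ⟨x, i⟩ | ⟨x, i⟩ | ⟨x, i⟩ | ⟨e, q⟩ | ⟨e, q⟩ <;>
    try exact absurd trivial hv
  · refine degree_ne_two_of_three (adj_left.2 (.inl rfl)) (adj_left.2 (.inr (.inl rfl)))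
      (adj_left.2 (.inr (.inr rfl))) ?_ ?_ (pathA_one_ne_firstDoor hk x)
    · exact gapLeft_ne fun t => pathA_ne (by simp) (by simp) (by simp)
    · refine gapLeft_ne fun t => ?_
      rcases firstDoor_cases (C := C) (k := k) x with ⟨e, -, h⟩ | ⟨-, h⟩ <;> rw [h]
      · exact enter_ne (by simp) (by simp)
      · exact pathB_ne (by simp) (by simp)
  · refine degree_ne_two_of_three (adj_right.2 (.inl rfl)) (adj_right.2 (.inr (.inl rfl)))
      (adj_right.2 (.inr (.inr rfl))) ?_ ?_ (pathA_ne_pathB₀ hk x)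
    · exact gapRight_ne fun t => pathA_ne (by simp) (by simp) (by simp)
    · refine gapRight_ne fun t => ?_
      unfold pathB₀
      split_ifs
      · exact lastDoor_ne (by simp) (by simp) (by simp)
      · exact pathB_ne (by simp) (by simp)
  · refine degree_ne_two_of_three (adj_railA.2 (.inl rfl)) (adj_railA.2 (.inr (.inl rfl)))
      (adj_railA.2 (.inr (.inr rfl))) ?_ ?_ (pathA_ne_add_two x i)
    · exact (pathA_ne (by simp) (by simp) (by simp)).symm
    · exact (pathA_ne (by simp) (by simp) (by simp)).symm
  · have : ∀ j, Vertex.rung x i ≠ pathB₀ C k x j := by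
      intro j
      unfold pathB₀
      split_ifs
      · exact (lastDoor_ne (by simp) (by simp) (by simp)).symm
      · exact (pathB_ne (by simp) (by simp)).symm
    exact degree_ne_two_of_three (adj_railB.2 (.inl rfl)) (adj_railB.2 (.inr (.inl rfl)))
      (adj_railB.2 (.inr (.inr rfl))) (this _) (this _) (pathB₀_ne_add_two x i)
  · cases q <;> try exact absurd trivial hv
    · exact degree_ne_two_of_three (adj_strict_X.2 (.inl rfl)) (adj_strict_X.2 (.inr (.inl rfl)))
        (adj_strict_X.2 (.inr (.inr rfl))) (prevV_ne_strict le_rfl _) (prevV_ne_strict le_rfl _)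
        (by simp)
    · exact degree_ne_two_of_three (adj_strict_Xp.2 (.inl rfl)) (adj_strict_Xp.2 (.inr (.inl rfl)))
        (adj_strict_Xp.2 (.inr (.inr rfl))) (nextV_ne_strict le_rfl _) (nextV_ne_strict le_rfl _)
        (by simp)
    · exact degree_ne_two_of_three (adj_strict_Y.2 (.inl rfl)) (adj_strict_Y.2 (.inr (.inl rfl)))
        (adj_strict_Y.2 (.inr (.inr rfl))) (prevV_ne_strict le_rfl _) (prevV_ne_strict le_rfl _)
        (by simp)
    · exact degree_ne_two_of_three (a := .strict e .midYYp) (b := .strict e .a) (c := .strict e .Z)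
        (by simp [adj_strict_Yp]) (by simp [adj_strict_Yp]) (by simp [adj_strict_Yp])
        (by simp) (by simp) (by simp)
    · exact degree_ne_two_of_three (a := .strict e .ap) (b := .strict e .Zp) (c := .strict e .Yp)
        (by simp [adj_strict_Z]) (by simp [adj_strict_Z]) (by simp [adj_strict_Z])
        (by simp) (by simp) (by simp)
    · exact degree_ne_two_of_three (a := .strict e .Y) (b := .strict e .Z) (c := .strict e .a)
        (by simp [adj_strict_Zp]) (by simp [adj_strict_Zp]) (by simp [adj_strict_Zp])
        (by simp) (by simp) (by simp)
    · exact degree_ne_two_of_three (a := .strict e .b) (b := .strict e .Yp) (c := .strict e .Zp)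
        (by simp [adj_strict_a]) (by simp [adj_strict_a]) (by simp [adj_strict_a])
        (by simp) (by simp) (by simp)
    · exact degree_ne_two_of_three (a := .strict e .midApX) (b := .strict e .bp)
        (c := .strict e .Z)
        (by simp [adj_strict_ap]) (by simp [adj_strict_ap]) (by simp [adj_strict_ap])
        (by simp) (by simp) (by simp)
    · exact degree_ne_two_of_three (a := .strict e .midBBp) (b := .strict e .X)
        (c := .strict e .a)
        (by simp [adj_strict_b]) (by simp [adj_strict_b]) (by simp [adj_strict_b])
        (by simp) (by simp) (by simp)
    · exact degree_ne_two_of_three (a := .strict e .midBBp) (b := .strict e .Xp)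
        (c := .strict e .ap)
        (by simp [adj_strict_bp]) (by simp [adj_strict_bp]) (by simp [adj_strict_bp])
        (by simp) (by simp) (by simp)
  · cases q <;> try exact absurd trivial hv
    · exact degree_ne_two_of_three (adj_flex_X.2 (.inl rfl)) (adj_flex_X.2 (.inr (.inl rfl)))
        (adj_flex_X.2 (.inr (.inr rfl))) (prevV_ne_flex le_rfl _) (prevV_ne_flex le_rfl _)
        (by simp)
    · exact degree_ne_two_of_three (a := .flex e .R) (b := .flex e .Yp) (c := .flex e .Zp)
        (by simp [adj_flex_Xp]) (by simp [adj_flex_Xp]) (by simp [adj_flex_Xp])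
        (by simp) (by simp) (by simp)
    · exact degree_ne_two_of_three (adj_flex_Y.2 (.inl rfl)) (adj_flex_Y.2 (.inr (.inl rfl)))
        (adj_flex_Y.2 (.inr (.inr rfl))) (prevV_ne_flex le_rfl _) (prevV_ne_flex le_rfl _)
        (by simp)
    · exact degree_ne_two_of_three (a := .flex e .S) (b := .flex e .Xp) (c := .flex e .Z)
        (by simp [adj_flex_Yp]) (by simp [adj_flex_Yp]) (by simp [adj_flex_Yp])
        (by simp) (by simp) (by simp)
    · exact degree_ne_two_of_three (a := .flex e .X) (b := .flex e .Zp) (c := .flex e .Yp)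
        (by simp [adj_flex_Z]) (by simp [adj_flex_Z]) (by simp [adj_flex_Z])
        (by simp) (by simp) (by simp)
    · exact degree_ne_two_of_three (a := .flex e .Y) (b := .flex e .Z) (c := .flex e .Xp)
        (by simp [adj_flex_Zp]) (by simp [adj_flex_Zp]) (by simp [adj_flex_Zp])
        (by simp) (by simp) (by simp)

/-- A vertex of degree at least three has at most one neighbor of degree two. -/
theorem isMid_unique {u m m' : Vertex C k} (hu : ¬ IsMid u) (hm : IsMid m) (hm' : IsMid m')
    (h : (graph C k).Adj u m) (h' : (graph C k).Adj u m') : m = m' := by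
  have hA : ∀ x i, ¬ IsMid (pathA C k x i) := by
    intro x i; unfold pathA; split_ifs <;> exact id
  have hB : ∀ x i, ¬ IsMid (pathB C k x i) := by
    intro x i; unfold pathB; split_ifs <;> exact id
  have hen : ∀ x e, ¬ IsMid (enter C k x e) := by
    intro x e; unfold enter port; split_ifs <;> exact id
  have hle : ∀ x e, ¬ IsMid (leave C k x e) := by
    intro x e; unfold leave port; split_ifs <;> exact id
  have hpr : ∀ x e, ¬ IsMid (prevV C k x e) := by
    intro x e; rcases prevV_cases (C := C) (k := k) x e with ⟨f, -, h⟩ | h <;> rw [h]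
    · exact hle _ _
    · exact id
  have hne : ∀ x e, ¬ IsMid (nextV C k x e) := by
    intro x e; rcases nextV_cases (C := C) (k := k) x e with ⟨f, -, h⟩ | h <;> rw [h]
    · exact hen _ _
    · exact hB _ _
  have hfd : ∀ x, ¬ IsMid (firstDoor C k x) := by
    intro x; rcases firstDoor_cases (C := C) (k := k) x with ⟨f, -, h⟩ | ⟨-, h⟩ <;> rw [h]
    · exact hen _ _
    · exact hB _ _
  have hld : ∀ x, ¬ IsMid (lastDoor C k x) := by
    intro x; rcases lastDoor_cases (C := C) (k := k) x with ⟨f, -, h⟩ | ⟨-, h⟩ <;> rw [h]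
    · exact hle _ _
    · exact id
  have hB₀ : ∀ x i, ¬ IsMid (pathB₀ C k x i) := by
    intro x i; unfold pathB₀; split_ifs
    · exact hld _
    · exact hB _ _
  have key : ∀ a : Vertex C k, (∀ m, (graph C k).Adj u m → IsMid m → m = a) → m = m' :=
    fun a ha => (ha m h hm).trans (ha m' h' hm').symm
  rcases u with s | x | x | ⟨x, i⟩ | ⟨x, i⟩ | ⟨x, i⟩ | ⟨e, q⟩ | ⟨e, q⟩ <;>
    try exact absurd trivial hu
  · refine key (gapLeft C k (.inl x)) fun m h hm => ?_
    rcases adj_left.1 h with rfl | rfl | rfl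
    exacts [rfl, absurd hm (hA _ _), absurd hm (hfd _)]
  · refine key (gapRight C k (.inl x)) fun m h hm => ?_
    rcases adj_right.1 h with rfl | rfl | rfl
    exacts [rfl, absurd hm (hA _ _), absurd hm (hB₀ _ _)]
  · refine key (.rung x i) fun m h hm => ?_
    rcases adj_railA.1 h with rfl | rfl | rfl
    exacts [rfl, absurd hm (hA _ _), absurd hm (hA _ _)]
  · refine key (.rung x i) fun m h hm => ?_
    rcases adj_railB.1 h with rfl | rfl | rfl
    exacts [rfl, absurd hm (hB₀ _ _), absurd hm (hB₀ _ _)]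
  · cases q <;> try exact absurd trivial hu
    · refine key (.strict e .midApX) fun m h hm => ?_
      rcases adj_strict_X.1 h with rfl | rfl | rfl
      exacts [absurd hm (hpr _ _), rfl, hm.elim]
    · refine key (.strict e .midAXp) fun m h hm => ?_
      rcases adj_strict_Xp.1 h with rfl | rfl | rfl
      exacts [absurd hm (hne _ _), rfl, hm.elim]
    · refine key (.strict e .midYYp) fun m h hm => ?_
      rcases adj_strict_Y.1 h with rfl | rfl | rfl
      exacts [absurd hm (hpr _ _), rfl, hm.elim]
    · refine key (.strict e .midYYp) fun m h hm => ?_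
      rcases adj_strict_Yp.1 h with rfl | rfl | rfl | rfl
      exacts [absurd hm (hne _ _), rfl, hm.elim, hm.elim]
    · refine key (gapLeft C k (.inr e)) fun m h hm => ?_
      rcases adj_strict_Z.1 h with rfl | rfl | rfl | rfl
      exacts [rfl, hm.elim, hm.elim, hm.elim]
    · refine key (gapRight C k (.inr e)) fun m h hm => ?_
      rcases adj_strict_Zp.1 h with rfl | rfl | rfl | rfl
      exacts [rfl, hm.elim, hm.elim, hm.elim]
    · refine key (.strict e .midAXp) fun m h hm => ?_
      rcases adj_strict_a.1 h with rfl | rfl | rfl | rfl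
      exacts [rfl, hm.elim, hm.elim, hm.elim]
    · refine key (.strict e .midApX) fun m h hm => ?_
      rcases adj_strict_ap.1 h with rfl | rfl | rfl
      exacts [rfl, hm.elim, hm.elim]
    · refine key (.strict e .midBBp) fun m h hm => ?_
      rcases adj_strict_b.1 h with rfl | rfl | rfl
      exacts [rfl, hm.elim, hm.elim]
    · refine key (.strict e .midBBp) fun m h hm => ?_
      rcases adj_strict_bp.1 h with rfl | rfl | rfl
      exacts [rfl, hm.elim, hm.elim]
  · cases q <;> try exact absurd trivial hu
    · refine key (.flex e .R) fun m h hm => ?_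
      rcases adj_flex_X.1 h with rfl | rfl | rfl
      exacts [absurd hm (hpr _ _), rfl, hm.elim]
    · refine key (.flex e .R) fun m h hm => ?_
      rcases adj_flex_Xp.1 h with rfl | rfl | rfl | rfl
      exacts [absurd hm (hne _ _), rfl, hm.elim, hm.elim]
    · refine key (.flex e .S) fun m h hm => ?_
      rcases adj_flex_Y.1 h with rfl | rfl | rfl
      exacts [absurd hm (hpr _ _), rfl, hm.elim]
    · refine key (.flex e .S) fun m h hm => ?_
      rcases adj_flex_Yp.1 h with rfl | rfl | rfl | rfl
      exacts [absurd hm (hne _ _), rfl, hm.elim, hm.elim]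
    · refine key (gapLeft C k (.inr e)) fun m h hm => ?_
      rcases adj_flex_Z.1 h with rfl | rfl | rfl | rfl
      exacts [rfl, hm.elim, hm.elim, hm.elim]
    · refine key (gapRight C k (.inr e)) fun m h hm => ?_
      rcases adj_flex_Zp.1 h with rfl | rfl | rfl | rfl
      exacts [rfl, hm.elim, hm.elim, hm.elim]

/-- A vertex of degree two has two neighbors, both of degree at least three. -/
theorem exists_nbrs_of_isMid (hE : Nonempty H.edgeSet) {m : Vertex C k} (hm : IsMid m) :
    ∃ a b, a ≠ b ∧ ¬ IsMid a ∧ ¬ IsMid b ∧ ∀ y, (graph C k).Adj m y ↔ y = a ∨ y = b := by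
  rcases m with s | x | x | ⟨x, i⟩ | ⟨x, i⟩ | ⟨x, i⟩ | ⟨e, q⟩ | ⟨e, q⟩ <;> try exact hm.elim
  · refine ⟨_, _, ?_, ?_, ?_, fun y => adj_gap⟩
    -- Since `H` has an edge, there are at least two slots. Hence the cyclic permutation has no
    -- fixed point, and the two neighbors of a gap belong to different slots.
    · have hs : C.next s ≠ s := by
        obtain ⟨e⟩ := hE
        refine C.next_cycle.apply_ne ⟨.inl (C.src e), trivial, .inr e, trivial, by simp⟩ trivial
      intro h
      apply hs
      rcases slotLast_cases (C := C) (k := k) s with ⟨x, hx, -, h'⟩ | ⟨x, hx, -, h'⟩ |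
        ⟨f, q, h'⟩ | ⟨f, q, h'⟩
      · rw [h'] at h
        rcases slotFirst_cases (C := C) (k := k) (C.next s) with ⟨y, hy, -, g⟩ | ⟨y, hy, -, g⟩ |
          ⟨f, q, g⟩ | ⟨f, q, g⟩ <;> rw [g] at h <;> cases h
        rw [hy, hx]
      · rw [h'] at h
        rcases slotFirst_cases (C := C) (k := k) (C.next s) with ⟨y, hy, -, g⟩ | ⟨y, hy, -, g⟩ |
          ⟨f, q, g⟩ | ⟨f, q, g⟩ <;> rw [g] at h <;> cases h
        rw [hy, hx]
      · rw [h'] at h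
        rw [(slotFirst_eq_strict.1 h.symm).1, (slotLast_eq_strict.1 h').1]
      · rw [h'] at h
        rw [(slotFirst_eq_flex.1 h.symm).1, (slotLast_eq_flex.1 h').1]
    · rcases s with x | f <;> simp only [slotLast, slotLeft, slotRight, port] <;> split_ifs <;>
        exact id
    · rcases C.next s with x | f <;> simp only [slotFirst, slotLeft, slotRight, port] <;>
        split_ifs <;>
        exact id
  · exact ⟨_, _, by simp, id, id, fun y => adj_rung⟩
  · cases q <;> try exact hm.elim
    · exact ⟨_, _, by simp, id, id, fun y => adj_strict_midApX⟩
    · exact ⟨_, _, by simp, id, id, fun y => adj_strict_midAXp⟩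
    · exact ⟨_, _, by simp, id, id, fun y => adj_strict_midBBp⟩
    · exact ⟨_, _, by simp, id, id, fun y => adj_strict_midYYp⟩
  · cases q <;> try exact hm.elim
    · exact ⟨_, _, by simp, id, id, fun y => adj_flex_R⟩
    · exact ⟨_, _, by simp, id, id, fun y => adj_flex_S⟩

end Places

end MaxCutReduction

/-! ### Degrees in a cycle, and traps. -/

namespace TSP

variable {U : Type*}

section Degrees

variable {R : U → U → Prop} {x m a b c z : U}

theorem isCyc_comm (hR : IsCyc R) : R a b ↔ R b a := ⟨isCyc_symm hR, isCyc_symm hR⟩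

theorem isCyc_eq_or_eq (hR : IsCyc R) (ha : R x a) (hb : R x b) (hab : a ≠ b) (hc : R x c) :
    c = a ∨ c = b := by
  obtain ⟨p, q, -, h⟩ := isCyc_two hR ha
  rw [h] at ha hb hc
  grind

theorem isCyc_exists_ne (hR : IsCyc R) (ha : R x a) : ∃ b, b ≠ a ∧ R x b := by
  obtain ⟨p, q, hpq, h⟩ := isCyc_two hR ha
  by_cases hp : p = a
  · exact ⟨q, fun hq => hpq (hp.trans hq.symm), (h q).2 (.inr rfl)⟩
  · exact ⟨p, hp, (h p).2 (.inl rfl)⟩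

theorem isCyc_both (hR : IsCyc R) (hz : R x z) (h : ∀ y, R x y → y = a ∨ y = b) :
    R x a ∧ R x b := by
  obtain ⟨p, q, hpq, h'⟩ := isCyc_two hR hz
  have hp := (h' p).2 (.inl rfl)
  have hq := (h' q).2 (.inr rfl)
  rcases h p hp with rfl | rfl <;> rcases h q hq with rfl | rfl <;> tauto

/-- One of the two cycle edges at `x` is `xm`; the other one must be exactly one of the remaining
candidates. -/
theorem isCyc_one_of_two (hR : IsCyc R) (hm : R x m)
    (h : ∀ y, R x y → y = m ∨ y = a ∨ y = b) (ha : a ≠ m) (hb : b ≠ m) (hab : a ≠ b) :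
    R x a ↔ ¬ R x b := by
  constructor
  · intro h1 h2
    rcases isCyc_eq_or_eq hR h1 h2 hab hm with h | h
    · exact ha h.symm
    · exact hb h.symm
  · intro h1
    obtain ⟨y, hy, hy'⟩ := isCyc_exists_ne hR hm
    rcases h y hy' with rfl | rfl | rfl <;> tauto

/-- Exactly one of three propositions holds. -/
abbrev ExactlyOne (p q r : Prop) : Prop :=
  (p ∧ ¬ q ∧ ¬ r) ∨ (¬ p ∧ q ∧ ¬ r) ∨ (¬ p ∧ ¬ q ∧ r)

theorem isCyc_one_of_three (hR : IsCyc R) (hm : R x m)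
    (h : ∀ y, R x y → y = m ∨ y = a ∨ y = b ∨ y = c) (ha : a ≠ m) (hb : b ≠ m) (hc : c ≠ m)
    (hab : a ≠ b) (hac : a ≠ c) (hbc : b ≠ c) :
    ExactlyOne (R x a) (R x b) (R x c) := by
  have key : ∀ {p q : U}, p ≠ m → q ≠ m → p ≠ q → R x p → ¬ R x q := by
    intro p q hp hq hpq h1 h2
    rcases isCyc_eq_or_eq hR h1 h2 hpq hm with h | h
    · exact hp h.symm
    · exact hq h.symm
  obtain ⟨y, hy, hy'⟩ := isCyc_exists_ne hR hm
  rcases h y hy' with rfl | rfl | rfl | rfl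
  · exact absurd rfl hy
  · exact .inl ⟨hy', key ha hb hab hy', key ha hc hac hy'⟩
  · exact .inr (.inl ⟨key hb ha hab.symm hy', hy', key hb hc hbc hy'⟩)
  · exact .inr (.inr ⟨key hc ha hac.symm hy', key hc hb hbc.symm hy', hy'⟩)

end Degrees

section Trap

variable {G : SimpleGraph U} {T : U → U → Prop} {high : U → Prop} {v v' m u p x y z : U}
  {K : U → U → Prop}

theorem Stuck.comm (S : Stuck G T high v v') : T x y ↔ T y x := isCyc_comm S.cyc

theorem Stuck.symm (S : Stuck G T high v v') (h : T x y) : T y x := isCyc_symm S.cyc h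

/-- If all neighbors of a high vertex are among `a` and `b`, then its tour edges lead there. -/
theorem Stuck.both (S : Stuck G T high v v') {a b : U} (hx : high x)
    (h : ∀ y, G.Adj x y → y = a ∨ y = b) : T x a ∧ T x b := by
  obtain ⟨z, hz⟩ := S.total x
  exact isCyc_both S.cyc hz fun y hy => h y (S.sat hx hy)

/-- As `m` is high, `vm` belongs to `G` and differs from the non-edge `vv'`. So these are the two
tour edges at `v`. -/
theorem Stuck.nbr_eq (S : Stuck G T high v v') (hm : T v m) (hmh : high m) (h : T v y) :
    y = m ∨ y = v' :=
  isCyc_eq_or_eq S.cyc hm S.adj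
    (fun h => S.not_adj (h ▸ (S.sat hmh (S.symm hm)).symm)) h

/-- A high tour edge at `v` is the only edge of `G` at `v` in the tour. -/
theorem Stuck.not_tour (S : Stuck G T high v v') (hm : T v m) (hmh : high m) (h : G.Adj v y)
    (hy : y ≠ m) : ¬ T v y := by
  intro h'
  rcases S.nbr_eq hm hmh h' with rfl | rfl
  · exact hy rfl
  · exact S.not_adj h

/-- A bad cycle, with the consequences of the fact that `m` is a high tour neighbor of `v`. -/
structure Trap (G : SimpleGraph U) (T : U → U → Prop) (high : U → Prop) (v m u p : U)
    (K : U → U → Prop) : Prop where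
  cyc : IsCyc K
  adj_u : K v u
  adj_m : K v m
  le : ∀ {x y}, K x y → G.Adj x y
  of_high : ∀ {x y z}, K x z → T x y → high y → K x y
  of_ne : ∀ {x y z}, K x z → T x y → x ≠ u → x ≠ v → K x y
  tour : ∀ {x y}, K x y → x ≠ u → x ≠ v → T x y
  pred : T u p
  not_high_pred : ¬ high p
  not_mem : ∀ z, ¬ K p z
  not_low : ∀ {x y}, K x y → high x ∨ high y ∨ x = v ∨ y = v

/-- Of the two tour neighbors `s` and `p` of `u`, the first is high. If at most one of them can be
high, `p` is not, and the bad cycle exists. It lies in `G`, since each of its edges contains a high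
vertex or is one of `vu` and `vm`. -/
theorem Stuck.exists_trap (S : Stuck G T high v v') (hm : T v m) (hmh : high m)
    (hvu : G.Adj v u) (hum : u ≠ m) {m' : U} (hu : ∀ y, T u y → high y → y = m') :
    ∃ p K, Trap G T high v m u p K := by
  have hnT := S.not_tour hm hmh hvu hum
  obtain ⟨s, p, hsp, hs, hp, hhs, h⟩ := S.move hvu hnT
  have hph : ¬ high p := fun hph => hsp ((hu s hs hhs).trans (hu p hp hph).symm)
  obtain ⟨K, B⟩ := h hph
  have hmv' : m ≠ v' := fun h => S.not_adj (h ▸ (S.sat hmh (S.symm hm)).symm)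
  have hv' : ¬ high v' := fun h => S.not_adj (S.sat h (S.symm S.adj)).symm
  -- The only tour edges that leave the bad cycle are `up` and `vv'`, and their outer ends are not
  -- high.
  have of_high : ∀ {x y z}, K x z → T x y → high y → K x y := by
    intro x y z hz hxy hy
    rcases B.mem_tour hz hxy with h | ⟨rfl, rfl⟩ | ⟨rfl, rfl⟩
    · exact h
    · exact absurd hy hph
    · exact absurd hy hv'
  have hvm : K v m := of_high B.adj hm hmh
  have hKv : ∀ {y}, K v y → y = u ∨ y = m := fun h => isCyc_eq_or_eq B.cyc B.adj hvm hum h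
  refine ⟨p, K, B.cyc, B.adj, hvm, ?_, of_high, ?_, ?_, hp, hph, B.not_mem, B.not_low⟩
  · have hKv' : ∀ {y}, K v y → G.Adj v y := by
      intro y hy
      rcases hKv hy with rfl | rfl
      · exact hvu
      · exact (S.sat hmh (S.symm hm)).symm
    intro x y hxy
    rcases B.tour hxy with h | ⟨rfl, rfl⟩ | ⟨rfl, rfl⟩
    · rcases B.not_low hxy with hx | hy | rfl | rfl
      · exact S.sat hx h
      · exact (S.sat hy (S.symm h)).symm
      · exact hKv' hxy
      · exact (hKv' (isCyc_symm B.cyc hxy)).symm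
    · exact hvu.symm
    · exact hvu
  · intro x y z hz hxy hxu hxv
    rcases B.mem_tour hz hxy with h | ⟨rfl, -⟩ | ⟨rfl, -⟩
    exacts [h, absurd rfl hxu, absurd rfl hxv]
  · intro x y hxy hxu hxv
    rcases B.tour hxy with h | ⟨rfl, -⟩ | ⟨rfl, -⟩
    exacts [h, absurd rfl hxu, absurd rfl hxv]

theorem Trap.symm (B : Trap G T high v m u p K) (h : K x y) : K y x := isCyc_symm B.cyc h

theorem Trap.nbr_eq (B : Trap G T high v m u p K) (hum : u ≠ m) (h : K v y) : y = u ∨ y = m :=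
  isCyc_eq_or_eq B.cyc B.adj_u B.adj_m hum h

end Trap

end TSP

/-! ### A stuck tour and the vertices of degree two. -/

namespace MaxCutReduction

section Context

variable {V : Type*} [Fintype V] [DecidableEq V]
variable {H : SimpleGraph V} [DecidableRel H.Adj] {C : Choices H} {k : ℕ}

open TSP

/-- The tour `T` is stuck at `v`, and the high vertices are those before `v` in the order of the
priorities. -/
structure Ctx (T : Vertex C k → Vertex C k → Prop) (high : Vertex C k → Prop) (v v' : Vertex C k) :
    Prop extends Stuck (graph C k) T high v v' where
  hk : 15 ≤ k
  hE : Nonempty H.edgeSet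
  high_of_lt : ∀ {x}, place C k x < place C k v → high x
  low_of_lt : ∀ {x}, place C k v < place C k x → ¬ high x

variable {T : Vertex C k → Vertex C k → Prop} {high : Vertex C k → Prop}
  {v v' m u p x y z : Vertex C k} {K : Vertex C k → Vertex C k → Prop}

theorem lex_zero_lt_of_one_le {a b c : ℕ} (h : 1 ≤ a) :
    toLex (0, toLex (0, 0)) < toLex (a, toLex (b, c)) := by
  rw [Prod.Lex.toLex_lt_toLex]; left; exact h

theorem zero_lt_place (hk : 15 ≤ k) (hv : ¬ IsMid v) :
    toLex (0, toLex (0, 0)) < place C k v := by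
  rw [place_of_not_isMid hk hv]
  rcases v with s | x | x | ⟨x, i⟩ | ⟨x, i⟩ | ⟨x, i⟩ | ⟨e, q⟩ | ⟨e, q⟩ <;>
    first | exact absurd trivial hv | exact lex_zero_lt_of_one_le (by norm_num)

/-- No tour is stuck at a vertex of degree two. -/
theorem Ctx.not_isMid (S : Ctx T high v v') : ¬ IsMid v := by
  intro hv
  obtain ⟨a, b, hab, ha, hb, hadj⟩ := exists_nbrs_of_isMid S.hE hv
  obtain ⟨u, hu, huv, huT⟩ : ∃ u, ¬ IsMid u ∧ (graph C k).Adj v u ∧ ¬ T v u := by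
    -- If both edges of `G` at `v` were in the tour, they would be the only tour edges at `v` and
    -- leave no place for a non-edge.
    by_contra! hcon
    have hTa := hcon a ha ((hadj a).2 (.inl rfl))
    have hTb := hcon b hb ((hadj b).2 (.inr rfl))
    rcases isCyc_eq_or_eq S.cyc hTa hTb hab S.adj with h | h
    · exact S.not_adj ((hadj _).2 (.inl h))
    · exact S.not_adj ((hadj _).2 (.inr h))
  obtain ⟨s, p, hsp, hs, hp, hhs, -⟩ := S.move huv huT
  -- If `v` has degree two, only vertices of degree two can be high. But `v` is the only neighbor of
  -- `u` of degree two, and `uv` is not in the tour.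
  by_cases hsm : IsMid s
  · have := isMid_unique hu hsm hv (S.sat hhs (S.symm hs)).symm huv.symm
    exact huT (S.symm (this ▸ hs))
  · exact S.low_of_lt (by rw [place_of_isMid hv]; exact zero_lt_place S.hk hsm) hhs

theorem Ctx.high_of_isMid (S : Ctx T high v v') (hm : IsMid m) : high m :=
  S.high_of_lt (by rw [place_of_isMid hm]; exact zero_lt_place S.hk S.not_isMid)

/-- The edges at vertices of degree two belong to the tour. -/
theorem Ctx.tour_of_isMid (S : Ctx T high v v') (hm : IsMid m) (h : (graph C k).Adj x m) :
    T x m := by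
  obtain ⟨a, b, -, -, -, hadj⟩ := exists_nbrs_of_isMid S.hE hm
  have := S.both (S.high_of_isMid hm) (fun y hy => (hadj y).1 hy)
  apply S.symm
  rcases (hadj x).1 h.symm with rfl | rfl
  exacts [this.1, this.2]

/-- If `m` is the neighbor of degree two of `u`, and no other tour neighbor of `u` is high, there
is a trap. -/
theorem Ctx.exists_trap (S : Ctx T high v v') (hm : IsMid m) (hvm : (graph C k).Adj v m)
    (hvu : (graph C k).Adj v u) (hum : u ≠ m) {m' : Vertex C k}
    (hu : ∀ y, T u y → high y → y = m') :
    ∃ p K, Trap (graph C k) T high v m u p K :=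
  S.toStuck.exists_trap (S.tour_of_isMid hm hvm) (S.high_of_isMid hm) hvu hum hu

/-- The edge of degree two at a vertex of a trap belongs to the trap. -/
theorem Ctx.trap_mid (S : Ctx T high v v') (B : Trap (graph C k) T high v m u p K) (hx : K x z)
    {n : Vertex C k} (hn : IsMid n) (h : (graph C k).Adj x n) : K x n :=
  B.of_high hx (S.tour_of_isMid hn h) (S.high_of_isMid hn)

/-- Both edges of a vertex of degree two in a trap belong to the trap. -/
theorem Ctx.trap_of_mid (S : Ctx T high v v') (B : Trap (graph C k) T high v m u p K)
    {n : Vertex C k} (hn : IsMid n) (hz : K n z) (h : (graph C k).Adj n y) : K n y := by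
  obtain ⟨a, b, -, -, -, hadj⟩ := exists_nbrs_of_isMid S.hE hn
  have := isCyc_both B.cyc hz (fun y hy => (hadj y).1 (B.le hy))
  rcases (hadj y).1 h with rfl | rfl
  exacts [this.1, this.2]

/-- A trap passes through the vertices of degree two that it meets. -/
theorem Ctx.trap_pass (S : Ctx T high v v') (B : Trap (graph C k) T high v m u p K) (hx : K x z)
    {n : Vertex C k} (hn : IsMid n) (h : (graph C k).Adj x n) (h' : (graph C k).Adj n y) :
    K y n :=
  B.symm (S.trap_of_mid B hn (B.symm (S.trap_mid B hx hn h)) h')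

end Context

end MaxCutReduction

namespace MaxCutReduction
section GadgetDegrees

variable {V : Type*} [Fintype V] [DecidableEq V]
variable {H : SimpleGraph V} [DecidableRel H.Adj] {C : Choices H} {k : ℕ}
variable {R : Vertex C k → Vertex C k → Prop}

open TSP

/-! ### The edges of a cycle at the vertices of the parity gadgets -/

/-- All edges of `R` at `x` belong to `G`, and all edges from `x` to vertices of degree two belong
to `R`. -/
structure Regular (R : Vertex C k → Vertex C k → Prop) (x : Vertex C k) : Prop where
  le : ∀ {y}, R x y → (graph C k).Adj x y
  mid : ∀ {m}, IsMid m → (graph C k).Adj x m → R x m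

theorem one_strict_X {e : {e : H.edgeSet // C.directed e = true}} (hR : IsCyc R)
    (h : Regular R (.strict e .X)) :
    R (.strict e .X) (prevV C k (C.src e) e) ↔
      ¬ R (.strict e .X) (.strict e .b) :=
  isCyc_one_of_two hR (h.mid (m := .strict e .midApX) trivial
    (adj_strict_X.2 (by simp)))
    (fun y hy => by rcases adj_strict_X.1 (h.le hy) with rfl | rfl | rfl <;> simp)
    (prevV_ne_strict le_rfl _) (by simp) (prevV_ne_strict le_rfl _)

theorem one_strict_Xp {e : {e : H.edgeSet // C.directed e = true}} (hR : IsCyc R)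
    (h : Regular R (.strict e .Xp)) :
    R (.strict e .Xp) (nextV C k (C.src e) e) ↔
      ¬ R (.strict e .Xp) (.strict e .bp) :=
  isCyc_one_of_two hR (h.mid (m := .strict e .midAXp) trivial
    (adj_strict_Xp.2 (by simp)))
    (fun y hy => by rcases adj_strict_Xp.1 (h.le hy) with rfl | rfl | rfl <;> simp)
    (nextV_ne_strict le_rfl _) (by simp) (nextV_ne_strict le_rfl _)

theorem one_strict_Y {e : {e : H.edgeSet // C.directed e = true}} (hR : IsCyc R)
    (h : Regular R (.strict e .Y)) :
    R (.strict e .Y) (prevV C k (C.tgt e) e) ↔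
      ¬ R (.strict e .Y) (.strict e .Zp) :=
  isCyc_one_of_two hR (h.mid (m := .strict e .midYYp) trivial
    (adj_strict_Y.2 (by simp)))
    (fun y hy => by rcases adj_strict_Y.1 (h.le hy) with rfl | rfl | rfl <;> simp)
    (prevV_ne_strict le_rfl _) (by simp) (prevV_ne_strict le_rfl _)

theorem one_strict_Yp {e : {e : H.edgeSet // C.directed e = true}} (hR : IsCyc R)
    (h : Regular R (.strict e .Yp)) :
    ExactlyOne (R (.strict e .Yp) (nextV C k (C.tgt e) e)) (R (.strict e .Yp) (.strict e .a))
      (R (.strict e .Yp) (.strict e .Z)) :=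
  isCyc_one_of_three hR (h.mid (m := .strict e .midYYp) trivial
    (adj_strict_Yp.2 (by simp)))
    (fun y hy => by rcases adj_strict_Yp.1 (h.le hy) with rfl | rfl | rfl | rfl <;> simp)
    (nextV_ne_strict le_rfl _) (by simp) (by simp) (nextV_ne_strict le_rfl _)
    (nextV_ne_strict le_rfl _) (by simp)

theorem one_strict_Z {e : {e : H.edgeSet // C.directed e = true}} (hR : IsCyc R)
    (h : Regular R (.strict e .Z)) :
    ExactlyOne (R (.strict e .Z) (.strict e .ap)) (R (.strict e .Z) (.strict e .Zp))
      (R (.strict e .Z) (.strict e .Yp)) :=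
  isCyc_one_of_three hR (h.mid (m := gapLeft C k (.inr e)) (isMid_gapLeft _)
    (adj_strict_Z.2 (by simp)))
    (fun y hy => by rcases adj_strict_Z.1 (h.le hy) with rfl | rfl | rfl | rfl <;> simp)
    (gapLeft_ne (by simp)).symm (gapLeft_ne (by simp)).symm (gapLeft_ne (by simp)).symm (by simp)
    (by simp) (by simp)

theorem one_strict_Zp {e : {e : H.edgeSet // C.directed e = true}} (hR : IsCyc R)
    (h : Regular R (.strict e .Zp)) :
    ExactlyOne (R (.strict e .Zp) (.strict e .Y)) (R (.strict e .Zp) (.strict e .Z))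
      (R (.strict e .Zp) (.strict e .a)) :=
  isCyc_one_of_three hR (h.mid (m := gapRight C k (.inr e)) (isMid_gapRight _)
    (adj_strict_Zp.2 (by simp)))
    (fun y hy => by rcases adj_strict_Zp.1 (h.le hy) with rfl | rfl | rfl | rfl <;> simp)
    (gapRight_ne (by simp)).symm (gapRight_ne (by simp)).symm (gapRight_ne (by simp)).symm
    (by simp) (by simp) (by simp)

theorem one_strict_a {e : {e : H.edgeSet // C.directed e = true}} (hR : IsCyc R)
    (h : Regular R (.strict e .a)) :
    ExactlyOne (R (.strict e .a) (.strict e .b)) (R (.strict e .a) (.strict e .Yp))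
      (R (.strict e .a) (.strict e .Zp)) :=
  isCyc_one_of_three hR (h.mid (m := .strict e .midAXp) trivial
    (adj_strict_a.2 (by simp)))
    (fun y hy => by rcases adj_strict_a.1 (h.le hy) with rfl | rfl | rfl | rfl <;> simp)
    (by simp) (by simp) (by simp) (by simp) (by simp) (by simp)

theorem one_strict_ap {e : {e : H.edgeSet // C.directed e = true}} (hR : IsCyc R)
    (h : Regular R (.strict e .ap)) :
    R (.strict e .ap) (.strict e .bp) ↔
      ¬ R (.strict e .ap) (.strict e .Z) :=
  isCyc_one_of_two hR (h.mid (m := .strict e .midApX) trivial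
    (adj_strict_ap.2 (by simp)))
    (fun y hy => by rcases adj_strict_ap.1 (h.le hy) with rfl | rfl | rfl <;> simp)
    (by simp) (by simp) (by simp)

theorem one_strict_b {e : {e : H.edgeSet // C.directed e = true}} (hR : IsCyc R)
    (h : Regular R (.strict e .b)) :
    R (.strict e .b) (.strict e .X) ↔
      ¬ R (.strict e .b) (.strict e .a) :=
  isCyc_one_of_two hR (h.mid (m := .strict e .midBBp) trivial
    (adj_strict_b.2 (by simp)))
    (fun y hy => by rcases adj_strict_b.1 (h.le hy) with rfl | rfl | rfl <;> simp)
    (by simp) (by simp) (by simp)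

theorem one_strict_bp {e : {e : H.edgeSet // C.directed e = true}} (hR : IsCyc R)
    (h : Regular R (.strict e .bp)) :
    R (.strict e .bp) (.strict e .Xp) ↔
      ¬ R (.strict e .bp) (.strict e .ap) :=
  isCyc_one_of_two hR (h.mid (m := .strict e .midBBp) trivial
    (adj_strict_bp.2 (by simp)))
    (fun y hy => by rcases adj_strict_bp.1 (h.le hy) with rfl | rfl | rfl <;> simp)
    (by simp) (by simp) (by simp)

theorem one_flex_X {e : {e : H.edgeSet // ¬ C.directed e = true}} (hR : IsCyc R)
    (h : Regular R (.flex e .X)) :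
    R (.flex e .X) (prevV C k (C.src e) e) ↔
      ¬ R (.flex e .X) (.flex e .Z) :=
  isCyc_one_of_two hR (h.mid (m := .flex e .R) trivial
    (adj_flex_X.2 (by simp)))
    (fun y hy => by rcases adj_flex_X.1 (h.le hy) with rfl | rfl | rfl <;> simp)
    (prevV_ne_flex le_rfl _) (by simp) (prevV_ne_flex le_rfl _)

theorem one_flex_Xp {e : {e : H.edgeSet // ¬ C.directed e = true}} (hR : IsCyc R)
    (h : Regular R (.flex e .Xp)) :
    ExactlyOne (R (.flex e .Xp) (nextV C k (C.src e) e)) (R (.flex e .Xp) (.flex e .Yp))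
      (R (.flex e .Xp) (.flex e .Zp)) :=
  isCyc_one_of_three hR (h.mid (m := .flex e .R) trivial
    (adj_flex_Xp.2 (by simp)))
    (fun y hy => by rcases adj_flex_Xp.1 (h.le hy) with rfl | rfl | rfl | rfl <;> simp)
    (nextV_ne_flex le_rfl _) (by simp) (by simp) (nextV_ne_flex le_rfl _) (nextV_ne_flex le_rfl _)
    (by simp)

theorem one_flex_Y {e : {e : H.edgeSet // ¬ C.directed e = true}} (hR : IsCyc R)
    (h : Regular R (.flex e .Y)) :
    R (.flex e .Y) (prevV C k (C.tgt e) e) ↔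
      ¬ R (.flex e .Y) (.flex e .Zp) :=
  isCyc_one_of_two hR (h.mid (m := .flex e .S) trivial
    (adj_flex_Y.2 (by simp)))
    (fun y hy => by rcases adj_flex_Y.1 (h.le hy) with rfl | rfl | rfl <;> simp)
    (prevV_ne_flex le_rfl _) (by simp) (prevV_ne_flex le_rfl _)

theorem one_flex_Yp {e : {e : H.edgeSet // ¬ C.directed e = true}} (hR : IsCyc R)
    (h : Regular R (.flex e .Yp)) :
    ExactlyOne (R (.flex e .Yp) (nextV C k (C.tgt e) e)) (R (.flex e .Yp) (.flex e .Xp))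
      (R (.flex e .Yp) (.flex e .Z)) :=
  isCyc_one_of_three hR (h.mid (m := .flex e .S) trivial
    (adj_flex_Yp.2 (by simp)))
    (fun y hy => by rcases adj_flex_Yp.1 (h.le hy) with rfl | rfl | rfl | rfl <;> simp)
    (nextV_ne_flex le_rfl _) (by simp) (by simp) (nextV_ne_flex le_rfl _) (nextV_ne_flex le_rfl _)
    (by simp)

theorem one_flex_Z {e : {e : H.edgeSet // ¬ C.directed e = true}} (hR : IsCyc R)
    (h : Regular R (.flex e .Z)) :
    ExactlyOne (R (.flex e .Z) (.flex e .X)) (R (.flex e .Z) (.flex e .Zp))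
      (R (.flex e .Z) (.flex e .Yp)) :=
  isCyc_one_of_three hR (h.mid (m := gapLeft C k (.inr e)) (isMid_gapLeft _)
    (adj_flex_Z.2 (by simp)))
    (fun y hy => by rcases adj_flex_Z.1 (h.le hy) with rfl | rfl | rfl | rfl <;> simp)
    (gapLeft_ne (by simp)).symm (gapLeft_ne (by simp)).symm (gapLeft_ne (by simp)).symm (by simp)
    (by simp) (by simp)

theorem one_flex_Zp {e : {e : H.edgeSet // ¬ C.directed e = true}} (hR : IsCyc R)
    (h : Regular R (.flex e .Zp)) :
    ExactlyOne (R (.flex e .Zp) (.flex e .Y)) (R (.flex e .Zp) (.flex e .Z))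
      (R (.flex e .Zp) (.flex e .Xp)) :=
  isCyc_one_of_three hR (h.mid (m := gapRight C k (.inr e)) (isMid_gapRight _)
    (adj_flex_Zp.2 (by simp)))
    (fun y hy => by rcases adj_flex_Zp.1 (h.le hy) with rfl | rfl | rfl | rfl <;> simp)
    (gapRight_ne (by simp)).symm (gapRight_ne (by simp)).symm (gapRight_ne (by simp)).symm
    (by simp) (by simp) (by simp)

end GadgetDegrees
end MaxCutReduction

/-! ### Indicators of cycle edges for counting modulo two. -/

namespace TSP

variable {U : Type*} {R : U → U → Prop} {x a b c d : U}

open Classical in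
/-- The indicator of the relation `R`. -/
noncomputable def bit (R : U → U → Prop) (x y : U) : ℕ := if R x y then 1 else 0

theorem bit_congr_iff : (bit R a b = bit R c d) ↔ (R a b ↔ R c d) := by
  by_cases h : R a b <;> by_cases h' : R c d <;> simp [bit, h, h']

theorem bit_comm (hR : IsCyc R) : bit R a b = bit R b a := bit_congr_iff.2 (isCyc_comm hR)

theorem bit_le_one : bit R a b ≤ 1 := by
  by_cases h : R a b <;> simp [bit, h]

/-- A cycle has degree zero or two at `x`, so `t` is 0 or 1. With an explicit `2 * t`, the degree
equations of a gadget can be added up by linear arithmetic. -/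
theorem exists_bit_add_eq (hR : IsCyc R) (h : ∀ y, R x y → y = a ∨ y = b ∨ y = c ∨ y = d)
    (hab : a ≠ b) (hac : a ≠ c) (had : a ≠ d) (hbc : b ≠ c) (hbd : b ≠ d) (hcd : c ≠ d) :
    ∃ t, bit R x a + bit R x b + bit R x c + bit R x d = 2 * t := by
  by_cases hz : ∃ z, R x z
  · obtain ⟨z, hz⟩ := hz
    obtain ⟨p, q, hpq, h'⟩ := isCyc_two hR hz
    have hp := h p ((h' p).2 (.inl rfl))
    have hq := h q ((h' q).2 (.inr rfl))
    refine ⟨1, ?_⟩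
    simp only [bit, h']
    rcases hp with rfl | rfl | rfl | rfl <;> rcases hq with rfl | rfl | rfl | rfl <;>
      simp_all [eq_comm]
  · push Not at hz
    exact ⟨0, by simp [bit, hz]⟩

theorem exists_bit_add_eq₃ (hR : IsCyc R) (h : ∀ y, R x y → y = a ∨ y = b ∨ y = c)
    (hab : a ≠ b) (hac : a ≠ c) (hbc : b ≠ c) :
    ∃ t, bit R x a + bit R x b + bit R x c = 2 * t := by
  by_cases hz : ∃ z, R x z
  · obtain ⟨z, hz⟩ := hz
    obtain ⟨p, q, hpq, h'⟩ := isCyc_two hR hz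
    have hp := h p ((h' p).2 (.inl rfl))
    have hq := h q ((h' q).2 (.inr rfl))
    refine ⟨1, ?_⟩
    simp only [bit, h']
    rcases hp with rfl | rfl | rfl <;> rcases hq with rfl | rfl | rfl <;>
      simp_all [eq_comm]
  · push Not at hz
    exact ⟨0, by simp [bit, hz]⟩

theorem bit_eq_of_two (hR : IsCyc R) (h : ∀ y, R x y → y = a ∨ y = b) :
    bit R x a = bit R x b := by
  rw [bit_congr_iff]
  exact ⟨fun h' => (isCyc_both hR h' h).2, fun h' => (isCyc_both hR h' h).1⟩

end TSP

namespace MaxCutReduction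

open TSP

section Gaps

variable {V : Type*} [Fintype V] [DecidableEq V]
variable {H : SimpleGraph V} [DecidableRel H.Adj] {C : Choices H} {k : ℕ}
variable {R : Vertex C k → Vertex C k → Prop}

/-! ### Doors -/

/-- `R` contains the door before the gadget of `e` on the second-set path of `x`. -/
def DoorIn (R : Vertex C k → Vertex C k → Prop) (x : V) (e : H.edgeSet) : Prop :=
  R (enter C k x e) (prevV C k x e)

/-- `R` contains the door behind the gadget of `e` on the second-set path of `x`. -/
def DoorOut (R : Vertex C k → Vertex C k → Prop) (x : V) (e : H.edgeSet) : Prop :=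
  R (leave C k x e) (nextV C k x e)

theorem enter_src_strict (e : {e : H.edgeSet // C.directed e = true}) :
    enter C k (C.src e) e = .strict e .X := by simp [enter_eq_strict]

theorem leave_src_strict (e : {e : H.edgeSet // C.directed e = true}) :
    leave C k (C.src e) e = .strict e .Xp := by simp [leave_eq_strict]

theorem enter_tgt_strict (e : {e : H.edgeSet // C.directed e = true}) :
    enter C k (C.tgt e) e = .strict e .Y := by simp [enter_eq_strict, (src_ne_tgt C e).symm]

theorem leave_tgt_strict (e : {e : H.edgeSet // C.directed e = true}) :
    leave C k (C.tgt e) e = .strict e .Yp := by simp [leave_eq_strict, (src_ne_tgt C e).symm]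

theorem enter_src_flex (e : {e : H.edgeSet // ¬ C.directed e = true}) :
    enter C k (C.src e) e = .flex e .X := by simp [enter_eq_flex]

theorem leave_src_flex (e : {e : H.edgeSet // ¬ C.directed e = true}) :
    leave C k (C.src e) e = .flex e .Xp := by simp [leave_eq_flex]

theorem enter_tgt_flex (e : {e : H.edgeSet // ¬ C.directed e = true}) :
    enter C k (C.tgt e) e = .flex e .Y := by simp [enter_eq_flex, (src_ne_tgt C e).symm]

theorem leave_tgt_flex (e : {e : H.edgeSet // ¬ C.directed e = true}) :
    leave C k (C.tgt e) e = .flex e .Yp := by simp [leave_eq_flex, (src_ne_tgt C e).symm]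

/-- If the gadgets before the gadget of `e` at `x` are entered if and only if they are left, then
the door before the gadget of `e` is used if and only if the door at `x_ℓ` is. -/
theorem doorIn_iff_firstDoor (hR : IsCyc R) {x : V} {e : H.edgeSet} (hx : x ∈ (e : Sym2 V))
    (h : ∀ f : H.edgeSet, x ∈ (f : Sym2 V) → C.psi f < C.psi e → (DoorIn R x f ↔ DoorOut R x f)) :
    DoorIn R x e ↔ R (.left x) (firstDoor C k x) := by
  -- The induction goes back along the second-set path: the door before `e` is the door behind its
  -- predecessor `f`, which is used if and only if the door before `f` is.
  induction hn : (C.psi e : ℕ) using Nat.strong_induction_on generalizing e with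
  | _ n ih =>
    rcases isFirst_or_exists_follows C hx with he | ⟨f, hf⟩
    · rw [DoorIn, he.prevV_eq, he.firstDoor_eq, isCyc_comm hR]
    · have hlt : C.psi f < C.psi e := hf.2.2.1
      rw [← ih (C.psi f) (by rw [← hn]; exact hlt) hf.1
        (fun g hg hg' => h g hg (hg'.trans hlt)) rfl, h f hf.1 hlt, DoorIn, DoorOut, hf.prevV_eq,
        hf.nextV_eq, isCyc_comm hR]

theorem doorOut_iff_of_isLast {x : V} {e : H.edgeSet} (h : IsLast C x e) :
    DoorOut R x e ↔ R (pathB₀ C k x 0) (pathB₀ C k x 1) := by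
  rw [DoorOut, h.nextV_eq, pathB₀_zero, h.lastDoor_eq, pathB₀_succ]

/-! ### XOR gadgets -/

/-- The vertices of the XOR gadget of `x` behind position `j`. -/
def Ladder (x : V) (j : ℕ) : Vertex C k → Prop
  | .right y => y = x
  | .railA y i => y = x ∧ j ≤ i
  | .railB y i => y = x ∧ j ≤ i
  | .rung y i => y = x ∧ j ≤ i
  | _ => False

theorem ladder_pathA {x : V} {i j : ℕ} (hj : j ≤ xorOrder C k x) (hi : i ≤ xorOrder C k x + 1) :
    Ladder x j (pathA C k x i) ↔ j < i := by
  rcases pathA_cases (C := C) (k := k) x hi with ⟨h, h'⟩ | ⟨l, h, h'⟩ | ⟨h, h'⟩ <;> rw [h'] <;>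
    simp only [Ladder, true_and, false_iff, true_iff] <;> omega

theorem not_ladder_lastDoor (x y : V) (j : ℕ) : ¬ Ladder y j (lastDoor C k x) := by
  rcases lastDoor_cases (C := C) (k := k) x with ⟨e, -, h⟩ | ⟨-, h⟩ <;> rw [h]
  · rcases leave_cases (C := C) (k := k) x e with ⟨f, q, h⟩ | ⟨f, q, h⟩ <;> rw [h] <;> exact id
  · exact id

theorem ladder_pathB₀ {x : V} {i j : ℕ} (hj : j ≤ xorOrder C k x) (hi : i ≤ xorOrder C k x + 1) :
    Ladder x j (pathB₀ C k x i) ↔ j < i := by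
  rcases Nat.eq_zero_or_pos i with rfl | h
  · rw [pathB₀_zero]
    simp [not_ladder_lastDoor]
  · rw [pathB₀, if_neg (by omega)]
    rcases pathB_cases (C := C) (k := k) x h hi with ⟨l, h, h'⟩ | ⟨h, h'⟩ <;> rw [h'] <;>
      simp only [Ladder, true_and, true_iff] <;> omega

theorem not_ladder_of_isMid_gap (x : V) (j : ℕ) (s : V ⊕ H.edgeSet) :
    ¬ Ladder x j (gapRight C k s) := by
  obtain ⟨t, h⟩ := gapRight_cases (C := C) (k := k) s
  rw [h]; exact id

/-- The number of edges that lead into the part of the XOR gadget of `x` behind position `j` is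
even. -/
theorem ladder_parity (hk : 15 ≤ k) (hR : IsCyc R) {x : V} {j : ℕ} (hj : j ≤ xorOrder C k x)
    (hG : ∀ a b, Ladder x j a → R a b → (graph C k).Adj a b) :
    (R (pathA C k x (j + 1)) (pathA C k x j) ↔ R (pathB₀ C k x (j + 1)) (pathB₀ C k x j)) ↔
      ¬ R (.right x) (gapRight C k (.inl x)) := by
  have hnA : ∀ i, pathA C k x i ≠ gapRight C k (.inl x) := fun i =>
    (gapRight_ne fun t => pathA_ne (by simp) (by simp) (by simp)).symm
  have hnB : ∀ i, pathB₀ C k x i ≠ gapRight C k (.inl x) := by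
    intro i
    refine (gapRight_ne fun t => ?_).symm
    unfold pathB₀
    split_ifs
    · exact lastDoor_ne (by simp) (by simp) (by simp)
    · exact pathB_ne (by simp) (by simp)
  -- This part of the XOR gadget can be left only by the rail edges at position `j` and by the gap
  -- edge at `x_r`.
  refine isCyc_parity hR (Ladder x j) ((ladder_pathA hj (by omega)).2 (by omega))
    ((ladder_pathB₀ hj (by omega)).2 (by omega)) rfl
    (fun h => absurd ((ladder_pathA hj (by omega)).1 h) (lt_irrefl _))
    (fun h => absurd ((ladder_pathB₀ hj (by omega)).1 h) (lt_irrefl _))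
    (not_ladder_of_isMid_gap _ _ _) ?_ (fun h => hnA _ h.2) (fun h => hnB _ h.2) ?_
  -- The two rail edges differ: behind positions `j < p` they end at `a_{j+1}` and `b_{j+1}`, and
  -- for `j = p`, where both end at `x_r`, they start at different vertices.
  · rintro ⟨h₁, h₂⟩
    rcases hj.lt_or_eq with h | rfl
    · rw [show pathA C k x (j + 1) = .railA x ⟨j, h⟩ from pathA_succ x ⟨j, h⟩, pathB₀_succ,
        show pathB C k x (j + 1) = .railB x ⟨j, h⟩ from pathB_succ x ⟨j, h⟩] at h₁
      simp at h₁
    · exact pathA_ne_pathB₀ hk x h₂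
  · intro a b ha hb hab
    have hadj := hG a b ha hab
    rcases a with s | y | y | ⟨y, i⟩ | ⟨y, i⟩ | ⟨y, i⟩ | ⟨e, q⟩ | ⟨e, q⟩ <;> try exact ha.elim
    · obtain rfl : y = x := ha
      rcases adj_right.1 hadj with rfl | rfl | rfl
      · simp
      · obtain rfl : j = xorOrder C k y := by
          by_contra hne
          exact hb ((ladder_pathA hj (by omega)).2 (by omega))
        simp [pathA_last]
      · obtain rfl : j = xorOrder C k y := by
          by_contra hne
          exact hb ((ladder_pathB₀ hj (by omega)).2 (by omega))
        simp [pathB₀_succ, pathB_last]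
    · obtain ⟨rfl, hi⟩ := ha
      rcases adj_railA.1 hadj with rfl | rfl | rfl
      · exact absurd ⟨rfl, hi⟩ hb
      · obtain rfl : j = i := by
          by_contra hne
          exact hb ((ladder_pathA hj (by omega)).2 (by omega))
        simp [pathA_succ]
      · exact absurd ((ladder_pathA hj (by omega)).2 (by omega)) hb
    · obtain ⟨rfl, hi⟩ := ha
      rcases adj_railB.1 hadj with rfl | rfl | rfl
      · exact absurd ⟨rfl, hi⟩ hb
      · obtain rfl : j = i := by
          by_contra hne
          exact hb ((ladder_pathB₀ hj (by omega)).2 (by omega))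
        simp [pathB₀_succ, pathB_succ]
      · exact absurd ((ladder_pathB₀ hj (by omega)).2 (by omega)) hb
    · obtain ⟨rfl, hi⟩ := ha
      rcases adj_rung.1 hadj with rfl | rfl <;> exact absurd ⟨rfl, hi⟩ hb

/-! ### The gaps in a cycle of `G` -/

theorem iff_of_iff_iff_not {a b c d : Prop} (h₁ : (a ↔ b) ↔ ¬ c) (h₂ : (b ↔ c) ↔ ¬ d) :
    a ↔ d := by tauto

/-- `x_ℓ` has three neighbors in `G` and an even degree in the cycle. -/
theorem left_parity (hk : 15 ≤ k) (hR : IsCyc R) (x : V)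
    (hG : ∀ b, R (.left x) b → (graph C k).Adj (.left x) b) :
    (R (.left x) (gapLeft C k (.inl x)) ↔ R (.left x) (pathA C k x 1)) ↔
      ¬ R (.left x) (firstDoor C k x) := by
  have h₁ : gapLeft C k (.inl x) ≠ pathA C k x 1 :=
    gapLeft_ne fun t => pathA_ne (by simp) (by simp) (by simp)
  have h₂ : gapLeft C k (.inl x) ≠ firstDoor C k x := by
    refine gapLeft_ne fun t => ?_
    rcases firstDoor_cases (C := C) (k := k) x with ⟨e, -, h⟩ | ⟨-, h⟩ <;> rw [h]
    · exact enter_ne (by simp) (by simp)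
    · exact pathB_ne (by simp) (by simp)
  obtain ⟨t, ht⟩ := exists_bit_add_eq₃ hR (fun y hy => adj_left.1 (hG y hy)) h₁ h₂
    (pathA_one_ne_firstDoor hk x)
  simp only [bit] at ht
  split_ifs at ht <;> simp_all <;> omega

/-- The parity at `x_ℓ` is combined with that of the whole XOR gadget. In between, equal doors at
all gadgets carry the use of the first door along the second-set path to the door before the XOR
gadget. -/
theorem gap_iff_inl (hk : 15 ≤ k) (hR : IsCyc R) (hG : ∀ {a b}, R a b → (graph C k).Adj a b) (x : V)
    (h : ∀ f : H.edgeSet, x ∈ (f : Sym2 V) → (DoorIn R x f ↔ DoorOut R x f)) :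
    R (.left x) (gapLeft C k (.inl x)) ↔ R (.right x) (gapRight C k (.inl x)) := by
  have h₁ := left_parity hk hR x (fun b hb => hG hb)
  have h₂ := ladder_parity hk hR (x := x) (j := 0) (by omega) (fun a b _ hab => hG hab)
  rw [pathA_zero, isCyc_comm hR, zero_add, isCyc_comm hR (a := pathB₀ C k x 1)] at h₂
  have h₃ : R (.left x) (firstDoor C k x) ↔ R (pathB₀ C k x 0) (pathB₀ C k x 1) := by
    by_cases hx : ∃ e : H.edgeSet, x ∈ (e : Sym2 V)
    · obtain ⟨e, he⟩ := hx
      obtain ⟨f, hf⟩ := exists_isLast C he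
      exact (doorIn_iff_firstDoor hR hf.1 (fun g hg _ => h g hg)).symm.trans
        ((h f hf.1).trans (doorOut_iff_of_isLast hf))
    · push Not at hx
      rw [firstDoor_eq_of_isolated C k hx, pathB₀_zero, lastDoor_eq_of_isolated C k hx,
        pathB₀_succ]
  rw [← h₃] at h₂
  exact iff_of_iff_iff_not h₁ h₂

/-- The number of edges that lead from the strict gadget of `e` to other vertices is even. -/
theorem strict_handshake (hR : IsCyc R) (e : {e : H.edgeSet // C.directed e = true})
    (hG : ∀ q y, R (.strict e q) y → (graph C k).Adj (.strict e q) y) :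
    (bit R (.strict e .X) (prevV C k (C.src e) e) + bit R (.strict e .Xp) (nextV C k (C.src e) e) +
      bit R (.strict e .Y) (prevV C k (C.tgt e) e) + bit R (.strict e .Yp) (nextV C k (C.tgt e) e) +
      bit R (.strict e .Z) (gapLeft C k (.inr e)) +
      bit R (.strict e .Zp) (gapRight C k (.inr e))) % 2 = 0 := by
  obtain ⟨t₁, h₁⟩ := exists_bit_add_eq₃ hR (fun y hy => (adj_strict_X (e := e)).1 (hG _ _ hy))
    (prevV_ne_strict le_rfl _) (prevV_ne_strict le_rfl _) (by simp)
  obtain ⟨t₂, h₂⟩ := exists_bit_add_eq₃ hR (fun y hy => (adj_strict_Xp (e := e)).1 (hG _ _ hy))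
    (nextV_ne_strict le_rfl _) (nextV_ne_strict le_rfl _) (by simp)
  obtain ⟨t₃, h₃⟩ := exists_bit_add_eq₃ hR (fun y hy => (adj_strict_Y (e := e)).1 (hG _ _ hy))
    (prevV_ne_strict le_rfl _) (prevV_ne_strict le_rfl _) (by simp)
  obtain ⟨t₄, h₄⟩ := exists_bit_add_eq hR (fun y hy => (adj_strict_Yp (e := e)).1 (hG _ _ hy))
    (nextV_ne_strict le_rfl _) (nextV_ne_strict le_rfl _) (nextV_ne_strict le_rfl _)
    (by simp) (by simp) (by simp)
  obtain ⟨t₅, h₅⟩ := exists_bit_add_eq hR (fun y hy => (adj_strict_Z (e := e)).1 (hG _ _ hy))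
    (gapLeft_ne (by simp)) (gapLeft_ne (by simp)) (gapLeft_ne (by simp))
    (by simp) (by simp) (by simp)
  obtain ⟨t₆, h₆⟩ := exists_bit_add_eq hR (fun y hy => (adj_strict_Zp (e := e)).1 (hG _ _ hy))
    (gapRight_ne (by simp)) (gapRight_ne (by simp)) (gapRight_ne (by simp))
    (by simp) (by simp) (by simp)
  obtain ⟨t₇, h₇⟩ := exists_bit_add_eq hR (fun y hy => (adj_strict_a (e := e)).1 (hG _ _ hy))
    (by simp) (by simp) (by simp) (by simp) (by simp) (by simp)
  obtain ⟨t₈, h₈⟩ := exists_bit_add_eq₃ hR (fun y hy => (adj_strict_ap (e := e)).1 (hG _ _ hy))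
    (by simp) (by simp) (by simp)
  obtain ⟨t₉, h₉⟩ := exists_bit_add_eq₃ hR (fun y hy => (adj_strict_b (e := e)).1 (hG _ _ hy))
    (by simp) (by simp) (by simp)
  obtain ⟨t₀, h₀⟩ := exists_bit_add_eq₃ hR (fun y hy => (adj_strict_bp (e := e)).1 (hG _ _ hy))
    (by simp) (by simp) (by simp)
  have m₁ := bit_eq_of_two hR (fun y hy => (adj_strict_midApX (e := e)).1 (hG _ _ hy))
  have m₂ := bit_eq_of_two hR (fun y hy => (adj_strict_midAXp (e := e)).1 (hG _ _ hy))
  have m₃ := bit_eq_of_two hR (fun y hy => (adj_strict_midBBp (e := e)).1 (hG _ _ hy))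
  have m₄ := bit_eq_of_two hR (fun y hy => (adj_strict_midYYp (e := e)).1 (hG _ _ hy))
  -- The internal edges are given one common orientation, so that each is counted twice in the sum
  -- of all degrees.
  have c := fun q r => bit_comm hR (a := .strict e q) (b := .strict e r)
  rw [c .midApX .ap, c .midApX .X] at m₁
  rw [c .midAXp .a, c .midAXp .Xp] at m₂
  rw [c .midBBp .b, c .midBBp .bp] at m₃
  rw [c .midYYp .Y, c .midYYp .Yp] at m₄
  rw [c .b .X] at h₉
  rw [c .bp .Xp, c .bp .ap] at h₀
  rw [c .a .b] at h₇
  rw [c .Z .ap, c .Z .Yp] at h₅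
  rw [c .Zp .Y, c .Zp .Z, c .Zp .a] at h₆
  rw [c .Yp .a] at h₄
  omega

theorem doors_src_strict (e : {e : H.edgeSet // C.directed e = true}) :
    (DoorIn R (C.src e) e ↔ DoorOut R (C.src e) e) ↔
      bit R (.strict e .X) (prevV C k (C.src e) e) =
        bit R (.strict e .Xp) (nextV C k (C.src e) e) := by
  rw [DoorIn, DoorOut, enter_src_strict, leave_src_strict, bit_congr_iff]

theorem doors_tgt_strict (e : {e : H.edgeSet // C.directed e = true}) :
    (DoorIn R (C.tgt e) e ↔ DoorOut R (C.tgt e) e) ↔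
      bit R (.strict e .Y) (prevV C k (C.tgt e) e) =
        bit R (.strict e .Yp) (nextV C k (C.tgt e) e) := by
  rw [DoorIn, DoorOut, enter_tgt_strict, leave_tgt_strict, bit_congr_iff]

/-- Equal doors on both paths contribute an even number to the handshake, so the two gap edges do as
well. -/
theorem gap_iff_strict (hR : IsCyc R) (hG : ∀ {a b}, R a b → (graph C k).Adj a b)
    (e : {e : H.edgeSet // C.directed e = true})
    (hs : DoorIn R (C.src e) e ↔ DoorOut R (C.src e) e)
    (ht : DoorIn R (C.tgt e) e ↔ DoorOut R (C.tgt e) e) :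
    R (.strict e .Z) (gapLeft C k (.inr e)) ↔ R (.strict e .Zp) (gapRight C k (.inr e)) := by
  rw [doors_src_strict] at hs
  rw [doors_tgt_strict] at ht
  rw [← bit_congr_iff]
  have h := strict_handshake hR e (fun _ _ => hG)
  have l₁ := bit_le_one (R := R) (a := .strict e .Z) (b := gapLeft C k (.inr e))
  have l₂ := bit_le_one (R := R) (a := .strict e .Zp) (b := gapRight C k (.inr e))
  omega

/-- If the strict gadget of `e` is regular and both gaps at it are used, then one of the paths
through it uses exactly one of its two doors there if and only if the other one does. -/
theorem doors_iff_doors_strict (hR : IsCyc R) (e : {e : H.edgeSet // C.directed e = true})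
    (hG : ∀ q y, R (.strict e q) y → (graph C k).Adj (.strict e q) y)
    (hZ : R (.strict e .Z) (gapLeft C k (.inr e)))
    (hZp : R (.strict e .Zp) (gapRight C k (.inr e))) :
    (DoorIn R (C.src e) e ↔ DoorOut R (C.src e) e) ↔
      (DoorIn R (C.tgt e) e ↔ DoorOut R (C.tgt e) e) := by
  rw [doors_src_strict, doors_tgt_strict]
  have h := strict_handshake hR e hG
  rw [bit_congr_iff.2 (iff_of_true hZ hZp)] at h
  have l₁ := bit_le_one (R := R) (a := .strict e .X) (b := prevV C k (C.src e) e)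
  have l₂ := bit_le_one (R := R) (a := .strict e .Xp) (b := nextV C k (C.src e) e)
  have l₃ := bit_le_one (R := R) (a := .strict e .Y) (b := prevV C k (C.tgt e) e)
  have l₄ := bit_le_one (R := R) (a := .strict e .Yp) (b := nextV C k (C.tgt e) e)
  omega

/-- The number of edges that lead from the flexible gadget of `e` to other vertices is even. -/
theorem flex_handshake (hR : IsCyc R) (e : {e : H.edgeSet // ¬ C.directed e = true})
    (hG : ∀ q y, R (.flex e q) y → (graph C k).Adj (.flex e q) y) :
    (bit R (.flex e .X) (prevV C k (C.src e) e) + bit R (.flex e .Xp) (nextV C k (C.src e) e) +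
      bit R (.flex e .Y) (prevV C k (C.tgt e) e) + bit R (.flex e .Yp) (nextV C k (C.tgt e) e) +
      bit R (.flex e .Z) (gapLeft C k (.inr e)) + bit R (.flex e .Zp) (gapRight C k (.inr e))) % 2 =
      0 := by
  obtain ⟨t₁, h₁⟩ := exists_bit_add_eq₃ hR (fun y hy => (adj_flex_X (e := e)).1 (hG _ _ hy))
    (prevV_ne_flex le_rfl _) (prevV_ne_flex le_rfl _) (by simp)
  obtain ⟨t₂, h₂⟩ := exists_bit_add_eq hR (fun y hy => (adj_flex_Xp (e := e)).1 (hG _ _ hy))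
    (nextV_ne_flex le_rfl _) (nextV_ne_flex le_rfl _) (nextV_ne_flex le_rfl _)
    (by simp) (by simp) (by simp)
  obtain ⟨t₃, h₃⟩ := exists_bit_add_eq₃ hR (fun y hy => (adj_flex_Y (e := e)).1 (hG _ _ hy))
    (prevV_ne_flex le_rfl _) (prevV_ne_flex le_rfl _) (by simp)
  obtain ⟨t₄, h₄⟩ := exists_bit_add_eq hR (fun y hy => (adj_flex_Yp (e := e)).1 (hG _ _ hy))
    (nextV_ne_flex le_rfl _) (nextV_ne_flex le_rfl _) (nextV_ne_flex le_rfl _)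
    (by simp) (by simp) (by simp)
  obtain ⟨t₅, h₅⟩ := exists_bit_add_eq hR (fun y hy => (adj_flex_Z (e := e)).1 (hG _ _ hy))
    (gapLeft_ne (by simp)) (gapLeft_ne (by simp)) (gapLeft_ne (by simp))
    (by simp) (by simp) (by simp)
  obtain ⟨t₆, h₆⟩ := exists_bit_add_eq hR (fun y hy => (adj_flex_Zp (e := e)).1 (hG _ _ hy))
    (gapRight_ne (by simp)) (gapRight_ne (by simp)) (gapRight_ne (by simp))
    (by simp) (by simp) (by simp)
  have m₁ := bit_eq_of_two hR (fun y hy => (adj_flex_R (e := e)).1 (hG _ _ hy))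
  have m₂ := bit_eq_of_two hR (fun y hy => (adj_flex_S (e := e)).1 (hG _ _ hy))
  have c := fun q r => bit_comm hR (a := .flex e q) (b := .flex e r)
  rw [c .R .X, c .R .Xp] at m₁
  rw [c .S .Y, c .S .Yp] at m₂
  rw [c .Z .X, c .Z .Yp] at h₅
  rw [c .Zp .Y, c .Zp .Z, c .Zp .Xp] at h₆
  rw [c .Yp .Xp] at h₄
  omega

theorem doors_src_flex (e : {e : H.edgeSet // ¬ C.directed e = true}) :
    (DoorIn R (C.src e) e ↔ DoorOut R (C.src e) e) ↔
      bit R (.flex e .X) (prevV C k (C.src e) e) = bit R (.flex e .Xp) (nextV C k (C.src e) e) := by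
  rw [DoorIn, DoorOut, enter_src_flex, leave_src_flex, bit_congr_iff]

theorem doors_tgt_flex (e : {e : H.edgeSet // ¬ C.directed e = true}) :
    (DoorIn R (C.tgt e) e ↔ DoorOut R (C.tgt e) e) ↔
      bit R (.flex e .Y) (prevV C k (C.tgt e) e) = bit R (.flex e .Yp) (nextV C k (C.tgt e) e) := by
  rw [DoorIn, DoorOut, enter_tgt_flex, leave_tgt_flex, bit_congr_iff]

theorem gap_iff_flex (hR : IsCyc R) (hG : ∀ {a b}, R a b → (graph C k).Adj a b)
    (e : {e : H.edgeSet // ¬ C.directed e = true})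
    (hs : DoorIn R (C.src e) e ↔ DoorOut R (C.src e) e)
    (ht : DoorIn R (C.tgt e) e ↔ DoorOut R (C.tgt e) e) :
    R (.flex e .Z) (gapLeft C k (.inr e)) ↔ R (.flex e .Zp) (gapRight C k (.inr e)) := by
  rw [doors_src_flex] at hs
  rw [doors_tgt_flex] at ht
  rw [← bit_congr_iff]
  have h := flex_handshake hR e (fun _ _ => hG)
  have l₁ := bit_le_one (R := R) (a := .flex e .Z) (b := gapLeft C k (.inr e))
  have l₂ := bit_le_one (R := R) (a := .flex e .Zp) (b := gapRight C k (.inr e))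
  omega

/-- If the flexible gadget of `e` is regular and both gaps at it are used, then one of the paths
through it uses exactly one of its two doors there if and only if the other one does. -/
theorem doors_iff_doors_flex (hR : IsCyc R) (e : {e : H.edgeSet // ¬ C.directed e = true})
    (hG : ∀ q y, R (.flex e q) y → (graph C k).Adj (.flex e q) y)
    (hZ : R (.flex e .Z) (gapLeft C k (.inr e))) (hZp : R (.flex e .Zp) (gapRight C k (.inr e))) :
    (DoorIn R (C.src e) e ↔ DoorOut R (C.src e) e) ↔
      (DoorIn R (C.tgt e) e ↔ DoorOut R (C.tgt e) e) := by
  rw [doors_src_flex, doors_tgt_flex]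
  have h := flex_handshake hR e hG
  rw [bit_congr_iff.2 (iff_of_true hZ hZp)] at h
  have l₁ := bit_le_one (R := R) (a := .flex e .X) (b := prevV C k (C.src e) e)
  have l₂ := bit_le_one (R := R) (a := .flex e .Xp) (b := nextV C k (C.src e) e)
  have l₃ := bit_le_one (R := R) (a := .flex e .Y) (b := prevV C k (C.tgt e) e)
  have l₄ := bit_le_one (R := R) (a := .flex e .Yp) (b := nextV C k (C.tgt e) e)
  omega

/-- If every gadget is entered if and only if it is left, on both paths through it, then a cycle
of `G` that contains a gap contains all of them. -/
theorem all_gaps (hk : 15 ≤ k) (hE : Nonempty H.edgeSet) (hR : IsCyc R)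
    (hG : ∀ {a b}, R a b → (graph C k).Adj a b)
    (h : ∀ (x : V) (f : H.edgeSet), x ∈ (f : Sym2 V) → (DoorIn R x f ↔ DoorOut R x f))
    {s : V ⊕ H.edgeSet} {z : Vertex C k} (hs : R (.gap s) z) (t : V ⊕ H.edgeSet) :
    ∃ z, R (.gap t) z := by
  -- A gap has degree two, so a cycle of `G` uses both or none of its edges.
  have hgap : ∀ {s : V ⊕ H.edgeSet} {y : Vertex C k}, (graph C k).Adj y (.gap s) →
      (R y (.gap s) ↔ ∃ z, R (.gap s) z) := by
    intro s y hy
    refine ⟨fun h => ⟨y, isCyc_symm hR h⟩, fun ⟨z, hz⟩ => isCyc_symm hR ?_⟩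
    obtain ⟨a, b, -, -, -, hadj⟩ := exists_nbrs_of_isMid (C := C) (k := k) hE
      (show IsMid (.gap s : Vertex C k) from trivial)
    have := isCyc_both hR hz (fun y hy => (hadj y).1 (hG hy))
    rcases (hadj y).1 hy.symm with rfl | rfl
    exacts [this.1, this.2]
  -- The gaps on the two sides of the slot of `t` are those of `t` and of its predecessor; `flip`
  -- only decides which one is at the left vertex.
  have hslot : ∀ {t : V ⊕ H.edgeSet} {a b : Vertex C k}, (graph C k).Adj a (gapLeft C k t) →
      (graph C k).Adj b (gapRight C k t) →
      (R a (gapLeft C k t) ↔ R b (gapRight C k t)) →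
      ((∃ z, R (.gap t) z) ↔ ∃ z, R (.gap (C.next.symm t)) z) := by
    intro t a b ha hb hab
    by_cases hf : C.flip t = true
    · simp only [gapLeft, gapRight, hf, if_true] at ha hb hab
      rw [← hgap ha, ← hgap hb, hab]
    · simp only [gapLeft, gapRight, hf, if_false, Bool.false_eq_true] at ha hb hab
      rw [← hgap ha, ← hgap hb, hab]
  have hstep : ∀ t : V ⊕ H.edgeSet,
      (∃ z, R (.gap t) z) ↔ ∃ z, R (.gap (C.next.symm t)) z := by
    rintro (x | f)
    · exact hslot (link_gapLeft x) (link_gapRight x) (gap_iff_inl hk hR hG x (h x))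
    · by_cases hf : C.directed f = true
      · exact hslot (adj_strict_Z.2 (.inl rfl)) (adj_strict_Zp.2 (.inl rfl))
          (gap_iff_strict hR hG ⟨f, hf⟩ (h _ _ (src_mem C f)) (h _ _ (tgt_mem C f)))
      · exact hslot (adj_flex_Z.2 (.inl rfl)) (adj_flex_Zp.2 (.inl rfl))
          (gap_iff_flex hR hG ⟨f, hf⟩ (h _ _ (src_mem C f)) (h _ _ (tgt_mem C f)))
  obtain ⟨n, -, rfl⟩ := C.next_cycle.exists_pow_eq' Set.finite_univ (Set.mem_univ s)
    (Set.mem_univ t)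
  induction n with
  | zero => exact ⟨z, hs⟩
  | succ n ih =>
    rw [hstep, pow_succ', Equiv.Perm.mul_apply, Equiv.symm_apply_apply]
    exact ih

end Gaps

end MaxCutReduction

/-! ### Leaves of stars, membership in the trap, and gadgets of low vertices. -/

namespace MaxCutReduction

open TSP

section Parity

variable {V : Type*} [Fintype V] [DecidableEq V]
variable {H : SimpleGraph V} [DecidableRel H.Adj] {C : Choices H} {k : ℕ}

/-! ### Leaves of the stars -/

/-- Every undirected edge has an endpoint at which it is the only undirected edge. -/
theorem exists_leaf {e : H.edgeSet} (he : ¬ C.directed e = true) :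
    ∃ x, x ∈ (e : Sym2 V) ∧ ∀ f : H.edgeSet, ¬ C.directed f = true → x ∈ (f : Sym2 V) → f = e := by
  set F := SimpleGraph.fromEdgeSet
    {z : Sym2 V | ∃ h : z ∈ H.edgeSet, C.directed ⟨z, h⟩ = false} with hF
  have hadj : ∀ {f : H.edgeSet} {x y : V}, ¬ C.directed f = true → (f : Sym2 V) = s(x, y) →
      F.Adj x y := by
    intro f x y hf hxy
    have h := f.2
    rw [hF, SimpleGraph.fromEdgeSet_adj, ← hxy]
    refine ⟨⟨h, by simpa using hf⟩, ?_⟩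
    rw [hxy, SimpleGraph.mem_edgeSet] at h
    exact h.ne
  have key : ∀ x y : V, (e : Sym2 V) = s(x, y) →
      (∀ f : H.edgeSet, ¬ C.directed f = true → x ∈ (f : Sym2 V) → f = e) ∨
      ∃ r : (F.connectedComponentMk x).supp, r.1 = x ∧
        F.induce (F.connectedComponentMk x).supp = SimpleGraph.starGraph r := by
    intro x y hxy
    obtain ⟨r, hr⟩ := C.stars (F.connectedComponentMk x)
    by_cases hrx : r.1 = x
    · exact .inr ⟨r, hrx, hr⟩
    · left
      -- A vertex of a star other than its center is adjacent to the center only.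
      have hcen : ∀ z, F.Adj x z → z = r := by
        intro z hz
        have hz' : z ∈ (F.connectedComponentMk x).supp :=
          (SimpleGraph.ConnectedComponent.connectedComponentMk_eq_of_adj hz).symm
        have : (F.induce (F.connectedComponentMk x).supp).Adj ⟨x, rfl⟩ ⟨z, hz'⟩ := hz
        rw [hr, SimpleGraph.starGraph_adj] at this
        rcases this.2 with h | h
        · exact absurd (congrArg Subtype.val h).symm hrx
        · exact congrArg Subtype.val h
      intro f hf hxf
      obtain ⟨z, hz⟩ := hxf
      apply Subtype.ext
      rw [hz, hxy, hcen z (hadj hf hz), hcen y (hadj he hxy)]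
  have hst : (e : Sym2 V) = s(C.src e, C.tgt e) := (C.endpoints e).symm
  rcases key _ _ hst with h | ⟨r, hr, hr'⟩
  · exact ⟨_, src_mem C e, h⟩
  · rcases key _ _ (hst.trans Sym2.eq_swap) with h | -
    · exact ⟨_, tgt_mem C e, h⟩
    -- Here the source is a center of the star, so every undirected edge at the target leads back to
    -- the source.
    · refine ⟨_, tgt_mem C e, fun f hf hxf => ?_⟩
      obtain ⟨z, hz⟩ := hxf
      have hz₁ := hadj hf hz
      have hz₂ := hadj he hst
      have m₁ : C.tgt e ∈ (F.connectedComponentMk (C.src e)).supp :=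
        (SimpleGraph.ConnectedComponent.connectedComponentMk_eq_of_adj hz₂).symm
      have m₂ : z ∈ (F.connectedComponentMk (C.src e)).supp :=
        ((SimpleGraph.ConnectedComponent.connectedComponentMk_eq_of_adj hz₁).symm).trans m₁
      have : (F.induce (F.connectedComponentMk (C.src e)).supp).Adj ⟨_, m₁⟩ ⟨z, m₂⟩ := hz₁
      rw [hr', SimpleGraph.starGraph_adj] at this
      apply Subtype.ext
      rw [hz, hst]
      rcases this.2 with h | h
      · exact absurd ((congrArg Subtype.val h).trans hr).symm (src_ne_tgt C e)
      · rw [show z = C.src e from (congrArg Subtype.val h).trans hr, Sym2.eq_swap]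

/-- At a leaf of its star, an undirected edge comes after all other edges, which are directed. So
one of the two paths through a flexible gadget visits it last, behind strict gadgets only. -/
theorem exists_isLast_of_not_directed {e : H.edgeSet} (he : ¬ C.directed e = true) :
    ∃ x, IsLast C x e ∧ ∀ f : H.edgeSet, x ∈ (f : Sym2 V) → C.psi f < C.psi e →
      C.directed f = true := by
  obtain ⟨x, hx, h⟩ := exists_leaf he
  refine ⟨x, ⟨hx, fun g hg => ?_⟩, fun f hf hlt => ?_⟩
  · by_cases hd : C.directed g = true
    · exact (C.psi_directed g e hd (by simpa using he)).le
    · rw [h g hd hg]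
  · by_contra hd
    rw [h f hd hf] at hlt
    exact lt_irrefl _ hlt

/-! ### Membership in gadgets -/

/-- The vertex belongs to the parity gadget of `f`. -/
def InGadget (f : H.edgeSet) : Vertex C k → Prop
  | .strict e _ => e.1 = f
  | .flex e _ => e.1 = f
  | _ => False

theorem inGadget_strict {e : {e : H.edgeSet // C.directed e = true}} {q : StrictVertex} :
    InGadget e.1 (.strict e q : Vertex C k) := rfl

theorem inGadget_flex {e : {e : H.edgeSet // ¬ C.directed e = true}} {q : FlexVertex} :
    InGadget e.1 (.flex e q : Vertex C k) := rfl

theorem InGadget.unique {e f : H.edgeSet} {x : Vertex C k} (he : InGadget e x)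
    (hf : InGadget f x) : e = f := by
  cases x <;> first | exact he.elim | exact (Eq.symm he).trans hf

theorem inGadget_enter (x : V) (f : H.edgeSet) : InGadget f (enter C k x f) := by
  unfold enter port
  split_ifs <;> rfl

theorem not_isMid_enter (x : V) (f : H.edgeSet) : ¬ IsMid (enter C k x f) := by
  unfold enter port
  split_ifs <;> exact id

theorem not_inGadget_pathB (x : V) (i : ℕ) (f : H.edgeSet) : ¬ InGadget f (pathB C k x i) := by
  unfold pathB
  split_ifs <;> exact id

theorem not_isMid_pathB (x : V) (i : ℕ) : ¬ IsMid (pathB C k x i) := by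
  unfold pathB
  split_ifs <;> exact id

theorem not_isMid_nextV (x : V) (f : H.edgeSet) : ¬ IsMid (nextV C k x f) := by
  rcases nextV_cases (C := C) (k := k) x f with ⟨g, -, h⟩ | h <;> rw [h]
  · exact not_isMid_enter x g
  · exact not_isMid_pathB x 1

theorem not_isMid_prevV (x : V) (f : H.edgeSet) : ¬ IsMid (prevV C k x f) := by
  rcases prevV_cases (C := C) (k := k) x f with ⟨g, -, h⟩ | h <;> rw [h]
  · unfold leave port
    split_ifs <;> exact id
  · exact id

theorem exists_isMid_adj {v : Vertex C k} (hv : ¬ IsMid v) :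
    ∃ m, IsMid m ∧ (graph C k).Adj v m := by
  rcases v with s | x | x | ⟨x, i⟩ | ⟨x, i⟩ | ⟨x, i⟩ | ⟨e, q⟩ | ⟨e, q⟩
  · exact absurd trivial hv
  · exact ⟨_, isMid_gapLeft _, link_gapLeft x⟩
  · exact ⟨_, isMid_gapRight _, link_gapRight x⟩
  · exact ⟨.rung x i, trivial, adj_railA.2 (.inl rfl)⟩
  · exact ⟨.rung x i, trivial, adj_railB.2 (.inl rfl)⟩
  · exact absurd trivial hv
  · cases q <;> try exact absurd trivial hv
    · exact ⟨.strict e .midApX, trivial, adj_strict_X.2 (by simp)⟩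
    · exact ⟨.strict e .midAXp, trivial, adj_strict_Xp.2 (by simp)⟩
    · exact ⟨.strict e .midYYp, trivial, adj_strict_Y.2 (by simp)⟩
    · exact ⟨.strict e .midYYp, trivial, adj_strict_Yp.2 (by simp)⟩
    · exact ⟨_, isMid_gapLeft _, adj_strict_Z.2 (.inl rfl)⟩
    · exact ⟨_, isMid_gapRight _, adj_strict_Zp.2 (.inl rfl)⟩
    · exact ⟨.strict e .midAXp, trivial, adj_strict_a.2 (by simp)⟩
    · exact ⟨.strict e .midApX, trivial, adj_strict_ap.2 (by simp)⟩
    · exact ⟨.strict e .midBBp, trivial, adj_strict_b.2 (by simp)⟩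
    · exact ⟨.strict e .midBBp, trivial, adj_strict_bp.2 (by simp)⟩
  · cases q <;> try exact absurd trivial hv
    · exact ⟨.flex e .R, trivial, adj_flex_X.2 (by simp)⟩
    · exact ⟨.flex e .R, trivial, adj_flex_Xp.2 (by simp)⟩
    · exact ⟨.flex e .S, trivial, adj_flex_Y.2 (by simp)⟩
    · exact ⟨.flex e .S, trivial, adj_flex_Yp.2 (by simp)⟩
    · exact ⟨_, isMid_gapLeft _, adj_flex_Z.2 (.inl rfl)⟩
    · exact ⟨_, isMid_gapRight _, adj_flex_Zp.2 (.inl rfl)⟩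

/-! ### The tour and the trap at a vertex -/

variable {T : Vertex C k → Vertex C k → Prop} {high : Vertex C k → Prop}
  {v v' m u p x y z : Vertex C k} {K : Vertex C k → Vertex C k → Prop}

/-- The vertex `x` is neither `v` nor high. -/
def Low (high : Vertex C k → Prop) (v x : Vertex C k) : Prop := ¬ high x ∧ x ≠ v

/-- The vertex `x` belongs to the cycle `K`. -/
def Mem (K : Vertex C k → Vertex C k → Prop) (x : Vertex C k) : Prop := ∃ z, K x z

theorem Ctx.low_of_place (S : Ctx T high v v') (h : place C k v < place C k x) : Low high v x :=
  ⟨S.low_of_lt h, by rintro rfl; exact lt_irrefl _ h⟩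

theorem Ctx.regular (S : Ctx T high v v') (hx : high x) : Regular T x :=
  ⟨fun h => S.sat hx h, fun hm h => S.tour_of_isMid hm h⟩

theorem Ctx.regular_trap (S : Ctx T high v v') (B : Trap (graph C k) T high v m u p K)
    (hx : Mem K x) : Regular K x :=
  ⟨fun h => B.le h, fun hm h => S.trap_mid B hx.choose_spec hm h⟩

/-- The edges of `G` at `v` in the tour lead to vertices of degree two. -/
theorem Ctx.not_tour_v (S : Ctx T high v v') (h : (graph C k).Adj v y) (hy : ¬ IsMid y) :
    ¬ T v y := by
  obtain ⟨m, hm, hvm⟩ := exists_isMid_adj S.not_isMid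
  exact S.not_tour (S.tour_of_isMid hm hvm) (S.high_of_isMid hm) h (by rintro rfl; exact hy hm)

/-- Both `v` and `u` have exactly one neighbor of degree two, and it is a high tour neighbor. If `u`
has no other high tour neighbor, the hypotheses of `Ctx.exists_trap` hold. The case distinctions
below use traps in this form. -/
theorem Ctx.exists_trap_of_not_isMid (S : Ctx T high v v') (hvu : (graph C k).Adj v u)
    (hu : ¬ IsMid u) (h : ∀ y, T u y → high y → IsMid y) :
    ∃ m p K, IsMid m ∧ Trap (graph C k) T high v m u p K := by
  obtain ⟨m, hm, hvm⟩ := exists_isMid_adj S.not_isMid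
  obtain ⟨m', hm', hum⟩ := exists_isMid_adj hu
  obtain ⟨p, K, B⟩ := S.exists_trap hm hvm hvu (by rintro rfl; exact hu hm)
    (m' := m') (fun y hy hh => isMid_unique hu (h y hy hh) hm' (S.sat hh (S.symm hy)).symm hum)
  exact ⟨m, p, K, hm, B⟩

theorem _root_.TSP.Trap.eq_or_isMid (B : Trap (graph C k) T high v m u p K)
    (hm : IsMid m) (hu : ¬ IsMid u) (h : K v y) : y = u ∨ IsMid y := by
  rcases B.nbr_eq (by rintro rfl; exact hu hm) h with h | rfl
  exacts [.inl h, .inr hm]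

/-- The trap is an arc of the tour with ends `u` and `v`, closed by `vu`; at inner vertices of the
arc, trap and tour have the same edges. -/
theorem _root_.TSP.Trap.iff (B : Trap (graph C k) T high v m u p K) (hx : Mem K x) (hxu : x ≠ u)
    (hxv : x ≠ v) : K x y ↔ T x y :=
  ⟨fun h => B.tour h hxu hxv, fun h => B.of_ne hx.choose_spec h hxu hxv⟩

theorem _root_.TSP.Trap.not_low_low (B : Trap (graph C k) T high v m u p K) (hx : Low high v x)
    (hy : Low high v y) : ¬ K x y := by
  intro h
  rcases B.not_low h with h | h | h | h
  exacts [hx.1 h, hy.1 h, hx.2 h, hy.2 h]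

theorem _root_.TSP.Trap.mem_right (B : Trap (graph C k) T high v m u p K) (h : K x y) : Mem K y :=
  ⟨x, B.symm h⟩

/-- Both neighbors of a vertex of degree two belong to the trap if one of them does. -/
theorem Ctx.mem_of_mid (S : Ctx T high v v') (B : Trap (graph C k) T high v m u p K)
    {n : Vertex C k} (hn : IsMid n) (h : (graph C k).Adj n x) (h' : (graph C k).Adj n y)
    (hx : Mem K x) : Mem K y :=
  ⟨n, S.trap_pass B hx.choose_spec hn h.symm h'⟩

theorem Ctx.mem_iff_of_mid (S : Ctx T high v v') (B : Trap (graph C k) T high v m u p K)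
    {n : Vertex C k} (hn : IsMid n) (h : (graph C k).Adj n x) (h' : (graph C k).Adj n y) :
    Mem K x ↔ Mem K y :=
  ⟨S.mem_of_mid B hn h h', S.mem_of_mid B hn h' h⟩

theorem Ctx.mem_strict_X (S : Ctx T high v v') (B : Trap (graph C k) T high v m u p K)
    (e : {e : H.edgeSet // C.directed e = true}) :
    Mem K (.strict e .X) ↔ Mem K (.strict e .ap) :=
  S.mem_iff_of_mid B (n := .strict e .midApX) trivial (adj_strict_midApX.2 (by simp))
    (adj_strict_midApX.2 (by simp))

theorem Ctx.mem_strict_Xp (S : Ctx T high v v') (B : Trap (graph C k) T high v m u p K)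
    (e : {e : H.edgeSet // C.directed e = true}) :
    Mem K (.strict e .Xp) ↔ Mem K (.strict e .a) :=
  S.mem_iff_of_mid B (n := .strict e .midAXp) trivial (adj_strict_midAXp.2 (by simp))
    (adj_strict_midAXp.2 (by simp))

theorem Ctx.mem_strict_b (S : Ctx T high v v') (B : Trap (graph C k) T high v m u p K)
    (e : {e : H.edgeSet // C.directed e = true}) :
    Mem K (.strict e .b) ↔ Mem K (.strict e .bp) :=
  S.mem_iff_of_mid B (n := .strict e .midBBp) trivial (adj_strict_midBBp.2 (by simp))
    (adj_strict_midBBp.2 (by simp))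

theorem Ctx.mem_strict_Y (S : Ctx T high v v') (B : Trap (graph C k) T high v m u p K)
    (e : {e : H.edgeSet // C.directed e = true}) :
    Mem K (.strict e .Y) ↔ Mem K (.strict e .Yp) :=
  S.mem_iff_of_mid B (n := .strict e .midYYp) trivial (adj_strict_midYYp.2 (by simp))
    (adj_strict_midYYp.2 (by simp))

theorem Ctx.mem_flex_X (S : Ctx T high v v') (B : Trap (graph C k) T high v m u p K)
    (e : {e : H.edgeSet // ¬ C.directed e = true}) :
    Mem K (.flex e .X) ↔ Mem K (.flex e .Xp) :=
  S.mem_iff_of_mid B (n := .flex e .R) trivial (adj_flex_R.2 (by simp)) (adj_flex_R.2 (by simp))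

theorem Ctx.mem_flex_Y (S : Ctx T high v v') (B : Trap (graph C k) T high v m u p K)
    (e : {e : H.edgeSet // ¬ C.directed e = true}) :
    Mem K (.flex e .Y) ↔ Mem K (.flex e .Yp) :=
  S.mem_iff_of_mid B (n := .flex e .S) trivial (adj_flex_S.2 (by simp)) (adj_flex_S.2 (by simp))

/-! ### Doors in terms of the vertices of the gadgets -/

variable {R : Vertex C k → Vertex C k → Prop}

theorem doorIn_src_strict (e : {e : H.edgeSet // C.directed e = true}) :
    DoorIn R (C.src e) e ↔ R (.strict e .X) (prevV C k (C.src e) e) := by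
  rw [DoorIn, enter_src_strict]

theorem doorOut_src_strict (e : {e : H.edgeSet // C.directed e = true}) :
    DoorOut R (C.src e) e ↔ R (.strict e .Xp) (nextV C k (C.src e) e) := by
  rw [DoorOut, leave_src_strict]

theorem doorIn_tgt_strict (e : {e : H.edgeSet // C.directed e = true}) :
    DoorIn R (C.tgt e) e ↔ R (.strict e .Y) (prevV C k (C.tgt e) e) := by
  rw [DoorIn, enter_tgt_strict]

theorem doorOut_tgt_strict (e : {e : H.edgeSet // C.directed e = true}) :
    DoorOut R (C.tgt e) e ↔ R (.strict e .Yp) (nextV C k (C.tgt e) e) := by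
  rw [DoorOut, leave_tgt_strict]

theorem doorIn_src_flex (e : {e : H.edgeSet // ¬ C.directed e = true}) :
    DoorIn R (C.src e) e ↔ R (.flex e .X) (prevV C k (C.src e) e) := by
  rw [DoorIn, enter_src_flex]

theorem doorOut_src_flex (e : {e : H.edgeSet // ¬ C.directed e = true}) :
    DoorOut R (C.src e) e ↔ R (.flex e .Xp) (nextV C k (C.src e) e) := by
  rw [DoorOut, leave_src_flex]

theorem doorIn_tgt_flex (e : {e : H.edgeSet // ¬ C.directed e = true}) :
    DoorIn R (C.tgt e) e ↔ R (.flex e .Y) (prevV C k (C.tgt e) e) := by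
  rw [DoorIn, enter_tgt_flex]

theorem doorOut_tgt_flex (e : {e : H.edgeSet // ¬ C.directed e = true}) :
    DoorOut R (C.tgt e) e ↔ R (.flex e .Yp) (nextV C k (C.tgt e) e) := by
  rw [DoorOut, leave_tgt_flex]

/-! ### Gadgets of low vertices -/

/-- The trap cannot use edges between low vertices, so inside this gadget it moves only along paths
of length two. From `X` or `X'` of a strict gadget such a path ends at `a'` or `a`, a dead end. All
other entrances are joined to their exits by such a path, and the trap passes straight through. -/
theorem Ctx.doors_of_low (S : Ctx T high v v') (B : Trap (graph C k) T high v m u p K)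
    {f : H.edgeSet} (hf : ∀ x, InGadget f x → ¬ IsMid x → Low high v x) {x : V}
    (hx : x ∈ (f : Sym2 V)) : DoorIn K x f ↔ DoorOut K x f := by
  by_cases hd : C.directed f = true
  · obtain ⟨e, rfl⟩ : ∃ e : {e : H.edgeSet // C.directed e = true}, e.1 = f := ⟨⟨f, hd⟩, rfl⟩
    have hl : ∀ q, ¬ q.IsMid → Low high v (.strict e q) := fun q hq => hf _ rfl hq
    have hn : ∀ q r, ¬ q.IsMid → ¬ r.IsMid → ¬ K (.strict e q) (.strict e r) :=
      fun q r hq hr => B.not_low_low (hl q hq) (hl r hr)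
    rcases (mem_iff_src_or_tgt C).1 hx with rfl | rfl
    · rw [doorIn_src_strict, doorOut_src_strict]
      refine iff_of_false (fun h => ?_) (fun h => ?_)
      · have := one_strict_ap B.cyc (S.regular_trap B ((S.mem_strict_X B e).1 ⟨_, h⟩))
        have h₁ := hn .ap .bp id id
        have h₂ := hn .ap .Z id id
        tauto
      · have := one_strict_a B.cyc (S.regular_trap B ((S.mem_strict_Xp B e).1 ⟨_, h⟩))
        have h₁ := hn .a .b id id
        have h₂ := hn .a .Yp id id
        have h₃ := hn .a .Zp id id
        tauto
    · rw [doorIn_tgt_strict, doorOut_tgt_strict]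
      constructor <;> intro h
      · have := one_strict_Yp B.cyc (S.regular_trap B ((S.mem_strict_Y B e).1 ⟨_, h⟩))
        have h₁ := hn .Yp .a id id
        have h₂ := hn .Yp .Z id id
        tauto
      · have := one_strict_Y B.cyc (S.regular_trap B ((S.mem_strict_Y B e).2 ⟨_, h⟩))
        have h₁ := hn .Y .Zp id id
        tauto
  · obtain ⟨e, rfl⟩ : ∃ e : {e : H.edgeSet // ¬ C.directed e = true}, e.1 = f := ⟨⟨f, hd⟩, rfl⟩
    have hl : ∀ q, ¬ q.IsMid → Low high v (.flex e q) := fun q hq => hf _ rfl hq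
    have hn : ∀ q r, ¬ q.IsMid → ¬ r.IsMid → ¬ K (.flex e q) (.flex e r) :=
      fun q r hq hr => B.not_low_low (hl q hq) (hl r hr)
    rcases (mem_iff_src_or_tgt C).1 hx with rfl | rfl
    · rw [doorIn_src_flex, doorOut_src_flex]
      constructor <;> intro h
      · have := one_flex_Xp B.cyc (S.regular_trap B ((S.mem_flex_X B e).1 ⟨_, h⟩))
        have h₁ := hn .Xp .Yp id id
        have h₂ := hn .Xp .Zp id id
        tauto
      · have := one_flex_X B.cyc (S.regular_trap B ((S.mem_flex_X B e).2 ⟨_, h⟩))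
        have h₁ := hn .X .Z id id
        tauto
    · rw [doorIn_tgt_flex, doorOut_tgt_flex]
      constructor <;> intro h
      · have := one_flex_Yp B.cyc (S.regular_trap B ((S.mem_flex_Y B e).1 ⟨_, h⟩))
        have h₁ := hn .Yp .Xp id id
        have h₂ := hn .Yp .Z id id
        tauto
      · have := one_flex_Y B.cyc (S.regular_trap B ((S.mem_flex_Y B e).2 ⟨_, h⟩))
        have h₁ := hn .Y .Zp id id
        tauto

/-- Besides the gap, all neighbors of `Z` are low, so the trap has no second edge there. -/
theorem Ctx.not_mem_Z_of_low (S : Ctx T high v v') (B : Trap (graph C k) T high v m u p K)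
    {f : H.edgeSet} (hf : ∀ x, InGadget f x → ¬ IsMid x → Low high v x) :
    ¬ Mem K (port C k .Z .Z f) := by
  intro h
  by_cases hd : C.directed f = true
  · obtain ⟨e, rfl⟩ : ∃ e : {e : H.edgeSet // C.directed e = true}, e.1 = f := ⟨⟨f, hd⟩, rfl⟩
    have hl : ∀ q, ¬ q.IsMid → Low high v (.strict e q) := fun q hq => hf _ rfl hq
    rw [port_strict] at h
    have := one_strict_Z B.cyc (S.regular_trap B h)
    have h₁ := B.not_low_low (hl .Z id) (hl .ap id)
    have h₂ := B.not_low_low (hl .Z id) (hl .Zp id)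
    have h₃ := B.not_low_low (hl .Z id) (hl .Yp id)
    tauto
  · obtain ⟨e, rfl⟩ : ∃ e : {e : H.edgeSet // ¬ C.directed e = true}, e.1 = f := ⟨⟨f, hd⟩, rfl⟩
    have hl : ∀ q, ¬ q.IsMid → Low high v (.flex e q) := fun q hq => hf _ rfl hq
    rw [port_flex] at h
    have := one_flex_Z B.cyc (S.regular_trap B h)
    have h₁ := B.not_low_low (hl .Z id) (hl .X id)
    have h₂ := B.not_low_low (hl .Z id) (hl .Zp id)
    have h₃ := B.not_low_low (hl .Z id) (hl .Yp id)
    tauto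

/-- If every gadget is entered by the trap if and only if it is left, and `Z` of some gadget does
not belong to the trap, then the trap contains no gap. -/
theorem Ctx.not_mem_gap (S : Ctx T high v v') (B : Trap (graph C k) T high v m u p K)
    (h : ∀ (x : V) (f : H.edgeSet), x ∈ (f : Sym2 V) → (DoorIn K x f ↔ DoorOut K x f))
    {f : H.edgeSet} (hf : ¬ Mem K (port C k .Z .Z f)) (s : V ⊕ H.edgeSet) :
    ¬ Mem K (.gap s) := by
  rintro ⟨z, hz⟩
  have hall := all_gaps S.hk S.hE B.cyc B.le h hz
  apply hf
  obtain ⟨t, ht⟩ := gapLeft_cases (C := C) (k := k) (.inr f)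
  obtain ⟨z, hz⟩ := hall t
  have hadj : (graph C k).Adj (.gap t) (port C k .Z .Z f) := by
    rw [← ht]
    by_cases hd : C.directed f = true
    · rw [port_strict ⟨f, hd⟩]
      exact ((adj_strict_Z (e := ⟨f, hd⟩)).2 (.inl rfl)).symm
    · rw [port_flex ⟨f, hd⟩]
      exact ((adj_flex_Z (e := ⟨f, hd⟩)).2 (.inl rfl)).symm
  exact ⟨_, B.symm (S.trap_of_mid B (n := .gap t) trivial hz hadj)⟩

end Parity

end MaxCutReduction

namespace TSP

variable {U : Type*} {R : U → U → Prop}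

/-- A set in which every vertex has two of its neighbors in a cycle contains the cycle, if it
meets it. -/
theorem isCyc_mem_of_closed (hR : IsCyc R) (P : U → Prop)
    (h : ∀ x, P x → ∃ a b, a ≠ b ∧ P a ∧ P b ∧ R x a ∧ R x b) {x y z : U} (hx : P x)
    (hyz : R y z) : P y := by
  by_contra hy
  obtain ⟨a, -, -, -, -, ha, -⟩ := h x hx
  -- A cycle edge that leaves the set would be a third edge at its end inside.
  obtain ⟨p, q, hpq, hp, hq⟩ := isCyc_cut hR P ha hyz hx hy
  obtain ⟨c, d, hcd, hc, hd, hpc, hpd⟩ := h p hp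
  rcases isCyc_eq_or_eq hR hpc hpd hcd hpq with rfl | rfl
  exacts [hq hc, hq hd]

theorem isCyc_irrefl (hR : IsCyc R) (x : U) : ¬ R x x := by
  obtain ⟨B, hB, h3, h⟩ := hR
  rw [h]
  exact fun h' => not_isDiag_of_mem_cycEdges hB h3 h' rfl

end TSP

/-! ### The tour and the trap around the gadget that contains v. -/

namespace MaxCutReduction

open TSP

section Gadget

variable {V : Type*} [Fintype V] [DecidableEq V]
variable {H : SimpleGraph V} [DecidableRel H.Adj] {C : Choices H} {k : ℕ}
variable {T : Vertex C k → Vertex C k → Prop} {high : Vertex C k → Prop}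
  {v v' m u p : Vertex C k} {K : Vertex C k → Vertex C k → Prop}

/-! ### The tour in the gadgets of high vertices -/

/-- The tour uses both or none of the doors at the source of a strict gadget. -/
theorem Ctx.doors_src_strict (S : Ctx T high v v') (e : {e : H.edgeSet // C.directed e = true})
    (hX : high (.strict e .X)) (hXp : high (.strict e .Xp)) (hb : high (.strict e .b))
    (hbp : high (.strict e .bp)) : DoorIn T (C.src e) e ↔ DoorOut T (C.src e) e := by
  rw [doorIn_src_strict, doorOut_src_strict]
  have o₁ := one_strict_X S.cyc (S.regular hX)
  have o₂ := one_strict_Xp S.cyc (S.regular hXp)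
  have o₃ := one_strict_b S.cyc (S.regular hb)
  have o₄ := one_strict_bp S.cyc (S.regular hbp)
  have c₁ := S.comm (x := .strict e .X) (y := .strict e .b)
  have c₂ := S.comm (x := .strict e .Xp) (y := .strict e .bp)
  have m₁ : T (.strict e .X) (.strict e .midApX) :=
    S.tour_of_isMid trivial (adj_strict_X.2 (by simp))
  have m₂ : T (.strict e .ap) (.strict e .midApX) :=
    S.tour_of_isMid trivial (adj_strict_ap.2 (by simp))
  have m₃ : T (.strict e .Xp) (.strict e .midAXp) :=
    S.tour_of_isMid trivial (adj_strict_Xp.2 (by simp))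
  have m₄ : T (.strict e .a) (.strict e .midAXp) :=
    S.tour_of_isMid trivial (adj_strict_a.2 (by simp))
  have m₅ : T (.strict e .b) (.strict e .midBBp) :=
    S.tour_of_isMid trivial (adj_strict_b.2 (by simp))
  have m₆ : T (.strict e .bp) (.strict e .midBBp) :=
    S.tour_of_isMid trivial (adj_strict_bp.2 (by simp))
  -- `Z` serves as a vertex of the tour outside of the two six-cycles below.
  obtain ⟨z, hz⟩ := S.total (.strict e .Z)
  constructor
  · intro h
    by_contra h'
    have t₁ : T (.strict e .b) (.strict e .a) := by grind
    have t₂ : T (.strict e .Xp) (.strict e .bp) := by grind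
    -- If only the door at `X` is used, the edges `ba` and `X'b'` are forced. With two of the paths
    -- of length two they form a cycle on six vertices, a subtour.
    have := isCyc_mem_of_closed S.cyc (fun x => x ∈ ([.strict e .b, .strict e .a,
      .strict e .midAXp, .strict e .Xp, .strict e .bp, .strict e .midBBp] : List (Vertex C k)))
      (fun x hx => ?_) (x := .strict e .b) (by simp) hz
    · simp at this
    · simp only [List.mem_cons, List.not_mem_nil, or_false] at hx
      rcases hx with rfl | rfl | rfl | rfl | rfl | rfl
      · exact ⟨_, _, by simp, by simp, by simp, t₁, m₅⟩
      · exact ⟨_, _, by simp, by simp, by simp, S.symm t₁, m₄⟩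
      · exact ⟨_, _, by simp, by simp, by simp, S.symm m₃, S.symm m₄⟩
      · exact ⟨_, _, by simp, by simp, by simp, t₂, m₃⟩
      · exact ⟨_, _, by simp, by simp, by simp, S.symm t₂, m₆⟩
      · exact ⟨_, _, by simp, by simp, by simp, S.symm m₅, S.symm m₆⟩
  · intro h
    by_contra h'
    have t₁ : T (.strict e .X) (.strict e .b) := by grind
    have t₂ : T (.strict e .bp) (.strict e .ap) := by grind
    -- If only the door at `X'` is used, `Xb` and `b'a'` close a subtour in the same way.
    have := isCyc_mem_of_closed S.cyc (fun x => x ∈ ([.strict e .b, .strict e .X,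
      .strict e .midApX, .strict e .ap, .strict e .bp, .strict e .midBBp] : List (Vertex C k)))
      (fun x hx => ?_) (x := .strict e .b) (by simp) hz
    · simp at this
    · simp only [List.mem_cons, List.not_mem_nil, or_false] at hx
      rcases hx with rfl | rfl | rfl | rfl | rfl | rfl
      · exact ⟨_, _, by simp, by simp, by simp, S.symm t₁, m₅⟩
      · exact ⟨_, _, by simp, by simp, by simp, t₁, m₁⟩
      · exact ⟨_, _, by simp, by simp, by simp, S.symm m₁, S.symm m₂⟩
      · exact ⟨_, _, by simp, by simp, by simp, S.symm t₂, m₂⟩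
      · exact ⟨_, _, by simp, by simp, by simp, t₂, m₆⟩
      · exact ⟨_, _, by simp, by simp, by simp, S.symm m₅, S.symm m₆⟩

/-- The tour is stuck at a vertex of the parity gadget of `e`. -/
structure GadgetCtx (T : Vertex C k → Vertex C k → Prop) (high : Vertex C k → Prop)
    (v v' : Vertex C k) (e : H.edgeSet) : Prop extends Ctx T high v v' where
  inGadget : InGadget e v
  high_of_not_inGadget : ∀ {x}, (∀ f, ¬ InGadget f x) → high x
  high_of_early : ∀ {f x}, C.psi f < C.psi e → InGadget f x → high x
  low_of_late : ∀ {f x}, C.psi e < C.psi f → InGadget f x → ¬ IsMid x → Low high v x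

variable {e : H.edgeSet}

theorem not_inGadget_of_ladder {x : V} {j : ℕ} {a : Vertex C k} (h : Ladder x j a)
    (f : H.edgeSet) : ¬ InGadget f a := by
  cases a <;> first | exact h.elim | exact id

/-- If all gadgets before the last gadget at `x` are entered by the tour if and only if they are
left, then this holds for the last gadget. -/
theorem GadgetCtx.doors_of_isLast (S : GadgetCtx T high v v' e) {x : V} {f : H.edgeSet}
    (hl : IsLast C x f) (h : ∀ g : H.edgeSet, x ∈ (g : Sym2 V) → C.psi g < C.psi f →
      (DoorIn T x g ↔ DoorOut T x g)) : DoorIn T x f ↔ DoorOut T x f := by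
  have h₁ := left_parity S.hk S.cyc x
    (fun b hb => S.sat (S.high_of_not_inGadget (fun _ => id)) hb)
  have h₂ := ladder_parity S.hk S.cyc (x := x) (j := 0) (Nat.zero_le _)
    (fun a b ha hab => S.sat (S.high_of_not_inGadget (not_inGadget_of_ladder ha)) hab)
  rw [pathA_zero, isCyc_comm S.cyc, zero_add, isCyc_comm S.cyc (a := pathB₀ C k x 1)] at h₂
  have g₁ := S.tour_of_isMid (isMid_gapLeft _) (link_gapLeft (C := C) (k := k) x)
  have g₂ := S.tour_of_isMid (isMid_gapRight _) (link_gapRight (C := C) (k := k) x)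
  -- The tour uses the gap edges at `x_ℓ` and `x_r`. So it uses exactly one of the first-set edge
  -- and the first door at `x_ℓ`, and exactly one of the two rail edges at position zero; the
  -- first-set edge is one of these rail edges.
  rw [doorIn_iff_firstDoor S.cyc hl.1 h, doorOut_iff_of_isLast hl]
  simp only [g₁, g₂, true_iff, not_true, iff_false] at h₁ h₂
  rw [h₁] at h₂
  tauto

theorem GadgetCtx.doors_src_of_early (S : GadgetCtx T high v v' e)
    (f : {e : H.edgeSet // C.directed e = true}) (hf : C.psi f < C.psi e) :
    DoorIn T (C.src f) f ↔ DoorOut T (C.src f) f :=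
  S.doors_src_strict f (S.high_of_early hf rfl) (S.high_of_early hf rfl)
    (S.high_of_early hf rfl) (S.high_of_early hf rfl)

/-- The tour enters the gadgets before that of `e` if and only if it leaves them. -/
theorem GadgetCtx.doors_of_early (S : GadgetCtx T high v v' e) {f : H.edgeSet}
    (hf : C.psi f < C.psi e) {x : V} (hx : x ∈ (f : Sym2 V)) : DoorIn T x f ↔ DoorOut T x f := by
  have strict : ∀ {f : H.edgeSet}, C.psi f < C.psi e → C.directed f = true →
      ∀ {x : V}, x ∈ (f : Sym2 V) → (DoorIn T x f ↔ DoorOut T x f) := by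
    intro f hf hd x hx
    have hs := S.doors_src_of_early ⟨f, hd⟩ hf
    -- Gaps have degree two, so the tour uses both gap edges of the gadget and the handshake relates
    -- the two pairs of doors.
    have := doors_iff_doors_strict S.cyc ⟨f, hd⟩ (fun q y hy => S.sat (S.high_of_early hf rfl) hy)
      (S.tour_of_isMid (isMid_gapLeft _) (adj_strict_Z.2 (by simp)))
      (S.tour_of_isMid (isMid_gapRight _) (adj_strict_Zp.2 (by simp)))
    rcases (mem_iff_src_or_tgt C).1 hx with rfl | rfl
    exacts [hs, this.1 hs]
  by_cases hd : C.directed f = true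
  · exact strict hf hd hx
  · have := doors_iff_doors_flex S.cyc ⟨f, hd⟩ (fun q y hy => S.sat (S.high_of_early hf rfl) hy)
      (S.tour_of_isMid (isMid_gapLeft _) (adj_flex_Z.2 (by simp)))
      (S.tour_of_isMid (isMid_gapRight _) (adj_flex_Zp.2 (by simp)))
    -- At the leaf `z`, this gadget is the last one, behind strict gadgets with equal doors. There
    -- the XOR gadget forces equal doors; the handshake transfers this to the other end.
    obtain ⟨z, hz, hz'⟩ := exists_isLast_of_not_directed hd
    have hdz := S.doors_of_isLast hz
      (fun g hg hlt => strict (hlt.trans hf) (hz' g hg hlt) hg)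
    rcases (mem_iff_src_or_tgt C).1 hz.1 with rfl | rfl <;>
      rcases (mem_iff_src_or_tgt C).1 hx with rfl | rfl
    exacts [hdz, this.1 hdz, this.2 hdz, hdz]

/-- At the last gadget of `x`, the XOR gadget would force equal doors. -/
theorem GadgetCtx.exists_follows (S : GadgetCtx T high v v' e) {x : V} (hx : x ∈ (e : Sym2 V))
    (h : ¬ (DoorIn T x e ↔ DoorOut T x e)) : ∃ g, Follows C x e g := by
  rcases isLast_or_exists_follows C hx with hl | h'
  · exact absurd (S.doors_of_isLast hl (fun g hg hlt => S.doors_of_early hlt hg)) h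
  · exact h'

theorem GadgetCtx.low_enter (S : GadgetCtx T high v v' e) {x : V} {g : H.edgeSet}
    (hg : Follows C x e g) : Low high v (enter C k x g) :=
  S.low_of_late hg.2.2.1 (inGadget_enter x g) (not_isMid_enter x g)

/-- The tour uses the door behind the gadget of `e` to a high vertex only if it uses the door
before it. -/
theorem GadgetCtx.doorIn_of_doorOut (S : GadgetCtx T high v v' e) {x : V} (hx : x ∈ (e : Sym2 V))
    (hh : high (nextV C k x e)) (h : DoorOut T x e) : DoorIn T x e := by
  by_contra h'
  obtain ⟨g, hg⟩ := S.exists_follows hx (fun h'' => h' (h''.2 h))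
  rw [hg.nextV_eq] at hh
  exact (S.low_enter hg).1 hh

/-- Behind the gadget of `e` comes either the XOR gadget, whose vertices are all high, or a later
parity gadget, entered at a low vertex. -/
theorem GadgetCtx.not_high_next (S : GadgetCtx T high v v' e) {x : V} (hx : x ∈ (e : Sym2 V))
    (hh : ¬ high (nextV C k x e)) : Low high v (nextV C k x e) := by
  rcases isLast_or_exists_follows C hx with hl | ⟨g, hg⟩
  · rw [hl.nextV_eq] at hh
    exact absurd (S.high_of_not_inGadget (not_inGadget_pathB x 1)) hh
  · rw [hg.nextV_eq]
    exact S.low_enter hg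

/-- If the tour enters the gadget of `e` and `v` is the vertex at which it would be left again,
there is a trap that contains the door there. -/
theorem GadgetCtx.exists_trap_next (S : GadgetCtx T high v v' e) {x : V} (hx : x ∈ (e : Sym2 V))
    (hv : v = leave C k x e) (h : DoorIn T x e) :
    ∃ m p K, IsMid m ∧ Trap (graph C k) T high v m (nextV C k x e) p K := by
  have hadj : (graph C k).Adj v (nextV C k x e) := hv ▸ adj_iff_link.2 (.inl (link_nextV hx))
  have hnT := S.not_tour_v hadj (not_isMid_nextV x e)
  -- At `v`, the tour edge of `G` leads to a vertex of degree two, so the tour does not use the door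
  -- behind `e`. As it uses the door before, a later gadget follows.
  obtain ⟨g, hg⟩ := S.exists_follows hx (fun h' => hnT (hv ▸ (h'.1 h)))
  refine S.exists_trap_of_not_isMid hadj (not_isMid_nextV x e) (fun y hy hh => ?_)
  by_contra hm
  have hlow : ∀ {x}, InGadget g x → ¬ IsMid x → ¬ high x :=
    fun h h' => (S.low_of_late hg.2.2.1 h h').1
  rw [hg.nextV_eq] at hy hadj
  have hyadj := (S.sat hh (S.symm hy)).symm
  -- The entrance of the later gadget is adjacent to `v`, to a vertex of degree two and to a low
  -- vertex. The first one is excluded as a tour neighbor.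
  have hprev : y ≠ prevV C k x g := by
    rintro rfl
    rw [hg.prevV_eq, ← hv] at hy
    exact S.not_tour_v hadj (not_isMid_enter x g) (S.symm hy)
  by_cases hd : C.directed g = true
  · obtain ⟨f, rfl⟩ : ∃ f : {e : H.edgeSet // C.directed e = true}, f.1 = g := ⟨⟨g, hd⟩, rfl⟩
    rcases (mem_iff_src_or_tgt C).1 hg.2.1 with rfl | rfl
    · rw [enter_src_strict, adj_strict_X] at hyadj
      rcases hyadj with rfl | rfl | rfl
      exacts [hprev rfl, hm trivial, hlow inGadget_strict hm hh]
    · rw [enter_tgt_strict, adj_strict_Y] at hyadj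
      rcases hyadj with rfl | rfl | rfl
      exacts [hprev rfl, hm trivial, hlow inGadget_strict hm hh]
  · obtain ⟨f, rfl⟩ : ∃ f : {e : H.edgeSet // ¬ C.directed e = true}, f.1 = g := ⟨⟨g, hd⟩, rfl⟩
    rcases (mem_iff_src_or_tgt C).1 hg.2.1 with rfl | rfl
    · rw [enter_src_flex, adj_flex_X] at hyadj
      rcases hyadj with rfl | rfl | rfl
      exacts [hprev rfl, hm trivial, hlow inGadget_flex hm hh]
    · rw [enter_tgt_flex, adj_flex_Y] at hyadj
      rcases hyadj with rfl | rfl | rfl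
      exacts [hprev rfl, hm trivial, hlow inGadget_flex hm hh]

/-! ### The trap in the gadgets of high vertices -/

theorem _root_.TSP.Trap.mem_iff_of_tour (B : Trap (graph C k) T high v m u p K)
    (S : Ctx T high v v') {x y : Vertex C k} (h : T x y) (hxu : x ≠ u) (hxv : x ≠ v) (hyu : y ≠ u)
    (hyv : y ≠ v) :
    Mem K x ↔ Mem K y :=
  ⟨fun hx => B.mem_right ((B.iff hx hxu hxv).2 h),
    fun hy => B.mem_right ((B.iff hy hyu hyv).2 (S.symm h))⟩

/-- The trap uses the doors of a gadget as the tour does, if it contains both or none of the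
vertices at the doors that are used by the tour. -/
theorem _root_.TSP.Trap.doors_of_tour (B : Trap (graph C k) T high v m u p K)
    {x : V} {f : H.edgeSet} (hT : DoorIn T x f ↔ DoorOut T x f)
    (hmem : DoorIn T x f → DoorOut T x f → (Mem K (enter C k x f) ↔ Mem K (leave C k x f)))
    (h₁ : enter C k x f ≠ u) (h₂ : enter C k x f ≠ v) (h₃ : leave C k x f ≠ u)
    (h₄ : leave C k x f ≠ v) : DoorIn K x f ↔ DoorOut K x f := by
  constructor <;> intro h
  · have hi : DoorIn T x f := B.tour h h₁ h₂
    have ho := hT.1 hi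
    exact (B.iff ((hmem hi ho).1 ⟨_, h⟩) h₃ h₄).2 ho
  · have ho : DoorOut T x f := B.tour h h₃ h₄
    have hi := hT.2 ho
    exact (B.iff ((hmem hi ho).2 ⟨_, h⟩) h₁ h₂).2 hi

/-- Membership is passed along `X, a', b', b, a, X'`, alternately through paths of length two and
through tour edges away from `u` and `v`. -/
theorem Ctx.mem_X_iff_mem_Xp (S : Ctx T high v v') (B : Trap (graph C k) T high v m u p K)
    (e : {e : H.edgeSet // C.directed e = true}) (h₁ : T (.strict e .b) (.strict e .a))
    (h₂ : T (.strict e .bp) (.strict e .ap))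
    (h : ∀ q ∈ ([.a, .ap, .b, .bp] : List StrictVertex),
      (.strict e q : Vertex C k) ≠ u ∧ .strict e q ≠ v) :
    Mem K (.strict e .X) ↔ Mem K (.strict e .Xp) := by
  have ha := h .a (by simp)
  have hap := h .ap (by simp)
  have hb := h .b (by simp)
  have hbp := h .bp (by simp)
  rw [S.mem_strict_X B, S.mem_strict_Xp B,
    ← B.mem_iff_of_tour S h₁ hb.1 hb.2 ha.1 ha.2, S.mem_strict_b B,
    B.mem_iff_of_tour S h₂ hbp.1 hbp.2 hap.1 hap.2]

/-- The trap uses both or none of the doors at the source of a strict gadget. -/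
theorem Ctx.trap_doors_src_strict (S : Ctx T high v v') (B : Trap (graph C k) T high v m u p K)
    (e : {e : H.edgeSet // C.directed e = true})
    (hh : ∀ q ∈ ([.X, .Xp, .b, .bp] : List StrictVertex),
      high (.strict e q) ∧ .strict e q ≠ u)
    (h : T (.strict e .b) (.strict e .a) → T (.strict e .bp) (.strict e .ap) →
      (.strict e .a : Vertex C k) ≠ u ∧ .strict e .a ≠ v ∧
        (.strict e .ap : Vertex C k) ≠ u ∧ .strict e .ap ≠ v) :
    DoorIn K (C.src e) e ↔ DoorOut K (C.src e) e := by
  obtain ⟨X, Xu⟩ := hh .X (by simp)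
  obtain ⟨Xp, Xpu⟩ := hh .Xp (by simp)
  obtain ⟨b, bu⟩ := hh .b (by simp)
  obtain ⟨bp, bpu⟩ := hh .bp (by simp)
  have hv : ∀ {x}, high x → x ≠ v := by rintro x hx rfl; exact S.not_high hx
  refine B.doors_of_tour (S.doors_src_strict e X Xp b bp) (fun hi ho => ?_)
    ?_ ?_ ?_ ?_ <;> simp only [enter_src_strict, leave_src_strict]
  · rw [doorIn_src_strict] at hi
    rw [doorOut_src_strict] at ho
    have o₁ := one_strict_X S.cyc (S.regular X)
    have o₂ := one_strict_Xp S.cyc (S.regular Xp)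
    have o₃ := one_strict_b S.cyc (S.regular b)
    have o₄ := one_strict_bp S.cyc (S.regular bp)
    rw [S.comm] at o₃ o₄
    have t₁ : T (.strict e .b) (.strict e .a) := by grind
    have t₂ : T (.strict e .bp) (.strict e .ap) := by grind
    obtain ⟨hau, hav, hapu, hapv⟩ := h t₁ t₂
    refine S.mem_X_iff_mem_Xp B e t₁ t₂ ?_
    simp only [List.mem_cons, List.not_mem_nil, or_false]
    rintro q (rfl | rfl | rfl | rfl)
    exacts [⟨hau, hav⟩, ⟨hapu, hapv⟩, ⟨bu, hv b⟩, ⟨bpu, hv bp⟩]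
  exacts [Xu, hv X, Xpu, hv Xp]

/-- With `u` and `v` outside of the gadget, trap and tour agree at all of its vertices in the trap.
Equal doors of the tour carry over, because the strands inside put both or none of entrance and exit
into the trap. -/
theorem GadgetCtx.trap_doors_of_early (S : GadgetCtx T high v v' e)
    (B : Trap (graph C k) T high v m u p K) {f : H.edgeSet} (hf : C.psi f < C.psi e)
    (hu : ¬ InGadget f u) {x : V} (hx : x ∈ (f : Sym2 V)) : DoorIn K x f ↔ DoorOut K x f := by
  have hv : ¬ InGadget f v := fun h => hf.ne (congrArg C.psi (h.unique S.inGadget))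
  have hne : ∀ {y}, InGadget f y → y ≠ u ∧ y ≠ v := fun hy =>
    ⟨by rintro rfl; exact hu hy, by rintro rfl; exact hv hy⟩
  by_cases hd : C.directed f = true
  · obtain ⟨g, rfl⟩ : ∃ g : {e : H.edgeSet // C.directed e = true}, g.1 = f := ⟨⟨f, hd⟩, rfl⟩
    have hq : ∀ q, Vertex.strict g q ≠ u ∧ .strict g q ≠ v := fun q => hne inGadget_strict
    rcases (mem_iff_src_or_tgt C).1 hx with rfl | rfl
    · exact S.trap_doors_src_strict B g
        (fun q _ => ⟨S.high_of_early hf inGadget_strict, (hq q).1⟩)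
        (fun _ _ => ⟨(hq _).1, (hq _).2, (hq _).1, (hq _).2⟩)
    · refine B.doors_of_tour (S.doors_of_early hf hx) ?_ ?_ ?_ ?_ ?_ <;>
        simp only [enter_tgt_strict, leave_tgt_strict]
      exacts [fun _ _ => S.mem_strict_Y B g, (hq _).1, (hq _).2, (hq _).1, (hq _).2]
  · obtain ⟨g, rfl⟩ : ∃ g : {e : H.edgeSet // ¬ C.directed e = true}, g.1 = f := ⟨⟨f, hd⟩, rfl⟩
    have hq : ∀ q, Vertex.flex g q ≠ u ∧ .flex g q ≠ v := fun q => hne inGadget_flex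
    refine B.doors_of_tour (S.doors_of_early hf hx) ?_ ?_ ?_ ?_ ?_ <;>
      rcases (mem_iff_src_or_tgt C).1 hx with rfl | rfl <;>
      simp only [enter_tgt_flex, leave_tgt_flex, enter_src_flex, leave_src_flex]
    exacts [fun _ _ => S.mem_flex_X B g, fun _ _ => S.mem_flex_Y B g, (hq _).1, (hq _).1,
      (hq _).2, (hq _).2, (hq _).1, (hq _).1, (hq _).2, (hq _).2]

/-- Followed backwards through the earlier gadgets, the door leads to `x_ℓ`, and a trap through
`x_ℓ` contains the gap there. -/
theorem GadgetCtx.mem_gap_of_doorIn (S : GadgetCtx T high v v' e)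
    (B : Trap (graph C k) T high v m u p K) (hu : ∀ f, C.psi f < C.psi e → ¬ InGadget f u)
    {x : V} (hx : x ∈ (e : Sym2 V)) (h : DoorIn K x e) : ∃ s, Mem K (.gap s) := by
  rw [doorIn_iff_firstDoor B.cyc hx
    (fun f hf hlt => S.trap_doors_of_early B hlt (hu f hlt) hf)] at h
  obtain ⟨t, ht⟩ := gapLeft_cases (C := C) (k := k) (.inl x)
  exact ⟨t, B.mem_right (ht ▸ S.trap_mid B h (isMid_gapLeft _) (link_gapLeft x))⟩

/-- A trap contains no gap if it enters the gadget of `e` if and only if it leaves it. -/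
theorem GadgetCtx.false_of_mem_gap (S : GadgetCtx T high v v' e)
    (B : Trap (graph C k) T high v m u p K) (hu : ∀ f, C.psi f < C.psi e → ¬ InGadget f u)
    (hs : DoorIn K (C.src e) e ↔ DoorOut K (C.src e) e)
    (ht : DoorIn K (C.tgt e) e ↔ DoorOut K (C.tgt e) e)
    (hZ : ∃ f, ¬ Mem K (port C k .Z .Z f)) {y : Vertex C k} (hy : ∃ s, y = .gap s)
    (hg : Mem K y) : False := by
  obtain ⟨f, hf⟩ := hZ
  obtain ⟨s, rfl⟩ := hy
  refine S.not_mem_gap B (fun x f hx => ?_) hf s hg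
  -- Earlier gadgets inherit equal doors from the tour and later gadgets are low; only the gadget of
  -- `e` needs the hypotheses on its doors.
  rcases lt_trichotomy (C.psi f) (C.psi e) with hlt | heq | hlt
  · exact S.trap_doors_of_early B hlt (hu f hlt) hx
  · obtain rfl := C.psi.injective heq
    rcases (mem_iff_src_or_tgt C).1 hx with rfl | rfl
    exacts [hs, ht]
  · exact S.doors_of_low B (fun x => S.low_of_late hlt) hx

theorem not_early_of_inGadget (h : InGadget e u) (f : H.edgeSet)
    (hf : C.psi f < C.psi e) : ¬ InGadget f u :=
  fun h' => hf.ne (congrArg C.psi (h'.unique h))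

theorem not_early_nextV (x : V) (f : H.edgeSet) (hf : C.psi f < C.psi e) :
    ¬ InGadget f (nextV C k x e) := by
  rcases nextV_cases (C := C) (k := k) x e with ⟨g, hg, h⟩ | h <;> rw [h]
  · exact fun h' => (hf.trans hg.2.2.1).ne (congrArg C.psi (h'.unique (inGadget_enter x g)))
  · exact not_inGadget_pathB x 1 f

theorem Ctx.mem_mid (S : Ctx T high v v') (B : Trap (graph C k) T high v m u p K)
    {x n : Vertex C k} (hx : Mem K x) (hn : IsMid n) (h : (graph C k).Adj x n) : Mem K n :=
  B.mem_right ((S.regular_trap B hx).mid hn h)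

theorem GadgetCtx.exists_not_mem_of_late (S : GadgetCtx T high v v' e)
    (B : Trap (graph C k) T high v m u p K) {f : H.edgeSet} (hf : C.psi e < C.psi f) :
    ∃ f, ¬ Mem K (port C k .Z .Z f) :=
  ⟨f, S.not_mem_Z_of_low B (fun _ => S.low_of_late hf)⟩

/-- Unequal doors of the tour imply that a later gadget follows; it is low, so its `Z` is not in the
trap. -/
theorem GadgetCtx.exists_not_mem_of_doors (S : GadgetCtx T high v v' e)
    (B : Trap (graph C k) T high v m u p K) {x : V} (hx : x ∈ (e : Sym2 V))
    (h : ¬ (DoorIn T x e ↔ DoorOut T x e)) : ∃ f, ¬ Mem K (port C k .Z .Z f) := by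
  obtain ⟨g, hg⟩ := S.exists_follows hx h
  exact S.exists_not_mem_of_late B hg.2.2.1

theorem Ctx.not_high_v' (S : Ctx T high v v') : ¬ high v' :=
  fun h => S.not_adj (S.sat h (S.symm S.adj)).symm

/-- As `v'` is not high, it lies in a parity gadget that does not precede that of `e`. If it is not
in the latter, its gadget is later and hence low. -/
theorem GadgetCtx.exists_not_mem_of_v' (S : GadgetCtx T high v v' e)
    (B : Trap (graph C k) T high v m u p K) (h : ¬ InGadget e v') :
    ∃ f, ¬ Mem K (port C k .Z .Z f) := by
  have hf : ∃ f, InGadget f v' := by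
    by_contra! hcon
    exact S.not_high_v' (S.high_of_not_inGadget hcon)
  obtain ⟨f, hf⟩ := hf
  rcases lt_trichotomy (C.psi f) (C.psi e) with hlt | heq | hlt
  · exact absurd (S.high_of_early hlt hf) S.not_high_v'
  · exact absurd (C.psi.injective heq ▸ hf) h
  · exact S.exists_not_mem_of_late B hlt

end Gadget

end MaxCutReduction

/-! ### Strict gadgets: places, and the vertices Y, X, b, X', b', a'. -/

namespace MaxCutReduction

open TSP

section StrictCases

variable {V : Type*} [Fintype V] [DecidableEq V]
variable {H : SimpleGraph V} [DecidableRel H.Adj] {C : Choices H} {k : ℕ}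
variable {T : Vertex C k → Vertex C k → Prop} {high : Vertex C k → Prop}
  {v v' m u p : Vertex C k} {K : Vertex C k → Vertex C k → Prop}

/-! ### Places of the vertices of the gadgets -/

theorem lex_lt_iff {a b c a' b' c' : ℕ} :
    (toLex (a, toLex (b, c)) : ℕ ×ₗ ℕ ×ₗ ℕ) < toLex (a', toLex (b', c')) ↔
      a < a' ∨ a = a' ∧ (b < b' ∨ b = b' ∧ c < c') := by
  simp only [Prod.Lex.toLex_lt_toLex]

/-- Parity gadgets form the last phase and are treated in the order `ψ`, so outside of the gadget of
`e` the first two coordinates of the places decide. -/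
theorem Ctx.gadgetCtx_of_place (S : Ctx T high v v') {e : H.edgeSet} {n : ℕ} (he : InGadget e v)
    (hv : place C k v = toLex (3, toLex ((C.psi e : ℕ), n))) : GadgetCtx T high v v' e := by
  have key : ∀ {f : H.edgeSet} {x : Vertex C k}, InGadget f x → ¬ IsMid x →
      ∃ n, place C k x = toLex (3, toLex ((C.psi f : ℕ), n)) := by
    intro f x hf hm
    rw [place_of_not_isMid S.hk hm]
    cases x <;> first | exact hf.elim | (obtain rfl := hf; exact ⟨_, rfl⟩)
  refine
    { S with
      inGadget := he
      high_of_not_inGadget := ?_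
      high_of_early := ?_
      low_of_late := ?_ }
  · intro x hx
    by_cases hm : IsMid x
    · exact S.high_of_isMid hm
    apply S.high_of_lt
    rw [hv, place_of_not_isMid S.hk hm]
    cases x with
    | strict f q => exact absurd rfl (hx f.1)
    | flex f q => exact absurd rfl (hx f.1)
    | gap s => exact absurd trivial hm
    | rung x i => exact absurd trivial hm
    | left x => exact lex_lt_iff.2 (.inl (by norm_num))
    | right x => exact lex_lt_iff.2 (.inl (by norm_num))
    | railA x i => exact lex_lt_iff.2 (.inl (by norm_num))
    | railB x i => exact lex_lt_iff.2 (.inl (by norm_num))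
  · intro f x hlt hf
    by_cases hm : IsMid x
    · exact S.high_of_isMid hm
    obtain ⟨n', h⟩ := key hf hm
    exact S.high_of_lt (by rw [hv, h]; exact lex_lt_iff.2 (.inr ⟨rfl, .inl hlt⟩))
  · intro f x hlt hf hm
    obtain ⟨n', h⟩ := key hf hm
    exact S.low_of_place (by rw [hv, h]; exact lex_lt_iff.2 (.inr ⟨rfl, .inl hlt⟩))

variable {e : {e : H.edgeSet // C.directed e = true}} {q r : StrictVertex}

theorem place_strict (hk : 15 ≤ k) (hq : ¬ q.IsMid) :
    place C k (.strict e q) = toLex (3, toLex ((C.psi e.1 : ℕ), strictPos q)) :=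
  place_of_not_isMid hk hq

theorem Ctx.gadgetCtx_strict (S : Ctx T high (.strict e q) v') :
    GadgetCtx T high (.strict e q) v' e :=
  S.gadgetCtx_of_place inGadget_strict (place_strict S.hk S.not_isMid)

theorem Ctx.high_strict (S : Ctx T high (.strict e q) v') (h : strictPos r < strictPos q) :
    high (.strict e r) := by
  by_cases hm : r.IsMid
  · exact S.high_of_isMid hm
  · apply S.high_of_lt
    rw [place_strict S.hk hm, place_strict S.hk S.not_isMid]
    exact lex_lt_iff.2 (.inr ⟨rfl, .inr ⟨rfl, h⟩⟩)

theorem Ctx.low_strict (S : Ctx T high (.strict e q) v') (h : strictPos q < strictPos r) :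
    Low high (.strict e q) (.strict e r) := by
  have hm : ¬ r.IsMid := by
    intro hm; cases r <;> first | exact hm | exact absurd h (by simp [strictPos])
  apply S.low_of_place
  rw [place_strict S.hk hm, place_strict S.hk S.not_isMid]
  exact lex_lt_iff.2 (.inr ⟨rfl, .inr ⟨rfl, h⟩⟩)

theorem Ctx.exists_strict_of_inGadget (S : Ctx T high (.strict e q) v') (h : InGadget e.1 v') :
    ∃ r, v' = .strict e r ∧ strictPos q < strictPos r := by
  cases v' with
  | strict f r =>
    obtain rfl : f = e := Subtype.ext h
    refine ⟨r, rfl, ?_⟩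
    rcases lt_trichotomy (strictPos q) (strictPos r) with hlt | heq | hlt
    · exact hlt
    · have hr : ¬ r.IsMid := fun hr => S.not_high_v' (S.high_of_isMid hr)
      have hq : ¬ q.IsMid := S.not_isMid
      have : q = r := by
        revert heq
        cases q <;> first | exact absurd trivial hq | skip
        all_goals cases r <;> first | exact absurd trivial hr | simp [strictPos]
      subst this
      exact absurd S.adj (isCyc_irrefl S.cyc _)
    · exact absurd (S.high_strict hlt) S.not_high_v'
  | flex f r => exact absurd e.2 (by have := f.2; rwa [show f.1 = e.1 from h] at this)
  | _ => exact h.elim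

/-! ### The vertices of the strict gadgets -/

/-- For `u = Z'`, the trap passes from `Y` to `Y'`. As `a` and `Z` are low, it leaves through the
door, and to a high vertex. Then the gadget is the last one on this path, and the tour, which uses
the door behind it, also uses the door before it. This door is an edge at `v = Y` that the tour
cannot contain. -/
theorem Ctx.not_strict_Y (S : Ctx T high (.strict e .Y) v') : False := by
  have G := S.gadgetCtx_strict
  obtain ⟨m, p, K, hm, B⟩ := S.exists_trap_of_not_isMid (u := .strict e .Zp)
    (adj_strict_Y.2 (by simp)) id (fun y hy hh => by
      rcases adj_strict_Zp.1 (S.sat hh (S.symm hy)).symm with rfl | rfl | rfl | rfl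
      · exact isMid_gapRight _
      · exact absurd hh S.not_high
      · exact absurd hh (S.low_strict (by decide)).1
      · exact absurd hh (S.low_strict (by decide)).1)
  have hYp : Low high _ (.strict e .Yp) := S.low_strict (by decide)
  have o := one_strict_Yp B.cyc (S.regular_trap B ((S.mem_strict_Y B e).1 ⟨_, B.adj_u⟩))
  have l₁ := B.not_low_low hYp (S.low_strict (r := .a) (by decide))
  have l₂ := B.not_low_low hYp (S.low_strict (r := .Z) (by decide))
  have hK : K (.strict e .Yp) (nextV C k (C.tgt e) e) := by grind
  have hnext : high (nextV C k (C.tgt e) e) := by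
    by_contra h
    exact B.not_low_low hYp (G.not_high_next (tgt_mem C e) h) hK
  have hT := G.doorIn_of_doorOut (tgt_mem C e) hnext
    ((doorOut_tgt_strict e).2 (B.tour hK (by simp) (by simp)))
  exact S.not_tour_v (adj_strict_Y.2 (by simp)) (not_isMid_prevV _ _) ((doorIn_tgt_strict e).1 hT)

/-- For `u = b`, the trap passes from `X` to `a'`, where only the low vertices `b'` and `Z` are
left. -/
theorem Ctx.not_strict_X (S : Ctx T high (.strict e .X) v') : False := by
  obtain ⟨m, p, K, hm, B⟩ := S.exists_trap_of_not_isMid (u := .strict e .b)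
    (adj_strict_X.2 (by simp)) id (fun y hy hh => by
      rcases adj_strict_b.1 (S.sat hh (S.symm hy)).symm with rfl | rfl | rfl
      · trivial
      · exact absurd hh S.not_high
      · exact absurd hh (S.low_strict (by decide)).1)
  have hap : Low high _ (.strict e .ap) := S.low_strict (by decide)
  have o := one_strict_ap B.cyc (S.regular_trap B ((S.mem_strict_X B e).1 ⟨_, B.adj_u⟩))
  have l₁ := B.not_low_low hap (S.low_strict (r := .bp) (by decide))
  have l₂ := B.not_low_low hap (S.low_strict (r := .Z) (by decide))
  grind

/-- For `u = a`, the trap passes from `b` to `b'`, where only the low vertices `X'` and `a'` are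
left. -/
theorem Ctx.not_strict_b (S : Ctx T high (.strict e .b) v') : False := by
  obtain ⟨m, p, K, hm, B⟩ := S.exists_trap_of_not_isMid (u := .strict e .a)
    (adj_strict_b.2 (by simp)) id (fun y hy hh => by
      rcases adj_strict_a.1 (S.sat hh (S.symm hy)).symm with rfl | rfl | rfl | rfl
      · trivial
      · exact absurd hh S.not_high
      · exact absurd hh (S.low_strict (by decide)).1
      · exact absurd hh (S.low_strict (by decide)).1)
  have hbp : Low high _ (.strict e .bp) := S.low_strict (by decide)
  have o := one_strict_bp B.cyc (S.regular_trap B ((S.mem_strict_b B e).1 ⟨_, B.adj_u⟩))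
  have l₁ := B.not_low_low hbp (S.low_strict (r := .Xp) (by decide))
  have l₂ := B.not_low_low hbp (S.low_strict (r := .ap) (by decide))
  grind

/-- If the tour contained `bX`, the trap for `u = b'` would run through `b` and `X` into the dead
end `a'`. So the tour enters at `X`, and the door behind `X'` has a trap. It runs from `X'` through
`a`, `b`, `b'` and back, which gives a third edge at `X'`. -/
theorem Ctx.not_strict_Xp (S : Ctx T high (.strict e .Xp) v') : False := by
  have G := S.gadgetCtx_strict
  have hbp : Low high _ (.strict e .bp) := S.low_strict (by decide)
  have hap : Low high _ (.strict e .ap) := S.low_strict (by decide)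
  have hbX : ¬ T (.strict e .b) (.strict e .X) := by
    intro hT
    obtain ⟨m, p, K, hm, B⟩ := S.exists_trap_of_not_isMid (u := .strict e .bp)
      (adj_strict_Xp.2 (by simp)) id (fun y hy hh => by
        rcases adj_strict_bp.1 (S.sat hh (S.symm hy)).symm with rfl | rfl | rfl
        · trivial
        · exact absurd hh S.not_high
        · exact absurd hh (S.low_strict (by decide)).1)
    have hX := B.mem_right ((B.iff ((S.mem_strict_b B e).2 (B.mem_right B.adj_u))
      (by simp) (by simp)).2 hT)
    have o := one_strict_ap B.cyc (S.regular_trap B ((S.mem_strict_X B e).1 hX))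
    have l₁ := B.not_low_low hap hbp
    have l₂ := B.not_low_low hap (S.low_strict (r := .Z) (by decide))
    grind
  have hin : DoorIn T (C.src e) e := by
    rw [doorIn_src_strict, one_strict_X S.cyc (S.regular (S.high_strict (by decide))), S.comm]
    exact hbX
  obtain ⟨m, p, K, hm, B⟩ := G.exists_trap_next (src_mem C e) (leave_src_strict e).symm hin
  have ha : Low high _ (.strict e .a) := S.low_strict (by decide)
  have memA := (S.mem_strict_Xp B e).1 ⟨_, B.adj_u⟩
  have o := one_strict_a B.cyc (S.regular_trap B memA)
  have l₁ := B.not_low_low ha (S.low_strict (r := .Yp) (by decide))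
  have l₂ := B.not_low_low ha (S.low_strict (r := .Zp) (by decide))
  have hab : K (.strict e .a) (.strict e .b) := by grind
  have o' := one_strict_bp B.cyc (S.regular_trap B ((S.mem_strict_b B e).1 (B.mem_right hab)))
  have l₃ := B.not_low_low hbp hap
  have hK : K (.strict e .Xp) (.strict e .bp) := B.symm (by grind)
  rcases B.eq_or_isMid hm (not_isMid_nextV _ _) hK with h | h
  exacts [nextV_ne_strict le_rfl _ h.symm, h]

/-- If the tour contains `Xb`, the trap for `u = X'` runs through `b`, `X`, `a'` back to `b'`, where
it would need a third edge. Otherwise the tour uses both source doors, and so does the trap for `u =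
a'`. Hence this trap contains a gap, while `Z` is missing. -/
theorem Ctx.not_strict_bp (S : Ctx T high (.strict e .bp) v') : False := by
  have G := S.gadgetCtx_strict
  have X : high (.strict e .X) := S.high_strict (by decide)
  have b : high (.strict e .b) := S.high_strict (by decide)
  have Xp : high (.strict e .Xp) := S.high_strict (by decide)
  have hap : Low high _ (.strict e .ap) := S.low_strict (by decide)
  have hZ : Low high _ (.strict e .Z) := S.low_strict (by decide)
  have oX := one_strict_X S.cyc (S.regular X)
  have ob := one_strict_b S.cyc (S.regular b)
  have oXp := one_strict_Xp S.cyc (S.regular Xp)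
  rw [S.comm] at ob
  have hbpXp : ¬ T (.strict e .Xp) (.strict e .bp) := fun h =>
    S.not_tour_v (adj_strict_bp.2 (by simp)) id (S.symm h)
  have hout : DoorOut T (C.src e) e := by rw [doorOut_src_strict]; exact oXp.2 hbpXp
  by_cases hbX : T (.strict e .X) (.strict e .b)
  · have hnin : ¬ DoorIn T (C.src e) e := by rw [doorIn_src_strict]; exact fun h => oX.1 h hbX
    obtain ⟨m, p, K, hm, B⟩ := S.exists_trap_of_not_isMid (u := .strict e .Xp)
      (adj_strict_bp.2 (by simp)) id (fun y hy hh => by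
        rcases adj_strict_Xp.1 (S.sat hh (S.symm hy)).symm with rfl | rfl | rfl
        · exact absurd (G.doorIn_of_doorOut (src_mem C e) hh hout) hnin
        · trivial
        · exact absurd hh S.not_high)
    have hX := B.mem_right ((B.iff ((S.mem_strict_b B e).2 ⟨_, B.adj_u⟩)
      (by simp) (by simp)).2 (S.symm hbX))
    have o := one_strict_ap B.cyc (S.regular_trap B ((S.mem_strict_X B e).1 hX))
    have l₂ := B.not_low_low hap hZ
    have hK : K (.strict e .bp) (.strict e .ap) := B.symm (by grind)
    rcases B.eq_or_isMid hm id hK with h | h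
    exacts [by simp at h, h]
  · have tX := oX.2 hbX
    have tb : T (.strict e .b) (.strict e .a) := by grind
    obtain ⟨m, p, K, hm, B⟩ := S.exists_trap_of_not_isMid (u := .strict e .ap)
      (adj_strict_bp.2 (by simp)) id (fun y hy hh => by
        rcases adj_strict_ap.1 (S.sat hh (S.symm hy)).symm with rfl | rfl | rfl
        · trivial
        · exact absurd hh S.not_high
        · exact absurd hh hZ.1)
    have hin : DoorIn K (C.src e) e := (doorIn_src_strict e).2
      ((B.iff ((S.mem_strict_X B e).2 (B.mem_right B.adj_u)) (by simp) (by simp)).2 tX)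
    have mem_a := B.mem_right ((B.iff ((S.mem_strict_b B e).2 ⟨_, B.adj_u⟩)
      (by simp) (by simp)).2 tb)
    have hKout : DoorOut K (C.src e) e := (doorOut_src_strict e).2
      ((B.iff ((S.mem_strict_Xp B e).2 mem_a) (by simp) (by simp)).2
        ((doorOut_src_strict e).1 hout))
    have hu := not_early_of_inGadget (k := k) (u := .strict e .ap) inGadget_strict
    obtain ⟨s, hs⟩ := G.mem_gap_of_doorIn B hu (src_mem C e) hin
    refine G.false_of_mem_gap B hu (iff_of_true hin hKout) ?_ ⟨e, ?_⟩ ⟨s, rfl⟩ hs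
    · by_cases hT : DoorIn T (C.tgt e) e ↔ DoorOut T (C.tgt e) e
      · refine B.doors_of_tour hT ?_ ?_ ?_ ?_ ?_ <;>
          simp only [enter_tgt_strict, leave_tgt_strict]
        exacts [fun _ _ => S.mem_strict_Y B e, by simp, by simp, by simp, by simp]
      -- If the tour has unequal doors at the target, a later gadget follows. Then `Y'` has only low
      -- neighbors besides the one of degree two, and the trap avoids `Y'` and `Y`.
      · obtain ⟨g, hg⟩ := G.exists_follows (tgt_mem C e) hT
        have hnot : ¬ Mem K (.strict e .Yp) := by
          intro h
          have hYp : Low high _ (.strict e .Yp) := S.low_strict (by decide)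
          have o := one_strict_Yp B.cyc (S.regular_trap B h)
          have l₁ := B.not_low_low hYp (hg.nextV_eq k ▸ G.low_enter hg)
          have l₂ := B.not_low_low hYp (S.low_strict (r := .a) (by decide))
          have l₃ := B.not_low_low hYp hZ
          grind
        rw [doorIn_tgt_strict, doorOut_tgt_strict]
        exact iff_of_false (fun h => hnot ((S.mem_strict_Y B e).1 ⟨_, h⟩)) (fun h => hnot ⟨_, h⟩)
    · rw [port_strict]
      intro h
      have o := one_strict_Z B.cyc (S.regular_trap B h)
      have l₁ := B.not_low_low hZ hap
      have l₂ := B.not_low_low hZ (S.low_strict (r := .Zp) (by decide))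
      have l₃ := B.not_low_low hZ (S.low_strict (r := .Yp) (by decide))
      grind

/-- Since `b'a'` is not in the tour, `Xb` and `b'X'` are. The trap for `u = Z` follows `X`, `b`,
`b'`, `X'` to `a`, where only the edge `ab` is left; but the tour does not contain it. -/
theorem Ctx.not_strict_ap (S : Ctx T high (.strict e .ap) v') : False := by
  have X : high (.strict e .X) := S.high_strict (by decide)
  have b : high (.strict e .b) := S.high_strict (by decide)
  have Xp : high (.strict e .Xp) := S.high_strict (by decide)
  have bp : high (.strict e .bp) := S.high_strict (by decide)
  have hd := S.doors_src_strict e X Xp b bp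
  rw [doorIn_src_strict, doorOut_src_strict] at hd
  have oX := one_strict_X S.cyc (S.regular X)
  have ob := one_strict_b S.cyc (S.regular b)
  have oXp := one_strict_Xp S.cyc (S.regular Xp)
  have obp := one_strict_bp S.cyc (S.regular bp)
  have c₁ := S.comm (x := .strict e .X) (y := .strict e .b)
  have c₂ := S.comm (x := .strict e .Xp) (y := .strict e .bp)
  have hbpap : ¬ T (.strict e .bp) (.strict e .ap) := fun h =>
    S.not_tour_v (adj_strict_ap.2 (by simp)) id (S.symm h)
  have t₁ : T (.strict e .X) (.strict e .b) := by grind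
  have t₂ : T (.strict e .bp) (.strict e .Xp) := by grind
  obtain ⟨m, p, K, hm, B⟩ := S.exists_trap_of_not_isMid (u := .strict e .Z)
    (adj_strict_ap.2 (by simp)) id (fun y hy hh => by
      rcases adj_strict_Z.1 (S.sat hh (S.symm hy)).symm with rfl | rfl | rfl | rfl
      · exact isMid_gapLeft _
      · exact absurd hh S.not_high
      · exact absurd hh (S.low_strict (by decide)).1
      · exact absurd hh (S.low_strict (by decide)).1)
  have mem_b := B.mem_right ((B.iff ((S.mem_strict_X B e).2 ⟨_, B.adj_u⟩)
    (by simp) (by simp)).2 t₁)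
  have mem_Xp := B.mem_right ((B.iff ((S.mem_strict_b B e).1 mem_b) (by simp) (by simp)).2 t₂)
  have ha : Low high _ (.strict e .a) := S.low_strict (by decide)
  have o := one_strict_a B.cyc (S.regular_trap B ((S.mem_strict_Xp B e).1 mem_Xp))
  have l₁ := B.not_low_low ha (S.low_strict (r := .Yp) (by decide))
  have l₂ := B.not_low_low ha (S.low_strict (r := .Zp) (by decide))
  have hK : K (.strict e .b) (.strict e .a) := B.symm (by grind)
  have := B.tour hK (by simp) (by simp)
  grind

end StrictCases

end MaxCutReduction

/-! ### Strict gadgets: the vertices Z, Z', a, Y'. -/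

namespace MaxCutReduction

open TSP

section StrictCases

variable {V : Type*} [Fintype V] [DecidableEq V]
variable {H : SimpleGraph V} [DecidableRel H.Adj] {C : Choices H} {k : ℕ}
variable {T : Vertex C k → Vertex C k → Prop} {high : Vertex C k → Prop}
  {v v' m u p : Vertex C k} {K : Vertex C k → Vertex C k → Prop}
variable {e : {e : H.edgeSet // C.directed e = true}}

/-- Since `a'Z` is not in the tour, `ba` is. The trap for `u = Y'` or `u = Z'`, depending on whether
the tour contains `YZ'`, contains the gap at `Z` and has equal doors here. -/
theorem Ctx.not_strict_Z (S : Ctx T high (.strict e .Z) v') : False := by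
  have G := S.gadgetCtx_strict
  have X : high (.strict e .X) := S.high_strict (by decide)
  have b : high (.strict e .b) := S.high_strict (by decide)
  have Xp : high (.strict e .Xp) := S.high_strict (by decide)
  have bp : high (.strict e .bp) := S.high_strict (by decide)
  have hd := S.doors_src_strict e X Xp b bp
  rw [doorIn_src_strict, doorOut_src_strict] at hd
  have oX := one_strict_X S.cyc (S.regular X)
  have ob := one_strict_b S.cyc (S.regular b)
  have oXp := one_strict_Xp S.cyc (S.regular Xp)
  have obp := one_strict_bp S.cyc (S.regular bp)
  have oap := one_strict_ap S.cyc (S.regular (S.high_strict (by decide)))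
  have oY := one_strict_Y S.cyc (S.regular (S.high_strict (by decide)))
  have c₁ := S.comm (x := .strict e .X) (y := .strict e .b)
  have c₂ := S.comm (x := .strict e .Xp) (y := .strict e .bp)
  have c₃ := S.comm (x := .strict e .ap) (y := .strict e .bp)
  have hapZ : ¬ T (.strict e .ap) (.strict e .Z) := fun h =>
    S.not_tour_v (adj_strict_Z.2 (by simp)) id (S.symm h)
  have tba : T (.strict e .b) (.strict e .a) := by grind
  have hTa : ∀ {y}, T (.strict e .a) y → y = .strict e .b ∨ y = .strict e .midAXp := fun h =>
    isCyc_eq_or_eq S.cyc (S.symm tba) (S.tour_of_isMid trivial (adj_strict_a.2 (by simp)))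
      (by simp) h
  -- Behind `Z` come `Z'`, `a` and `Y'`. The first and the last are neighbors of `Z` in `G`, and
  -- both tour edges at `a` are already known.
  have hv' : ¬ InGadget e.1 v' := by
    intro h
    obtain ⟨r, rfl, hr⟩ := S.exists_strict_of_inGadget h
    cases r <;> try exact absurd hr (by decide)
    · exact S.not_adj (adj_strict_Z.2 (by simp))
    · exact S.not_adj (adj_strict_Z.2 (by simp))
    · simpa using hTa (S.symm S.adj)
  by_cases hY : T (.strict e .Y) (.strict e .Zp)
  · obtain ⟨m, p, K, hm, B⟩ := S.exists_trap_of_not_isMid (u := .strict e .Yp)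
      (adj_strict_Z.2 (by simp)) id (fun y hy hh => by
        rcases adj_strict_Yp.1 (S.sat hh (S.symm hy)).symm with rfl | rfl | rfl | rfl
        · have := (doorIn_tgt_strict e).1
            (G.doorIn_of_doorOut (tgt_mem C e) hh ((doorOut_tgt_strict e).2 hy))
          grind
        · trivial
        · exact absurd hh (S.low_strict (by decide)).1
        · exact absurd hh S.not_high)
    have oYp := one_strict_Yp B.cyc (S.regular_trap B (B.mem_right B.adj_u))
    have hYpZ := B.symm B.adj_u
    refine G.false_of_mem_gap B (not_early_of_inGadget inGadget_strict)
      (S.trap_doors_src_strict B e ?_ (by simp)) (iff_of_false ?_ ?_)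
      (G.exists_not_mem_of_v' B hv') (gapLeft_cases _)
      (S.mem_mid B ⟨_, B.adj_u⟩ (isMid_gapLeft _) (adj_strict_Z.2 (.inl rfl)))
    · simp [X, Xp, b, bp]
    · rw [doorIn_tgt_strict]
      intro h
      have := B.tour h (by simp) (by simp)
      grind
    · rw [doorOut_tgt_strict]
      grind
  · obtain ⟨m, p, K, hm, B⟩ := S.exists_trap_of_not_isMid (u := .strict e .Zp)
      (adj_strict_Z.2 (by simp)) id (fun y hy hh => by
        rcases adj_strict_Zp.1 (S.sat hh (S.symm hy)).symm with rfl | rfl | rfl | rfl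
        · exact isMid_gapRight _
        · exact absurd (S.symm hy) hY
        · exact absurd hh S.not_high
        · exact absurd hh (S.low_strict (by decide)).1)
    refine G.false_of_mem_gap B (not_early_of_inGadget inGadget_strict)
      (S.trap_doors_src_strict B e ?_ (by simp)) ?_
      (G.exists_not_mem_of_v' B hv') (gapLeft_cases _)
      (S.mem_mid B ⟨_, B.adj_u⟩ (isMid_gapLeft _) (adj_strict_Z.2 (.inl rfl)))
    · simp [X, Xp, b, bp]
    · rw [doorIn_tgt_strict, doorOut_tgt_strict]
      constructor <;> intro h
      · have oYp := one_strict_Yp B.cyc (S.regular_trap B ((S.mem_strict_Y B e).1 ⟨_, h⟩))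
        have n₁ : ¬ K (.strict e .Yp) (.strict e .a) := fun h => by
          simpa using hTa (S.symm (B.tour h (by simp) (by simp)))
        have n₂ : ¬ K (.strict e .Yp) (.strict e .Z) := fun h => by
          rcases B.eq_or_isMid hm id (B.symm h) with h | h
          exacts [by simp at h, h]
        grind
      · exact (B.iff ((S.mem_strict_Y B e).2 ⟨_, h⟩) (by simp) (by simp)).2 (oY.2 hY)

/-- The tour continues from `Z` to `a'` or to `Y'`. The trap is formed with `u = a` in the first
case and with `u = Z` in the second. It contains the gap at `Z'` and has equal doors here. -/
theorem Ctx.not_strict_Zp (S : Ctx T high (.strict e .Zp) v') : False := by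
  have G := S.gadgetCtx_strict
  have X : high (.strict e .X) := S.high_strict (by decide)
  have b : high (.strict e .b) := S.high_strict (by decide)
  have Xp : high (.strict e .Xp) := S.high_strict (by decide)
  have bp : high (.strict e .bp) := S.high_strict (by decide)
  have hd := S.doors_src_strict e X Xp b bp
  rw [doorIn_src_strict, doorOut_src_strict] at hd
  have oX := one_strict_X S.cyc (S.regular X)
  have ob := one_strict_b S.cyc (S.regular b)
  have oXp := one_strict_Xp S.cyc (S.regular Xp)
  have obp := one_strict_bp S.cyc (S.regular bp)
  have oap := one_strict_ap S.cyc (S.regular (S.high_strict (by decide)))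
  have oY := one_strict_Y S.cyc (S.regular (S.high_strict (by decide)))
  have oZ := one_strict_Z S.cyc (S.regular (S.high_strict (by decide)))
  have c₁ := S.comm (x := .strict e .X) (y := .strict e .b)
  have c₂ := S.comm (x := .strict e .Xp) (y := .strict e .bp)
  have c₃ := S.comm (x := .strict e .ap) (y := .strict e .bp)
  have c₄ := S.comm (x := .strict e .ap) (y := .strict e .Z)
  have hY : ¬ T (.strict e .Y) (.strict e .Zp) := fun h =>
    S.not_tour_v (adj_strict_Zp.2 (by simp)) id (S.symm h)
  have hZ : ¬ T (.strict e .Z) (.strict e .Zp) := fun h =>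
    S.not_tour_v (adj_strict_Zp.2 (by simp)) id (S.symm h)
  have mYp : T (.strict e .Yp) (.strict e .midYYp) :=
    S.tour_of_isMid trivial (adj_strict_Yp.2 (by simp))
  have hin : DoorIn T (C.tgt e) e := (doorIn_tgt_strict e).2 (oY.2 hY)
  by_cases hap : T (.strict e .Z) (.strict e .ap)
  · have tba : ¬ T (.strict e .b) (.strict e .a) := by grind
    have tZYp : ¬ T (.strict e .Z) (.strict e .Yp) := by grind
    obtain ⟨m, p, K, hm, B⟩ := S.exists_trap_of_not_isMid (u := .strict e .a)
      (adj_strict_Zp.2 (by simp)) id (fun y hy hh => by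
        rcases adj_strict_a.1 (S.sat hh (S.symm hy)).symm with rfl | rfl | rfl | rfl
        · trivial
        · exact absurd (S.symm hy) tba
        · exact absurd hh (S.low_strict (by decide)).1
        · exact absurd hh S.not_high)
    refine G.false_of_mem_gap B (not_early_of_inGadget inGadget_strict)
      (S.trap_doors_src_strict B e ?_ (fun h => absurd h tba)) ?_ ?_ (gapRight_cases _)
      (S.mem_mid B ⟨_, B.adj_u⟩ (isMid_gapRight _) (adj_strict_Zp.2 (.inl rfl)))
    · simp [X, Xp, b, bp]
    · rw [doorIn_tgt_strict, doorOut_tgt_strict]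
      constructor <;> intro h
      · have oYp := one_strict_Yp B.cyc (S.regular_trap B ((S.mem_strict_Y B e).1 ⟨_, h⟩))
        have n₁ : ¬ K (.strict e .Yp) (.strict e .a) :=
          B.not_low_low (S.low_strict (by decide)) (S.low_strict (by decide))
        have n₂ : ¬ K (.strict e .Yp) (.strict e .Z) := fun h =>
          tZYp (S.symm (B.tour h (by simp) (by simp)))
        grind
      · exact (B.iff ((S.mem_strict_Y B e).2 ⟨_, h⟩) (by simp) (by simp)).2 (oY.2 hY)
    -- If the tour also uses the door behind `Y'`, both tour edges at `Y'` are known; `a` is a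
    -- neighbor of `Z'` in `G`, so `v'` lies in another gadget. Otherwise the doors at the target
    -- are unequal.
    · by_cases hout : DoorOut T (C.tgt e) e
      · refine G.exists_not_mem_of_v' B fun h => ?_
        obtain ⟨r, rfl, hr⟩ := S.exists_strict_of_inGadget h
        cases r <;> try exact absurd hr (by decide)
        · rcases isCyc_eq_or_eq S.cyc mYp ((doorOut_tgt_strict e).1 hout)
            (nextV_ne_strict le_rfl _).symm (S.symm S.adj) with h | h
          exacts [by simp at h, nextV_ne_strict le_rfl _ h.symm]
        · exact S.not_adj (adj_strict_Zp.2 (by simp))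
      · exact G.exists_not_mem_of_doors B (tgt_mem C e) (fun h => hout (h.1 hin))
  · have tZYp : T (.strict e .Z) (.strict e .Yp) := by grind
    have hout : ¬ DoorOut T (C.tgt e) e := by
      rw [doorOut_tgt_strict]
      intro h
      rcases isCyc_eq_or_eq S.cyc mYp (S.symm tZYp) (by simp) h with h | h
      exacts [nextV_ne_strict le_rfl _ h, nextV_ne_strict le_rfl _ h]
    obtain ⟨m, p, K, hm, B⟩ := S.exists_trap_of_not_isMid (u := .strict e .Z)
      (adj_strict_Zp.2 (by simp)) id (fun y hy hh => by
        rcases adj_strict_Z.1 (S.sat hh (S.symm hy)).symm with rfl | rfl | rfl | rfl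
        · exact isMid_gapLeft _
        · exact absurd hy hap
        · exact absurd hh S.not_high
        · exact absurd hh (S.low_strict (by decide)).1)
    -- The tour neighbors of `u = Z` are the gap, which is high, and `Y'`. So the latter is `p`,
    -- which the trap avoids.
    have hp : p = .strict e .Yp := by
      rcases isCyc_eq_or_eq S.cyc (S.tour_of_isMid (isMid_gapLeft _) (adj_strict_Z.2 (.inl rfl)))
        tZYp (gapLeft_ne (by simp)) B.pred with h | h
      · exact absurd (h ▸ S.high_of_isMid (isMid_gapLeft _)) B.not_high_pred
      · exact h
    have hYp : ¬ Mem K (.strict e .Yp) := fun ⟨z, hz⟩ => B.not_mem z (hp ▸ hz)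
    refine G.false_of_mem_gap B (not_early_of_inGadget inGadget_strict)
      (S.trap_doors_src_strict B e ?_ (by simp)) (iff_of_false ?_ ?_)
      (G.exists_not_mem_of_doors B (tgt_mem C e) (fun h => hout (h.1 hin))) (gapRight_cases _)
      (S.mem_mid B ⟨_, B.adj_u⟩ (isMid_gapRight _) (adj_strict_Zp.2 (.inl rfl)))
    · simp [X, Xp, b, bp]
    · rw [doorIn_tgt_strict]
      exact fun h => hYp ((S.mem_strict_Y B e).1 ⟨_, h⟩)
    · rw [doorOut_tgt_strict]
      exact fun h => hYp ⟨_, h⟩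

/-- Since `ab` and `aZ'` are not in the tour, `Za'` and `YZ'` are. The trap for `u = Y'` passes
through `Y` and `Z'` to the gap there and uses no door at the target. -/
theorem Ctx.not_strict_a (S : Ctx T high (.strict e .a) v') : False := by
  have G := S.gadgetCtx_strict
  have X : high (.strict e .X) := S.high_strict (by decide)
  have b : high (.strict e .b) := S.high_strict (by decide)
  have Xp : high (.strict e .Xp) := S.high_strict (by decide)
  have bp : high (.strict e .bp) := S.high_strict (by decide)
  have hd := S.doors_src_strict e X Xp b bp
  rw [doorIn_src_strict, doorOut_src_strict] at hd
  have oX := one_strict_X S.cyc (S.regular X)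
  have ob := one_strict_b S.cyc (S.regular b)
  have oXp := one_strict_Xp S.cyc (S.regular Xp)
  have obp := one_strict_bp S.cyc (S.regular bp)
  have oap := one_strict_ap S.cyc (S.regular (S.high_strict (by decide)))
  have oY := one_strict_Y S.cyc (S.regular (S.high_strict (by decide)))
  have oZ := one_strict_Z S.cyc (S.regular (S.high_strict (by decide)))
  have oZp := one_strict_Zp S.cyc (S.regular (S.high_strict (by decide)))
  have c₁ := S.comm (x := .strict e .X) (y := .strict e .b)
  have c₂ := S.comm (x := .strict e .Xp) (y := .strict e .bp)
  have c₃ := S.comm (x := .strict e .ap) (y := .strict e .bp)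
  have c₄ := S.comm (x := .strict e .ap) (y := .strict e .Z)
  have c₅ := S.comm (x := .strict e .Z) (y := .strict e .Zp)
  have c₆ := S.comm (x := .strict e .Y) (y := .strict e .Zp)
  have tba : ¬ T (.strict e .b) (.strict e .a) := fun h =>
    S.not_tour_v (adj_strict_a.2 (by simp)) id (S.symm h)
  have hZpa : ¬ T (.strict e .Zp) (.strict e .a) := fun h =>
    S.not_tour_v (adj_strict_a.2 (by simp)) id (S.symm h)
  have tZ : T (.strict e .Z) (.strict e .ap) := by grind
  have tY : T (.strict e .Y) (.strict e .Zp) := by grind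
  obtain ⟨m, p, K, hm, B⟩ := S.exists_trap_of_not_isMid (u := .strict e .Yp)
    (adj_strict_a.2 (by simp)) id (fun y hy hh => by
      rcases adj_strict_Yp.1 (S.sat hh (S.symm hy)).symm with rfl | rfl | rfl | rfl
      · have := (doorIn_tgt_strict e).1
          (G.doorIn_of_doorOut (tgt_mem C e) hh ((doorOut_tgt_strict e).2 hy))
        grind
      · trivial
      · exact absurd hh S.not_high
      · have := S.symm hy
        grind)
  have oYp := one_strict_Yp B.cyc (S.regular_trap B (B.mem_right B.adj_u))
  have hYpa := B.symm B.adj_u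
  have mem_Zp := B.mem_right ((B.iff ((S.mem_strict_Y B e).2 (B.mem_right B.adj_u))
    (by simp) (by simp)).2 tY)
  refine G.false_of_mem_gap B (not_early_of_inGadget inGadget_strict)
    (S.trap_doors_src_strict B e ?_ (fun h => absurd h tba)) (iff_of_false ?_ ?_)
    (G.exists_not_mem_of_v' B fun h => ?_) (gapRight_cases _)
    (S.mem_mid B mem_Zp (isMid_gapRight _) (adj_strict_Zp.2 (.inl rfl)))
  · simp [X, Xp, b, bp]
  · rw [doorIn_tgt_strict]
    intro h
    have := B.tour h (by simp) (by simp)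
    grind
  · rw [doorOut_tgt_strict]
    grind
  · obtain ⟨r, rfl, hr⟩ := S.exists_strict_of_inGadget h
    cases r <;> try exact absurd hr (by decide)
    exact S.not_adj (adj_strict_a.2 (by simp))

/-- All other vertices of the gadget are high. As `Y'Z` and `Y'a` are not in the tour, it must enter
at `Y`. The trap of the door behind `Y'` goes back through `Y` and the earlier gadgets to a gap. -/
theorem Ctx.not_strict_Yp (S : Ctx T high (.strict e .Yp) v') : False := by
  have G := S.gadgetCtx_strict
  have X : high (.strict e .X) := S.high_strict (by decide)
  have b : high (.strict e .b) := S.high_strict (by decide)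
  have Xp : high (.strict e .Xp) := S.high_strict (by decide)
  have bp : high (.strict e .bp) := S.high_strict (by decide)
  have hd := S.doors_src_strict e X Xp b bp
  rw [doorIn_src_strict, doorOut_src_strict] at hd
  have tY : T (.strict e .Y) (prevV C k (C.tgt e) e) := by
    have oX := one_strict_X S.cyc (S.regular X)
    have ob := one_strict_b S.cyc (S.regular b)
    have oXp := one_strict_Xp S.cyc (S.regular Xp)
    have obp := one_strict_bp S.cyc (S.regular bp)
    have oap := one_strict_ap S.cyc (S.regular (S.high_strict (by decide)))
    have oY := one_strict_Y S.cyc (S.regular (S.high_strict (by decide)))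
    have oZ := one_strict_Z S.cyc (S.regular (S.high_strict (by decide)))
    have oZp := one_strict_Zp S.cyc (S.regular (S.high_strict (by decide)))
    have oa := one_strict_a S.cyc (S.regular (S.high_strict (by decide)))
    have c₁ := S.comm (x := .strict e .X) (y := .strict e .b)
    have c₂ := S.comm (x := .strict e .Xp) (y := .strict e .bp)
    have c₃ := S.comm (x := .strict e .ap) (y := .strict e .bp)
    have c₄ := S.comm (x := .strict e .ap) (y := .strict e .Z)
    have c₅ := S.comm (x := .strict e .Z) (y := .strict e .Zp)
    have c₆ := S.comm (x := .strict e .Y) (y := .strict e .Zp)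
    have c₇ := S.comm (x := .strict e .a) (y := .strict e .b)
    have c₈ := S.comm (x := .strict e .a) (y := .strict e .Zp)
    have n₁ : ¬ T (.strict e .Z) (.strict e .Yp) := fun h =>
      S.not_tour_v (adj_strict_Yp.2 (by simp)) id (S.symm h)
    have n₂ : ¬ T (.strict e .a) (.strict e .Yp) := fun h =>
      S.not_tour_v (adj_strict_Yp.2 (by simp)) id (S.symm h)
    grind
  have hin : DoorIn T (C.tgt e) e := (doorIn_tgt_strict e).2 tY
  have hout : ¬ DoorOut T (C.tgt e) e := by
    rw [doorOut_tgt_strict]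
    exact S.not_tour_v (adj_strict_Yp.2 (by simp)) (not_isMid_nextV _ _)
  obtain ⟨m, p, K, hm, B⟩ := G.exists_trap_next (tgt_mem C e) (leave_tgt_strict e).symm hin
  have hne : ∀ q, (.strict e q : Vertex C k) ≠ nextV C k (C.tgt e) e := fun q =>
    (nextV_ne_strict le_rfl q).symm
  have hKin : DoorIn K (C.tgt e) e := (doorIn_tgt_strict e).2
    ((B.iff ((S.mem_strict_Y B e).2 ⟨_, B.adj_u⟩) (hne _) (by simp)).2 tY)
  obtain ⟨s, hs⟩ := G.mem_gap_of_doorIn B (not_early_nextV _) (tgt_mem C e) hKin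
  refine G.false_of_mem_gap B (not_early_nextV _) (S.trap_doors_src_strict B e ?_ ?_)
    (iff_of_true hKin ((doorOut_tgt_strict e).2 B.adj_u))
    (G.exists_not_mem_of_doors B (tgt_mem C e) (fun h => hout (h.1 hin))) ⟨s, rfl⟩ hs
  · simp [X, Xp, b, bp, hne]
  · simp [hne]

/-- No tour is stuck at a vertex of a strict gadget. -/
theorem Ctx.not_strict {q : StrictVertex} (S : Ctx T high (.strict e q) v') : False := by
  cases q
  exacts [S.not_strict_X, S.not_strict_Xp, S.not_strict_Y, S.not_strict_Yp, S.not_strict_Z,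
    S.not_strict_Zp, S.not_strict_a, S.not_strict_ap, S.not_strict_b, S.not_strict_bp,
    S.not_isMid trivial, S.not_isMid trivial, S.not_isMid trivial, S.not_isMid trivial]

end StrictCases

end MaxCutReduction

/-! ### Flexible gadgets. -/

namespace MaxCutReduction

open TSP

section FlexCases

variable {V : Type*} [Fintype V] [DecidableEq V]
variable {H : SimpleGraph V} [DecidableRel H.Adj] {C : Choices H} {k : ℕ}
variable {T : Vertex C k → Vertex C k → Prop} {high : Vertex C k → Prop}
  {v v' m u p : Vertex C k} {K : Vertex C k → Vertex C k → Prop}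
variable {e : {e : H.edgeSet // ¬ C.directed e = true}} {q r : FlexVertex}

theorem place_flex (hk : 15 ≤ k) (hq : ¬ q.IsMid) :
    place C k (.flex e q) = toLex (3, toLex ((C.psi e.1 : ℕ), flexPos q)) :=
  place_of_not_isMid hk hq

theorem Ctx.gadgetCtx_flex (S : Ctx T high (.flex e q) v') :
    GadgetCtx T high (.flex e q) v' e :=
  S.gadgetCtx_of_place inGadget_flex (place_flex S.hk S.not_isMid)

theorem Ctx.high_flex (S : Ctx T high (.flex e q) v') (h : flexPos r < flexPos q) :
    high (.flex e r) := by
  by_cases hm : r.IsMid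
  · exact S.high_of_isMid hm
  · apply S.high_of_lt
    rw [place_flex S.hk hm, place_flex S.hk S.not_isMid]
    exact lex_lt_iff.2 (.inr ⟨rfl, .inr ⟨rfl, h⟩⟩)

theorem Ctx.low_flex (S : Ctx T high (.flex e q) v') (h : flexPos q < flexPos r) :
    Low high (.flex e q) (.flex e r) := by
  have hm : ¬ r.IsMid := by
    intro hm
    cases r <;> first | exact hm | exact absurd h (by simp [flexPos])
  apply S.low_of_place
  rw [place_flex S.hk hm, place_flex S.hk S.not_isMid]
  exact lex_lt_iff.2 (.inr ⟨rfl, .inr ⟨rfl, h⟩⟩)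

theorem Ctx.exists_flex_of_inGadget (S : Ctx T high (.flex e q) v') (h : InGadget e.1 v') :
    ∃ r, v' = .flex e r ∧ flexPos q < flexPos r := by
  cases v' with
  | flex f r =>
    obtain rfl : f = e := Subtype.ext h
    refine ⟨r, rfl, ?_⟩
    rcases lt_trichotomy (flexPos q) (flexPos r) with hlt | heq | hlt
    · exact hlt
    · have hr : ¬ r.IsMid := fun hr => S.not_high_v' (S.high_of_isMid hr)
      have hq : ¬ q.IsMid := S.not_isMid
      have : q = r := by
        revert heq
        cases q <;> first | exact absurd trivial hq | skip
        all_goals cases r <;> first | exact absurd trivial hr | simp [flexPos]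
      subst this
      exact absurd S.adj (isCyc_irrefl S.cyc _)
    · exact absurd (S.high_flex hlt) S.not_high_v'
  | strict f r => exact absurd f.2 (by have := e.2; rwa [← show f.1 = e.1 from h] at this)
  | _ => exact h.elim

/-! ### The vertices of the flexible gadgets -/

/-- The argument for `Y` in a strict gadget applies, with `X'` in the role of `a`. -/
theorem Ctx.not_flex_Y (S : Ctx T high (.flex e .Y) v') : False := by
  have G := S.gadgetCtx_flex
  obtain ⟨m, p, K, hm, B⟩ := S.exists_trap_of_not_isMid (u := .flex e .Zp)
    (adj_flex_Y.2 (by simp)) id (fun y hy hh => by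
      rcases adj_flex_Zp.1 (S.sat hh (S.symm hy)).symm with rfl | rfl | rfl | rfl
      · exact isMid_gapRight _
      · exact absurd hh S.not_high
      · exact absurd hh (S.low_flex (by decide)).1
      · exact absurd hh (S.low_flex (by decide)).1)
  have hYp : Low high _ (.flex e .Yp) := S.low_flex (by decide)
  have o := one_flex_Yp B.cyc (S.regular_trap B ((S.mem_flex_Y B e).1 ⟨_, B.adj_u⟩))
  have l₁ := B.not_low_low hYp (S.low_flex (r := .Xp) (by decide))
  have l₂ := B.not_low_low hYp (S.low_flex (r := .Z) (by decide))
  have hK : K (.flex e .Yp) (nextV C k (C.tgt e) e) := by grind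
  have hnext : high (nextV C k (C.tgt e) e) := by
    by_contra h
    exact B.not_low_low hYp (G.not_high_next (tgt_mem C e) h) hK
  have hT := G.doorIn_of_doorOut (tgt_mem C e) hnext
    ((doorOut_tgt_flex e).2 (B.tour hK (by simp) (by simp)))
  exact S.not_tour_v (adj_flex_Y.2 (by simp)) (not_isMid_prevV _ _) ((doorIn_tgt_flex e).1 hT)

/-- The argument for `Y` applies to the other path: for `u = Z`, the trap can leave `X'` only
through the door. -/
theorem Ctx.not_flex_X (S : Ctx T high (.flex e .X) v') : False := by
  have G := S.gadgetCtx_flex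
  obtain ⟨m, p, K, hm, B⟩ := S.exists_trap_of_not_isMid (u := .flex e .Z)
    (adj_flex_X.2 (by simp)) id (fun y hy hh => by
      rcases adj_flex_Z.1 (S.sat hh (S.symm hy)).symm with rfl | rfl | rfl | rfl
      · exact isMid_gapLeft _
      · exact absurd hh S.not_high
      · exact absurd hh (S.low_flex (by decide)).1
      · exact absurd hh (S.low_flex (by decide)).1)
  have hXp : Low high _ (.flex e .Xp) := S.low_flex (by decide)
  have o := one_flex_Xp B.cyc (S.regular_trap B ((S.mem_flex_X B e).1 ⟨_, B.adj_u⟩))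
  have l₁ := B.not_low_low hXp (S.low_flex (r := .Yp) (by decide))
  have l₂ := B.not_low_low hXp (S.low_flex (r := .Zp) (by decide))
  have hK : K (.flex e .Xp) (nextV C k (C.src e) e) := by grind
  have hnext : high (nextV C k (C.src e) e) := by
    by_contra h
    exact B.not_low_low hXp (G.not_high_next (src_mem C e) h) hK
  have hT := G.doorIn_of_doorOut (src_mem C e) hnext
    ((doorOut_src_flex e).2 (B.tour hK (by simp) (by simp)))
  exact S.not_tour_v (adj_flex_X.2 (by simp)) (not_isMid_prevV _ _) ((doorIn_src_flex e).1 hT)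

/-- Since `XZ` is not in the tour, the tour enters at `X`. The trap for `u = Y'` or `u = Z'`,
depending on whether the tour contains `YZ'`, contains the gap at `Z`. -/
theorem Ctx.not_flex_Z (S : Ctx T high (.flex e .Z) v') : False := by
  have G := S.gadgetCtx_flex
  have oX := one_flex_X S.cyc (S.regular (S.high_flex (by decide)))
  have oY := one_flex_Y S.cyc (S.regular (S.high_flex (by decide)))
  have hXZ : ¬ T (.flex e .X) (.flex e .Z) := fun h =>
    S.not_tour_v (adj_flex_Z.2 (by simp)) id (S.symm h)
  have hin : DoorIn T (C.src e) e := (doorIn_src_flex e).2 (oX.2 hXZ)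
  have mXp : T (.flex e .Xp) (.flex e .R) := S.tour_of_isMid trivial (adj_flex_Xp.2 (by simp))
  -- A trap that contains `X'` must leave it through the door, as `Y'` and `Z'` are low. Conversely,
  -- a trap that leaves there contains `X`, where it follows the tour to the door.
  have hsrc : ∀ {m u p : Vertex C k} {K : Vertex C k → Vertex C k → Prop},
      Trap (graph C k) T high (.flex e .Z) m u p K → u ≠ .flex e .X →
      (DoorIn K (C.src e) e ↔ DoorOut K (C.src e) e) := by
    intro m u p K B hu
    rw [doorIn_src_flex, doorOut_src_flex]
    constructor <;> intro h
    · have o := one_flex_Xp B.cyc (S.regular_trap B ((S.mem_flex_X B e).1 ⟨_, h⟩))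
      have hXp : Low high _ (.flex e .Xp) := S.low_flex (by decide)
      have l₁ := B.not_low_low hXp (S.low_flex (r := .Yp) (by decide))
      have l₂ := B.not_low_low hXp (S.low_flex (r := .Zp) (by decide))
      grind
    · exact (B.iff ((S.mem_flex_X B e).2 ⟨_, h⟩) hu.symm (by simp)).2 (oX.2 hXZ)
  have hZ : ∀ {m u p : Vertex C k} {K : Vertex C k → Vertex C k → Prop},
      Trap (graph C k) T high (.flex e .Z) m u p K → ∃ f, ¬ Mem K (port C k .Z .Z f) := by
    intro m u p K B
    -- If the tour also uses the door behind `X'`, both tour edges at `X'` are known; `Z'` and `Y'`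
    -- are neighbors of `Z` in `G`, so `v'` lies in another gadget. Otherwise the doors at the
    -- source are unequal.
    by_cases hout : DoorOut T (C.src e) e
    · refine G.exists_not_mem_of_v' B fun h => ?_
      obtain ⟨r, rfl, hr⟩ := S.exists_flex_of_inGadget h
      cases r <;> try exact absurd hr (by decide)
      · rcases isCyc_eq_or_eq S.cyc mXp ((doorOut_src_flex e).1 hout)
          (nextV_ne_flex le_rfl _).symm (S.symm S.adj) with h | h
        exacts [by simp at h, nextV_ne_flex le_rfl _ h.symm]
      · exact S.not_adj (adj_flex_Z.2 (by simp))
      · exact S.not_adj (adj_flex_Z.2 (by simp))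
    · exact G.exists_not_mem_of_doors B (src_mem C e) (fun h => hout (h.1 hin))
  by_cases hY : T (.flex e .Y) (.flex e .Zp)
  · obtain ⟨m, p, K, hm, B⟩ := S.exists_trap_of_not_isMid (u := .flex e .Yp)
      (adj_flex_Z.2 (by simp)) id (fun y hy hh => by
        rcases adj_flex_Yp.1 (S.sat hh (S.symm hy)).symm with rfl | rfl | rfl | rfl
        · have := (doorIn_tgt_flex e).1
            (G.doorIn_of_doorOut (tgt_mem C e) hh ((doorOut_tgt_flex e).2 hy))
          grind
        · trivial
        · exact absurd hh (S.low_flex (by decide)).1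
        · exact absurd hh S.not_high)
    have oYp := one_flex_Yp B.cyc (S.regular_trap B (B.mem_right B.adj_u))
    have hYpZ := B.symm B.adj_u
    refine G.false_of_mem_gap B (not_early_of_inGadget inGadget_flex)
      (hsrc B (by simp)) (iff_of_false ?_ ?_) (hZ B) (gapLeft_cases _)
      (S.mem_mid B ⟨_, B.adj_u⟩ (isMid_gapLeft _) (adj_flex_Z.2 (.inl rfl)))
    · rw [doorIn_tgt_flex]
      intro h
      have := B.tour h (by simp) (by simp)
      grind
    · rw [doorOut_tgt_flex]
      grind
  · obtain ⟨m, p, K, hm, B⟩ := S.exists_trap_of_not_isMid (u := .flex e .Zp)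
      (adj_flex_Z.2 (by simp)) id (fun y hy hh => by
        rcases adj_flex_Zp.1 (S.sat hh (S.symm hy)).symm with rfl | rfl | rfl | rfl
        · exact isMid_gapRight _
        · exact absurd (S.symm hy) hY
        · exact absurd hh S.not_high
        · exact absurd hh (S.low_flex (by decide)).1)
    refine G.false_of_mem_gap B (not_early_of_inGadget inGadget_flex)
      (hsrc B (by simp)) ?_ (hZ B) (gapLeft_cases _)
      (S.mem_mid B ⟨_, B.adj_u⟩ (isMid_gapLeft _) (adj_flex_Z.2 (.inl rfl)))
    rw [doorIn_tgt_flex, doorOut_tgt_flex]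
    constructor <;> intro h
    · have oYp := one_flex_Yp B.cyc (S.regular_trap B ((S.mem_flex_Y B e).1 ⟨_, h⟩))
      have n₁ : ¬ K (.flex e .Yp) (.flex e .Xp) :=
        B.not_low_low (S.low_flex (by decide)) (S.low_flex (by decide))
      have n₂ : ¬ K (.flex e .Yp) (.flex e .Z) := fun h => by
        rcases B.eq_or_isMid hm id (B.symm h) with h | h
        exacts [by simp at h, h]
      grind
    · exact (B.iff ((S.mem_flex_Y B e).2 ⟨_, h⟩) (by simp) (by simp)).2 (oY.2 hY)

/-- The tour continues from `Z` to `X` or to `Y'`. In the first case the trap for `u = X'` uses no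
source door. In the second case, for `u = Z`, the vertex `p` is `Y'`, so the trap avoids the target
path. -/
theorem Ctx.not_flex_Zp (S : Ctx T high (.flex e .Zp) v') : False := by
  have G := S.gadgetCtx_flex
  have oX := one_flex_X S.cyc (S.regular (S.high_flex (by decide)))
  have oY := one_flex_Y S.cyc (S.regular (S.high_flex (by decide)))
  have oZ := one_flex_Z S.cyc (S.regular (S.high_flex (by decide)))
  have c₁ := S.comm (x := .flex e .X) (y := .flex e .Z)
  have hY : ¬ T (.flex e .Y) (.flex e .Zp) := fun h =>
    S.not_tour_v (adj_flex_Zp.2 (by simp)) id (S.symm h)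
  have hZ : ¬ T (.flex e .Z) (.flex e .Zp) := fun h =>
    S.not_tour_v (adj_flex_Zp.2 (by simp)) id (S.symm h)
  have mYp : T (.flex e .Yp) (.flex e .S) := S.tour_of_isMid trivial (adj_flex_Yp.2 (by simp))
  have hin : DoorIn T (C.tgt e) e := (doorIn_tgt_flex e).2 (oY.2 hY)
  by_cases hX : T (.flex e .Z) (.flex e .X)
  · have tZYp : ¬ T (.flex e .Z) (.flex e .Yp) := by grind
    have tX : ¬ T (.flex e .X) (prevV C k (C.src e) e) := by grind
    obtain ⟨m, p, K, hm, B⟩ := S.exists_trap_of_not_isMid (u := .flex e .Xp)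
      (adj_flex_Zp.2 (by simp)) id (fun y hy hh => by
        rcases adj_flex_Xp.1 (S.sat hh (S.symm hy)).symm with rfl | rfl | rfl | rfl
        · exact absurd ((doorIn_src_flex e).1
            (G.doorIn_of_doorOut (src_mem C e) hh ((doorOut_src_flex e).2 hy))) tX
        · trivial
        · exact absurd hh (S.low_flex (by decide)).1
        · exact absurd hh S.not_high)
    have oXp := one_flex_Xp B.cyc (S.regular_trap B (B.mem_right B.adj_u))
    have hXpZp := B.symm B.adj_u
    refine G.false_of_mem_gap B (not_early_of_inGadget inGadget_flex)
      (iff_of_false ?_ ?_) ?_ ?_ (gapRight_cases _)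
      (S.mem_mid B ⟨_, B.adj_u⟩ (isMid_gapRight _) (adj_flex_Zp.2 (.inl rfl)))
    · rw [doorIn_src_flex]
      exact fun h => tX (B.tour h (by simp) (by simp))
    · rw [doorOut_src_flex]
      grind
    · rw [doorIn_tgt_flex, doorOut_tgt_flex]
      constructor <;> intro h
      · have oYp := one_flex_Yp B.cyc (S.regular_trap B ((S.mem_flex_Y B e).1 ⟨_, h⟩))
        have n₁ : ¬ K (.flex e .Yp) (.flex e .Xp) :=
          B.not_low_low (S.low_flex (by decide)) (S.low_flex (by decide))
        have n₂ : ¬ K (.flex e .Yp) (.flex e .Z) := fun h =>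
          tZYp (S.symm (B.tour h (by simp) (by simp)))
        grind
      · exact (B.iff ((S.mem_flex_Y B e).2 ⟨_, h⟩) (by simp) (by simp)).2 (oY.2 hY)
    · by_cases hout : DoorOut T (C.tgt e) e
      · refine G.exists_not_mem_of_v' B fun h => ?_
        obtain ⟨r, rfl, hr⟩ := S.exists_flex_of_inGadget h
        cases r <;> try exact absurd hr (by decide)
        · exact S.not_adj (adj_flex_Zp.2 (by simp))
        · rcases isCyc_eq_or_eq S.cyc mYp ((doorOut_tgt_flex e).1 hout)
            (nextV_ne_flex le_rfl _).symm (S.symm S.adj) with h | h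
          exacts [by simp at h, nextV_ne_flex le_rfl _ h.symm]
      · exact G.exists_not_mem_of_doors B (tgt_mem C e) (fun h => hout (h.1 hin))
  · have tZYp : T (.flex e .Z) (.flex e .Yp) := by grind
    have tX : T (.flex e .X) (prevV C k (C.src e) e) := by grind
    have hout : ¬ DoorOut T (C.tgt e) e := by
      rw [doorOut_tgt_flex]
      intro h
      rcases isCyc_eq_or_eq S.cyc mYp (S.symm tZYp) (by simp) h with h | h
      exacts [nextV_ne_flex le_rfl _ h, nextV_ne_flex le_rfl _ h]
    obtain ⟨m, p, K, hm, B⟩ := S.exists_trap_of_not_isMid (u := .flex e .Z)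
      (adj_flex_Zp.2 (by simp)) id (fun y hy hh => by
        rcases adj_flex_Z.1 (S.sat hh (S.symm hy)).symm with rfl | rfl | rfl | rfl
        · exact isMid_gapLeft _
        · exact absurd hy hX
        · exact absurd hh S.not_high
        · exact absurd hh (S.low_flex (by decide)).1)
    have hp : p = .flex e .Yp := by
      rcases isCyc_eq_or_eq S.cyc (S.tour_of_isMid (isMid_gapLeft _) (adj_flex_Z.2 (.inl rfl)))
        tZYp (gapLeft_ne (by simp)) B.pred with h | h
      · exact absurd (h ▸ S.high_of_isMid (isMid_gapLeft _)) B.not_high_pred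
      · exact h
    have hYp : ¬ Mem K (.flex e .Yp) := fun ⟨z, hz⟩ => B.not_mem z (hp ▸ hz)
    refine G.false_of_mem_gap B (not_early_of_inGadget inGadget_flex) ?_ (iff_of_false ?_ ?_)
      (G.exists_not_mem_of_doors B (tgt_mem C e) (fun h => hout (h.1 hin))) (gapRight_cases _)
      (S.mem_mid B ⟨_, B.adj_u⟩ (isMid_gapRight _) (adj_flex_Zp.2 (.inl rfl)))
    · rw [doorIn_src_flex, doorOut_src_flex]
      constructor <;> intro h
      · have oXp := one_flex_Xp B.cyc (S.regular_trap B ((S.mem_flex_X B e).1 ⟨_, h⟩))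
        have n₁ : ¬ K (.flex e .Xp) (.flex e .Yp) := fun h => hYp (B.mem_right h)
        have n₂ : ¬ K (.flex e .Xp) (.flex e .Zp) := fun h => by
          rcases B.eq_or_isMid hm id (B.symm h) with h | h
          exacts [by simp at h, h]
        grind
      · exact (B.iff ((S.mem_flex_X B e).2 ⟨_, h⟩) (by simp) (by simp)).2 tX
    · rw [doorIn_tgt_flex]
      exact fun h => hYp ((S.mem_flex_Y B e).1 ⟨_, h⟩)
    · rw [doorOut_tgt_flex]
      exact fun h => hYp ⟨_, h⟩

/-- If the tour contains `XZ`, it also contains `YZ'`, and the trap for `u = Y'` reaches the gap at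
`Z'` without any door of this gadget. Otherwise the tour enters at `X`, and the trap of the door
behind `X'` goes back through `X` to a gap. -/
theorem Ctx.not_flex_Xp (S : Ctx T high (.flex e .Xp) v') : False := by
  have G := S.gadgetCtx_flex
  have oX := one_flex_X S.cyc (S.regular (S.high_flex (by decide)))
  have oY := one_flex_Y S.cyc (S.regular (S.high_flex (by decide)))
  have oZ := one_flex_Z S.cyc (S.regular (S.high_flex (by decide)))
  have oZp := one_flex_Zp S.cyc (S.regular (S.high_flex (by decide)))
  have c₁ := S.comm (x := .flex e .X) (y := .flex e .Z)
  have c₂ := S.comm (x := .flex e .Z) (y := .flex e .Zp)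
  have c₃ := S.comm (x := .flex e .Y) (y := .flex e .Zp)
  have c₄ := S.comm (x := .flex e .Yp) (y := .flex e .Z)
  have hZp : ¬ T (.flex e .Zp) (.flex e .Xp) := fun h =>
    S.not_tour_v (adj_flex_Xp.2 (by simp)) id (S.symm h)
  by_cases hX : T (.flex e .X) (.flex e .Z)
  · have tY : T (.flex e .Y) (.flex e .Zp) := by grind
    have tX : ¬ T (.flex e .X) (prevV C k (C.src e) e) := by grind
    have tY' : ¬ T (.flex e .Y) (prevV C k (C.tgt e) e) := by grind
    have tZYp : ¬ T (.flex e .Yp) (.flex e .Z) := by grind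
    obtain ⟨m, p, K, hm, B⟩ := S.exists_trap_of_not_isMid (u := .flex e .Yp)
      (adj_flex_Xp.2 (by simp)) id (fun y hy hh => by
        rcases adj_flex_Yp.1 (S.sat hh (S.symm hy)).symm with rfl | rfl | rfl | rfl
        · exact absurd ((doorIn_tgt_flex e).1
            (G.doorIn_of_doorOut (tgt_mem C e) hh ((doorOut_tgt_flex e).2 hy))) tY'
        · trivial
        · exact absurd hh S.not_high
        · exact absurd hy tZYp)
    have oYp := one_flex_Yp B.cyc (S.regular_trap B (B.mem_right B.adj_u))
    have hYpXp := B.symm B.adj_u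
    have mem_Zp := B.mem_right ((B.iff ((S.mem_flex_Y B e).2 (B.mem_right B.adj_u))
      (by simp) (by simp)).2 tY)
    refine G.false_of_mem_gap B (not_early_of_inGadget inGadget_flex)
      (iff_of_false ?_ ?_) (iff_of_false ?_ ?_)
      (G.exists_not_mem_of_v' B fun h => ?_) (gapRight_cases _)
      (S.mem_mid B mem_Zp (isMid_gapRight _) (adj_flex_Zp.2 (.inl rfl)))
    · rw [doorIn_src_flex]
      exact fun h => tX (B.tour h (by simp) (by simp))
    · rw [doorOut_src_flex]
      intro h
      rcases B.eq_or_isMid hm id h with h | h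
      exacts [nextV_ne_flex le_rfl _ h, not_isMid_nextV _ _ h]
    · rw [doorIn_tgt_flex]
      exact fun h => tY' (B.tour h (by simp) (by simp))
    · rw [doorOut_tgt_flex]
      grind
    · obtain ⟨r, rfl, hr⟩ := S.exists_flex_of_inGadget h
      cases r <;> try exact absurd hr (by decide)
      exact S.not_adj (adj_flex_Xp.2 (by simp))
  · have tX := oX.2 hX
    have hin : DoorIn T (C.src e) e := (doorIn_src_flex e).2 tX
    have hout : ¬ DoorOut T (C.src e) e := by
      rw [doorOut_src_flex]
      exact S.not_tour_v (adj_flex_Xp.2 (by simp)) (not_isMid_nextV _ _)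
    obtain ⟨m, p, K, hm, B⟩ := G.exists_trap_next (src_mem C e) (leave_src_flex e).symm hin
    have hne : ∀ q, (.flex e q : Vertex C k) ≠ nextV C k (C.src e) e := fun q =>
      (nextV_ne_flex le_rfl q).symm
    have hKin : DoorIn K (C.src e) e := (doorIn_src_flex e).2
      ((B.iff ((S.mem_flex_X B e).2 ⟨_, B.adj_u⟩) (hne _) (by simp)).2 tX)
    obtain ⟨s, hs⟩ := G.mem_gap_of_doorIn B (not_early_nextV _) (src_mem C e) hKin
    refine G.false_of_mem_gap B (not_early_nextV _)
      (iff_of_true hKin ((doorOut_src_flex e).2 B.adj_u)) ?_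
      (G.exists_not_mem_of_doors B (src_mem C e) (fun h => hout (h.1 hin))) ⟨s, rfl⟩ hs
    rw [doorIn_tgt_flex, doorOut_tgt_flex]
    constructor <;> intro h
    · have oYp := one_flex_Yp B.cyc (S.regular_trap B ((S.mem_flex_Y B e).1 ⟨_, h⟩))
      have n₁ : ¬ K (.flex e .Yp) (.flex e .Xp) := fun h => by
        rcases B.eq_or_isMid hm (not_isMid_nextV _ _) (B.symm h) with h | h
        exacts [hne _ h, h]
      have n₂ : K (.flex e .Yp) (.flex e .Z) → T (.flex e .Yp) (.flex e .Z) := fun h =>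
        B.tour h (hne _) (by simp)
      have := B.tour h (hne _) (by simp)
      grind
    · have mem_Y := (S.mem_flex_Y B e).2 ⟨_, h⟩
      have tYp := B.tour h (hne _) (by simp)
      refine (B.iff mem_Y (hne _) (by simp)).2 ?_
      have n₁ : ¬ T (.flex e .Yp) (.flex e .Z) := fun h' => by
        rcases isCyc_eq_or_eq S.cyc (S.tour_of_isMid (m := .flex e .S) trivial
          (adj_flex_Yp.2 (by simp))) tYp (nextV_ne_flex le_rfl _).symm h' with h | h
        exacts [by simp at h, nextV_ne_flex le_rfl _ h.symm]
      grind

/-- If the tour contains `YZ'`, then `XZ` and the door behind `X'` are forced. The source doors are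
unequal, so a later gadget exists, while the trap for `u = X'` reaches the gap at `Z'`. Otherwise
the tour enters at `Y`, and the trap of the door behind `Y'` goes back through `Y` to a gap. -/
theorem Ctx.not_flex_Yp (S : Ctx T high (.flex e .Yp) v') : False := by
  have G := S.gadgetCtx_flex
  have oX := one_flex_X S.cyc (S.regular (S.high_flex (by decide)))
  have oY := one_flex_Y S.cyc (S.regular (S.high_flex (by decide)))
  have oZ := one_flex_Z S.cyc (S.regular (S.high_flex (by decide)))
  have oZp := one_flex_Zp S.cyc (S.regular (S.high_flex (by decide)))
  have oXp := one_flex_Xp S.cyc (S.regular (S.high_flex (by decide)))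
  have c₁ := S.comm (x := .flex e .X) (y := .flex e .Z)
  have c₂ := S.comm (x := .flex e .Z) (y := .flex e .Zp)
  have c₃ := S.comm (x := .flex e .Y) (y := .flex e .Zp)
  have c₄ := S.comm (x := .flex e .Xp) (y := .flex e .Zp)
  have n₁ : ¬ T (.flex e .Xp) (.flex e .Yp) := fun h =>
    S.not_tour_v (adj_flex_Yp.2 (by simp)) id (S.symm h)
  have n₂ : ¬ T (.flex e .Z) (.flex e .Yp) := fun h =>
    S.not_tour_v (adj_flex_Yp.2 (by simp)) id (S.symm h)
  by_cases hY : T (.flex e .Y) (.flex e .Zp)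
  · have tXp : T (.flex e .Xp) (nextV C k (C.src e) e) := by grind
    have tX : ¬ T (.flex e .X) (prevV C k (C.src e) e) := by grind
    have tY : ¬ T (.flex e .Y) (prevV C k (C.tgt e) e) := by grind
    have hin : ¬ DoorIn T (C.src e) e := by rwa [doorIn_src_flex]
    have hout : DoorOut T (C.src e) e := (doorOut_src_flex e).2 tXp
    obtain ⟨m, p, K, hm, B⟩ := S.exists_trap_of_not_isMid (u := .flex e .Xp)
      (adj_flex_Yp.2 (by simp)) id (fun y hy hh => by
        rcases adj_flex_Xp.1 (S.sat hh (S.symm hy)).symm with rfl | rfl | rfl | rfl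
        · exact absurd (G.doorIn_of_doorOut (src_mem C e) hh hout) hin
        · trivial
        · exact absurd hh S.not_high
        · grind)
    have oXp' := one_flex_Xp B.cyc (S.regular_trap B (B.mem_right B.adj_u))
    have hXpYp := B.symm B.adj_u
    have mem_Zp := B.mem_right ((B.iff ((S.mem_flex_Y B e).2 ⟨_, B.adj_u⟩)
      (by simp) (by simp)).2 hY)
    refine G.false_of_mem_gap B (not_early_of_inGadget inGadget_flex)
      (iff_of_false ?_ ?_) (iff_of_false ?_ ?_)
      (G.exists_not_mem_of_doors B (src_mem C e) (fun h => hin (h.2 hout))) (gapRight_cases _)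
      (S.mem_mid B mem_Zp (isMid_gapRight _) (adj_flex_Zp.2 (.inl rfl)))
    · rw [doorIn_src_flex]
      exact fun h => tX (B.tour h (by simp) (by simp))
    · rw [doorOut_src_flex]
      grind
    · rw [doorIn_tgt_flex]
      exact fun h => tY (B.tour h (by simp) (by simp))
    · rw [doorOut_tgt_flex]
      intro h
      rcases B.eq_or_isMid hm id h with h | h
      exacts [nextV_ne_flex le_rfl _ h, not_isMid_nextV _ _ h]
  · have tY := oY.2 hY
    have hin : DoorIn T (C.tgt e) e := (doorIn_tgt_flex e).2 tY
    have hout : ¬ DoorOut T (C.tgt e) e := by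
      rw [doorOut_tgt_flex]
      exact S.not_tour_v (adj_flex_Yp.2 (by simp)) (not_isMid_nextV _ _)
    have hsrc : DoorIn T (C.src e) e ↔ DoorOut T (C.src e) e := by
      rw [doorIn_src_flex, doorOut_src_flex]
      grind
    obtain ⟨m, p, K, hm, B⟩ := G.exists_trap_next (tgt_mem C e) (leave_tgt_flex e).symm hin
    have hne : ∀ q, (.flex e q : Vertex C k) ≠ nextV C k (C.tgt e) e := fun q =>
      (nextV_ne_flex le_rfl q).symm
    have hKin : DoorIn K (C.tgt e) e := (doorIn_tgt_flex e).2
      ((B.iff ((S.mem_flex_Y B e).2 ⟨_, B.adj_u⟩) (hne _) (by simp)).2 tY)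
    obtain ⟨s, hs⟩ := G.mem_gap_of_doorIn B (not_early_nextV _) (tgt_mem C e) hKin
    refine G.false_of_mem_gap B (not_early_nextV _) ?_
      (iff_of_true hKin ((doorOut_tgt_flex e).2 B.adj_u))
      (G.exists_not_mem_of_doors B (tgt_mem C e) (fun h => hout (h.1 hin))) ⟨s, rfl⟩ hs
    refine B.doors_of_tour hsrc ?_ ?_ ?_ ?_ ?_ <;> simp only [enter_src_flex, leave_src_flex]
    exacts [fun _ _ => S.mem_flex_X B e, hne _, by simp, hne _, by simp]

/-- No tour is stuck at a vertex of a flexible gadget. -/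
theorem Ctx.not_flex (S : Ctx T high (.flex e q) v') : False := by
  cases q
  exacts [S.not_flex_X, S.not_flex_Xp, S.not_flex_Y, S.not_flex_Yp, S.not_flex_Z,
    S.not_flex_Zp, S.not_isMid trivial, S.not_isMid trivial]

end FlexCases

end MaxCutReduction

/-! ### XOR gadgets. -/

namespace MaxCutReduction

open TSP

section XorCases

variable {V : Type*} [Fintype V] [DecidableEq V]
variable {H : SimpleGraph V} [DecidableRel H.Adj] {C : Choices H} {k : ℕ}
variable {T : Vertex C k → Vertex C k → Prop} {high : Vertex C k → Prop}
  {v v' m u p : Vertex C k} {K : Vertex C k → Vertex C k → Prop}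
  {x : V}

/-! ### The vertices of the XOR gadgets -/

theorem Ctx.low_of_inGadget (S : Ctx T high v v') (hv : ∀ f, ¬ InGadget f v) (f : H.edgeSet)
    (y : Vertex C k) (hf : InGadget f y) (hm : ¬ IsMid y) : Low high v y := by
  have hv₃ : ∃ a b c, place C k v = toLex (a, toLex (b, c)) ∧ a < 3 := by
    rw [place_of_not_isMid S.hk S.not_isMid]
    cases v with
    | strict f q => exact absurd rfl (hv f.1)
    | flex f q => exact absurd rfl (hv f.1)
    | _ => exact ⟨_, _, _, rfl, by norm_num⟩
  obtain ⟨a, b, c, h, ha⟩ := hv₃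
  apply S.low_of_place
  rw [h, place_of_not_isMid S.hk hm]
  cases y <;> first | exact hf.elim | exact lex_lt_iff.2 (.inl ha)

/-- A trap at a vertex outside of the parity gadgets contains no gap. -/
theorem Ctx.not_mem_gap_of_not_inGadget (S : Ctx T high v v') (hv : ∀ f, ¬ InGadget f v)
    (B : Trap (graph C k) T high v m u p K) {y : Vertex C k} (hy : ∃ s, y = .gap s) :
    ¬ Mem K y := by
  obtain ⟨s, rfl⟩ := hy
  obtain ⟨f⟩ := S.hE
  exact S.not_mem_gap B (fun x f hx => S.doors_of_low B (S.low_of_inGadget hv f) hx)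
    (S.not_mem_Z_of_low B (S.low_of_inGadget hv f)) s

/-- The vertex before the XOR gadget has no high tour neighbor of degree at least three. -/
theorem Ctx.isMid_of_tour_leave (S : Ctx T high v v') (hv : ∀ f, ¬ InGadget f v) {e : H.edgeSet}
    (hl : IsLast C x e) (hx : v = pathB C k x 1) {y : Vertex C k} (hy : T (leave C k x e) y)
    (hh : high y) : IsMid y := by
  by_contra hm
  have hlow : ∀ f {y}, InGadget f y → ¬ IsMid y → ¬ high y :=
    fun f _ h h' => (S.low_of_inGadget hv f _ h h').1
  have hadj := (S.sat hh (S.symm hy)).symm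
  have hnext : y ≠ nextV C k x e := by
    rintro rfl
    rw [hl.nextV_eq, ← hx] at hh
    exact S.not_high hh
  by_cases hd : C.directed e = true
  · obtain ⟨f, rfl⟩ : ∃ f : {e : H.edgeSet // C.directed e = true}, f.1 = e := ⟨⟨e, hd⟩, rfl⟩
    rcases (mem_iff_src_or_tgt C).1 hl.1 with rfl | rfl
    · rw [leave_src_strict, adj_strict_Xp] at hadj
      rcases hadj with rfl | rfl | rfl
      exacts [hnext rfl, hm trivial, hlow _ inGadget_strict hm hh]
    · rw [leave_tgt_strict, adj_strict_Yp] at hadj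
      rcases hadj with rfl | rfl | rfl | rfl
      exacts [hnext rfl, hm trivial, hlow _ inGadget_strict hm hh, hlow _ inGadget_strict hm hh]
  · obtain ⟨f, rfl⟩ : ∃ f : {e : H.edgeSet // ¬ C.directed e = true}, f.1 = e := ⟨⟨e, hd⟩, rfl⟩
    rcases (mem_iff_src_or_tgt C).1 hl.1 with rfl | rfl
    · rw [leave_src_flex, adj_flex_Xp] at hadj
      rcases hadj with rfl | rfl | rfl | rfl
      exacts [hnext rfl, hm trivial, hlow _ inGadget_flex hm hh, hlow _ inGadget_flex hm hh]
    · rw [leave_tgt_flex, adj_flex_Yp] at hadj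
      rcases hadj with rfl | rfl | rfl | rfl
      exacts [hnext rfl, hm trivial, hlow _ inGadget_flex hm hh, hlow _ inGadget_flex hm hh]

theorem inGadget_leave (x : V) (f : H.edgeSet) : InGadget f (leave C k x f) := by
  unfold leave port
  split_ifs <;> rfl

theorem not_isMid_leave (x : V) (f : H.edgeSet) : ¬ IsMid (leave C k x f) := by
  unfold leave port
  split_ifs <;> exact id

theorem not_isMid_pathA (x : V) (i : ℕ) : ¬ IsMid (pathA C k x i) := by
  unfold pathA
  split_ifs <;> exact id

theorem not_isMid_pathB₀ (x : V) (i : ℕ) : ¬ IsMid (pathB₀ C k x i) := by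
  unfold pathB₀
  split_ifs
  · rcases lastDoor_cases (C := C) (k := k) x with ⟨e, -, h⟩ | ⟨-, h⟩ <;> rw [h]
    · exact not_isMid_leave x e
    · exact id
  · exact not_isMid_pathB x i

theorem place_left (hk : 15 ≤ k) : place C k (.left x) = toLex (1, toLex (0, 0)) :=
  place_of_not_isMid hk id

theorem place_right (hk : 15 ≤ k) :
    place C k (.right x) = toLex (2, toLex ((C.ord x : ℕ), xorOrder C k x)) :=
  place_of_not_isMid hk id

theorem place_railA (hk : 15 ≤ k) (i : Fin (xorOrder C k x)) :
    place C k (.railA x i) = toLex (2, toLex ((C.ord x : ℕ), (i : ℕ))) :=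
  place_of_not_isMid hk id

theorem place_railB (hk : 15 ≤ k) (i : Fin (xorOrder C k x)) :
    place C k (.railB x i) = toLex (2, toLex ((C.ord x : ℕ), 2 * xorOrder C k x - (i : ℕ))) :=
  place_of_not_isMid hk id

/-- The trap along the first-set path contains the gap at `x_ℓ`, but all parity gadgets are still
low and exclude gaps. -/
theorem Ctx.not_left (S : Ctx T high (.left x) v') : False := by
  have hlow : ∀ {i}, i ≤ xorOrder C k x + 1 → 1 ≤ i → ¬ high (pathA C k x i) := by
    intro i hi h₁
    apply S.low_of_lt
    rcases pathA_cases (C := C) (k := k) x hi with ⟨h, h'⟩ | ⟨j, h, h'⟩ | ⟨h, h'⟩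
    · omega
    · rw [h', place_left S.hk, place_railA S.hk]
      exact lex_lt_iff.2 (.inl (by norm_num))
    · rw [h', place_left S.hk, place_right S.hk]
      exact lex_lt_iff.2 (.inl (by norm_num))
  obtain ⟨m, p, K, hm, B⟩ := S.exists_trap_of_not_isMid (u := pathA C k x 1)
    (adj_left.2 (by simp)) (not_isMid_pathA x 1) (fun y hy hh => by
      have hadj := (S.sat hh (S.symm hy)).symm
      rcases Nat.eq_zero_or_pos (xorOrder C k x) with h₀ | h₀
      · have h1 := pathA_last (C := C) (k := k) x
        rw [h₀, zero_add] at h1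
        rw [h1, adj_right, h₀, pathA_zero, pathB₀_zero] at hadj
        rcases hadj with rfl | rfl | rfl
        · exact isMid_gapRight _
        · exact absurd hh S.not_high
        · rcases lastDoor_cases (C := C) (k := k) x with ⟨e, -, h⟩ | ⟨h, -⟩
          · rw [h] at hh
            exact absurd hh (S.low_of_inGadget (fun _ => id) e _ (inGadget_leave x e)
              (not_isMid_leave x e)).1
          · exact absurd h₀ (xorOrder_pos_of_isolated S.hk h).ne'
      · rw [show pathA C k x 1 = .railA x ⟨0, h₀⟩ from pathA_succ x ⟨0, h₀⟩, adj_railA] at hadj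
        rcases hadj with rfl | rfl | rfl
        · trivial
        · rw [show ((⟨0, h₀⟩ : Fin (xorOrder C k x)) : ℕ) = 0 from rfl, pathA_zero] at hh
          exact absurd hh S.not_high
        · exact absurd hh (hlow (by simp only; omega) (by omega)))
  exact S.not_mem_gap_of_not_inGadget (fun _ => id) B (gapLeft_cases _)
    (S.mem_mid B ⟨_, B.adj_u⟩ (isMid_gapLeft _) (link_gapLeft x))

/-- The vertices of the second rail come late. -/
theorem Ctx.low_pathB₀ (S : Ctx T high v v') (hv : ∀ f, ¬ InGadget f v) {n i : ℕ}
    (hx : place C k v = toLex (2, toLex ((C.ord x : ℕ), n))) (hn : n < 2 * xorOrder C k x + 1 - i)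
    (hi : i ≤ xorOrder C k x) (h₀ : i = 0 → ∃ e : H.edgeSet, x ∈ (e : Sym2 V)) :
    Low high v (pathB₀ C k x i) := by
  rcases Nat.eq_zero_or_pos i with rfl | h
  · rw [pathB₀_zero]
    obtain ⟨e, he⟩ := h₀ rfl
    obtain ⟨f, hf⟩ := exists_isLast C he
    rw [hf.lastDoor_eq]
    exact S.low_of_inGadget hv f _ (inGadget_leave x f) (not_isMid_leave x f)
  · rw [pathB₀, if_neg (by omega)]
    rcases pathB_cases (C := C) (k := k) x h (by omega) with ⟨j, hj, h'⟩ | ⟨h', -⟩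
    · rw [h']
      apply S.low_of_place
      rw [hx, place_railB S.hk]
      exact lex_lt_iff.2 (.inr ⟨rfl, .inr ⟨rfl, by omega⟩⟩)
    · omega

/-- The trap along the second rail contains the gap at `x_r`, which is excluded in the same way. The
first rail is already high, so it cannot be used here. -/
theorem Ctx.not_right (S : Ctx T high (.right x) v') : False := by
  have hv : ∀ f, ¬ InGadget f (.right x : Vertex C k) := fun _ => id
  obtain ⟨m, p, K, hm, B⟩ := S.exists_trap_of_not_isMid (u := pathB₀ C k x (xorOrder C k x))
    (adj_right.2 (by simp)) (not_isMid_pathB₀ x _) (fun y hy hh => by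
      rcases Nat.eq_zero_or_pos (xorOrder C k x) with h₀ | h₀
      · rw [h₀, pathB₀_zero] at hy
        rcases lastDoor_cases (C := C) (k := k) x with ⟨e, he, h⟩ | ⟨h, -⟩
        · rw [h] at hy
          have h1 := pathB_last (C := C) (k := k) x
          rw [h₀, zero_add] at h1
          exact S.isMid_of_tour_leave hv he h1.symm hy hh
        · exact absurd h₀ (xorOrder_pos_of_isolated S.hk h).ne'
      · obtain ⟨n, hn⟩ := Nat.exists_eq_succ_of_ne_zero h₀.ne'
        have hadj := (S.sat hh (S.symm hy)).symm
        rw [hn, Nat.succ_eq_add_one, pathB₀_succ,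
          show pathB C k x (n + 1) = .railB x ⟨n, by omega⟩ from pathB_succ x ⟨n, by omega⟩,
          adj_railB] at hadj
        rcases hadj with rfl | rfl | rfl
        · trivial
        · refine absurd hh (S.low_pathB₀ hv (place_right S.hk) (by simp; omega) (by simp; omega)
            fun h => ?_).1
          -- The vertex before `b_p` could be the high vertex `x_ℓ` only if `x` were isolated and `p
          -- = 1`; but isolated vertices have larger XOR gadgets.
          by_contra! hiso
          have h1 := one_lt_xorOrder_of_isolated (C := C) S.hk hiso
          simp only at h
          omega
        · simp only [pathB₀_succ] at hh
          rw [show n + 1 = xorOrder C k x by omega, pathB_last] at hh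
          exact absurd hh S.not_high)
  exact S.not_mem_gap_of_not_inGadget hv B (gapRight_cases _)
    (S.mem_mid B ⟨_, B.adj_u⟩ (isMid_gapRight _) (link_gapRight x))

/-- With the next vertex of the first rail as `u`, the trap crosses the rung to the second rail,
which is low because its priorities are given out backwards after `x_r`. Its only way on could be
`x_ℓ`, for isolated `x` and `i = 0`, and there it would contain a gap. -/
theorem Ctx.not_railA {i : Fin (xorOrder C k x)} (S : Ctx T high (.railA x i) v') : False := by
  have hv : ∀ f, ¬ InGadget f (.railA x i : Vertex C k) := fun _ => id
  have hlowB : Low high (.railA x i) (.railB x i) := by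
    apply S.low_of_place
    rw [place_railA S.hk, place_railB S.hk]
    exact lex_lt_iff.2 (.inr ⟨rfl, .inr ⟨rfl, by omega⟩⟩)
  have hlowR : Low high (.railA x i) (.right x) := by
    apply S.low_of_place
    rw [place_railA S.hk, place_right S.hk]
    exact lex_lt_iff.2 (.inr ⟨rfl, .inr ⟨rfl, by omega⟩⟩)
  have hlowA : ∀ {j}, (i : ℕ) + 1 < j → j ≤ xorOrder C k x + 1 → ¬ high (pathA C k x j) := by
    intro j hj hj'
    rcases pathA_cases (C := C) (k := k) x hj' with ⟨h, h'⟩ | ⟨l, h, h'⟩ | ⟨h, h'⟩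
    · omega
    · rw [h']
      apply S.low_of_lt
      rw [place_railA S.hk, place_railA S.hk]
      exact lex_lt_iff.2 (.inr ⟨rfl, .inr ⟨rfl, by omega⟩⟩)
    · rw [h']
      exact hlowR.1
  obtain ⟨m, p, K, hm, B⟩ := S.exists_trap_of_not_isMid (u := pathA C k x (i + 2))
    (adj_railA.2 (by simp)) (not_isMid_pathA x _) (fun y hy hh => by
      have hadj := (S.sat hh (S.symm hy)).symm
      rcases pathA_cases (C := C) (k := k) x (i := i + 2) (by omega) with
        ⟨h, -⟩ | ⟨l, h, h'⟩ | ⟨h, h'⟩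
      · omega
      · rw [h', adj_railA] at hadj
        rcases hadj with rfl | rfl | rfl
        · trivial
        · rw [show (l : ℕ) = i + 1 by omega, pathA_succ] at hh
          exact absurd hh S.not_high
        · exact absurd hh (hlowA (by omega) (by omega))
      · rw [h', adj_right] at hadj
        rcases hadj with rfl | rfl | rfl
        · exact isMid_gapRight _
        · rw [show xorOrder C k x = i + 1 by omega, pathA_succ] at hh
          exact absurd hh S.not_high
        · exact absurd hh (S.low_pathB₀ hv (place_railA S.hk i) (by omega) le_rfl
            (by omega)).1)
  have hB : Mem K (.railB x i) := S.mem_of_mid B (n := .rung x i) trivial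
    (adj_rung.2 (.inl rfl)) (adj_rung.2 (.inr rfl)) ⟨_, B.adj_u⟩
  have hreg := S.regular_trap B hB
  obtain ⟨y, hy, hKy⟩ := isCyc_exists_ne B.cyc
    (hreg.mid (m := .rung x i) trivial (adj_railB.2 (.inl rfl)))
  rcases adj_railB.1 (hreg.le hKy) with rfl | rfl | rfl
  · exact hy rfl
  · by_cases h₀ : (i : ℕ) = 0 → ∃ e : H.edgeSet, x ∈ (e : Sym2 V)
    · exact B.not_low_low hlowB
        (S.low_pathB₀ hv (place_railA S.hk i) (by omega) (by omega) h₀) hKy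
    · push Not at h₀
      rw [h₀.1, pathB₀_zero, lastDoor_eq_of_isolated C k h₀.2] at hKy
      exact S.not_mem_gap_of_not_inGadget hv B (gapLeft_cases _)
        (S.mem_mid B (B.mem_right hKy) (isMid_gapLeft _) (link_gapLeft x))
  · refine B.not_low_low hlowB ?_ hKy
    rcases Nat.lt_or_ge (i + 1) (xorOrder C k x) with h | h
    · exact S.low_pathB₀ hv (place_railA S.hk i) (by omega) (by omega) (by omega)
    · rw [pathB₀_succ, show (i : ℕ) + 1 = xorOrder C k x by omega, pathB_last]
      exact hlowR

/-- The part of the XOR gadget behind `v` is high. The tour enters it at the gap of `x_r` but not by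
the rail edge at `v`, so by parity it uses the opposite edge of the first rail. With the previous
vertex of the second rail as `u`, the trap crosses the rung and follows this edge; but of the three
edges of the cut it uses only this one. -/
theorem Ctx.not_railB {i : Fin (xorOrder C k x)} (S : Ctx T high (.railB x i) v') : False := by
  have hv : ∀ f, ¬ InGadget f (.railB x i : Vertex C k) := fun _ => id
  have highL : high (.left x) := by
    apply S.high_of_lt
    rw [place_left S.hk, place_railB S.hk]
    exact lex_lt_iff.2 (.inl (by norm_num))
  have highA : ∀ j, high (.railA x j) := by
    intro j
    apply S.high_of_lt
    rw [place_railA S.hk, place_railB S.hk]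
    exact lex_lt_iff.2 (.inr ⟨rfl, .inr ⟨rfl, by omega⟩⟩)
  have highLadder : ∀ a, Ladder x (i + 1) a → high a := by
    intro a ha
    rcases a with s | y | y | ⟨y, j⟩ | ⟨y, j⟩ | ⟨y, j⟩ | ⟨e, q⟩ | ⟨e, q⟩ <;> try exact ha.elim
    · obtain rfl : y = x := ha
      apply S.high_of_lt
      rw [place_right S.hk, place_railB S.hk]
      exact lex_lt_iff.2 (.inr ⟨rfl, .inr ⟨rfl, by omega⟩⟩)
    · obtain ⟨rfl, -⟩ := ha
      exact highA j
    · obtain ⟨rfl, hj⟩ := ha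
      apply S.high_of_lt
      rw [place_railB S.hk, place_railB S.hk]
      exact lex_lt_iff.2 (.inr ⟨rfl, .inr ⟨rfl, by omega⟩⟩)
    · exact S.high_of_isMid trivial
  have hv₁ : pathB₀ C k x (i + 1) = .railB x i := by rw [pathB₀_succ, pathB_succ]
  have tA : T (.railA x i) (pathA C k x (i + 2)) := by
    have h := ladder_parity S.hk S.cyc (x := x) (j := i + 1) (by omega)
      (fun a b ha hab => S.sat (highLadder a ha) hab)
    have hg := S.tour_of_isMid (isMid_gapRight _) (link_gapRight (C := C) (k := k) x)
    have hB : ¬ T (pathB₀ C k x (i + 1 + 1)) (pathB₀ C k x (i + 1)) := by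
      rw [hv₁]
      exact fun h => S.not_tour_v (adj_railB.2 (by simp)) (not_isMid_pathB₀ x _) (S.symm h)
    simp only [hg, hB, not_true, iff_false, not_not, pathA_succ] at h
    exact S.symm h
  have tA' : ∀ y, T (.railA x i) y → y = .rung x i ∨ y = pathA C k x (i + 2) := fun y hy =>
    isCyc_eq_or_eq S.cyc (S.tour_of_isMid trivial (adj_railA.2 (.inl rfl))) tA
      (pathA_ne (by simp) (by simp) (by simp)).symm hy
  -- The tour does not use the edge between `x_ℓ` and the second rail if `x` is isolated.
  have hiso : (∀ e : H.edgeSet, x ∉ (e : Sym2 V)) → ∀ j : Fin (xorOrder C k x), (j : ℕ) = 0 →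
      (i : ℕ) ≤ 1 → ¬ T (.left x) (.railB x j) ∧ (i : ℕ) ≠ 0 := by
    intro h j hj hi
    have hfirst : firstDoor C k x = .railB x j := by
      rw [firstDoor_eq_of_isolated C k h, show 1 = (j : ℕ) + 1 by omega, pathB_succ]
    have hpar := left_parity S.hk S.cyc x (fun b hb => S.sat highL hb)
    have hg := S.tour_of_isMid (isMid_gapLeft _) (link_gapLeft (C := C) (k := k) x)
    rw [hfirst, show 1 = (j : ℕ) + 1 by omega, pathA_succ] at hpar
    simp only [hg, true_iff] at hpar
    -- For `i = 0`, the parity at `x_ℓ` would force a third tour edge at `a_1`. For `i = 1`, the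
    -- tour edges at `a_2` exclude `a_1a_2`, so `x_ℓ` is joined to `a_1` and not to `b_1`.
    rcases Nat.eq_zero_or_pos (i : ℕ) with h₀ | h₀
    · exfalso
      obtain rfl : j = i := Fin.ext (by omega)
      have h₁ : ¬ T (.left x) (.railB x j) := fun h' =>
        S.not_tour_v (adj_left.2 (.inr (.inr hfirst.symm))).symm id (S.symm h')
      rcases tA' _ (S.symm (hpar.2 h₁)) with h' | h'
      · simp at h'
      · have := pathA_ne_add_two x j
        rw [hj, pathA_zero, ← hj] at this
        exact this h'
    · refine ⟨hpar.1 ?_, h₀.ne'⟩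
      have hi₁ : (i : ℕ) = 1 := by omega
      have hnot : ¬ T (.railA x j) (.railA x i) := by
        intro h'
        rcases tA' _ (S.symm h') with h' | h'
        · simp at h'
        · have := pathA_ne_add_two x i
          rw [hi₁, show 1 = (j : ℕ) + 1 by omega, pathA_succ,
            ← show (i : ℕ) = j + 1 by omega] at this
          exact this h'
      obtain ⟨y, hy, hTy⟩ := isCyc_exists_ne S.cyc
        (S.tour_of_isMid (m := .rung x j) trivial (adj_railA.2 (.inl rfl)))
      rcases adj_railA.1 (S.sat (highA j) hTy) with rfl | rfl | rfl
      · exact absurd rfl hy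
      · rw [hj, pathA_zero] at hTy
        exact S.symm hTy
      · rw [show (j : ℕ) + 2 = i + 1 by omega, pathA_succ] at hTy
        exact absurd hTy hnot
  obtain ⟨m, p, K, hm, B⟩ := S.exists_trap_of_not_isMid (u := pathB₀ C k x i)
    (adj_railB.2 (by simp)) (not_isMid_pathB₀ x _) (fun y hy hh => by
      rcases Nat.eq_zero_or_pos (i : ℕ) with h₀ | h₀
      · rw [h₀, pathB₀_zero] at hy
        rcases lastDoor_cases (C := C) (k := k) x with ⟨e, he, h⟩ | ⟨h, -⟩
        · rw [h] at hy
          refine S.isMid_of_tour_leave hv he ?_ hy hh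
          rw [show 1 = (i : ℕ) + 1 by omega, pathB_succ]
        · exact absurd h₀ (hiso h i h₀ (by omega)).2
      · obtain ⟨j, hj⟩ : ∃ j : Fin (xorOrder C k x), (i : ℕ) = j + 1 :=
          ⟨⟨i - 1, by omega⟩, by simp only; omega⟩
        have hadj := (S.sat hh (S.symm hy)).symm
        rw [hj, pathB₀_succ, pathB_succ] at hy hadj
        rw [adj_railB] at hadj
        rcases hadj with rfl | rfl | rfl
        · trivial
        · by_cases h₁ : (j : ℕ) = 0 → ∃ e : H.edgeSet, x ∈ (e : Sym2 V)
          · exact absurd hh (S.low_pathB₀ hv (place_railB S.hk i) (by omega) (by omega) h₁).1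
          · push Not at h₁
            rw [h₁.1, pathB₀_zero, lastDoor_eq_of_isolated C k h₁.2] at hy
            exact absurd (S.symm hy) (hiso h₁.2 j h₁.1 (by omega)).1
        · rw [show (j : ℕ) + 2 = i + 1 by omega, hv₁] at hh
          exact absurd hh S.not_high)
  have hA : Mem K (.railA x i) := S.mem_of_mid B (n := .rung x i) trivial
    (adj_rung.2 (.inr rfl)) (adj_rung.2 (.inl rfl)) ⟨_, B.adj_u⟩
  have hne : (.railA x i : Vertex C k) ≠ pathB₀ C k x i := by
    unfold pathB₀
    split_ifs
    · exact (lastDoor_ne (by simp) (by simp) (by simp)).symm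
    · exact (pathB_ne (by simp) (by simp)).symm
  have kA := B.symm ((B.iff hA hne (by simp)).2 tA)
  have h := ladder_parity S.hk B.cyc (x := x) (j := i + 1) (by omega) (fun a b _ hab => B.le hab)
  have hB : ¬ K (pathB₀ C k x (i + 1 + 1)) (pathB₀ C k x (i + 1)) := by
    rw [hv₁]
    intro h
    rcases B.eq_or_isMid hm (not_isMid_pathB₀ x _) (B.symm h) with h | h
    exacts [pathB₀_ne_add_two x i h.symm, not_isMid_pathB₀ x _ h]
  have hg : ¬ K (.right x) (gapRight C k (.inl x)) := fun h =>
    S.not_mem_gap_of_not_inGadget hv B (gapRight_cases _) (B.mem_right h)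
  rw [pathA_succ] at h
  exact hB ((h.2 hg).1 kA)

/-- No tour is stuck. -/
theorem Ctx.false (S : Ctx T high v v') : False := by
  cases v with
  | gap s => exact S.not_isMid trivial
  | rung x i => exact S.not_isMid trivial
  | left x => exact S.not_left
  | right x => exact S.not_right
  | railA x i => exact S.not_railA
  | railB x i => exact S.not_railB
  | strict e q => exact S.not_strict
  | flex e q => exact S.not_flex

end XorCases

end MaxCutReduction

/-! ### The weights and the conclusion. -/

namespace MaxCutReduction

open TSP

section Main

variable {V : Type*} [Fintype V] [DecidableEq V]
variable {H : SimpleGraph V} [DecidableRel H.Adj] {C : Choices H} {k : ℕ}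

theorem adj_port_Z_Zp (e : H.edgeSet) :
    (graph C k).Adj (port C k .Z .Z e) (port C k .Zp .Zp e) := by
  by_cases h : C.directed e = true
  · rw [port_strict ⟨e, h⟩, port_strict ⟨e, h⟩]
    exact adj_strict_Z.2 (by simp)
  · rw [port_flex ⟨e, h⟩, port_flex ⟨e, h⟩]
    exact adj_flex_Z.2 (by simp)

theorem adj_port_Yp_Z (e : H.edgeSet) :
    (graph C k).Adj (port C k .Yp .Yp e) (port C k .Z .Z e) := by
  by_cases h : C.directed e = true
  · rw [port_strict ⟨e, h⟩, port_strict ⟨e, h⟩]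
    exact adj_strict_Yp.2 (by simp)
  · rw [port_flex ⟨e, h⟩, port_flex ⟨e, h⟩]
    exact adj_flex_Yp.2 (by simp)

theorem edgeWeight_le_totalWeight (w : H.edgeSet → ℤ) {z : Sym2 (Vertex C k)}
    (hz : z ∈ (graph C k).edgeSet) : edgeWeight C k w z ≤ totalWeight C k w := by
  classical
  exact Finset.single_le_sum (f := edgeWeight C k w) (fun _ _ => Nat.zero_le _)
    (SimpleGraph.mem_edgeFinset.2 hz)

theorem le_edgeWeight (w : H.edgeSet → ℤ) (z : Sym2 (Vertex C k)) (e : H.edgeSet) :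
    (if z ∈ sameSetEdges C k e then (w e).toNat else 0) +
      (if z ∈ differentSetEdges C k e then (-w e).toNat else 0) ≤ edgeWeight C k w z :=
  Finset.single_le_sum (f := fun e => (if z ∈ sameSetEdges C k e then (w e).toNat else 0) +
      (if z ∈ differentSetEdges C k e then (-w e).toNat else 0)) (fun _ _ => Nat.zero_le _)
    (Finset.mem_univ e)

/-- An edge of `H` with nonzero weight passes its absolute value on to a same-set or a different-set
edge. Without this, `M` and all costs of non-edges would vanish. -/
theorem totalWeight_pos {w : H.edgeSet → ℤ} {e : H.edgeSet} (hw : w e ≠ 0) :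
    0 < totalWeight C k w := by
  rcases lt_or_gt_of_ne hw with h | h
  · refine lt_of_lt_of_le ?_ (edgeWeight_le_totalWeight w
      ((graph C k).mem_edgeSet.2 (adj_port_Yp_Z e)))
    refine lt_of_lt_of_le ?_ (le_edgeWeight w _ e)
    rw [if_pos (by simp [differentSetEdges] : _ ∈ differentSetEdges C k e)]
    omega
  · refine lt_of_lt_of_le ?_ (edgeWeight_le_totalWeight w
      ((graph C k).mem_edgeSet.2 (adj_port_Z_Zp e)))
    refine lt_of_lt_of_le ?_ (le_edgeWeight w _ e)
    rw [if_pos (by simp [sameSetEdges] : _ ∈ sameSetEdges C k e)]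
    omega

theorem isPenalty {w : H.edgeSet → ℤ} (hw : ∃ e, w e ≠ 0) {prio : Vertex C k → ℕ}
    (hprio : IsPriority C k prio) :
    IsPenalty (graph C k) prio (completedWeight C k w prio) (totalWeight C k w) where
  pos := totalWeight_pos hw.choose_spec
  prio_pos x := (hprio.1.mapsTo (Set.mem_univ x)).1
  prio_inj x y h := hprio.1.injOn (Set.mem_univ x) (Set.mem_univ y) h
  sum_le F hF := by
    classical
    calc ∑ z ∈ F, completedWeight C k w prio z = ∑ z ∈ F, edgeWeight C k w z :=
          Finset.sum_congr rfl fun z hz => if_pos (hF z hz)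
      _ ≤ totalWeight C k w := Finset.sum_le_sum_of_subset_of_nonneg
          (fun z hz => SimpleGraph.mem_edgeFinset.2 (hF z hz)) (fun _ _ _ => Nat.zero_le _)
  eq x y h := by
    rw [completedWeight, if_neg (fun h' => h ((SimpleGraph.mem_edgeSet _).1 h'))]
    rfl

/-- A tour with a non-edge has an improving `3`-swap. -/
theorem exists_improving {w : H.edgeSet → ℤ} (hw : ∃ e, w e ≠ 0) (hk : 15 ≤ k)
    {prio : Vertex C k → ℕ} (hprio : IsPriority C k prio) {τ : Finset (Sym2 (Vertex C k))}
    (hτ : IsTour (⊤ : SimpleGraph (Vertex C k)) τ) (hne : ∃ z ∈ τ, z ∉ (graph C k).edgeSet) :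
    ∃ E₁ E₂, IsSwap 3 E₁ E₂ ∧ IsImproving (completedWeight C k w prio) τ E₁ E₂ := by
  by_contra hno
  obtain ⟨v, v', S⟩ := exists_stuck (isPenalty hw hprio) hτ hne hno
  exact Ctx.false
    { S with
      hk := hk
      hE := ⟨hw.choose⟩
      high_of_lt := fun h => hprio.2 _ _ h
      low_of_lt := fun h => (hprio.2 _ _ h).not_gt }

end Main

end MaxCutReduction

theorem mainTheorem3 {V : Type*} [Fintype V] [DecidableEq V]
    (H : SimpleGraph V) [DecidableRel H.Adj] (hH : ∀ x : V, H.degree x ≤ 5)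
    (w : H.edgeSet → ℤ) (hw : ∃ e : H.edgeSet, w e ≠ 0)
    (k : ℕ) (hk : 15 ≤ k)
    (C : MaxCutReduction.Choices H)
    (prio : MaxCutReduction.Vertex C k → ℕ) (hprio : MaxCutReduction.IsPriority C k prio) :
    (∀ τ : Finset (Sym2 (MaxCutReduction.Vertex C k)),
      TSP.IsTour (⊤ : SimpleGraph (MaxCutReduction.Vertex C k)) τ →
      (∃ z ∈ τ, z ∉ (MaxCutReduction.graph C k).edgeSet) →
      ∃ E₁ E₂ : Finset (Sym2 (MaxCutReduction.Vertex C k)),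
        TSP.IsSwap 3 E₁ E₂ ∧
        TSP.IsImproving (MaxCutReduction.completedWeight C k w prio) τ E₁ E₂) ∧
    (∀ K : ℕ, 3 ≤ K → ∀ τ : Finset (Sym2 (MaxCutReduction.Vertex C k)),
      TSP.IsLocalOptimum K (MaxCutReduction.completedWeight C k w prio) τ →
      ∀ z ∈ τ, z ∈ (MaxCutReduction.graph C k).edgeSet) := by
  refine ⟨fun τ hτ hne => MaxCutReduction.exists_improving hw hk hprio hτ hne,
    fun K hK τ hτ z hz => ?_⟩
  by_contra hne
  obtain ⟨E₁, E₂, ⟨h₁, h₂, h₃, h₄⟩, h₅, h₆, h₇⟩ :=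
    MaxCutReduction.exists_improving hw hk hprio hτ.1 ⟨z, hz, hne⟩
  exact h₇.not_ge (hτ.2 E₁ E₂ ⟨h₁, h₂, h₃, h₄.trans hK⟩ h₅ h₆)
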